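/- All manifolds are smooth, Hausdorff, second countable and finite-dimensional; vector bundles have finite rank. A Courant algebroid over $X$ is a vector bundle $V\to X$ with a fibrewise nondegenerate symmetric bilinear form $\langle\cdot,\cdot\rangle$, a bundle map $\pi:V\to TX$ (the anchor) and an $\mathbb R$-bilinear bracket on $\Gamma(V)$ such that, for all sections $e_i$ and functions $f$: (C1) $[e_1,[e_2,e_3]]=[[e_1,e_2],e_3]+[e_2,[e_1,e_3]]$; (C2) $\pi[e_1,e_2]=[\pi e_1,\pi e_2]$; (C3) $[e_1,fe_2]=f[e_1,e_2]+(\pi(e_1)f)e_2$; (C4) $\pi(e_1)\langle e_2,e_3\rangle=\langle[e_1,e_2],e_3\rangle+\langle e_2,[e_1,e_3]\rangle$; (C5) $[e,e]=\tfrac12\pi^*d\langle e,e\rangle$, where $V\cong V^*$ via the form. It is exact if $0\to T^*X\xrightarrow{\pi^*}V\xrightarrow{\pi}TX\to0$ is exact. Let $G$ be a connected Lie group acting smoothly on a manifold $M$, with infinitesimal action $\psi:\mathfrak g\to\Gamma(TM)$ (a Lie algebra homomorphism), and let $E$ be an exact Courant algebroid over $M$. An extended action is given by: a real vector space $\mathfrak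 a$ with a bilinear bracket satisfying (C1) and a surjective bracket-preserving linear map $\mathfrak a\to\mathfrak g$ whose kernel $\mathfrak h$ satisfies $[\mathfrak h,\mathfrak h]=0$; and a linear bracket-preserving map $\rho:\mathfrak a\to\Gamma(E)$ covering $\psi$, such that $[\rho(h),\cdot]=0$ for $h\in\mathfrak h$ and the induced action of $\mathfrak g=\mathfrak a/\mathfrak h$ on $\Gamma(E)$ by $[\rho(a),\cdot]$ integrates to a smooth action of $G$ on $E$ by vector bundle maps covering the action on $M$. Put $K=\rho(\mathfrak a)\subset E$ (pointwise), let $K^\perp$ be its orthogonal, and let $\Delta_b=\pi(K+K^\perp)\subset TM$. A leaf of $\Delta_b$ is a maximal connected (injectively immersed) integral submanifold. Theorem. Let $P$ be a leaf of $\Delta_b$ on which $G$ acts freely and properly (the action of $G$ on $M$ restricts to a free and proper action on the manifold $P$) and along which $\rho(\mathfrak h)$ has constant rank. Then $P/G$ is a smooth manifold with $P\to P/G$ a submersion, and $$E_{red}=\left.\frac{K^\perp|_P}{(K\cap K^\perp)|_P}\right/G$$ is a smooth vector bundle over $P/G$ to which the Courant algebroid structure of $E$ descends: $E_{red}$ carries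 a Courant algebroid structure over $P/G$ whose form and anchor are induced by those of $E$, and whose bracket at the orbit of $x\in P$ of two sections is represented by $[v_1,v_2](x)\in K^\perp$ for any sections $v_1,v_2$ of $E$ which along $P$ near $x$ lie in $K^\perp$ and represent the given sections. The anchor of $E_{red}$ is surjective. If $K$ is isotropic along $P$, then $E_{red}$ is exact; in general, $E_{red}$ is exact if and only if $\pi(K)\cap\pi(K^\perp)=\pi(K\cap K^\perp)$ at every point of $P$. -/

import Mathlib

open Bundle Set Filter Topology
open scoped Manifold ContDiff

noncomputable section

/-- A smooth real Lie group is regular enough for its tangent space at `1` to be a Lie algebra. -/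
instance lieGroupMinSmoothness {k : ℕ} {G : Type*} [TopologicalSpace G]
    [ChartedSpace (EuclideanSpace ℝ (Fin k)) G] [Group G] [LieGroup (𝓡 k) ∞ G] :
    LieGroup (𝓡 k) (minSmoothness ℝ 3) G := by
  rw [minSmoothness_of_isRCLikeNormedField]
  infer_instance

section CourantAlgebroids

variable {d : ℕ} {X : Type*} [TopologicalSpace X] [ChartedSpace (EuclideanSpace ℝ (Fin d)) X]
  {F : Type*} [NormedAddCommGroup F] [NormedSpace ℝ F]
  {V : X → Type*} [TopologicalSpace (TotalSpace F V)] [∀ x, AddCommGroup (V x)]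
  [∀ x, Module ℝ (V x)] [∀ x, TopologicalSpace (V x)] [FiberBundle F V] [VectorBundle ℝ F V]

/-- The product `f e` of a smooth function `f` and a smooth section `e` of a vector bundle. -/
def funSMulSection (f : C^∞⟮𝓡 d, X; 𝓘(ℝ, ℝ), ℝ⟯) (e : Cₛ^∞⟮𝓡 d; F, V⟯) : Cₛ^∞⟮𝓡 d; F, V⟯ :=
  ⟨fun x => f x • e x, f.contMDiff.smul_section e.contMDiff⟩

/-- The value at `x` of smooth sections, as a linear map. -/
def sectionEval (F : Type*) [NormedAddCommGroup F] [NormedSpace ℝ F]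
    (V : X → Type*) [TopologicalSpace (TotalSpace F V)] [∀ x, AddCommGroup (V x)]
    [∀ x, Module ℝ (V x)] [∀ x, TopologicalSpace (V x)] [FiberBundle F V] [VectorBundle ℝ F V]
    (x : X) : Cₛ^∞⟮𝓡 d; F, V⟯ →ₗ[ℝ] V x where
  toFun e := e x
  map_add' _ _ := rfl
  map_smul' _ _ := rfl

variable (d F V) in
/-- A Courant algebroid structure on a smooth vector bundle `V` (with typical fibre `F`) over a
`d`-dimensional manifold `X`. -/
structure CourantAlgebroid [IsManifold (𝓡 d) ∞ X] [ContMDiffVectorBundle ∞ F V (𝓡 d)] where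
  /-- The fibrewise symmetric bilinear form. -/
  pairing : ∀ x, LinearMap.BilinForm ℝ (V x)
  pairing_symm : ∀ x (e e' : V x), pairing x e e' = pairing x e' e
  pairing_nondegenerate : ∀ x (e : V x), (∀ e' : V x, pairing x e e' = 0) → e = 0
  pairing_smooth : ∀ e e' : Cₛ^∞⟮𝓡 d; F, V⟯,
    ContMDiff (𝓡 d) 𝓘(ℝ, ℝ) ∞ (fun x => pairing x (e x) (e' x))
  /-- The anchor, a bundle map to the tangent bundle. -/
  anchor : ∀ x, V x →ₗ[ℝ] TangentSpace (𝓡 d) x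
  anchor_smooth : ContMDiff ((𝓡 d).prod 𝓘(ℝ, F)) (𝓡 d).tangent ∞
    (fun v : TotalSpace F V => (⟨v.proj, anchor v.proj v.2⟩ : TangentBundle (𝓡 d) X))
  /-- The bracket on smooth sections. -/
  bracket : Cₛ^∞⟮𝓡 d; F, V⟯ →ₗ[ℝ] Cₛ^∞⟮𝓡 d; F, V⟯ →ₗ[ℝ] Cₛ^∞⟮𝓡 d; F, V⟯
  /-- (C1) The Leibniz form of the Jacobi identity. -/
  jacobi : ∀ e₁ e₂ e₃, bracket e₁ (bracket e₂ e₃) =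
    bracket (bracket e₁ e₂) e₃ + bracket e₂ (bracket e₁ e₃)
  /-- (C2) The anchor intertwines the brackets. -/
  anchor_bracket : ∀ e₁ e₂ x, anchor x (bracket e₁ e₂ x) =
    VectorField.mlieBracket (𝓡 d) (fun y => anchor y (e₁ y)) (fun y => anchor y (e₂ y)) x
  /-- (C3) The Leibniz rule. -/
  leibniz : ∀ e₁ e₂ (f : C^∞⟮𝓡 d, X; 𝓘(ℝ, ℝ), ℝ⟯) x,
    bracket e₁ (funSMulSection f e₂) x =
      f x • bracket e₁ e₂ x + mvfderiv (𝓡 d) f x (anchor x (e₁ x)) • e₂ x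
  /-- (C4) Invariance of the pairing. -/
  invariance : ∀ e₁ e₂ e₃ x,
    mvfderiv (𝓡 d) (fun y => pairing y (e₂ y) (e₃ y)) x (anchor x (e₁ x)) =
      pairing x (bracket e₁ e₂ x) (e₃ x) + pairing x (e₂ x) (bracket e₁ e₃ x)
  /-- (C5) `[e, e] = D⟨e, e⟩`, where `⟨D f, w⟩ = ½ df(π w)` for every vector `w` of the bundle. -/
  bracket_self : ∀ e x (w : V x), pairing x (bracket e e x) w =
    (1 / 2 : ℝ) * mvfderiv (𝓡 d) (fun y => pairing y (e y) (e y)) x (anchor x w)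

namespace CourantAlgebroid

variable [IsManifold (𝓡 d) ∞ X] [ContMDiffVectorBundle ∞ F V (𝓡 d)]

/-- `e = π^* ξ`, where the pairing identifies the bundle with its dual: `⟨e, e'⟩ = ξ (π e')` for
all `e'`. -/
def IsCoanchor (C : CourantAlgebroid d F V) (x : X) (ξ : Module.Dual ℝ (TangentSpace (𝓡 d) x))
    (e : V x) : Prop :=
  ∀ e' : V x, C.pairing x e e' = ξ (C.anchor x e')

/-- Exactness of `0 → T^*X → V → TX → 0`, with maps `π^*` and `π`. -/
structure IsExact (C : CourantAlgebroid d F V) : Prop where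
  coanchor_injective : ∀ x (ξ : Module.Dual ℝ (TangentSpace (𝓡 d) x)),
    C.IsCoanchor x ξ 0 → ξ = 0
  ker_anchor : ∀ x (e : V x), C.anchor x e = 0 ↔ ∃ ξ, C.IsCoanchor x ξ e
  anchor_surjective : ∀ x, Function.Surjective (C.anchor x)

end CourantAlgebroid

end CourantAlgebroids

/-- A Courant algebra structure over a real Lie algebra `𝔤` on the vector space `𝔞`. -/
structure CourantAlgebra (𝔤 : Type*) [LieRing 𝔤] [LieAlgebra ℝ 𝔤]
    (𝔞 : Type*) [AddCommGroup 𝔞] [Module ℝ 𝔞] where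
  bracket : 𝔞 →ₗ[ℝ] 𝔞 →ₗ[ℝ] 𝔞
  proj : 𝔞 →ₗ[ℝ] 𝔤
  jacobi : ∀ a₁ a₂ a₃, bracket a₁ (bracket a₂ a₃) =
    bracket (bracket a₁ a₂) a₃ + bracket a₂ (bracket a₁ a₃)
  proj_bracket : ∀ a₁ a₂, proj (bracket a₁ a₂) = ⁅proj a₁, proj a₂⁆

namespace CourantAlgebra

variable {𝔤 : Type*} [LieRing 𝔤] [LieAlgebra ℝ 𝔤] {𝔞 : Type*} [AddCommGroup 𝔞] [Module ℝ 𝔞]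

/-- The ideal `𝔥 = ker (𝔞 → 𝔤)`. -/
def ideal (A : CourantAlgebra 𝔤 𝔞) : Submodule ℝ 𝔞 := LinearMap.ker A.proj

/-- A Courant algebra is exact if its projection is surjective with abelian kernel. -/
structure IsExact (A : CourantAlgebra 𝔤 𝔞) : Prop where
  proj_surjective : Function.Surjective A.proj
  ideal_abelian : ∀ h₁ ∈ A.ideal, ∀ h₂ ∈ A.ideal, A.bracket h₁ h₂ = 0

end CourantAlgebra

section Actions

variable {k n : ℕ}
  {G : Type*} [TopologicalSpace G] [ChartedSpace (EuclideanSpace ℝ (Fin k)) G] [Group G]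
  [LieGroup (𝓡 k) ∞ G]
  {M : Type*} [TopologicalSpace M] [ChartedSpace (EuclideanSpace ℝ (Fin n)) M]
  [IsManifold (𝓡 n) ∞ M] [MulAction G M]
  {F : Type*} [NormedAddCommGroup F] [NormedSpace ℝ F]
  {E : M → Type*} [TopologicalSpace (TotalSpace F E)] [∀ x, AddCommGroup (E x)]
  [∀ x, Module ℝ (E x)] [∀ x, TopologicalSpace (E x)] [FiberBundle F E] [VectorBundle ℝ F E]
  [ContMDiffVectorBundle ∞ F E (𝓡 n)]
  {𝔞 : Type*} [AddCommGroup 𝔞] [Module ℝ 𝔞]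

/-- The infinitesimal action `ψ : 𝔤 → Γ(TM)` of a left action. It is `d/dt exp(-tu) x` at `t = 0`;
the sign makes `ψ` a homomorphism for the bracket of left-invariant vector fields on `𝔤`. -/
def infinitesimalAction (u : GroupLieAlgebra (𝓡 k) G) (x : M) : TangentSpace (𝓡 n) x :=
  -(mfderiv (𝓡 k) (𝓡 n) (fun g : G => g • x) 1 u : EuclideanSpace ℝ (Fin n))

/-- An extension of the action of `G` on `M` to the Courant algebroid `C`, with exact Courant
algebra `A`. -/
structure ExtendedAction (C : CourantAlgebroid n F E)
    (A : CourantAlgebra (GroupLieAlgebra (𝓡 k) G) 𝔞) where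
  exact : A.IsExact
  /-- The morphism of Courant algebras `ρ : 𝔞 → Γ(E)`. -/
  toSection : 𝔞 →ₗ[ℝ] Cₛ^∞⟮𝓡 n; F, E⟯
  map_bracket : ∀ a b, toSection (A.bracket a b) = C.bracket (toSection a) (toSection b)
  anchor_toSection : ∀ a x, C.anchor x (toSection a x) = infinitesimalAction (A.proj a) x
  /-- `𝔥` acts trivially. -/
  bracket_ideal : ∀ h ∈ A.ideal, ∀ v, C.bracket (toSection h) v = 0
  /-- The action of `G` on the total space of `E` by vector bundle maps over its action on `M`. -/
  act : ∀ (g : G) (x : M), E x →ₗ[ℝ] E (g • x)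
  act_one : ∀ x (v : E x), (⟨(1 : G) • x, act 1 x v⟩ : TotalSpace F E) = ⟨x, v⟩
  act_mul : ∀ (g h : G) x (v : E x), (⟨(g * h) • x, act (g * h) x v⟩ : TotalSpace F E) =
    ⟨g • h • x, act g (h • x) (act h x v)⟩
  act_smooth : ContMDiff ((𝓡 k).prod ((𝓡 n).prod 𝓘(ℝ, F))) ((𝓡 n).prod 𝓘(ℝ, F)) ∞
    (fun z : G × TotalSpace F E =>
      (⟨z.1 • z.2.proj, act z.1 z.2.proj z.2.2⟩ : TotalSpace F E))
  /-- The action of `G` integrates that of `𝔤 = 𝔞 / 𝔥` on sections: the derivative at `g = 1` of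
  `(g · v)(x) = g (v (g⁻¹ x))`, a curve in the fibre at `x`, which the trivialization at `x`
  identifies with `F`, is `[ρ(a), v](x)` in the direction `π(a)`. -/
  act_infinitesimal : ∀ (a : 𝔞) (v : Cₛ^∞⟮𝓡 n; F, E⟯) (x : M),
    mvfderiv (𝓡 k) (fun g : G => (trivializationAt F E x
      (⟨g • g⁻¹ • x, act g (g⁻¹ • x) (v (g⁻¹ • x))⟩ : TotalSpace F E)).2) 1 (A.proj a) =
    (trivializationAt F E x
      (⟨x, C.bracket (toSection a) v x⟩ : TotalSpace F E)).2

namespace ExtendedAction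

variable {C : CourantAlgebroid n F E} {A : CourantAlgebra (GroupLieAlgebra (𝓡 k) G) 𝔞}
  (R : ExtendedAction C A)

/-- The distribution `K = ρ(𝔞)`. -/
def K (x : M) : Submodule ℝ (E x) := LinearMap.range (sectionEval F E x ∘ₗ R.toSection)

/-- The orthogonal distribution `K^⊥`. -/
def Kperp (x : M) : Submodule ℝ (E x) := (C.pairing x).orthogonal (R.K x)

/-- The distribution `ρ(𝔥)`. -/
def idealImage (x : M) : Submodule ℝ (E x) :=
  A.ideal.map (sectionEval F E x ∘ₗ R.toSection)

/-- The big distribution `Δ_b = π(K + K^⊥)`. -/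
def bigDistribution (x : M) : Submodule ℝ (TangentSpace (𝓡 n) x) :=
  (R.K x ⊔ R.Kperp x).map (C.anchor x)

/-- The fibre of `K^⊥ / (K ∩ K^⊥)`. -/
abbrev QuotFiber (x : M) : Type _ :=
  R.Kperp x ⧸ (R.K x ⊓ R.Kperp x).submoduleOf (R.Kperp x)

end ExtendedAction

end Actions

/-- A connected integral manifold of a distribution `Δ` on `M`: an injectively immersed connected
manifold whose tangent spaces are the fibres of `Δ`. -/
structure IsIntegralManifold (n p : ℕ) {M : Type*} [TopologicalSpace M]
    [ChartedSpace (EuclideanSpace ℝ (Fin n)) M]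
    (Δ : ∀ x : M, Submodule ℝ (TangentSpace (𝓡 n) x))
    {P : Type*} [TopologicalSpace P] [ChartedSpace (EuclideanSpace ℝ (Fin p)) P]
    (ι : P → M) : Prop where
  connected : ConnectedSpace P
  immersion : Manifold.IsImmersion (𝓡 p) (𝓡 n) ∞ ι
  injective : Function.Injective ι
  tangent : ∀ x : P, LinearMap.range (mfderiv (𝓡 p) (𝓡 n) ι x).toLinearMap = Δ (ι x)

/-- A leaf of a distribution: a maximal connected integral manifold. -/
structure IsLeaf.{u, v} (n p : ℕ) {M : Type u} [TopologicalSpace M]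
    [ChartedSpace (EuclideanSpace ℝ (Fin n)) M]
    (Δ : ∀ x : M, Submodule ℝ (TangentSpace (𝓡 n) x))
    {P : Type v} [TopologicalSpace P] [ChartedSpace (EuclideanSpace ℝ (Fin p)) P]
    (ι : P → M) : Prop extends
    IsIntegralManifold n p Δ ι where
  maximal : ∀ (q : ℕ) (N : Type u) [TopologicalSpace N]
    [ChartedSpace (EuclideanSpace ℝ (Fin q)) N] [IsManifold (𝓡 q) ∞ N]
    [SecondCountableTopology N] (j : N → M), IsIntegralManifold n q Δ j →
    range ι ⊆ range j → range j ⊆ range ι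

theorem totalSpace_add_eq {M F : Type*} {E : M → Type*} [∀ x, AddCommGroup (E x)] {x y : M}
    {a a' : E x} {b b' : E y} (h : (⟨x, a⟩ : TotalSpace F E) = ⟨y, b⟩)
    (h' : (⟨x, a'⟩ : TotalSpace F E) = ⟨y, b'⟩) :
    (⟨x, a + a'⟩ : TotalSpace F E) = ⟨y, b + b'⟩ := by
  cases h
  cases h'
  rfl

theorem totalSpace_smul_eq {M F : Type*} {E : M → Type*} [∀ x, AddCommGroup (E x)]
    [∀ x, Module ℝ (E x)] {x y : M} {a : E x} {b : E y} (t : ℝ)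
    (h : (⟨x, a⟩ : TotalSpace F E) = ⟨y, b⟩) :
    (⟨x, t • a⟩ : TotalSpace F E) = ⟨y, t • b⟩ := by
  cases h
  rfl

theorem totalSpace_zero_eq {M F : Type*} {E : M → Type*} [∀ x, AddCommGroup (E x)] {x y : M}
    (h : x = y) : (⟨x, 0⟩ : TotalSpace F E) = ⟨y, 0⟩ := by
  cases h
  rfl

section Reduction

variable {k n : ℕ}
  {G : Type*} [TopologicalSpace G] [ChartedSpace (EuclideanSpace ℝ (Fin k)) G] [Group G]
  [LieGroup (𝓡 k) ∞ G]
  {M : Type*} [TopologicalSpace M] [ChartedSpace (EuclideanSpace ℝ (Fin n)) M]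
  [IsManifold (𝓡 n) ∞ M] [MulAction G M]
  {F : Type*} [NormedAddCommGroup F] [NormedSpace ℝ F]
  {E : M → Type*} [TopologicalSpace (TotalSpace F E)] [∀ x, AddCommGroup (E x)]
  [∀ x, Module ℝ (E x)] [∀ x, TopologicalSpace (E x)] [FiberBundle F E] [VectorBundle ℝ F E]
  [ContMDiffVectorBundle ∞ F E (𝓡 n)]
  {𝔞 : Type*} [AddCommGroup 𝔞] [Module ℝ 𝔞]
  {C : CourantAlgebroid n F E} {A : CourantAlgebra (GroupLieAlgebra (𝓡 k) G) 𝔞}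

/-- The orbit map `P → P/G`. -/
def orbitMap (G : Type*) [Group G] {P : Type*} [MulAction G P] (p : P) :
    MulAction.orbitRel.Quotient G P :=
  Quotient.mk _ p

namespace ExtendedAction

variable (R : ExtendedAction C A) {P : Type*} [MulAction G P] (ι : P → M)
  (hι : ∀ (g : G) (p : P), ι (g • p) = g • ι p)

/-- The fibre of `(K^⊥ / (K ∩ K^⊥))|_P / G` over an orbit `c`, as the space of `G`-equivariant
sections of `K^⊥ / (K ∩ K^⊥)` along `c`. For a free action, evaluation at a point `p` of the orbit
identifies it with the fibre of `K^⊥ / (K ∩ K^⊥)` at `p`. -/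
def reducedSubmodule (c : MulAction.orbitRel.Quotient G P) :
    Submodule ℝ (∀ p : {p : P // orbitMap G p = c}, R.QuotFiber (ι p)) where
  carrier := {s | ∀ (g : G) (p : P) (hp : orbitMap G p = c) (hgp : orbitMap G (g • p) = c),
    ∃ (w : R.Kperp (ι p)) (w' : R.Kperp (ι (g • p))),
      s ⟨p, hp⟩ = Submodule.Quotient.mk w ∧ s ⟨g • p, hgp⟩ = Submodule.Quotient.mk w' ∧
      (⟨ι (g • p), (w' : E (ι (g • p)))⟩ : TotalSpace F E) = ⟨g • ι p, R.act g (ι p) w⟩}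
  add_mem' := by
    intro s t hs ht g p hp hgp
    obtain ⟨w, w', h₁, h₂, h₃⟩ := hs g p hp hgp
    obtain ⟨z, z', l₁, l₂, l₃⟩ := ht g p hp hgp
    refine ⟨w + z, w' + z', ?_, ?_, ?_⟩
    · rw [Pi.add_apply, h₁, l₁]; rfl
    · rw [Pi.add_apply, h₂, l₂]; rfl
    · simpa using totalSpace_add_eq h₃ l₃
  zero_mem' := by
    intro g p hp hgp
    refine ⟨0, 0, rfl, rfl, ?_⟩
    simpa using totalSpace_zero_eq (F := F) (E := E) (hι g p)
  smul_mem' := by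
    intro t s hs g p hp hgp
    obtain ⟨w, w', h₁, h₂, h₃⟩ := hs g p hp hgp
    refine ⟨t • w, t • w', ?_, ?_, ?_⟩
    · rw [Pi.smul_apply, h₁]; rfl
    · rw [Pi.smul_apply, h₂]; rfl
    · simpa using totalSpace_smul_eq t h₃

/-- The family of fibres of `E_red`. -/
def ReducedFiber (c : MulAction.orbitRel.Quotient G P) : Type _ := R.reducedSubmodule ι hι c

instance (c : MulAction.orbitRel.Quotient G P) : AddCommGroup (R.ReducedFiber ι hι c) :=
  inferInstanceAs (AddCommGroup (R.reducedSubmodule ι hι c))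

instance (c : MulAction.orbitRel.Quotient G P) : Module ℝ (R.ReducedFiber ι hι c) :=
  inferInstanceAs (Module ℝ (R.reducedSubmodule ι hι c))

/-- Evaluation at `p` of an element of the fibre of `E_red` over the orbit of `p`. -/
def reducedEval (p : P) : R.ReducedFiber ι hι (orbitMap G p) →ₗ[ℝ] R.QuotFiber (ι p) where
  toFun e := (e : R.reducedSubmodule ι hι (orbitMap G p)).1 ⟨p, rfl⟩
  map_add' _ _ := rfl
  map_smul' _ _ := rfl

/-- The vector `v ∈ E_{ι(p)}` lies in `K^⊥` and represents the element `e` of `E_red`. -/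
def Represents (p : P) (v : E (ι p)) (e : R.ReducedFiber ι hι (orbitMap G p)) : Prop :=
  ∃ hv : v ∈ R.Kperp (ι p),
    (Submodule.Quotient.mk ⟨v, hv⟩ : R.QuotFiber (ι p)) = R.reducedEval ι hι p e

/-- The restriction to `P` of the section `v` of `E` is, near `p`, a section of `K^⊥|_P` which
represents the section `e` of `E_red`. -/
def IsLiftAt [TopologicalSpace P] (p : P) (v : Cₛ^∞⟮𝓡 n; F, E⟯)
    (e : ∀ c : MulAction.orbitRel.Quotient G P, R.ReducedFiber ι hι c) : Prop :=
  ∀ᶠ p' in 𝓝 p, R.Represents ι hι p' (v (ι p')) (e (orbitMap G p'))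

/-- `K` is isotropic along `P`. -/
def IsIsotropicAlong : Prop := ∀ p : P, R.K (ι p) ≤ R.Kperp (ι p)

/-- The condition `π(K) ∩ π(K^⊥) = π(K ∩ K^⊥)` along `P`. -/
def ExactnessCondition : Prop :=
  ∀ p : P, (R.K (ι p)).map (C.anchor (ι p)) ⊓ (R.Kperp (ι p)).map (C.anchor (ι p)) =
    (R.K (ι p) ⊓ R.Kperp (ι p)).map (C.anchor (ι p))

variable {p d r : ℕ} [TopologicalSpace P] [ChartedSpace (EuclideanSpace ℝ (Fin p)) P]
  [ChartedSpace (EuclideanSpace ℝ (Fin d)) (MulAction.orbitRel.Quotient G P)]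
  [IsManifold (𝓡 d) ∞ (MulAction.orbitRel.Quotient G P)]
  [TopologicalSpace (TotalSpace (EuclideanSpace ℝ (Fin r)) (R.ReducedFiber ι hι))]
  [∀ c, TopologicalSpace (R.ReducedFiber ι hι c)]
  [FiberBundle (EuclideanSpace ℝ (Fin r)) (R.ReducedFiber ι hι)]
  [VectorBundle ℝ (EuclideanSpace ℝ (Fin r)) (R.ReducedFiber ι hι)]

variable (d r) in
/-- The smooth vector bundle structure on `E_red` is that of the quotient bundle
`(K^⊥ / (K ∩ K^⊥))|_P / G`: evaluation at points of `P` gives isomorphisms of fibres, and a section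
is smooth on an open set exactly if it is locally represented by smooth sections of `K^⊥|_P`. -/
structure IsQuotientBundle : Prop where
  eval_bijective : ∀ x : P, Function.Bijective (R.reducedEval ι hι x)
  smooth_iff : ∀ (U : Set (MulAction.orbitRel.Quotient G P)), IsOpen U →
    ∀ e : ∀ c : MulAction.orbitRel.Quotient G P, R.ReducedFiber ι hι c,
      ContMDiffOn (𝓡 d) ((𝓡 d).prod 𝓘(ℝ, EuclideanSpace ℝ (Fin r))) ∞
        (fun c => (⟨c, e c⟩ : TotalSpace (EuclideanSpace ℝ (Fin r)) (R.ReducedFiber ι hι))) U ↔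
      ∀ x : P, orbitMap G x ∈ U → ∃ v : Cₛ^∞⟮𝓡 n; F, E⟯, R.IsLiftAt ι hι x v e

variable (p) in
/-- The Courant algebroid structure `B` on `E_red` is induced by that of `E`: representatives in
`K^⊥|_P` compute the pairing and the anchor, and extensions to `M` of representatives of sections
compute the bracket. -/
structure IsInduced
    [ContMDiffVectorBundle ∞ (EuclideanSpace ℝ (Fin r)) (R.ReducedFiber ι hι) (𝓡 d)]
    (B : CourantAlgebroid d (EuclideanSpace ℝ (Fin r)) (R.ReducedFiber ι hι)) : Prop where
  pairing : ∀ (x : P) (v v' : E (ι x)) (e e' : R.ReducedFiber ι hι (orbitMap G x)),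
    R.Represents ι hι x v e → R.Represents ι hι x v' e' →
    B.pairing (orbitMap G x) e e' = C.pairing (ι x) v v'
  anchor : ∀ (x : P) (v : E (ι x)) (e : R.ReducedFiber ι hι (orbitMap G x))
    (u : TangentSpace (𝓡 p) x), R.Represents ι hι x v e →
    mfderiv (𝓡 p) (𝓡 n) ι x u = C.anchor (ι x) v →
    B.anchor (orbitMap G x) e = mfderiv (𝓡 p) (𝓡 d) (orbitMap G) x u
  bracket : ∀ (x : P) (v₁ v₂ : Cₛ^∞⟮𝓡 n; F, E⟯)
    (e₁ e₂ : Cₛ^∞⟮𝓡 d; EuclideanSpace ℝ (Fin r), R.ReducedFiber ι hι⟯),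
    R.IsLiftAt ι hι x v₁ e₁ → R.IsLiftAt ι hι x v₂ e₂ →
    R.Represents ι hι x (C.bracket v₁ v₂ (ι x)) (B.bracket e₁ e₂ (orbitMap G x))

end ExtendedAction

end Reduction

end

open Bundle Set Filter Topology
open scoped Manifold ContDiff

noncomputable section

/-! Two facts about the leaf are used throughout. Because the tangent spaces of `P` are the fibres
of `π(K + K^⊥)`, a function on `M` that vanishes along `P` has zero derivative along the anchor of
any element of `K + K^⊥` (`mvfderiv_anchor_eq_zero`). Identities that hold only along `P` can
therefore be differentiated in these directions, although brackets are computed with sections over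
`M`. And because the pairing is nondegenerate, `K^⊥⊥ = K`, so membership in `K` is tested by pairing
with `K^⊥` (`mem_K_of_forall_pairing`).

From the Lie algebra to the group. The action on `E` is known through the operators `[ρ(a), ·]`,
which give the derivatives of `g ↦ g v(g⁻¹ x)` along left-invariant fields (`mvfderiv_linear_push`).
On a connected group a function with zero such derivatives is constant, and by Gronwall a function
that vanishes at a point and is controlled linearly by itself vanishes nearby
(`eventually_eq_zero_of_frame_bound`). Axiom (C4) then makes the action isometric (`pairing_actTo`).
The derivative of `g ρ(a)` is `g ρ([b, a])`, a linear equation closed on frames of `K`, so the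
action preserves `K`, hence `K^⊥`, along `P`.

Constant ranks. Freeness makes `ρ(𝔥)` the kernel of `π` on `K`, so `K` has constant rank. The
dimension of `K ∩ K^⊥` is the corank of the Gram matrix `S` of a frame of `K`. Along `π(ρ(b))` its
derivative is `B S + S Bᵀ`, and along `π(K^⊥)` it is zero by polarized (C5). These directions span
the tangent space of `P`, and an equation of this shape preserves the rank
(`Matrix.eventually_rank_eq`); connectedness of `P` does the rest.

The reduced structure. Slices make `P/G` a manifold, and dual frames of `K^⊥/(K ∩ K^⊥)` along slices
give the bundle charts. A lift `v` of a section of `E_red` satisfies `[ρ(a), v] ∈ K ∩ K^⊥` along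
`P`. With (C4) and (C5) this puts `[v₁, v₂]` in `K^⊥` and makes its class independent of the lifts;
with (C1) the derivative of `g [v₁, v₂]` lies in `K`, so the class is equivariant. The anchor `π(v)`
is tangent to `P` and is projected to `P/G`, where `π(K)`, the orbit directions, disappears. Each
axiom is then the axiom of `E` evaluated on lifts (`exists_isInduced`).

Exactness. The orbit map kills `π(K)`, so `π(K^⊥)` alone covers the tangent spaces of `P/G`. The
class of `v ∈ K^⊥` has zero reduced anchor exactly if `π(v) ∈ π(K)`, and it comes from a covector of
`P/G` exactly if `v` can be changed by an element of `K ∩ K^⊥` into the kernel of `π`. Comparing the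
two conditions gives `π(K) ∩ π(K^⊥) = π(K ∩ K^⊥)`. -/

/-! ### Smooth germs -/

section SmoothNear

variable {m : ℕ} {N : Type*} [TopologicalSpace N] [ChartedSpace (EuclideanSpace ℝ (Fin m)) N]
  {V : Type*} [NormedAddCommGroup V] [NormedSpace ℝ V]

/-- The function `f` is smooth on a neighbourhood of `x`. -/
def SmoothNear (m : ℕ) {N : Type*} [TopologicalSpace N]
    [ChartedSpace (EuclideanSpace ℝ (Fin m)) N]
    {V : Type*} [NormedAddCommGroup V] [NormedSpace ℝ V] (f : N → V) (x : N) : Prop :=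
  ∀ᶠ y in 𝓝 x, ContMDiffAt (𝓡 m) 𝓘(ℝ, V) ∞ f y

theorem ContMDiff.smoothNear {f : N → V} (h : ContMDiff (𝓡 m) 𝓘(ℝ, V) ∞ f) (x : N) :
    SmoothNear m f x :=
  Eventually.of_forall fun y => h y

namespace SmoothNear

variable {f g : N → V} {a b : N → ℝ} {x : N}

theorem contMDiffAt (h : SmoothNear m f x) : ContMDiffAt (𝓡 m) 𝓘(ℝ, V) ∞ f x :=
  h.self_of_nhds

theorem mdifferentiableAt (h : SmoothNear m f x) :
    MDifferentiableAt (𝓡 m) 𝓘(ℝ, V) f x :=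
  h.contMDiffAt.mdifferentiableAt (by simp)

theorem continuousAt (h : SmoothNear m f x) : ContinuousAt f x :=
  h.contMDiffAt.continuousAt

theorem eventually (h : SmoothNear m f x) : ∀ᶠ y in 𝓝 x, SmoothNear m f y :=
  eventually_eventually_nhds.2 h

theorem congr (h : SmoothNear m f x) (hfg : g =ᶠ[𝓝 x] f) : SmoothNear m g x := by
  filter_upwards [h, hfg.eventuallyEq_nhds] with y hy hy'
  exact hy.congr_of_eventuallyEq hy'

theorem const (c : V) : SmoothNear m (fun _ : N => c) x :=
  contMDiff_const.smoothNear x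

theorem add (hf : SmoothNear m f x) (hg : SmoothNear m g x) :
    SmoothNear m (fun y => f y + g y) x := by
  filter_upwards [hf, hg] with y h h' using h.add h'

theorem sub (hf : SmoothNear m f x) (hg : SmoothNear m g x) :
    SmoothNear m (fun y => f y - g y) x := by
  filter_upwards [hf, hg] with y h h' using h.sub h'

theorem smul (ha : SmoothNear m a x) (hg : SmoothNear m g x) :
    SmoothNear m (fun y => a y • g y) x := by
  filter_upwards [ha, hg] with y h h' using h.smul h'

theorem mul (ha : SmoothNear m a x) (hb : SmoothNear m b x) :
    SmoothNear m (fun y => a y * b y) x :=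
  ha.smul hb

theorem sum {ι : Type*} {s : Finset ι} {F : ι → N → V} (h : ∀ i ∈ s, SmoothNear m (F i) x) :
    SmoothNear m (fun y => ∑ i ∈ s, F i y) x := by
  have : ∀ᶠ y in 𝓝 x, ∀ i ∈ s, ContMDiffAt (𝓡 m) 𝓘(ℝ, V) ∞ (F i) y :=
    (Filter.eventually_all_finset s).2 h
  filter_upwards [this] with y hy
  exact ContMDiffAt.sum hy

theorem prod {ι : Type*} {s : Finset ι} {F : ι → N → ℝ} (h : ∀ i ∈ s, SmoothNear m (F i) x) :
    SmoothNear m (fun y => ∏ i ∈ s, F i y) x := by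
  classical
  induction s using Finset.induction_on with
  | empty => simpa using const (m := m) (x := x) (1 : ℝ)
  | insert i s hi ih =>
    simp only [Finset.prod_insert hi]
    exact (h i (by simp)).mul (ih fun j hj => h j (by simp [hj]))

theorem inv (ha : SmoothNear m a x) (h0 : a x ≠ 0) : SmoothNear m (fun y => (a y)⁻¹) x := by
  filter_upwards [ha, ha.continuousAt.eventually_ne h0] with y h h' using h.inv₀ h'

theorem comp {m' : ℕ} {N' : Type*} [TopologicalSpace N']
    [ChartedSpace (EuclideanSpace ℝ (Fin m')) N'] {φ : N' → N} {z : N'}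
    (hf : SmoothNear m f (φ z)) (hφ : ∀ᶠ y in 𝓝 z, ContMDiffAt (𝓡 m') (𝓡 m) ∞ φ y) :
    SmoothNear m' (fun y => f (φ y)) z := by
  filter_upwards [hφ, hφ.self_of_nhds.continuousAt.eventually hf] with y h h'
  exact h'.comp y h

theorem matrix_det {ι : Type*} [Fintype ι] [DecidableEq ι] {A : N → Matrix ι ι ℝ}
    (h : ∀ i j, SmoothNear m (fun y => A y i j) x) : SmoothNear m (fun y => (A y).det) x := by
  simp only [Matrix.det_apply]
  refine sum fun σ _ => ?_
  have : SmoothNear m (fun y => ((Equiv.Perm.sign σ : ℤ) : ℝ) * ∏ i, A y (σ i) i) x :=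
    (const _).mul (prod fun i _ => h _ _)
  refine this.congr (Eventually.of_forall fun y => ?_)
  simp [Units.smul_def]

theorem matrix_inv {ι : Type*} [Fintype ι] [DecidableEq ι] {A : N → Matrix ι ι ℝ}
    (h : ∀ i j, SmoothNear m (fun y => A y i j) x) (h0 : (A x).det ≠ 0) (i j : ι) :
    SmoothNear m (fun y => (A y)⁻¹ i j) x := by
  have : SmoothNear m (fun y => ((A y).det)⁻¹ * (A y).adjugate i j) x := by
    refine ((matrix_det h).inv h0).mul ?_
    simp only [Matrix.adjugate_apply]
    refine matrix_det fun k l => ?_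
    by_cases hk : k = j
    · subst hk
      simpa using const (m := m) (x := x) _
    · simpa [Matrix.updateRow_ne hk] using h k l
  -- Adjugate over determinant equals the inverse at every point: where the determinant vanishes,
  -- both sides are zero by convention.
  refine this.congr (Eventually.of_forall fun y => ?_)
  simp [Matrix.inv_def, Ring.inverse_eq_inv']

/-- Germs of smooth functions extend to globally defined smooth functions. -/
theorem exists_contMDiffMap [T2Space N] [IsManifold (𝓡 m) ∞ N] {f : N → ℝ}
    (hf : SmoothNear m f x) :
    ∃ F : C^∞⟮𝓡 m, N; 𝓘(ℝ, ℝ), ℝ⟯, ∀ᶠ y in 𝓝 x, F y = f y := by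
  obtain ⟨b, -, hb⟩ := (SmoothBumpFunction.nhds_basis_tsupport (I := 𝓡 m) x).mem_iff.1 hf
  refine ⟨⟨fun y => b y * f y, ?_⟩, ?_⟩
  · refine contMDiff_of_tsupport fun y hy => ?_
    have hy' : y ∈ tsupport b := tsupport_mul_subset_left hy
    exact b.contMDiffAt.mul (hb hy')
  · filter_upwards [b.eventuallyEq_one] with y hy
    change b y * f y = f y
    rw [hy]
    simp

end SmoothNear

end SmoothNear

/-! ### Sections of vector bundles -/

section Sections

variable {m : ℕ} {X : Type*} [TopologicalSpace X] [ChartedSpace (EuclideanSpace ℝ (Fin m)) X]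
  [IsManifold (𝓡 m) ∞ X]
  {F : Type*} [NormedAddCommGroup F] [NormedSpace ℝ F]
  {V : X → Type*} [TopologicalSpace (TotalSpace F V)] [∀ x, AddCommGroup (V x)]
  [∀ x, Module ℝ (V x)] [∀ x, TopologicalSpace (V x)] [FiberBundle F V] [VectorBundle ℝ F V]

/-- A bump function with closed support in the set of smoothness cuts the germ off. Brackets accept
only globally defined sections, so every local construction passes through this. -/
theorem exists_section_eventuallyEq [T2Space X] {σ : ∀ x, V x} {x : X}
    (hσ : ∀ᶠ y in 𝓝 x, ContMDiffAt (𝓡 m) ((𝓡 m).prod 𝓘(ℝ, F)) ∞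
      (fun y => TotalSpace.mk' F y (σ y)) y) :
    ∃ s : Cₛ^∞⟮𝓡 m; F, V⟯, ∀ᶠ y in 𝓝 x, s y = σ y := by
  obtain ⟨U, hU, hUo, hxU⟩ := eventually_nhds_iff.1 hσ
  obtain ⟨b, -, hb⟩ := (SmoothBumpFunction.nhds_basis_tsupport (I := 𝓡 m) x).mem_iff.1
    (hUo.mem_nhds hxU)
  refine ⟨⟨fun y => b y • σ y, ?_⟩, ?_⟩
  · exact ContMDiffOn.smul_section_of_tsupport (u := U) b.contMDiff.contMDiffOn hUo hb
      fun y hy => (hU y hy).contMDiffWithinAt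
  · filter_upwards [b.eventuallyEq_one] with y hy
    change b y • σ y = σ y
    rw [hy]
    simp

theorem exists_section_eq [ContMDiffVectorBundle ∞ F V (𝓡 m)] [T2Space X] (x : X) (v : V x) :
    ∃ s : Cₛ^∞⟮𝓡 m; F, V⟯, s x = v := by
  obtain ⟨U, hU, hs⟩ := FiberBundle.exists_contMDiffOn_extend (k := ∞) (𝓡 m) F v
  obtain ⟨s, h⟩ := exists_section_eventuallyEq (m := m) (F := F)
    (σ := FiberBundle.extend F v) (x := x) (by
      filter_upwards [eventually_mem_nhds_iff.2 hU] with y hy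
      exact hs.contMDiffAt hy)
  exact ⟨s, by rw [h.self_of_nhds]; simp⟩

/-- Near every point there is a frame of globally defined smooth sections, with coefficients
given by a basis of the typical fibre and the trivialization at the point. -/
theorem exists_local_frame [ContMDiffVectorBundle ∞ F V (𝓡 m)] [T2Space X]
    {ι : Type*} [Fintype ι] (b : Module.Basis ι ℝ F) (x : X) :
    ∃ s : ι → Cₛ^∞⟮𝓡 m; F, V⟯, ∀ᶠ y in 𝓝 x, ∀ v : V y,
      v = ∑ i, b.repr (trivializationAt F V x ⟨y, v⟩).2 i • s i y := by
  have hx := FiberBundle.mem_baseSet_trivializationAt' (F := F) (E := V) x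
  have H : ∀ i, ∃ s : Cₛ^∞⟮𝓡 m; F, V⟯, ∀ᶠ y in 𝓝 x,
      s y = (trivializationAt F V x).localFrame b i y := by
    intro i
    refine exists_section_eventuallyEq ?_
    filter_upwards [(trivializationAt F V x).open_baseSet.mem_nhds hx] with y hy
    exact contMDiffAt_localFrame_of_mem (n := ∞) (trivializationAt F V x) b i hy
  choose s hs using H
  refine ⟨s, ?_⟩
  filter_upwards [(trivializationAt F V x).open_baseSet.mem_nhds hx, eventually_all.2 hs]
    with y hy hsy v
  simp only [hsy, Trivialization.localFrame_apply_of_mem_baseSet _ b hy]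
  conv_lhs => rw [← ((trivializationAt F V x).basisAt b hy).sum_repr v]
  refine Finset.sum_congr rfl fun i _ => ?_
  simp [Trivialization.basisAt]

/-- The axiom gives smoothness only for pairs of global sections. Expanding in a local frame extends
it to vectors over a moving base point `β z`, as needed for curves of the form `g⁻¹ v`. -/
theorem CourantAlgebroid.contMDiffAt_pairing [ContMDiffVectorBundle ∞ F V (𝓡 m)] [T2Space X]
    [FiniteDimensional ℝ F]
    (C : CourantAlgebroid m F V) {E' H' : Type*} [NormedAddCommGroup E'] [NormedSpace ℝ E']
    [TopologicalSpace H'] {I' : ModelWithCorners ℝ E' H'} {N : Type*} [TopologicalSpace N]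
    [ChartedSpace H' N] {β : N → X} {f₁ f₂ : ∀ z, V (β z)} {z : N}
    (h₁ : ContMDiffAt I' ((𝓡 m).prod 𝓘(ℝ, F)) ∞ (fun z => (⟨β z, f₁ z⟩ : TotalSpace F V)) z)
    (h₂ : ContMDiffAt I' ((𝓡 m).prod 𝓘(ℝ, F)) ∞ (fun z => (⟨β z, f₂ z⟩ : TotalSpace F V)) z) :
    ContMDiffAt I' 𝓘(ℝ, ℝ) ∞ (fun z => C.pairing (β z) (f₁ z) (f₂ z)) z := by
  obtain ⟨s, hs⟩ := exists_local_frame (m := m) (F := F) (V := V) (Module.finBasis ℝ F) (β z)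
  set b := Module.finBasis ℝ F
  rw [contMDiffAt_totalSpace] at h₁ h₂
  obtain ⟨hβ, h₁⟩ := h₁
  obtain ⟨-, h₂⟩ := h₂
  have hco : ∀ (f : ∀ z, V (β z)), ContMDiffAt I' 𝓘(ℝ, F) ∞
      (fun y => (trivializationAt F V (β z) ⟨β y, f y⟩).2) z → ∀ i, ContMDiffAt I' 𝓘(ℝ, ℝ) ∞
      (fun y => b.repr (trivializationAt F V (β z) ⟨β y, f y⟩).2 i) z := by
    intro f hf i
    exact (LinearMap.toContinuousLinearMap (b.coord i)).contMDiff.contMDiffAt.comp z hf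
  have hsum : ContMDiffAt I' 𝓘(ℝ, ℝ) ∞ (fun y => ∑ i, ∑ j,
      b.repr (trivializationAt F V (β z) ⟨β y, f₁ y⟩).2 i *
      (b.repr (trivializationAt F V (β z) ⟨β y, f₂ y⟩).2 j *
        C.pairing (β y) (s i (β y)) (s j (β y)))) z := by
    refine ContMDiffAt.sum fun i _ => ContMDiffAt.sum fun j _ => ?_
    refine (hco f₁ h₁ i).mul ((hco f₂ h₂ j).mul ?_)
    exact (C.pairing_smooth (s i) (s j)).contMDiffAt.comp z hβ
  refine hsum.congr_of_eventuallyEq ?_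
  filter_upwards [hβ.continuousAt.eventually hs] with y hy
  conv_lhs => rw [hy (f₁ y), hy (f₂ y)]
  simp only [map_sum, map_smul, LinearMap.sum_apply, LinearMap.smul_apply, smul_eq_mul,
    Finset.mul_sum]
  rw [Finset.sum_comm]
  refine Finset.sum_congr rfl fun i _ => Finset.sum_congr rfl fun j _ => ?_
  ring

end Sections

/-! ### Immersed submanifolds: local retractions and extension of functions. -/

section Immersions

variable {n p : ℕ} {M : Type*} [TopologicalSpace M] [ChartedSpace (EuclideanSpace ℝ (Fin n)) M]
  [IsManifold (𝓡 n) ∞ M]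
  {P : Type*} [TopologicalSpace P] [ChartedSpace (EuclideanSpace ℝ (Fin p)) P]
  [IsManifold (𝓡 p) ∞ P] {ι : P → M}

omit [IsManifold (𝓡 n) ∞ M] [IsManifold (𝓡 p) ∞ P] in
/-- An immersion has local smooth left inverses. -/
theorem Manifold.IsImmersion.exists_local_retraction
    (hι : Manifold.IsImmersion (𝓡 p) (𝓡 n) ∞ ι) (x : P) :
    ∃ r : M → P, (∀ᶠ y in 𝓝 (ι x), ContMDiffAt (𝓡 n) (𝓡 p) ∞ r y) ∧ ∀ᶠ y in 𝓝 x, r (ι y) = y := by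
  have h := hι.isImmersionAt x
  set φ := h.domChart
  set ψ := h.codChart
  have hφx : x ∈ φ.source := h.mem_domChart_source
  have hψx : ι x ∈ ψ.source := h.mem_codChart_source
  have hw : ∀ y ∈ φ.source, ψ (ι y) = h.equiv (φ y, 0) := by
    intro y hy
    have hm : φ y ∈ (h.domChart.extend (𝓡 p)).target := by
      simpa [φ] using φ.map_source hy
    have hw := h.writtenInCharts hm
    simp only [Function.comp_apply] at hw
    have : (h.domChart.extend (𝓡 p)).symm (φ y) = y := by simp [φ, hy]
    rw [this] at hw
    exact hw
  have hpr : Continuous fun z => (h.equiv.symm z).1 := by fun_prop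
  -- In adapted charts the immersion is `u ↦ (u, 0)`, and the retraction is the first projection.
  refine ⟨fun y => φ.symm (h.equiv.symm (ψ y)).1, ?_, ?_⟩
  · have hfst : (h.equiv.symm (ψ (ι x))).1 ∈ φ.target := by
      rw [hw x hφx]
      simpa using φ.map_source hφx
    have h1 : ∀ᶠ y in 𝓝 (ι x), (h.equiv.symm (ψ y)).1 ∈ φ.target :=
      (hpr.continuousAt.comp (ψ.continuousAt hψx)).eventually (φ.open_target.mem_nhds hfst)
    filter_upwards [h1, ψ.open_source.mem_nhds hψx] with y hy hy'
    have a1 : ContMDiffAt (𝓡 n) (𝓡 n) ∞ ψ y :=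
      contMDiffAt_of_mem_maximalAtlas h.codChart_mem_maximalAtlas hy'
    have a2 : ContMDiffAt (𝓡 n) 𝓘(ℝ, EuclideanSpace ℝ (Fin p)) ∞
        (fun z : EuclideanSpace ℝ (Fin n) => (h.equiv.symm z).1) (ψ y) := by
      have : ContDiff ℝ ∞ (fun z : EuclideanSpace ℝ (Fin n) => (h.equiv.symm z).1) := by fun_prop
      exact this.contMDiff.contMDiffAt
    have a3 : ContMDiffAt (𝓡 p) (𝓡 p) ∞ φ.symm (h.equiv.symm (ψ y)).1 :=
      contMDiffAt_symm_of_mem_maximalAtlas h.domChart_mem_maximalAtlas hy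
    exact a3.comp y (a2.comp y a1)
  · filter_upwards [φ.open_source.mem_nhds hφx] with y hy
    simp [hw y hy, hy]

/-- Locally, smooth functions on an immersed manifold extend to the ambient manifold. -/
theorem Manifold.IsImmersion.exists_extension [T2Space M]
    (hι : Manifold.IsImmersion (𝓡 p) (𝓡 n) ∞ ι) {x : P} {f : P → ℝ} (hf : SmoothNear p f x) :
    ∃ F : C^∞⟮𝓡 n, M; 𝓘(ℝ, ℝ), ℝ⟯, ∀ᶠ y in 𝓝 x, F (ι y) = f y := by
  obtain ⟨r, hr, hrι⟩ := hι.exists_local_retraction x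
  have hfr : SmoothNear n (fun y => f (r y)) (ι x) :=
    SmoothNear.comp (by rwa [hrι.self_of_nhds]) hr
  obtain ⟨F, hF⟩ := hfr.exists_contMDiffMap
  refine ⟨F, ?_⟩
  filter_upwards [hι.contMDiff.continuous.continuousAt.eventually hF, hrι] with y hy hy'
  rw [hy, hy']

theorem Manifold.IsImmersion.mfderiv_injective
    (hι : Manifold.IsImmersion (𝓡 p) (𝓡 n) ∞ ι) (x : P) :
    Function.Injective (mfderiv (𝓡 p) (𝓡 n) ι x) := by
  obtain ⟨r, hr, hrι⟩ := hι.exists_local_retraction x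
  have h1 : mfderiv (𝓡 p) (𝓡 p) (r ∘ ι) x =
      (mfderiv (𝓡 n) (𝓡 p) r (ι x)).comp (mfderiv (𝓡 p) (𝓡 n) ι x) :=
    mfderiv_comp x (hr.self_of_nhds.mdifferentiableAt (by simp))
      (hι.contMDiff.contMDiffAt.mdifferentiableAt (by simp))
  have h2 : r ∘ ι =ᶠ[𝓝 x] id := hrι
  have h3 : mfderiv (𝓡 p) (𝓡 p) (r ∘ ι) x = mfderiv (𝓡 p) (𝓡 p) id x := h2.mfderiv_eq
  rw [mfderiv_id] at h3
  intro u v huv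
  have key : ∀ w : TangentSpace (𝓡 p) x,
      mfderiv (𝓡 n) (𝓡 p) r (ι x) (mfderiv (𝓡 p) (𝓡 n) ι x w) = w := by
    intro w
    exact (congrArg (fun A => A w) (h1.symm.trans h3) :)
  exact (key u).symm.trans ((congrArg (mfderiv (𝓡 n) (𝓡 p) r (ι x)) huv).trans (key v))

-- Continuity into `P` has to be supplied: an injective immersion need not be an embedding, so
-- smoothness into `M` alone does not control the topology of `P`.
omit [IsManifold (𝓡 n) ∞ M] [IsManifold (𝓡 p) ∞ P] in
theorem Manifold.IsImmersion.contMDiffAt_iff {E' H' N : Type*} [NormedAddCommGroup E']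
    [NormedSpace ℝ E'] [TopologicalSpace H'] {I' : ModelWithCorners ℝ E' H'} [TopologicalSpace N]
    [ChartedSpace H' N] (hι : Manifold.IsImmersion (𝓡 p) (𝓡 n) ∞ ι) {f : N → P}
    {z : N} (hf : ContinuousAt f z) (h : ContMDiffAt I' (𝓡 n) ∞ (ι ∘ f) z) :
    ContMDiffAt I' (𝓡 p) ∞ f z :=
  (ContMDiffAt.iff_comp_isImmersionAtOfComplement
    (hι.isImmersionAt (f z)).isImmersionAtOfComplement_complement).2 ⟨hf, h⟩

end Immersions

/-! ### Gronwall's inequality along frames. -/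

section Frames

variable {m : ℕ} {N : Type*} [TopologicalSpace N] [ChartedSpace (EuclideanSpace ℝ (Fin m)) N]
  [IsManifold (𝓡 m) ∞ N]
  {V : Type*} [NormedAddCommGroup V] [NormedSpace ℝ V]

theorem mvfderiv_eq_fderiv_comp_extChartAt {l : N → V} {x₀ y : N}
    (hy : y ∈ (chartAt (EuclideanSpace ℝ (Fin m)) x₀).source)
    (hl : MDifferentiableAt (𝓡 m) 𝓘(ℝ, V) l y) (u : TangentSpace (𝓡 m) y) :
    DifferentiableAt ℝ (l ∘ (extChartAt (𝓡 m) x₀).symm) (extChartAt (𝓡 m) x₀ y) ∧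
    mvfderiv (𝓡 m) l y u = fderiv ℝ (l ∘ (extChartAt (𝓡 m) x₀).symm) (extChartAt (𝓡 m) x₀ y)
      ((trivializationAt (EuclideanSpace ℝ (Fin m)) (TangentSpace (𝓡 m)) x₀ ⟨y, u⟩).2) := by
  have hy' : y ∈ (extChartAt (𝓡 m) x₀).source := by simpa using hy
  have hs : MDifferentiableAt (𝓡 m) (𝓡 m) (extChartAt (𝓡 m) x₀).symm (extChartAt (𝓡 m) x₀ y) := by
    have := (contMDiffOn_extChartAt_symm (I := 𝓡 m) (n := ∞) x₀).contMDiffAt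
      (extChartAt_target_mem_nhds' ((extChartAt (𝓡 m) x₀).map_source hy'))
    exact this.mdifferentiableAt (by simp)
  have hinv : (extChartAt (𝓡 m) x₀).symm (extChartAt (𝓡 m) x₀ y) = y :=
    (extChartAt (𝓡 m) x₀).left_inv hy'
  have hφ : MDifferentiableAt (𝓡 m) (𝓡 m) (extChartAt (𝓡 m) x₀) y :=
    (contMDiffAt_extChartAt' (n := ∞) hy).mdifferentiableAt (by simp)
  have hd : MDifferentiableAt (𝓡 m) 𝓘(ℝ, V) (l ∘ (extChartAt (𝓡 m) x₀).symm)
      (extChartAt (𝓡 m) x₀ y) := MDifferentiableAt.comp _ (by rwa [hinv]) hs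
  refine ⟨mdifferentiableAt_iff_differentiableAt.1 hd, ?_⟩
  have hcomp : mfderiv (𝓡 m) 𝓘(ℝ, V) ((l ∘ (extChartAt (𝓡 m) x₀).symm) ∘ extChartAt (𝓡 m) x₀) y =
      (mfderiv (𝓡 m) 𝓘(ℝ, V) (l ∘ (extChartAt (𝓡 m) x₀).symm) (extChartAt (𝓡 m) x₀ y)).comp
        (mfderiv (𝓡 m) (𝓡 m) (extChartAt (𝓡 m) x₀) y) := mfderiv_comp y hd hφ
  have hev : (l ∘ (extChartAt (𝓡 m) x₀).symm) ∘ extChartAt (𝓡 m) x₀ =ᶠ[𝓝 y] l := by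
    filter_upwards [extChartAt_source_mem_nhds' hy'] with z hz
    exact congrArg l ((extChartAt (𝓡 m) x₀).left_inv hz)
  have htr := TangentBundle.continuousLinearMapAt_trivializationAt (I := 𝓡 m) hy
  have hb : y ∈ (trivializationAt (EuclideanSpace ℝ (Fin m)) (TangentSpace (𝓡 m)) x₀).baseSet := hy
  have htr' : (trivializationAt (EuclideanSpace ℝ (Fin m)) (TangentSpace (𝓡 m)) x₀ ⟨y, u⟩).2 =
      mfderiv (𝓡 m) (𝓡 m) (extChartAt (𝓡 m) x₀) y u := by
    have h1 : (trivializationAt (EuclideanSpace ℝ (Fin m)) (TangentSpace (𝓡 m))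
        x₀).continuousLinearMapAt ℝ y u =
        (trivializationAt (EuclideanSpace ℝ (Fin m)) (TangentSpace (𝓡 m)) x₀ ⟨y, u⟩).2 := by
      rw [Trivialization.continuousLinearMapAt_apply, Trivialization.coe_linearMapAt_of_mem _ hb]
    exact h1.symm.trans (congrArg (fun A => A u) htr)
  have h2 : mvfderiv (𝓡 m) l y u = mfderiv (𝓡 m) 𝓘(ℝ, V)
      ((l ∘ (extChartAt (𝓡 m) x₀).symm) ∘ extChartAt (𝓡 m) x₀) y u := by
    rw [hev.mfderiv_eq]; rfl
  rw [h2, hcomp, htr', ← mfderiv_eq_fderiv]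
  rfl

/-- A linear estimate on the derivatives of `l` along a continuous frame bounds its differential
in a chart. -/
theorem eventually_eq_zero_of_frame_bound {κ : Type*} [Fintype κ] {x₀ : N} {l : N → V}
    (hl : ∀ᶠ y in 𝓝 x₀, MDifferentiableAt (𝓡 m) 𝓘(ℝ, V) l y)
    {X : κ → ∀ y : N, TangentSpace (𝓡 m) y}
    (hX : ∀ i, ContinuousAt (fun y => (⟨y, X i y⟩ : TangentBundle (𝓡 m) N)) x₀)
    (hspan : ⊤ ≤ Submodule.span ℝ (Set.range fun i => X i x₀)) {K : ℝ}
    (hb : ∀ᶠ y in 𝓝 x₀, ∀ i, ‖mvfderiv (𝓡 m) l y (X i y)‖ ≤ K * ‖l y‖) (h0 : l x₀ = 0) :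
    ∀ᶠ y in 𝓝 x₀, l y = 0 := by
  classical
  let e := trivializationAt (EuclideanSpace ℝ (Fin m)) (TangentSpace (𝓡 m) : N → Type _) x₀
  let Y : κ → N → EuclideanSpace ℝ (Fin m) := fun i y => (e ⟨y, X i y⟩).2
  have hY : ∀ i, ContinuousAt (Y i) x₀ := by
    intro i
    have h1 := hX i
    rw [FiberBundle.continuousAt_totalSpace] at h1
    exact h1.2
  have hx₀ : x₀ ∈ e.baseSet := FiberBundle.mem_baseSet_trivializationAt' x₀
  have hYspan : ∀ ζ : EuclideanSpace ℝ (Fin m), ∃ c : κ → ℝ, ∑ i, c i • Y i x₀ = ζ := by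
    intro ζ
    have h1 : e.symm x₀ ζ ∈ Submodule.span ℝ (Set.range fun i => X i x₀) := hspan trivial
    obtain ⟨c, hc⟩ := (Submodule.mem_span_range_iff_exists_fun ℝ).1 h1
    refine ⟨c, ?_⟩
    have h2 : ∀ u : TangentSpace (𝓡 m) x₀, (e ⟨x₀, u⟩).2 = e.linearEquivAt ℝ x₀ hx₀ u :=
      fun u => rfl
    have h3 : e.linearEquivAt ℝ x₀ hx₀ (e.symm x₀ ζ) = ζ := by
      rw [← h2, e.apply_mk_symm hx₀]
    simp only [Y, h2]
    rw [← h3, ← hc, map_sum]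
    simp only [map_smul]
  let S : (κ → ℝ) →ₗ[ℝ] EuclideanSpace ℝ (Fin m) :=
    { toFun := fun c => ∑ i, c i • Y i x₀
      map_add' := fun c c' => by simp [add_smul, Finset.sum_add_distrib]
      map_smul' := fun t c => by simp [mul_smul, Finset.smul_sum] }
  -- A linear right inverse chooses coefficients of `ζ` in the spanning family at `x₀`, bounded by
  -- `β ‖ζ‖`.
  obtain ⟨B, hB⟩ := S.exists_rightInverse_of_surjective (LinearMap.range_eq_top.2 hYspan)
  let B' := LinearMap.toContinuousLinearMap B
  have hB' : ∀ ζ, ∑ i, B' ζ i • Y i x₀ = ζ := fun ζ => LinearMap.congr_fun hB ζ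
  set β := ‖B'‖
  set c₀ := (Fintype.card κ : ℝ)
  -- `ε` bounds the variation of the frame near `x₀`. It is so small that the error it causes, at
  -- most `‖L‖ / 2`, can be absorbed in the left-hand side.
  obtain ⟨ε, hε, hε'⟩ : ∃ ε > 0, β * c₀ * ε ≤ 1 / 2 := by
    refine ⟨1 / (2 * (β * c₀ + 1)), by positivity, ?_⟩
    have : 0 ≤ β * c₀ := by positivity
    rw [mul_one_div, div_le_div_iff₀ (by positivity) (by norm_num)]
    linarith
  let φ := extChartAt (𝓡 m) x₀
  let lh := l ∘ φ.symm
  have hK0 : ∀ y, K * ‖l y‖ ≤ |K| * ‖l y‖ := fun y => by gcongr; exact le_abs_self K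
  have hbound : ∀ᶠ y in 𝓝 x₀, DifferentiableAt ℝ lh (φ y) ∧
      ‖fderiv ℝ lh (φ y)‖ ≤ 2 * (β * c₀ * |K|) * ‖l y‖ := by
    have hYε : ∀ᶠ y in 𝓝 x₀, ∀ i, ‖Y i x₀ - Y i y‖ ≤ ε := by
      refine eventually_all.2 fun i => ?_
      filter_upwards [(hY i).eventually (Metric.ball_mem_nhds _ hε)] with y hy
      rw [dist_comm, dist_eq_norm] at hy
      exact hy.le
    filter_upwards [hl, hb, hYε, (chartAt (EuclideanSpace ℝ (Fin m)) x₀).open_source.mem_nhds (mem_chart_source (EuclideanSpace ℝ (Fin m)) x₀)]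
      with y hly hby hYy hys
    have hd := mvfderiv_eq_fderiv_comp_extChartAt (V := V) hys hly
    have hdiff := (hd (0 : TangentSpace (𝓡 m) y)).1
    refine ⟨hdiff, ?_⟩
    set L := fderiv ℝ lh (φ y)
    have hLY : ∀ i, ‖L (Y i y)‖ ≤ |K| * ‖l y‖ := fun i => by
      rw [show L (Y i y) = _ from ((hd (X i y)).2).symm]
      exact (hby i).trans (hK0 y)
    -- Expand a vector in the frame at `x₀`; on each frame vector replace `Y i x₀` by `Y i y`, where
    -- the hypothesis applies, at the cost of `‖L‖ ε`.
    have hL : ‖L‖ ≤ β * c₀ * (|K| * ‖l y‖ + ‖L‖ * ε) := by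
      refine L.opNorm_le_bound (by positivity) fun ζ => ?_
      conv_lhs => rw [← hB' ζ]
      rw [map_sum]
      refine (norm_sum_le _ _).trans ?_
      have hterm : ∀ i ∈ Finset.univ, ‖L (B' ζ i • Y i x₀)‖ ≤
          β * ‖ζ‖ * (|K| * ‖l y‖ + ‖L‖ * ε) := by
        intro i _
        rw [map_smul, norm_smul]
        have h1 : ‖B' ζ i‖ ≤ β * ‖ζ‖ := (norm_le_pi_norm _ i).trans (B'.le_opNorm ζ)
        have h2 : ‖L (Y i x₀)‖ ≤ |K| * ‖l y‖ + ‖L‖ * ε := by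
          have : L (Y i x₀) = L (Y i y) + L (Y i x₀ - Y i y) := by rw [← map_add]; simp
          rw [this]
          refine (norm_add_le _ _).trans (add_le_add (hLY i) ?_)
          exact (L.le_opNorm _).trans (by gcongr; exact hYy i)
        gcongr
      refine (Finset.sum_le_card_nsmul _ _ _ hterm).trans (le_of_eq ?_)
      simp only [Finset.card_univ, nsmul_eq_mul]
      ring
    have h5 : β * c₀ * (‖L‖ * ε) ≤ 1 / 2 * ‖L‖ := by
      have := mul_le_mul_of_nonneg_right hε' (norm_nonneg L)
      linarith
    linarith [hL, h5]
  -- transfer to the chart and use Gronwall's inequality on segments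
  have hφc : ContinuousAt φ.symm (φ x₀) := continuousAt_extChartAt_symm x₀
  have hφx : φ.symm (φ x₀) = x₀ := extChartAt_to_inv x₀
  have hz : ∀ᶠ z in 𝓝 (φ x₀), DifferentiableAt ℝ lh z ∧
      ‖fderiv ℝ lh z‖ ≤ 2 * (β * c₀ * |K|) * ‖lh z‖ := by
    have h1 : ∀ᶠ z in 𝓝 (φ x₀), φ.symm z ∈ {y | DifferentiableAt ℝ lh (φ y) ∧
        ‖fderiv ℝ lh (φ y)‖ ≤ 2 * (β * c₀ * |K|) * ‖l y‖} :=
      hφc.eventually (by rw [hφx]; exact hbound)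
    filter_upwards [h1, extChartAt_target_mem_nhds (I := 𝓡 m) x₀] with z hz hzt
    have hz' : φ (φ.symm z) = z := φ.right_inv hzt
    change DifferentiableAt ℝ lh (φ (φ.symm z)) ∧
      ‖fderiv ℝ lh (φ (φ.symm z))‖ ≤ 2 * (β * c₀ * |K|) * ‖l (φ.symm z)‖ at hz
    rw [hz'] at hz
    exact hz
  obtain ⟨δ, hδ, hball⟩ := Metric.eventually_nhds_iff_ball.1 hz
  have hzero : ∀ z ∈ Metric.ball (φ x₀) δ, lh z = 0 := by
    intro z hz
    -- On the segment from the centre the differential bound becomes `|f'| ≤ const · |f|` with `f(0)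
    -- = 0`.
    let γ : ℝ → EuclideanSpace ℝ (Fin m) := fun t => φ x₀ + t • (z - φ x₀)
    have hγ : ∀ t ∈ Icc (0 : ℝ) 1, γ t ∈ Metric.ball (φ x₀) δ := by
      intro t ht
      rw [Metric.mem_ball, dist_eq_norm]
      simp only [γ, add_sub_cancel_left, norm_smul, Real.norm_eq_abs, abs_of_nonneg ht.1]
      have h2 : ‖z - φ x₀‖ < δ := by simpa [dist_eq_norm] using hz
      nlinarith [norm_nonneg (z - φ x₀), ht.2]
    have hγd : ∀ t, HasDerivAt γ (z - φ x₀) t := by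
      intro t
      simpa [γ] using ((hasDerivAt_id t).smul_const (z - φ x₀)).const_add (φ x₀)
    have hd : ∀ t ∈ Icc (0 : ℝ) 1,
        HasDerivAt (fun t => lh (γ t)) (fderiv ℝ lh (γ t) (z - φ x₀)) t := by
      intro t ht
      exact ((hball _ (hγ t ht)).1.hasFDerivAt).comp_hasDerivAt t (hγd t)
    have := eq_zero_of_abs_deriv_le_mul_abs_self_of_eq_zero_right
      (f := fun t => lh (γ t)) (f' := fun t => fderiv ℝ lh (γ t) (z - φ x₀))
      (K := 2 * (β * c₀ * |K|) * ‖z - φ x₀‖) (a := 0) (b := 1)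
      (fun t ht => (hd t ht).continuousAt.continuousWithinAt)
      (fun t ht => (hd t ⟨ht.1, ht.2.le⟩).hasDerivWithinAt)
      (by simp only [γ, zero_smul, add_zero, lh, Function.comp_apply, hφx, h0])
      (fun t ht => by
        refine ((fderiv ℝ lh (γ t)).le_opNorm _).trans ?_
        have := (hball _ (hγ t ⟨ht.1, ht.2.le⟩)).2
        calc _ ≤ (2 * (β * c₀ * |K|) * ‖lh (γ t)‖) * ‖z - φ x₀‖ := by gcongr
          _ = _ := by ring) 1 ⟨zero_le_one, le_rfl⟩
    simpa [γ] using this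
  have hφc' : ContinuousAt φ x₀ := continuousAt_extChartAt x₀
  filter_upwards [hφc'.eventually (Metric.ball_mem_nhds _ hδ), extChartAt_source_mem_nhds (I := 𝓡 m) x₀]
    with y hy hys
  have := hzero _ hy
  have hys' : φ.symm (φ y) = y := φ.left_inv hys
  change l (φ.symm (φ y)) = 0 at this
  rwa [hys'] at this

end Frames

/-! ### Vector fields as derivations. -/

section VectorFields

variable {m : ℕ} {N : Type*} [TopologicalSpace N] [ChartedSpace (EuclideanSpace ℝ (Fin m)) N]
  [IsManifold (𝓡 m) ∞ N]
  {V : Type*} [NormedAddCommGroup V] [NormedSpace ℝ V]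

/-- The coordinates of a tangent vector in the chart at `x₀`. -/
def chartVector (x₀ : N) {y : N} (u : TangentSpace (𝓡 m) y) : EuclideanSpace ℝ (Fin m) :=
  (trivializationAt (EuclideanSpace ℝ (Fin m)) (TangentSpace (𝓡 m)) x₀ ⟨y, u⟩).2

theorem chartVector_eq_mfderiv {x₀ y : N}
    (hy : y ∈ (chartAt (EuclideanSpace ℝ (Fin m)) x₀).source) (u : TangentSpace (𝓡 m) y) :
    chartVector x₀ u = mfderiv (𝓡 m) (𝓡 m) (extChartAt (𝓡 m) x₀) y u := by
  have hb : y ∈ (trivializationAt (EuclideanSpace ℝ (Fin m)) (TangentSpace (𝓡 m)) x₀).baseSet := hy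
  have h1 : (trivializationAt (EuclideanSpace ℝ (Fin m)) (TangentSpace (𝓡 m))
      x₀).continuousLinearMapAt ℝ y u = chartVector x₀ u := by
    rw [Trivialization.continuousLinearMapAt_apply, Trivialization.coe_linearMapAt_of_mem _ hb]
    rfl
  exact h1.symm.trans
    (congrArg (fun A => A u) (TangentBundle.continuousLinearMapAt_trivializationAt (I := 𝓡 m) hy))

theorem ContMDiffAt.contDiffAt_chartVector {X : ∀ y : N, TangentSpace (𝓡 m) y} {x : N}
    (hX : ContMDiffAt (𝓡 m) (𝓡 m).tangent ∞ (fun y => (⟨y, X y⟩ : TangentBundle (𝓡 m) N)) x) :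
    ContDiffAt ℝ ∞ (fun z => chartVector x (X ((extChartAt (𝓡 m) x).symm z)))
      (extChartAt (𝓡 m) x x) := by
  have h1 : ContMDiffAt (𝓡 m) 𝓘(ℝ, EuclideanSpace ℝ (Fin m)) ∞
      (fun y => chartVector x (X y)) x := (contMDiffAt_totalSpace.1 hX).2
  have h2 : ContMDiffAt (𝓡 m) (𝓡 m) ∞ (extChartAt (𝓡 m) x).symm (extChartAt (𝓡 m) x x) :=
    (contMDiffOn_extChartAt_symm x).contMDiffAt (extChartAt_target_mem_nhds x)
  have h3 := ContMDiffAt.comp_of_eq (g := fun y : N => chartVector x (X y)) h1 h2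
    (extChartAt_to_inv x)
  exact contMDiffAt_iff_contDiffAt.1 h3

/-- The Lie bracket of vector fields is the commutator of the derivations they define. -/
theorem mvfderiv_mlieBracket {X Y : ∀ y : N, TangentSpace (𝓡 m) y} {f : N → ℝ} {x : N}
    (hX : ContMDiffAt (𝓡 m) (𝓡 m).tangent ∞ (fun y => (⟨y, X y⟩ : TangentBundle (𝓡 m) N)) x)
    (hY : ContMDiffAt (𝓡 m) (𝓡 m).tangent ∞ (fun y => (⟨y, Y y⟩ : TangentBundle (𝓡 m) N)) x)
    (hf : SmoothNear m f x) :
    mvfderiv (𝓡 m) f x (VectorField.mlieBracket (𝓡 m) X Y x) =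
      mvfderiv (𝓡 m) (fun y => mvfderiv (𝓡 m) f y (Y y)) x (X x) -
      mvfderiv (𝓡 m) (fun y => mvfderiv (𝓡 m) f y (X y)) x (Y x) := by
  let φ := extChartAt (𝓡 m) x
  have hsrc := (chartAt (EuclideanSpace ℝ (Fin m)) x).open_source.mem_nhds
    (mem_chart_source (EuclideanSpace ℝ (Fin m)) x)
  let fh := f ∘ φ.symm
  have hsymm : ContMDiffAt (𝓡 m) (𝓡 m) ∞ φ.symm (φ x) :=
    (contMDiffOn_extChartAt_symm x).contMDiffAt (extChartAt_target_mem_nhds x)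
  have hfh : ContDiffAt ℝ ∞ fh (φ x) := by
    refine contMDiffAt_iff_contDiffAt.1 (ContMDiffAt.comp_of_eq hf.contMDiffAt hsymm ?_)
    exact extChartAt_to_inv x
  have hφx : φ.symm (φ x) = x := extChartAt_to_inv x
  -- the derivation defined by a vector field, in the chart
  have key : ∀ Z W : ∀ y : N, TangentSpace (𝓡 m) y,
      ContMDiffAt (𝓡 m) (𝓡 m).tangent ∞ (fun y => (⟨y, Z y⟩ : TangentBundle (𝓡 m) N)) x →
      mvfderiv (𝓡 m) (fun y => mvfderiv (𝓡 m) f y (Z y)) x (W x) =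
        fderiv ℝ (fun z => fderiv ℝ fh z (chartVector x (Z (φ.symm z)))) (φ x)
          (chartVector x (W x)) := by
    intro Z W hZ
    have hZh : ContDiffAt ℝ ∞ (fun z => chartVector x (Z (φ.symm z))) (φ x) :=
      ContMDiffAt.contDiffAt_chartVector hZ
    have hg : DifferentiableAt ℝ (fun z => fderiv ℝ fh z (chartVector x (Z (φ.symm z)))) (φ x) :=
      ((hfh.fderiv_right (m := 1) (by norm_cast)).differentiableAt (by simp)).clm_apply
        (hZh.differentiableAt (by simp))
    have hev : (fun y => mvfderiv (𝓡 m) f y (Z y)) =ᶠ[𝓝 x]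
        fun y => fderiv ℝ fh (φ y) (chartVector x (Z y)) := by
      filter_upwards [hf, hsrc] with y hy hys
      exact (mvfderiv_eq_fderiv_comp_extChartAt hys (hy.mdifferentiableAt (by simp)) (Z y)).2
    have hev2 : (fun y => mvfderiv (𝓡 m) f y (Z y)) =ᶠ[𝓝 x]
        (fun z => fderiv ℝ fh z (chartVector x (Z (φ.symm z)))) ∘ φ := by
      filter_upwards [hev, extChartAt_source_mem_nhds (I := 𝓡 m) x] with y hy hys
      rw [hy, Function.comp_apply, show φ.symm (φ y) = y from φ.left_inv hys]
    have hmd : MDifferentiableAt (𝓡 m) 𝓘(ℝ, ℝ) (fun y => mvfderiv (𝓡 m) f y (Z y)) x :=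
      (MDifferentiableAt.comp x hg.mdifferentiableAt
        ((contMDiffAt_extChartAt (n := ∞)).mdifferentiableAt (by simp))).congr_of_eventuallyEq hev2
    rw [(mvfderiv_eq_fderiv_comp_extChartAt (mem_chart_source _ x) hmd (W x)).2]
    have hev3 : (fun y => mvfderiv (𝓡 m) f y (Z y)) ∘ φ.symm =ᶠ[𝓝 (φ x)]
        (fun z => fderiv ℝ fh z (chartVector x (Z (φ.symm z)))) := by
      have := (continuousAt_extChartAt_symm (I := 𝓡 m) x).eventually (by rw [hφx]; exact hev2)
      filter_upwards [this, extChartAt_target_mem_nhds (I := 𝓡 m) x] with z hz hzt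
      rw [Function.comp_apply, hz, Function.comp_apply, show φ (φ.symm z) = z from φ.right_inv hzt]
    rw [show fderiv ℝ ((fun y => mvfderiv (𝓡 m) f y (Z y)) ∘ (extChartAt (𝓡 m) x).symm)
      (extChartAt (𝓡 m) x x) = _ from hev3.fderiv_eq]
    rfl
  rw [key Y X hY, key X Y hX]
  rw [(mvfderiv_eq_fderiv_comp_extChartAt (mem_chart_source _ x)
    hf.mdifferentiableAt (VectorField.mlieBracket (𝓡 m) X Y x)).2]
  let Xh := fun z => chartVector x (X (φ.symm z))
  let Yh := fun z => chartVector x (Y (φ.symm z))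
  have hXh : DifferentiableAt ℝ Xh (φ x) :=
    (ContMDiffAt.contDiffAt_chartVector hX).differentiableAt (by simp)
  have hYh : DifferentiableAt ℝ Yh (φ x) :=
    (ContMDiffAt.contDiffAt_chartVector hY).differentiableAt (by simp)
  -- The manifold bracket is defined by pulling back along the inverse chart; the pullback of a
  -- field is its coordinate expression.
  have hpull : ∀ Z : ∀ y : N, TangentSpace (𝓡 m) y,
      VectorField.mpullbackWithin 𝓘(ℝ, EuclideanSpace ℝ (Fin m)) (𝓡 m) φ.symm Z (range (𝓡 m))
        =ᶠ[𝓝 (φ x)] fun z => chartVector x (Z (φ.symm z)) := by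
    intro Z
    filter_upwards [extChartAt_target_mem_nhds (I := 𝓡 m) x] with z hz
    rw [VectorField.mpullbackWithin_apply]
    have h1 := mfderiv_extChartAt_comp_mfderivWithin_extChartAt_symm (I := 𝓡 m) hz
    have h2 := mfderivWithin_extChartAt_symm_comp_mfderiv_extChartAt (I := 𝓡 m) hz
    rw [ContinuousLinearMap.inverse_eq h2 h1]
    have : φ.symm z ∈ (chartAt (EuclideanSpace ℝ (Fin m)) x).source := by
      simpa [φ] using φ.map_target hz
    rw [chartVector_eq_mfderiv this]
    rfl
  have hbr : chartVector x (VectorField.mlieBracket (𝓡 m) X Y x) =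
      fderiv ℝ Yh (φ x) (Xh (φ x)) - fderiv ℝ Xh (φ x) (Yh (φ x)) := by
    rw [← VectorField.mlieBracketWithin_univ, VectorField.mlieBracketWithin_apply]
    rw [chartVector_eq_mfderiv (mem_chart_source _ x)]
    have hinv := isInvertible_mfderiv_extChartAt (I := 𝓡 m) (mem_extChartAt_source (I := 𝓡 m) x)
    have h1 : ∀ w, mfderiv (𝓡 m) (𝓡 m) (extChartAt (𝓡 m) x) x
        ((mfderiv (𝓡 m) (𝓡 m) (extChartAt (𝓡 m) x) x).inverse w) = w := by
      intro w
      exact congrArg (fun A => A w) (hinv.self_comp_inverse)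
    refine (h1 _).trans ?_
    have hset : (extChartAt (𝓡 m) x).symm ⁻¹' univ ∩ range (𝓡 m) = univ := by simp
    rw [hset]
    refine (congrFun (VectorField.lieBracketWithin_univ (𝕜 := ℝ)
      (E := EuclideanSpace ℝ (Fin m))) _).trans ?_
    exact Filter.EventuallyEq.lieBracket_vectorField_eq (hpull X) (hpull Y)
  have hff : DifferentiableAt ℝ (fderiv ℝ fh) (φ x) :=
    (hfh.fderiv_right (m := 1) (by norm_cast)).differentiableAt (by simp)
  -- Symmetry of the second derivative cancels the second-order terms of the commutator.
  have hsym : IsSymmSndFDerivAt ℝ fh (φ x) :=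
    (hfh.of_le (by norm_cast : (2 : WithTop ℕ∞) ≤ ∞)).isSymmSndFDerivAt (by simp)
  have e1 : ∀ Zh : EuclideanSpace ℝ (Fin m) → EuclideanSpace ℝ (Fin m),
      DifferentiableAt ℝ Zh (φ x) → ∀ w, fderiv ℝ (fun z => fderiv ℝ fh z (Zh z)) (φ x) w =
        fderiv ℝ (fderiv ℝ fh) (φ x) w (Zh (φ x)) + fderiv ℝ fh (φ x) (fderiv ℝ Zh (φ x) w) := by
    intro Zh hZ w
    rw [fderiv_clm_apply hff hZ]
    simp [add_comm]
  have hx1 : chartVector x (X x) = Xh (φ x) := by simp only [Xh]; rw [hφx]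
  have hx2 : chartVector x (Y x) = Yh (φ x) := by simp only [Yh]; rw [hφx]
  rw [e1 Yh hYh, e1 Xh hXh, hx1, hx2, hsym.eq (Xh (φ x)) (Yh (φ x))]
  change fderiv ℝ fh (φ x) (chartVector x (VectorField.mlieBracket (𝓡 m) X Y x)) = _
  rw [hbr, map_sub]
  ring

/-- A vector field is smooth at a point if its derivatives of smooth functions are. -/
theorem contMDiffAt_vectorField_of_mvfderiv {X : ∀ y : N, TangentSpace (𝓡 m) y} {x : N}
    (h : ∀ f : N → ℝ, SmoothNear m f x →
      ContMDiffAt (𝓡 m) 𝓘(ℝ, ℝ) ∞ (fun y => mvfderiv (𝓡 m) f y (X y)) x) :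
    ContMDiffAt (𝓡 m) (𝓡 m).tangent ∞ (fun y => (⟨y, X y⟩ : TangentBundle (𝓡 m) N)) x := by
  rw [contMDiffAt_totalSpace]
  refine ⟨contMDiffAt_id, ?_⟩
  change ContMDiffAt (𝓡 m) 𝓘(ℝ, EuclideanSpace ℝ (Fin m)) ∞ (fun y => chartVector x (X y)) x
  have hsrc := (chartAt (EuclideanSpace ℝ (Fin m)) x).open_source.mem_nhds
    (mem_chart_source (EuclideanSpace ℝ (Fin m)) x)
  have hcoord : ∀ i : Fin m, ContMDiffAt (𝓡 m) 𝓘(ℝ, ℝ) ∞ (fun y => chartVector x (X y) i) x := by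
    intro i
    -- Testing the field on the coordinate functions of the chart recovers its components; a germ
    -- suffices, so no cut-off is needed.
    let pr : EuclideanSpace ℝ (Fin m) →L[ℝ] ℝ := EuclideanSpace.proj i
    have hφ : ∀ᶠ y in 𝓝 x, ContMDiffAt (𝓡 m) (𝓡 m) ∞ (extChartAt (𝓡 m) x) y := by
      filter_upwards [hsrc] with y hy using contMDiffAt_extChartAt' hy
    have hfs : SmoothNear m (fun y => pr (extChartAt (𝓡 m) x y)) x := by
      filter_upwards [hφ] with y hy
      exact pr.contMDiff.contMDiffAt.comp y hy
    refine (h _ hfs).congr_of_eventuallyEq ?_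
    filter_upwards [hsrc, hφ] with y hy hφy
    rw [chartVector_eq_mfderiv hy]
    have h1 : mvfderiv (𝓡 m) (pr ∘ extChartAt (𝓡 m) x) y (X y) =
        mvfderiv (𝓡 m) pr (extChartAt (𝓡 m) x y)
          (mfderiv (𝓡 m) (𝓡 m) (extChartAt (𝓡 m) x) y (X y)) :=
      mvfderiv_comp_apply y ((pr.contMDiff (n := ∞)).contMDiffAt.mdifferentiableAt (by simp))
        (hφy.mdifferentiableAt (by simp)) (X y)
    refine Eq.trans ?_ h1.symm
    change _ = mfderiv (𝓡 m) 𝓘(ℝ, ℝ) pr (extChartAt (𝓡 m) x y) _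
    rw [mfderiv_eq_fderiv, pr.fderiv]
    rfl
  have h2 : ContMDiffAt (𝓡 m) 𝓘(ℝ, Fin m → ℝ) ∞ (fun y => fun i => chartVector x (X y) i) x :=
    contMDiffAt_pi_space.2 hcoord
  have h3 := ((PiLp.continuousLinearEquiv 2 ℝ (fun _ : Fin m => ℝ)).symm.contDiff (n := ∞)).contMDiff.contMDiffAt.comp x h2
  exact h3

end VectorFields

/-! ### The inverse function theorem on manifolds without boundary. -/

section InverseFunctionTheorem

variable {E H E' H' N N' : Type*} [NormedAddCommGroup E] [NormedSpace ℝ E] [CompleteSpace E]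
  [TopologicalSpace H] {I : ModelWithCorners ℝ E H} [I.Boundaryless]
  [NormedAddCommGroup E'] [NormedSpace ℝ E']
  [TopologicalSpace H'] {J : ModelWithCorners ℝ E' H'} [J.Boundaryless]
  [TopologicalSpace N] [ChartedSpace H N] [IsManifold I ∞ N]
  [TopologicalSpace N'] [ChartedSpace H' N'] [IsManifold J ∞ N']

/-- The inverse function theorem on manifolds. -/
theorem isLocalDiffeomorphAt_of_mfderiv_eq {f : N → N'} {x : N}
    (hf : ∀ᶠ y in 𝓝 x, ContMDiffAt I J ∞ f y) (A : E ≃L[ℝ] E')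
    (hA : mfderiv I J f x = (A : E →L[ℝ] E')) : IsLocalDiffeomorphAt I J ∞ f x := by
  let φ : OpenPartialHomeomorph N E :=
    (chartAt H x).trans I.toHomeomorph.toOpenPartialHomeomorph
  let ψ : OpenPartialHomeomorph N' E' :=
    (chartAt H' (f x)).trans J.toHomeomorph.toOpenPartialHomeomorph
  have hφs : φ.source = (chartAt H x).source := by simp [φ]
  have hψs : ψ.source = (chartAt H' (f x)).source := by simp [ψ]
  have hxφ : x ∈ φ.source := by rw [hφs]; exact mem_chart_source H x
  have hxψ : f x ∈ ψ.source := by rw [hψs]; exact mem_chart_source H' (f x)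
  have hφ : ∀ y ∈ φ.source, ContMDiffAt I 𝓘(ℝ, E) ∞ φ y := fun y hy =>
    contMDiffAt_extChartAt' (by rwa [hφs] at hy)
  have hψ : ∀ y ∈ ψ.source, ContMDiffAt J 𝓘(ℝ, E') ∞ ψ y := fun y hy =>
    contMDiffAt_extChartAt' (by rwa [hψs] at hy)
  have htφ : φ.target = (extChartAt I x).target := by
    simp [φ, extChartAt_target, I.range_eq_univ]; rfl
  have htψ : ψ.target = (extChartAt J (f x)).target := by
    simp [ψ, extChartAt_target, J.range_eq_univ]; rfl
  have hφ' : ∀ z ∈ φ.target, ContMDiffAt 𝓘(ℝ, E) I ∞ φ.symm z := fun z hz =>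
    (contMDiffOn_extChartAt_symm (I := I) x).contMDiffAt
      (by rw [← htφ]; exact φ.open_target.mem_nhds hz)
  have hψ' : ∀ z ∈ ψ.target, ContMDiffAt 𝓘(ℝ, E') J ∞ ψ.symm z := fun z hz =>
    (contMDiffOn_extChartAt_symm (I := J) (f x)).contMDiffAt
      (by rw [← htψ]; exact ψ.open_target.mem_nhds hz)
  let fh : E → E' := fun z => ψ (f (φ.symm z))
  have hφx : φ.symm (φ x) = x := φ.left_inv hxφ
  have hT1 : ∀ᶠ z in 𝓝 (φ x), z ∈ φ.target ∧ f (φ.symm z) ∈ ψ.source ∧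
      ContMDiffAt I J ∞ f (φ.symm z) := by
    have hc : ContinuousAt φ.symm (φ x) := φ.continuousAt_symm (φ.map_source hxφ)
    have h1 : ∀ᶠ y in 𝓝 x, f y ∈ ψ.source ∧ ContMDiffAt I J ∞ f y :=
      (hf.self_of_nhds.continuousAt.eventually (ψ.open_source.mem_nhds hxψ)).and hf
    filter_upwards [φ.open_target.mem_nhds (φ.map_source hxφ),
      hc.eventually (by rw [hφx]; exact h1)] with z h h' using ⟨h, h'⟩
  have hsm : ∀ z, z ∈ φ.target ∧ f (φ.symm z) ∈ ψ.source ∧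
      ContMDiffAt I J ∞ f (φ.symm z) → ContDiffAt ℝ ∞ fh z := by
    rintro z ⟨h1, h2, h3⟩
    exact contMDiffAt_iff_contDiffAt.1 ((hψ _ h2).comp z (h3.comp z (hφ' z h1)))
  have hd : HasFDerivAt fh (A : E →L[ℝ] E') (φ x) := by
    have h1 : HasFDerivWithinAt fh (A : E →L[ℝ] E') (range I) (φ x) := by
      have h2 := (hf.self_of_nhds.mdifferentiableAt (by simp)).hasMFDerivAt.2
      rw [hA] at h2
      exact h2
    rwa [I.range_eq_univ, hasFDerivWithinAt_univ] at h1
  have hsm0 : ContDiffAt ℝ ∞ fh (φ x) := hsm _ hT1.self_of_nhds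
  let Θ := hsm0.toOpenPartialHomeomorph fh hd (by simp)
  have hΘ : ∀ z, Θ z = fh z := fun z => rfl
  have hxΘ : φ x ∈ Θ.source := hsm0.mem_toOpenPartialHomeomorph_source hd (by simp)
  -- Invertible operators form an open set. Invertibility at nearby points is needed because the
  -- inverse must be smooth on a whole open set, not just at the image of `x`.
  have hinv : ∀ᶠ z in 𝓝 (φ x), ∃ B : E ≃L[ℝ] E', HasFDerivAt fh (B : E →L[ℝ] E') z := by
    have hc : ContinuousAt (fderiv ℝ fh) (φ x) :=
      (hsm0.fderiv_right (m := 0) (by simp)).continuousAt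
    have ho : range ((↑) : (E ≃L[ℝ] E') → E →L[ℝ] E') ∈ 𝓝 (fderiv ℝ fh (φ x)) := by
      rw [hd.fderiv]
      exact ContinuousLinearEquiv.nhds A
    filter_upwards [hc.eventually ho, hT1] with z ⟨B, hB⟩ hz
    exact ⟨B, by rw [hB]; exact ((hsm z hz).differentiableAt (by simp)).hasFDerivAt⟩
  obtain ⟨T, hT, hTo, hxT⟩ := eventually_nhds_iff.1 (hT1.and hinv)
  let Θ' := Θ.restrOpen T hTo
  have hΘ's : Θ'.source = Θ.source ∩ T := Θ.restrOpen_source T hTo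
  let Φ := (φ.trans Θ').trans ψ.symm
  have hs : ∀ y ∈ Φ.source, y ∈ φ.source ∧ φ y ∈ Θ.source ∧ φ y ∈ T := by
    intro y hy
    have h1 : y ∈ (φ.trans Θ').source := by
      simp only [Φ, OpenPartialHomeomorph.trans_source] at hy
      simpa using hy.1
    rw [OpenPartialHomeomorph.trans_source] at h1
    have h2 : φ y ∈ Θ'.source := h1.2
    rw [hΘ's] at h2
    exact ⟨h1.1, h2⟩
  have heq : ∀ y ∈ Φ.source, f y = Φ y := by
    intro y hy
    obtain ⟨h1, h2, h3⟩ := hs y hy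
    have h4 := (hT _ h3).1.2.1
    rw [φ.left_inv h1] at h4
    change f y = ψ.symm (ψ (f (φ.symm (φ y))))
    rw [φ.left_inv h1, ψ.left_inv h4]
  refine ⟨{ toPartialEquiv := Φ.toPartialEquiv, open_source := Φ.open_source,
            open_target := Φ.open_target, contMDiffOn_toFun := ?_, contMDiffOn_invFun := ?_ },
    ?_, heq⟩
  · intro y hy
    obtain ⟨h1, h2, h3⟩ := hs y hy
    have h4 := (hT _ h3).1.2.2
    rw [φ.left_inv h1] at h4
    exact h4.contMDiffWithinAt.congr (fun z hz => (heq z hz).symm) (heq y hy).symm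
  · intro w hw
    have hw1 : w ∈ Φ.target := hw
    have hw2 : Φ.symm w ∈ Φ.source := Φ.map_target hw1
    have hwψ : w ∈ ψ.source := by
      simp only [Φ, OpenPartialHomeomorph.trans_target] at hw1
      simpa using hw1.1
    obtain ⟨h1, h2, h3⟩ := hs _ hw2
    have hΘw : ψ w ∈ Θ'.target := by
      simp only [Φ, OpenPartialHomeomorph.trans_target] at hw1
      exact hw1.2.1
    have hΘs : Θ'.symm (ψ w) ∈ Θ'.source := Θ'.map_target hΘw
    rw [hΘ's] at hΘs
    have hΘt : ψ w ∈ Θ.target := by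
      have := Θ.map_source hΘs.1
      have h5 : Θ' (Θ'.symm (ψ w)) = ψ w := Θ'.right_inv hΘw
      rwa [show Θ (Θ'.symm (ψ w)) = ψ w from h5] at this
    obtain ⟨B, hB⟩ := (hT _ hΘs.2).2
    have h6 : ContDiffAt ℝ ∞ Θ.symm (ψ w) :=
      Θ.contDiffAt_symm (f₀' := B) hΘt hB (hsm _ (hT _ hΘs.2).1)
    have h7 : ContMDiffAt 𝓘(ℝ, E) I ∞ φ.symm (Θ.symm (ψ w)) := hφ' _ (hT _ hΘs.2).1.1
    exact (h7.comp w (h6.contMDiffAt.comp w (hψ w hwψ))).contMDiffWithinAt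
  · change x ∈ Φ.source
    simp only [Φ, OpenPartialHomeomorph.trans_source, OpenPartialHomeomorph.symm_source]
    refine ⟨⟨hxφ, ?_⟩, ?_⟩
    · change φ x ∈ Θ'.source
      rw [hΘ's]
      exact ⟨hxΘ, hxT⟩
    · change ψ (f (φ.symm (φ x))) ∈ ψ.target
      rw [hφx]
      exact ψ.map_source hxψ

end InverseFunctionTheorem

/-! ### Left-invariant fields and functions on a connected group. -/

section InvariantFields

variable {k : ℕ} {G : Type*} [TopologicalSpace G] [ChartedSpace (EuclideanSpace ℝ (Fin k)) G]
  [Group G] [LieGroup (𝓡 k) ∞ G]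
  {V : Type*} [NormedAddCommGroup V] [NormedSpace ℝ V]

theorem mulInvariantVectorField_surjective (g : G) :
    Function.Surjective fun u : GroupLieAlgebra (𝓡 k) G => mulInvariantVectorField u g := by
  intro w
  let w' : GroupLieAlgebra (𝓡 k) G := mfderiv (𝓡 k) (𝓡 k) (fun h : G => g⁻¹ * h) g w
  refine ⟨w', ?_⟩
  have h1 : MDifferentiableAt (𝓡 k) (𝓡 k) (fun h : G => g * h) (g⁻¹ * g) :=
    (contMDiff_mul_left (I := 𝓡 k) (n := ∞) (a := g)).contMDiffAt.mdifferentiableAt (by simp)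
  have h2 : MDifferentiableAt (𝓡 k) (𝓡 k) (fun h : G => g⁻¹ * h) g :=
    (contMDiff_mul_left (I := 𝓡 k) (n := ∞) (a := g⁻¹)).contMDiffAt.mdifferentiableAt (by simp)
  have h3 := mfderiv_comp_apply g h1 h2 w
  have h4 : ((fun h : G => g * h) ∘ fun h : G => g⁻¹ * h) = id := by
    ext h; simp
  rw [h4, mfderiv_id, inv_mul_cancel] at h3
  exact h3.symm

theorem continuousAt_mulInvariantVectorField (u : GroupLieAlgebra (𝓡 k) G) (g : G) :
    ContinuousAt (fun h : G => (⟨h, mulInvariantVectorField u h⟩ : TangentBundle (𝓡 k) G)) g :=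
  (contMDiff_mulInvariantVectorField (I := 𝓡 k) u).continuous.continuousAt

/-- A map on a connected Lie group is determined by a linear differential inequality for its
derivatives along left-invariant vector fields. -/
theorem eventually_eq_zero_of_mulInvariant_bound {l : G → V} {g₀ : G}
    (hl : ∀ᶠ g in 𝓝 g₀, MDifferentiableAt (𝓡 k) 𝓘(ℝ, V) l g) {K : ℝ}
    (u : Module.Basis (Fin k) ℝ (GroupLieAlgebra (𝓡 k) G))
    (hb : ∀ᶠ g in 𝓝 g₀, ∀ i, ‖mvfderiv (𝓡 k) l g (mulInvariantVectorField (u i) g)‖ ≤ K * ‖l g‖)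
    (h0 : l g₀ = 0) : ∀ᶠ g in 𝓝 g₀, l g = 0 := by
  refine eventually_eq_zero_of_frame_bound hl
    (fun i => continuousAt_mulInvariantVectorField (u i) g₀) ?_ hb h0
  intro w _
  obtain ⟨v, rfl⟩ := mulInvariantVectorField_surjective (k := k) g₀ w
  -- The invariant fields of a basis span every tangent space, so they serve as the frame in
  -- Gronwall's inequality.
  have h : ∀ v : GroupLieAlgebra (𝓡 k) G, mulInvariantVectorField v g₀ ∈
      Submodule.span ℝ (range fun i => mulInvariantVectorField (u i) g₀) := by
    intro v
    let L : GroupLieAlgebra (𝓡 k) G →ₗ[ℝ] TangentSpace (𝓡 k) g₀ :=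
      (mfderiv (𝓡 k) (𝓡 k) (fun h : G => g₀ * h) 1).toLinearMap
    have h1 : L v = ∑ i, u.repr v i • L (u i) := by
      conv_lhs => rw [← u.sum_repr v]
      rw [map_sum]
      simp
    change L v ∈ _
    rw [h1]
    exact Submodule.sum_mem _ fun i _ => Submodule.smul_mem _ _ (Submodule.subset_span ⟨i, rfl⟩)
  exact h v

/-- The inequality with constant zero, applied to `l - l g₀`, shows that `l` is locally constant.
Invariance of the pairing, the anchor and the bracket all pass from the Lie algebra to the group in
this way. -/
theorem eq_of_mulInvariant_derivative_eq_zero [ConnectedSpace G] {l : G → V}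
    (hl : ∀ g, MDifferentiableAt (𝓡 k) 𝓘(ℝ, V) l g)
    (h0 : ∀ g (u : GroupLieAlgebra (𝓡 k) G),
      mvfderiv (𝓡 k) l g (mulInvariantVectorField u g) = 0) (g g' : G) : l g = l g' := by
  have hloc : IsLocallyConstant l := by
    rw [IsLocallyConstant.iff_eventually_eq]
    intro g₀
    let u : Module.Basis (Fin k) ℝ (GroupLieAlgebra (𝓡 k) G) :=
      (EuclideanSpace.basisFun (Fin k) ℝ).toBasis
    have h1 : ∀ᶠ g in 𝓝 g₀, (fun h => l h - l g₀) g = 0 := by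
      refine eventually_eq_zero_of_mulInvariant_bound (K := 0) (Eventually.of_forall fun g => ?_)
        u (Eventually.of_forall fun g i => ?_) (sub_self _)
      · exact (hl g).sub mdifferentiableAt_const
      · have h2 : mvfderiv (𝓡 k) (fun h => l h - l g₀) g = mvfderiv (𝓡 k) l g := by
          have := mvfderiv_sub (hl g) (mdifferentiableAt_const (c := l g₀) (I := 𝓡 k) (x := g))
          simp only [mvfderiv_const, sub_zero] at this
          exact this
        rw [h2, h0]
        simp
    filter_upwards [h1] with g hg using sub_eq_zero.1 hg
  exact hloc.apply_eq_of_preconnectedSpace g g'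

end InvariantFields

/-! ### Differentials of orbit maps. -/

section InvariantDerivative

variable {k : ℕ} {G : Type*} [TopologicalSpace G] [ChartedSpace (EuclideanSpace ℝ (Fin k)) G]
  [Group G] [LieGroup (𝓡 k) ∞ G]

theorem mfderiv_mulInvariantVectorField {E' H' N' : Type*} [NormedAddCommGroup E']
    [NormedSpace ℝ E'] [TopologicalSpace H'] {J : ModelWithCorners ℝ E' H'} [TopologicalSpace N']
    [ChartedSpace H' N'] {f : G → N'} {g : G} (hf : MDifferentiableAt (𝓡 k) J f g)
    (u : GroupLieAlgebra (𝓡 k) G) :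
    (mfderiv (𝓡 k) J f g (mulInvariantVectorField u g) : E') =
      mfderiv (𝓡 k) J (fun h => f (g * h)) 1 u := by
  have h1 : MDifferentiableAt (𝓡 k) (𝓡 k) (fun h : G => g * h) 1 :=
    (contMDiff_mul_left (I := 𝓡 k) (n := ∞) (a := g)).contMDiffAt.mdifferentiableAt (by simp)
  have h2 := mfderiv_comp_apply_of_eq (f := fun h : G => g * h) (x := 1) hf h1 (mul_one g) u
  exact h2.symm

variable {p : ℕ} {P : Type*} [TopologicalSpace P] [ChartedSpace (EuclideanSpace ℝ (Fin p)) P]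
  [IsManifold (𝓡 p) ∞ P] [MulAction G P] [ContMDiffSMul (𝓡 k) (𝓡 p) ∞ G P]

variable (k p) in
omit [LieGroup (𝓡 k) ∞ G] [IsManifold (𝓡 p) ∞ P] in
theorem contMDiff_orbit (x : P) : ContMDiff (𝓡 k) (𝓡 p) ∞ (fun g : G => g • x) :=
  (contMDiff_id (I := 𝓡 k)).smul contMDiff_const

theorem contMDiff_translation (k p : ℕ) {G : Type*} [TopologicalSpace G]
    [ChartedSpace (EuclideanSpace ℝ (Fin k)) G] [Group G]
    {P : Type*} [TopologicalSpace P] [ChartedSpace (EuclideanSpace ℝ (Fin p)) P]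
    [MulAction G P] [ContMDiffSMul (𝓡 k) (𝓡 p) ∞ G P] (g : G) : ContMDiff (𝓡 p) (𝓡 p) ∞ (fun x : P => g • x) :=
  (contMDiff_const (I' := 𝓡 k)).smul contMDiff_id

variable (k p) in
/-- The differential of the orbit map at a point with trivial stabilizer is injective. -/
theorem mfderiv_orbit_injective {x : P} (hfree : ∀ g : G, g • x = x → g = 1) :
    Function.Injective (mfderiv (𝓡 k) (𝓡 p) (fun g : G => g • x) 1) := by
  have hO : ContMDiff (𝓡 k) (𝓡 p) ∞ (fun g : G => g • x) := contMDiff_orbit k p x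
  refine (injective_iff_map_eq_zero _).2 fun u hu => ?_
  -- By `(g h) x = g (h x)`, a vector killed at the identity generates an invariant field killed at
  -- every point of `G`.
  have hzero : ∀ g : G,
      mfderiv (𝓡 k) (𝓡 p) (fun g : G => g • x) g (mulInvariantVectorField u g) = 0 := by
    intro g
    have h1 := mfderiv_mulInvariantVectorField
      ((hO g).mdifferentiableAt (by simp)) u
    have h2 : MDifferentiableAt (𝓡 p) (𝓡 p) (fun y : P => g • y) ((1 : G) • x) :=
      (contMDiff_translation k p g).contMDiffAt.mdifferentiableAt (by simp)
    have h3 := mfderiv_comp_apply (f := fun h : G => h • x) (g := fun y : P => g • y) 1 h2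
      (hO.contMDiffAt.mdifferentiableAt (by simp)) u
    have h4 : (fun y : P => g • y) ∘ (fun h : G => h • x) = fun h => (g * h) • x := by
      ext h; simp [mul_smul]
    rw [h4, hu, map_zero] at h3
    exact h1.trans h3
  have hX : ContMDiffAt (𝓡 k) (𝓡 k).tangent 1
      (fun h : G => (⟨h, mulInvariantVectorField u h⟩ : TangentBundle (𝓡 k) G)) 1 :=
    ((contMDiff_mulInvariantVectorField (I := 𝓡 k) u).contMDiffAt).of_le
      (by rw [minSmoothness_of_isRCLikeNormedField]; norm_num)
  haveI : IsManifold (𝓡 k) 1 G := IsManifold.of_le (n := ∞) (by norm_cast)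
  -- Along an integral curve `c` of this field through `1` the point `c t • x` does not move;
  -- freeness forces `c t = 1`, so the velocity `u` of `c` is zero.
  obtain ⟨c, hc0, hc⟩ := exists_isMIntegralCurveAt_of_contMDiffAt_boundaryless (t₀ := 0) hX
  let φ := extChartAt (𝓡 p) x
  have hcc : ContinuousAt c 0 := hc.continuousAt
  have hOc : ContinuousAt (fun t => c t • x) 0 :=
    ContinuousAt.comp (g := fun g : G => g • x) hO.continuous.continuousAt hcc
  have hsrc : ∀ᶠ t in 𝓝 (0 : ℝ), c t • x ∈ φ.source := by
    refine hOc.eventually (extChartAt_source_mem_nhds' (I := 𝓡 p) (x := x) ?_)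
    change c 0 • x ∈ _
    rw [hc0, one_smul]
    exact mem_extChartAt_source x
  have hder : ∀ᶠ t in 𝓝 (0 : ℝ), HasDerivAt (fun t => φ (c t • x)) 0 t ∧ c t • x ∈ φ.source := by
    filter_upwards [hc, hsrc] with t ht hs
    refine ⟨?_, hs⟩
    have h1 : HasMFDerivAt 𝓘(ℝ, ℝ) (𝓡 p) (fun t => c t • x) t _ :=
      ((hO (c t)).mdifferentiableAt (by simp)).hasMFDerivAt.comp t ht
    have h2 : MDifferentiableAt (𝓡 p) (𝓡 p) φ (c t • x) :=
      (contMDiffAt_extChartAt' (n := ∞) (by simpa [φ] using hs)).mdifferentiableAt (by simp)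
    have h4 := congrArg (mfderiv (𝓡 p) (𝓡 p) φ (c t • x)) (hzero (c t))
    rw [map_zero] at h4
    have h3 : HasFDerivAt (fun t => φ (c t • x)) (0 : ℝ →L[ℝ] EuclideanSpace ℝ (Fin p)) t := by
      refine HasFDerivAt.congr_fderiv (h2.hasMFDerivAt.comp t h1).hasFDerivAt ?_
      refine ContinuousLinearMap.ext_ring (Eq.trans ?_ h4)
      change mfderiv (𝓡 p) (𝓡 p) φ (c t • x) (mfderiv (𝓡 k) (𝓡 p) (fun g : G => g • x) (c t)
        ((1 : ℝ) • mulInvariantVectorField u (c t))) = _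
      rw [one_smul]
    simpa using h3.hasDerivAt
  obtain ⟨δ, hδ, hball⟩ := Metric.eventually_nhds_iff_ball.1 hder
  have hconst : ∀ t ∈ Metric.ball (0 : ℝ) δ, c t = 1 := by
    intro t ht
    have h1 := Metric.isOpen_ball.is_const_of_deriv_eq_zero
      (convex_ball (0 : ℝ) δ).isPreconnected
      (fun t ht => (hball t ht).1.differentiableAt.differentiableWithinAt)
      (fun t ht => (hball t ht).1.deriv) ht (Metric.mem_ball_self hδ)
    have h2 := φ.injOn (hball t ht).2 (hball 0 (Metric.mem_ball_self hδ)).2 h1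
    rw [hc0, one_smul] at h2
    exact hfree _ h2
  have hev : c =ᶠ[𝓝 0] fun _ => 1 := by
    filter_upwards [Metric.ball_mem_nhds (0 : ℝ) hδ] with t ht using hconst t ht
  have h5 : HasMFDerivAt 𝓘(ℝ, ℝ) (𝓡 k) c 0 _ := hc.self_of_nhds
  have h6 := h5.mfderiv
  rw [hev.mfderiv_eq, mfderiv_const] at h6
  have h7 : (0 : EuclideanSpace ℝ (Fin k)) = (1 : ℝ) • mulInvariantVectorField u (c 0) :=
    congrArg (fun L => L (1 : ℝ)) h6
  rw [one_smul, hc0] at h7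
  have h8 : mulInvariantVectorField u (1 : G) = u := by
    have : (fun h : G => 1 * h) = id := by ext; simp
    unfold mulInvariantVectorField
    rw [this, mfderiv_id]
    rfl
  exact h8.symm.trans h7.symm

end InvariantDerivative

/-! ### Slices and tubes for free proper actions. -/

section Tubes

variable {k p : ℕ} {G : Type*} [TopologicalSpace G] [ChartedSpace (EuclideanSpace ℝ (Fin k)) G]
  [Group G] [LieGroup (𝓡 k) ∞ G]
  {P : Type*} [TopologicalSpace P] [ChartedSpace (EuclideanSpace ℝ (Fin p)) P]
  [IsManifold (𝓡 p) ∞ P] [MulAction G P]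

/-- An equivariant identification of an invariant open set of `P` with `G × W`, where `W` is an
open set of parameters of a slice. -/
structure OrbitTube (k p d : ℕ) (G : Type*) [TopologicalSpace G]
    [ChartedSpace (EuclideanSpace ℝ (Fin k)) G] [Group G]
    (P : Type*) [TopologicalSpace P] [ChartedSpace (EuclideanSpace ℝ (Fin p)) P]
    [MulAction G P] where
  slice : EuclideanSpace ℝ (Fin d) → P
  params : Set (EuclideanSpace ℝ (Fin d))
  elt : P → G
  coord : P → EuclideanSpace ℝ (Fin d)
  domain : Set P
  isOpen_params : IsOpen params
  isOpen_domain : IsOpen domain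
  contMDiffAt_slice : ∀ w ∈ params, ContMDiffAt (𝓡 d) (𝓡 p) ∞ slice w
  contMDiffAt_elt : ∀ y ∈ domain, ContMDiffAt (𝓡 p) (𝓡 k) ∞ elt y
  contMDiffAt_coord : ∀ y ∈ domain, ContMDiffAt (𝓡 p) (𝓡 d) ∞ coord y
  coord_mem : ∀ y ∈ domain, coord y ∈ params
  slice_mem : ∀ w ∈ params, slice w ∈ domain
  smul_mem : ∀ (g : G), ∀ y ∈ domain, g • y ∈ domain
  elt_smul_slice : ∀ y ∈ domain, elt y • slice (coord y) = y
  coord_slice : ∀ w ∈ params, coord (slice w) = w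
  elt_slice : ∀ w ∈ params, elt (slice w) = 1
  coord_smul : ∀ (g : G), ∀ y ∈ domain, coord (g • y) = coord y
  elt_smul : ∀ (g : G), ∀ y ∈ domain, elt (g • y) = g * elt y

-- The map `(g, y) ↦ (g y, y)` is closed by properness, so the image of the complement of `N` is
-- closed; freeness at `x` keeps `(x, x)` out of it. A product neighbourhood of `(x, x)` missing
-- this image gives `A`.
omit [IsManifold (𝓡 p) ∞ P] in
theorem exists_nhds_smul_mem [ProperSMul G P] {x : P} (hfree : ∀ g : G, g • x = x → g = 1)
    {N : Set G} (hN : N ∈ 𝓝 (1 : G)) :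
    ∃ A : Set P, IsOpen A ∧ x ∈ A ∧ ∀ (g : G) (y : P), y ∈ A → g • y ∈ A → g ∈ N := by
  obtain ⟨N₁, hN₁, hN₁o, h1⟩ := mem_nhds_iff.1 hN
  have hcl : IsClosed ((fun gx : G × P => (gx.1 • gx.2, gx.2)) '' (Prod.fst ⁻¹' N₁ᶜ)) :=
    (ProperSMul.isProperMap_smul_pair (G := G) (X := P)).isClosedMap _
      (hN₁o.isClosed_compl.preimage continuous_fst)
  have hx : (x, x) ∉ (fun gx : G × P => (gx.1 • gx.2, gx.2)) '' (Prod.fst ⁻¹' N₁ᶜ) := by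
    rintro ⟨⟨g, y⟩, hg, h⟩
    obtain ⟨h2, h3⟩ := Prod.mk.inj h
    simp only at h2 h3
    subst h3
    exact hg (by rw [hfree g h2]; exact h1)
  obtain ⟨A, B, hA, hB, hxA, hxB, hAB⟩ := isOpen_prod_iff.1 hcl.isOpen_compl x x hx
  refine ⟨A ∩ B, hA.inter hB, ⟨hxA, hxB⟩, fun g y hy hgy => ?_⟩
  by_contra hg
  exact hAB (⟨hgy.1, hy.2⟩ : (g • y, y) ∈ A ×ˢ B) ⟨(g, y), fun h => hg (hN₁ h), rfl⟩

variable [ContMDiffSMul (𝓡 k) (𝓡 p) ∞ G P]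

/-- A submanifold transverse to the orbit, given by a parametrization. -/
theorem exists_transversal {x : P} (hfree : ∀ g : G, g • x = x → g = 1) :
    ∃ σ : EuclideanSpace ℝ (Fin (p - k)) → P, σ 0 = x ∧
      (∀ᶠ w in 𝓝 0, ContMDiffAt (𝓡 (p - k)) (𝓡 p) ∞ σ w) ∧
      IsLocalDiffeomorphAt ((𝓡 k).prod (𝓡 (p - k))) (𝓡 p) ∞
        (fun z : G × EuclideanSpace ℝ (Fin (p - k)) => z.1 • σ z.2) (1, 0) := by
  let φ := extChartAt (𝓡 p) x
  obtain ⟨D, hD⟩ := isInvertible_mfderiv_extChartAt (I := 𝓡 p) (mem_extChartAt_source (I := 𝓡 p) x)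
  let D' : EuclideanSpace ℝ (Fin p) ≃L[ℝ] EuclideanSpace ℝ (Fin p) := D
  let A : EuclideanSpace ℝ (Fin k) →L[ℝ] EuclideanSpace ℝ (Fin p) :=
    mfderiv (𝓡 k) (𝓡 p) (fun g : G => g • x) 1
  have hA : Function.Injective A := mfderiv_orbit_injective k p hfree
  let T : EuclideanSpace ℝ (Fin k) →ₗ[ℝ] EuclideanSpace ℝ (Fin p) :=
    D'.toLinearEquiv.toLinearMap ∘ₗ A.toLinearMap
  have hT : Function.Injective T := D'.injective.comp hA
  -- In the chart the slice is an affine piece in a direction `S` complementary to the orbit.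
  obtain ⟨S, hS⟩ := Submodule.exists_isCompl (LinearMap.range T)
  have hSd : Module.finrank ℝ S = p - k := by
    have h1 := Submodule.finrank_add_eq_of_isCompl hS
    rw [LinearMap.finrank_range_of_inj hT] at h1
    simp at h1
    omega
  let L₀ : EuclideanSpace ℝ (Fin (p - k)) ≃ₗ[ℝ] S :=
    LinearEquiv.ofFinrankEq _ _ (by simp [hSd])
  let B : EuclideanSpace ℝ (Fin (p - k)) →L[ℝ] EuclideanSpace ℝ (Fin p) :=
    LinearMap.toContinuousLinearMap (S.subtype ∘ₗ L₀.toLinearMap)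
  let e₀ : (EuclideanSpace ℝ (Fin k) × EuclideanSpace ℝ (Fin (p - k))) ≃ₗ[ℝ]
      EuclideanSpace ℝ (Fin p) :=
    ((LinearEquiv.ofInjective T hT).prodCongr L₀).trans (Submodule.prodEquivOfIsCompl _ _ hS)
  have he₀ : ∀ u w, e₀ (u, w) = D' (A u) + B w := fun u w => rfl
  let σ : EuclideanSpace ℝ (Fin (p - k)) → P := fun w => φ.symm (φ x + B w)
  have hσ0 : σ 0 = x := by
    simp only [σ, map_zero, add_zero]
    exact extChartAt_to_inv x
  have hBc : ContinuousAt (fun w => φ x + B w) 0 := by fun_prop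
  have htgt : ∀ᶠ w in 𝓝 (0 : EuclideanSpace ℝ (Fin (p - k))), φ x + B w ∈ φ.target := by
    refine hBc.eventually ?_
    change ∀ᶠ y in 𝓝 (φ x + B 0), _
    rw [map_zero, add_zero]
    exact extChartAt_target_mem_nhds x
  have hσ : ∀ᶠ w in 𝓝 0, ContMDiffAt (𝓡 (p - k)) (𝓡 p) ∞ σ w := by
    filter_upwards [htgt] with w hw
    have h1 : ContMDiffAt (𝓡 p) (𝓡 p) ∞ φ.symm (φ x + B w) :=
      (contMDiffOn_extChartAt_symm x).contMDiffAt (extChartAt_target_mem_nhds' hw)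
    have h2 : ContDiff ℝ ∞ fun w => φ x + B w := by fun_prop
    exact h1.comp w h2.contMDiff.contMDiffAt
  refine ⟨σ, hσ0, hσ, ?_⟩
  let Ψ : G × EuclideanSpace ℝ (Fin (p - k)) → P := fun z => z.1 • σ z.2
  have hΨ : ∀ᶠ z in 𝓝 ((1 : G), (0 : EuclideanSpace ℝ (Fin (p - k)))),
      ContMDiffAt ((𝓡 k).prod (𝓡 (p - k))) (𝓡 p) ∞ Ψ z := by
    have h1 := (continuous_snd.continuousAt (x := ((1 : G),
      (0 : EuclideanSpace ℝ (Fin (p - k)))))).eventually hσ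
    filter_upwards [h1] with z hz
    exact contMDiffAt_fst.smul (hz.comp z contMDiffAt_snd)
  -- The differential of `(g, w) ↦ g σ(w)` at `(1, 0)` is orbit direction plus slice direction. `e₀`
  -- is this sum read in the chart, and `D'.symm` returns it to the tangent space at `x`.
  let At : (EuclideanSpace ℝ (Fin k) × EuclideanSpace ℝ (Fin (p - k))) ≃L[ℝ]
      EuclideanSpace ℝ (Fin p) := e₀.toContinuousLinearEquiv.trans D'.symm
  refine isLocalDiffeomorphAt_of_mfderiv_eq hΨ At ?_
  have hσd : MDifferentiableAt (𝓡 (p - k)) (𝓡 p) σ 0 :=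
    hσ.self_of_nhds.mdifferentiableAt (by simp)
  have hDσ : ∀ w : EuclideanSpace ℝ (Fin (p - k)),
      D' (mfderiv (𝓡 (p - k)) (𝓡 p) σ 0 w) = B w := by
    intro w
    have h1 : MDifferentiableAt (𝓡 p) (𝓡 p) φ x :=
      (contMDiffAt_extChartAt (n := ∞)).mdifferentiableAt (by simp)
    have h2 := mfderiv_comp_apply_of_eq 0 h1 hσd hσ0 w
    have h3 : φ ∘ σ =ᶠ[𝓝 0] fun w => φ x + B w := by
      filter_upwards [htgt] with w hw using φ.right_inv hw
    rw [h3.mfderiv_eq, ← hD] at h2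
    refine h2.symm.trans ?_
    rw [mfderiv_eq_fderiv]
    have h4 : HasFDerivAt (fun w => φ x + B w) B 0 := B.hasFDerivAt.const_add _
    rw [h4.fderiv]
    rfl
  refine ContinuousLinearMap.ext fun v => ?_
  have h1 := mfderiv_prod_eq_add_apply (v := v)
    (hΨ.self_of_nhds.mdifferentiableAt (by simp))
  refine h1.trans ?_
  have h2 : (fun z : EuclideanSpace ℝ (Fin (p - k)) => Ψ (1, z)) = σ := by
    ext z; simp [Ψ]
  have h3 : (fun z : G => Ψ (z, 0)) = fun g => g • x := by
    ext z; simp [Ψ, hσ0]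
  dsimp only
  rw [h2, h3]
  have h4 : At v = D'.symm (D' (A v.1) + B v.2) := rfl
  have h5 : ∀ a b, a + b = D'.symm (D' a + D' b) := fun a b => by
    rw [← map_add, D'.symm_apply_apply]
  refine Eq.trans ?_ h4.symm
  rw [← hDσ]
  exact h5 _ _

/-- The inverse function theorem makes `(g, w) ↦ g σ(w)` injective only near `(1, 0)`. Properness
forces any `g` that moves one point of a small slice to another to be close to `1`, so the map is
injective on all of `G × W`; translation carries smoothness of the inverse along the orbits. -/
theorem OrbitTube.exists_mem_domain [ProperSMul G P] {x : P}
    (hfree : ∀ (g : G) (y : P), g • y = y → g = 1) :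
    ∃ T : OrbitTube k p (p - k) G P, x ∈ T.domain ∧ T.slice (T.coord x) = x := by
  classical
  obtain ⟨σ, hσ0, hσ, Φ, h10, hΦ⟩ := exists_transversal (k := k) (p := p) (hfree · x)
  obtain ⟨N₁, W₁, hN₁, hW₁, h1N, h0W, hNW⟩ := isOpen_prod_iff.1 Φ.open_source 1 0 h10
  obtain ⟨A, hAo, hxA, hA⟩ := exists_nhds_smul_mem (hfree · x) (hN₁.mem_nhds h1N)
  have hσA : ∀ᶠ w in 𝓝 0, σ w ∈ A :=
    hσ.self_of_nhds.continuousAt.eventually (by rw [hσ0]; exact hAo.mem_nhds hxA)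
  obtain ⟨W, hW, hWo, h0⟩ := eventually_nhds_iff.1 ((hσ.and hσA).and (hW₁.mem_nhds h0W))
  have key0 : ∀ (g : G), ∀ w ∈ W, ∀ w' ∈ W, g • σ w = σ w' → g = 1 ∧ w = w' := by
    intro g w hw w' hw' h
    have hg : g ∈ N₁ := hA g (σ w) (hW w hw).1.2 (by rw [h]; exact (hW w' hw').1.2)
    have m1 : (g, w) ∈ Φ.source := hNW ⟨hg, (hW w hw).2⟩
    have m2 : (1, w') ∈ Φ.source := hNW ⟨h1N, (hW w' hw').2⟩
    have h2 : (g, w) = (1, w') := by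
      refine Φ.toPartialEquiv.injOn m1 m2 ?_
      refine (hΦ m1).symm.trans (Eq.trans ?_ (hΦ m2))
      simpa using h
    exact Prod.mk.inj h2
  have key : ∀ (g g' : G), ∀ w ∈ W, ∀ w' ∈ W, g • σ w = g' • σ w' → g = g' ∧ w = w' := by
    intro g g' w hw w' hw' h
    have := key0 (g'⁻¹ * g) w hw w' hw' (by rw [mul_smul, h, inv_smul_smul])
    exact ⟨(inv_mul_eq_one.1 this.1).symm, this.2⟩
  let D : Set P := {y | ∃ z : G × EuclideanSpace ℝ (Fin (p - k)), z.2 ∈ W ∧ z.1 • σ z.2 = y}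
  let c : P → G × EuclideanSpace ℝ (Fin (p - k)) :=
    -- The pair is unique on `D` by `key`, so the choice is harmless; outside `D` the value is a
    -- dummy.
    fun y => if h : y ∈ D then h.choose else (1, 0)
  have hc : ∀ y ∈ D, (c y).2 ∈ W ∧ (c y).1 • σ (c y).2 = y := by
    intro y hy
    have : c y = hy.choose := dif_pos hy
    rw [this]
    exact hy.choose_spec
  have hcu : ∀ g, ∀ w ∈ W, c (g • σ w) = (g, w) := by
    intro g w hw
    have h1 := hc (g • σ w) ⟨(g, w), hw, rfl⟩
    have h2 := key _ _ _ h1.1 _ hw h1.2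
    exact Prod.ext h2.1 h2.2
  have hloc : ∀ y₀ ∈ D, ∃ h : P → G × EuclideanSpace ℝ (Fin (p - k)),
      ContMDiffAt (𝓡 p) ((𝓡 k).prod (𝓡 (p - k))) ∞ h y₀ ∧
      ∀ᶠ y in 𝓝 y₀, y ∈ D ∧ c y = h y := by
    rintro y₀ ⟨⟨g₀, w₀⟩, hw₀, hy₀⟩
    simp only at hw₀ hy₀
    have m1 : ((1 : G), w₀) ∈ Φ.source := hNW ⟨h1N, (hW w₀ hw₀).2⟩
    have e1 : Φ.toPartialEquiv (1, w₀) = σ w₀ := by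
      refine (hΦ m1).symm.trans ?_
      simp
    have m2 : σ w₀ ∈ Φ.target := by rw [← e1]; exact Φ.toPartialEquiv.map_source m1
    have e2 : Φ.toPartialEquiv.symm (σ w₀) = (1, w₀) := by
      rw [← e1]; exact Φ.toPartialEquiv.left_inv m1
    have hinv : ContMDiffAt (𝓡 p) ((𝓡 k).prod (𝓡 (p - k))) ∞ Φ.toPartialEquiv.symm (σ w₀) :=
      Φ.contMDiffOn_invFun.contMDiffAt (Φ.open_target.mem_nhds m2)
    have htr : ContMDiffAt (𝓡 p) (𝓡 p) ∞ (fun y : P => g₀⁻¹ • y) y₀ :=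
      (contMDiff_translation k p g₀⁻¹).contMDiffAt
    have e3 : g₀⁻¹ • y₀ = σ w₀ := by rw [← hy₀, inv_smul_smul]
    -- Near `g₀ σ(w₀)` the tube coordinates come from the local inverse at `σ(w₀)`, after
    -- translating by `g₀⁻¹`.
    let h0 : P → G × EuclideanSpace ℝ (Fin (p - k)) := fun y => Φ.toPartialEquiv.symm (g₀⁻¹ • y)
    have hh0 : ContMDiffAt (𝓡 p) ((𝓡 k).prod (𝓡 (p - k))) ∞ h0 y₀ :=
      ContMDiffAt.comp_of_eq hinv htr e3
    have hh0y : h0 y₀ = (1, w₀) := by simp only [h0]; rw [e3, e2]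
    refine ⟨fun y => (g₀ * (h0 y).1, (h0 y).2), ?_, ?_⟩
    · refine ContMDiffAt.prodMk ?_ (contMDiffAt_snd.comp y₀ hh0)
      exact (contMDiff_mul_left (I := 𝓡 k) (n := ∞) (a := g₀)).contMDiffAt.comp y₀
        (contMDiffAt_fst.comp y₀ hh0)
    · have ev1 : ∀ᶠ y in 𝓝 y₀, (h0 y).2 ∈ W := by
        refine (continuous_snd.continuousAt.comp hh0.continuousAt).eventually ?_
        refine hWo.mem_nhds ?_
        change (h0 y₀).2 ∈ W
        rw [hh0y]
        exact hw₀
      have ev2 : ∀ᶠ y in 𝓝 y₀, g₀⁻¹ • y ∈ Φ.target :=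
        htr.continuousAt.eventually (Φ.open_target.mem_nhds
          (show g₀⁻¹ • y₀ ∈ Φ.target by rw [e3]; exact m2))
      filter_upwards [ev1, ev2] with y hy1 hy2
      have m3 : h0 y ∈ Φ.source := Φ.toPartialEquiv.map_target hy2
      have e4 : (h0 y).1 • σ (h0 y).2 = g₀⁻¹ • y :=
        (hΦ m3).trans (Φ.toPartialEquiv.right_inv hy2)
      have e5 : (g₀ * (h0 y).1) • σ (h0 y).2 = y := by
        rw [mul_smul, e4, smul_inv_smul]
      refine ⟨⟨(g₀ * (h0 y).1, (h0 y).2), hy1, e5⟩, ?_⟩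
      conv_lhs => rw [← e5]
      exact hcu _ _ hy1
  have hD : ∀ (g : G), ∀ w ∈ W, g • σ w ∈ D := fun g w hw => ⟨(g, w), hw, rfl⟩
  refine ⟨{
    slice := σ
    params := W
    elt := fun y => (c y).1
    coord := fun y => (c y).2
    domain := D
    isOpen_params := hWo
    isOpen_domain := isOpen_iff_mem_nhds.2 fun y hy => by
      obtain ⟨h, -, h2⟩ := hloc y hy
      filter_upwards [h2] with z hz using hz.1
    contMDiffAt_slice := fun w hw => (hW w hw).1.1
    contMDiffAt_elt := fun y hy => by
      obtain ⟨h, h1, h2⟩ := hloc y hy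
      refine (contMDiffAt_fst.comp y h1).congr_of_eventuallyEq ?_
      filter_upwards [h2] with z hz
      rw [hz.2]; rfl
    contMDiffAt_coord := fun y hy => by
      obtain ⟨h, h1, h2⟩ := hloc y hy
      refine (contMDiffAt_snd.comp y h1).congr_of_eventuallyEq ?_
      filter_upwards [h2] with z hz
      rw [hz.2]; rfl
    coord_mem := fun y hy => (hc y hy).1
    slice_mem := fun w hw => by simpa using hD 1 w hw
    smul_mem := ?_
    elt_smul_slice := fun y hy => (hc y hy).2
    coord_slice := fun w hw => by
      have := hcu 1 w hw
      rw [one_smul] at this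
      rw [this]
    elt_slice := fun w hw => by
      have := hcu 1 w hw
      rw [one_smul] at this
      rw [this]
    coord_smul := ?_
    elt_smul := ?_ }, ?_, ?_⟩
  · rintro g y ⟨⟨g', w⟩, hw, rfl⟩
    rw [smul_smul]
    exact hD _ w hw
  · rintro g y ⟨⟨g', w⟩, hw, rfl⟩
    simp only at hw ⊢
    rw [smul_smul, hcu _ _ hw, hcu _ _ hw]
  · rintro g y ⟨⟨g', w⟩, hw, rfl⟩
    simp only at hw ⊢
    rw [smul_smul, hcu _ _ hw, hcu _ _ hw]
  · have := hD 1 0 h0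
    rwa [one_smul, hσ0] at this
  · have := hcu 1 0 h0
    rw [one_smul, hσ0] at this
    change σ (c x).2 = x
    rw [this, hσ0]

end Tubes

/-! ### The manifold structure of the orbit space. -/

section OrbitSpaces

variable {k p d : ℕ} {G : Type*} [TopologicalSpace G] [ChartedSpace (EuclideanSpace ℝ (Fin k)) G]
  [Group G]
  {P : Type*} [TopologicalSpace P] [ChartedSpace (EuclideanSpace ℝ (Fin p)) P]
  [MulAction G P]

theorem orbitMap_smul (g : G) (y : P) : orbitMap G (g • y) = orbitMap G y :=
  Quotient.sound ⟨g, rfl⟩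

theorem exists_smul_eq_of_orbitMap_eq {x y : P} (h : orbitMap G x = orbitMap G y) :
    ∃ g : G, g • y = x :=
  Quotient.exact h

variable (G) in
theorem orbitMap_surjective : Function.Surjective (orbitMap G : P → _) := Quot.mk_surjective

theorem orbitMap_out (c : MulAction.orbitRel.Quotient G P) : orbitMap G c.out = c :=
  Quotient.out_eq c

variable (G P) in
theorem isOpenQuotientMap_orbitMap [ContinuousConstSMul G P] :
    IsOpenQuotientMap (orbitMap G : P → MulAction.orbitRel.Quotient G P) :=
  MulAction.isOpenQuotientMap_quotientMk

namespace OrbitTube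

variable (T : OrbitTube k p d G P)

theorem mem_domain_iff {y y' : P} (h : orbitMap G y = orbitMap G y') :
    y ∈ T.domain ↔ y' ∈ T.domain := by
  obtain ⟨g, rfl⟩ := exists_smul_eq_of_orbitMap_eq h
  refine ⟨fun h => ?_, T.smul_mem g _⟩
  have := T.smul_mem g⁻¹ _ h
  rwa [inv_smul_smul] at this

theorem coord_eq {y y' : P} (hy : y ∈ T.domain) (h : orbitMap G y = orbitMap G y') :
    T.coord y = T.coord y' := by
  obtain ⟨g, rfl⟩ := exists_smul_eq_of_orbitMap_eq h
  exact T.coord_smul g _ ((T.mem_domain_iff h).1 hy)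

theorem orbitMap_mem_image {y : P} : orbitMap G y ∈ orbitMap G '' T.domain ↔ y ∈ T.domain :=
  ⟨fun ⟨_, hz, h⟩ => (T.mem_domain_iff h).1 hz, fun h => ⟨y, h, rfl⟩⟩

theorem orbitMap_slice_coord {y : P} (hy : y ∈ T.domain) :
    orbitMap G (T.slice (T.coord y)) = orbitMap G y := by
  conv_rhs => rw [← T.elt_smul_slice y hy]
  rw [orbitMap_smul]

variable [ContinuousConstSMul G P]

/-- The chart of the orbit space defined by a slice. -/
def chart : OpenPartialHomeomorph (MulAction.orbitRel.Quotient G P) (EuclideanSpace ℝ (Fin d)) where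
  -- The slice coordinate is constant on orbits, so the chosen representative does not matter.
  toFun c := T.coord c.out
  invFun w := orbitMap G (T.slice w)
  source := orbitMap G '' T.domain
  target := T.params
  map_source' := by
    rintro c ⟨y, hy, rfl⟩
    exact T.coord_mem _ ((T.mem_domain_iff (orbitMap_out _)).2 hy)
  map_target' := fun w hw => ⟨_, T.slice_mem w hw, rfl⟩
  left_inv' := by
    rintro c ⟨y, hy, rfl⟩
    rw [T.orbitMap_slice_coord ((T.mem_domain_iff (orbitMap_out _)).2 hy), orbitMap_out]
  right_inv' := by
    intro w hw
    rw [T.coord_eq ((T.mem_domain_iff (orbitMap_out _)).2 (T.slice_mem w hw)) (orbitMap_out _),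
      T.coord_slice w hw]
  open_source := (isOpenQuotientMap_orbitMap G P).isOpenMap _ T.isOpen_domain
  open_target := T.isOpen_params
  continuousOn_toFun := by
    rintro c ⟨y, hy, rfl⟩
    refine ContinuousAt.continuousWithinAt ?_
    rw [← (isOpenQuotientMap_orbitMap G P).continuousAt_comp_iff]
    refine (T.contMDiffAt_coord y hy).continuousAt.congr ?_
    filter_upwards [T.isOpen_domain.mem_nhds hy] with z hz
    exact T.coord_eq hz (orbitMap_out _).symm
  continuousOn_invFun := fun w hw =>
    ((isOpenQuotientMap_orbitMap G P).continuous.continuousAt.comp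
      (T.contMDiffAt_slice w hw).continuousAt).continuousWithinAt

theorem chart_orbitMap {y : P} (hy : y ∈ T.domain) : T.chart (orbitMap G y) = T.coord y :=
  T.coord_eq ((T.mem_domain_iff (orbitMap_out _)).2 hy) (orbitMap_out _)

end OrbitTube

/-- An atlas of the orbit space, given tubes through all points. -/
@[reducible]
def orbitChartedSpace [ContinuousConstSMul G P]
    (H : ∀ x : P, ∃ T : OrbitTube k p d G P, x ∈ T.domain) :
    ChartedSpace (EuclideanSpace ℝ (Fin d)) (MulAction.orbitRel.Quotient G P) where
  atlas := range fun T : OrbitTube k p d G P => T.chart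
  chartAt c := (H c.out).choose.chart
  mem_chart_source c := ⟨c.out, (H c.out).choose_spec, orbitMap_out c⟩
  chart_mem_atlas c := ⟨_, rfl⟩

/-- A change of charts lifts to `P`: it is `T'.coord ∘ T.slice`, a composition of smooth maps. -/
theorem orbitChartedSpace_isManifold [ContinuousConstSMul G P]
    (H : ∀ x : P, ∃ T : OrbitTube k p d G P, x ∈ T.domain) :
    letI := orbitChartedSpace H
    IsManifold (𝓡 d) ∞ (MulAction.orbitRel.Quotient G P) := by
  letI := orbitChartedSpace H
  refine isManifold_of_contDiffOn _ _ _ ?_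
  rintro _ _ ⟨T, rfl⟩ ⟨T', rfl⟩
  rintro w ⟨hw, -⟩
  have hw' : w ∈ (T.chart.symm ≫ₕ T'.chart).source := hw
  rw [OpenPartialHomeomorph.trans_source] at hw'
  obtain ⟨h1, h2⟩ := hw'
  have h1' : w ∈ T.params := h1
  have h2' : T.slice w ∈ T'.domain := T'.orbitMap_mem_image.1 h2
  refine ContDiffAt.contDiffWithinAt ?_
  have h3 : ContMDiffAt (𝓡 d) (𝓡 d) ∞ (fun w => T'.coord (T.slice w)) w :=
    (T'.contMDiffAt_coord _ h2').comp w (T.contMDiffAt_slice w h1')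
  refine (contMDiffAt_iff_contDiffAt.1 h3).congr_of_eventuallyEq ?_
  filter_upwards [(T.contMDiffAt_slice w h1').continuousAt.eventually
    (T'.isOpen_domain.mem_nhds h2')] with z hz
  exact T'.chart_orbitMap hz

/-- The orbit space of a free action, with local sections and the corresponding local
trivializations of the orbit map. -/
structure IsSmoothOrbitSpace (k p d : ℕ) (G : Type*) [TopologicalSpace G]
    [ChartedSpace (EuclideanSpace ℝ (Fin k)) G] [Group G]
    (P : Type*) [TopologicalSpace P] [ChartedSpace (EuclideanSpace ℝ (Fin p)) P] [MulAction G P]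
    [ChartedSpace (EuclideanSpace ℝ (Fin d)) (MulAction.orbitRel.Quotient G P)] : Prop where
  contMDiff : ContMDiff (𝓡 p) (𝓡 d) ∞ (orbitMap G : P → MulAction.orbitRel.Quotient G P)
  isSubmersion : Manifold.IsSubmersion (𝓡 p) (𝓡 d) ∞
    (orbitMap G : P → MulAction.orbitRel.Quotient G P)
  exists_section : ∀ x : P, ∃ (U : Set (MulAction.orbitRel.Quotient G P))
    (s : MulAction.orbitRel.Quotient G P → P) (γ : P → G), IsOpen U ∧ orbitMap G x ∈ U ∧
    s (orbitMap G x) = x ∧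
    (∀ c ∈ U, orbitMap G (s c) = c ∧ ContMDiffAt (𝓡 d) (𝓡 p) ∞ s c) ∧
    ∀ y, orbitMap G y ∈ U → ContMDiffAt (𝓡 p) (𝓡 k) ∞ γ y ∧ γ y • s (orbitMap G y) = y

variable [LieGroup (𝓡 k) ∞ G] [IsManifold (𝓡 p) ∞ P]

/-- In the tube coordinates `(coord, elt)` the orbit map is the first projection, hence a
submersion; the slice supplies the local section and `elt` the group element that moves it to a
given point. -/
theorem exists_isSmoothOrbitSpace [ContMDiffSMul (𝓡 k) (𝓡 p) ∞ G P] [ProperSMul G P]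
    [Nonempty P] (hfree : ∀ (g : G) (y : P), g • y = y → g = 1) :
    ∃ (_ : ChartedSpace (EuclideanSpace ℝ (Fin (p - k))) (MulAction.orbitRel.Quotient G P))
      (_ : IsManifold (𝓡 (p - k)) ∞ (MulAction.orbitRel.Quotient G P)),
      IsSmoothOrbitSpace k p (p - k) G P := by
  have H : ∀ x : P, ∃ T : OrbitTube k p (p - k) G P, x ∈ T.domain := fun x => by
    obtain ⟨T, h⟩ := OrbitTube.exists_mem_domain (k := k) (p := p) (x := x) hfree
    exact ⟨T, h.1⟩
  letI := orbitChartedSpace H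
  haveI := orbitChartedSpace_isManifold H
  -- Makes the truncated subtraction `p - k` a true codimension, so that `p = (p - k) + k`.
  have hkp : k ≤ p := by
    obtain ⟨x⟩ := ‹Nonempty P›
    let A : EuclideanSpace ℝ (Fin k) →ₗ[ℝ] EuclideanSpace ℝ (Fin p) :=
      (mfderiv (𝓡 k) (𝓡 p) (fun g : G => g • x) 1).toLinearMap
    have hA : Function.Injective A := mfderiv_orbit_injective k p (hfree · x)
    simpa using LinearMap.finrank_le_finrank_of_injective hA
  have hat : ∀ T : OrbitTube k p (p - k) G P,
      T.chart ∈ IsManifold.maximalAtlas (𝓡 (p - k)) ∞ (MulAction.orbitRel.Quotient G P) :=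
    fun T => IsManifold.subset_maximalAtlas ⟨T, rfl⟩
  refine ⟨inferInstance, inferInstance, ?_⟩
  have hsub : Manifold.IsSubmersion (𝓡 p) (𝓡 (p - k)) ∞
      (orbitMap G : P → MulAction.orbitRel.Quotient G P) := by
    have : Manifold.IsSubmersionOfComplement (EuclideanSpace ℝ (Fin k)) (𝓡 p) (𝓡 (p - k)) ∞
        (orbitMap G : P → MulAction.orbitRel.Quotient G P) := by
      intro x
      obtain ⟨T, hx⟩ := H x
      let ch := chartAt (EuclideanSpace ℝ (Fin k)) (T.elt x)
      let e : EuclideanSpace ℝ (Fin p) ≃L[ℝ]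
          EuclideanSpace ℝ (Fin (p - k)) × EuclideanSpace ℝ (Fin k) :=
        ContinuousLinearEquiv.ofFinrankEq (by simp [hkp])
      have hto : ∀ y ∈ T.domain, T.elt y ∈ ch.source →
          ContMDiffAt (𝓡 p) (𝓡 p) ∞ (fun y => e.symm (T.coord y, ch (T.elt y))) y := by
        intro y hy hy'
        have h1 : ContMDiffAt (𝓡 k) (𝓡 k) ∞ ch (T.elt y) :=
          contMDiffAt_of_mem_maximalAtlas (IsManifold.chart_mem_maximalAtlas _) hy'
        have h2 : ContMDiffAt (𝓡 p) 𝓘(ℝ, EuclideanSpace ℝ (Fin (p - k)) ×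
            EuclideanSpace ℝ (Fin k)) ∞ (fun y => (T.coord y, ch (T.elt y))) y :=
          (T.contMDiffAt_coord y hy).prodMk_space (h1.comp y (T.contMDiffAt_elt y hy))
        exact e.symm.contDiff.contMDiff.contMDiffAt.comp y h2
      have hinv : ∀ z, (e z).1 ∈ T.params → (e z).2 ∈ ch.target →
          ContMDiffAt (𝓡 p) (𝓡 p) ∞ (fun z => ch.symm (e z).2 • T.slice (e z).1) z := by
        intro z hz hz'
        have h1 : ContMDiffAt (𝓡 k) (𝓡 k) ∞ ch.symm (e z).2 :=
          contMDiffAt_symm_of_mem_maximalAtlas (IsManifold.chart_mem_maximalAtlas _) hz'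
        have h2 : ContDiff ℝ ∞ fun z => (e z).2 := by fun_prop
        have h3 : ContDiff ℝ ∞ fun z => (e z).1 := by fun_prop
        exact (h1.comp z h2.contMDiff.contMDiffAt).smul
          ((T.contMDiffAt_slice _ hz).comp z h3.contMDiff.contMDiffAt)
      have hco : ∀ (g : G) w, w ∈ T.params → T.coord (g • T.slice w) = w ∧
          T.elt (g • T.slice w) = g ∧ g • T.slice w ∈ T.domain := by
        intro g w hw
        have h := T.slice_mem w hw
        refine ⟨?_, ?_, T.smul_mem g _ h⟩
        · rw [T.coord_smul g _ h, T.coord_slice w hw]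
        · rw [T.elt_smul g _ h, T.elt_slice w hw, mul_one]
      have hcelt : ContinuousOn T.elt T.domain := fun y hy =>
        (T.contMDiffAt_elt y hy).continuousAt.continuousWithinAt
      -- The tube chart of `P`: slice coordinate together with the group element read in a chart of
      -- `G`.
      let Θ : OpenPartialHomeomorph P (EuclideanSpace ℝ (Fin p)) :=
        { toFun := fun y => e.symm (T.coord y, ch (T.elt y))
          invFun := fun z => ch.symm (e z).2 • T.slice (e z).1
          source := T.domain ∩ T.elt ⁻¹' ch.source
          target := e ⁻¹' (T.params ×ˢ ch.target)
          map_source' := fun y hy => by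
            simp only [mem_preimage, e.apply_symm_apply]
            exact ⟨T.coord_mem y hy.1, ch.map_source hy.2⟩
          map_target' := fun z hz => by
            obtain ⟨-, h2, h3⟩ := hco (ch.symm (e z).2) _ hz.1
            refine ⟨h3, ?_⟩
            rw [mem_preimage, h2]
            exact ch.map_target hz.2
          left_inv' := fun y hy => by
            simp only [e.apply_symm_apply, ch.left_inv hy.2]
            exact T.elt_smul_slice y hy.1
          right_inv' := fun z hz => by
            obtain ⟨h1, h2, h3⟩ := hco (ch.symm (e z).2) _ hz.1
            simp only [h1, h2, ch.right_inv hz.2]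
            exact e.symm_apply_apply z
          open_source := hcelt.isOpen_inter_preimage T.isOpen_domain ch.open_source
          open_target := (T.isOpen_params.prod ch.open_target).preimage e.continuous
          continuousOn_toFun := fun y hy => (hto y hy.1 hy.2).continuousAt.continuousWithinAt
          continuousOn_invFun := fun z hz => (hinv z hz.1 hz.2).continuousAt.continuousWithinAt }
      refine Manifold.IsSubmersionAtOfComplement.mk_of_charts e Θ T.chart ?_ ⟨x, hx, rfl⟩ ?_
        (hat T) ?_ ?_
      · exact ⟨hx, mem_chart_source _ _⟩
      · exact Θ.mem_maximalAtlas_of_contMDiffOn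
          (fun y hy => (hto y hy.1 hy.2).contMDiffWithinAt)
          (fun z hz => (hinv z hz.1 hz.2).contMDiffWithinAt)
      · exact fun y hy => ⟨y, hy.1, rfl⟩
      · intro z hz
        have hz' : z ∈ Θ.target := by simpa using hz
        obtain ⟨h1, h2, h3⟩ := hco (ch.symm (e z).2) _ hz'.1
        have h4 : T.chart (orbitMap G (Θ.symm z)) = (e z).1 := (T.chart_orbitMap h3).trans h1
        simpa using h4
    exact this.isSubmersion
  refine ⟨hsub.contMDiff, hsub, fun x => ?_⟩
  obtain ⟨T, hx, hxs⟩ := OrbitTube.exists_mem_domain (k := k) (p := p) (x := x) hfree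
  refine ⟨T.chart.source, fun c => T.slice (T.chart c), T.elt, T.chart.open_source, ⟨x, hx, rfl⟩,
    ?_, ?_, ?_⟩
  · dsimp only
    rw [T.chart_orbitMap hx, hxs]
  · intro c hc
    refine ⟨T.chart.left_inv hc, ?_⟩
    have h1 : ContMDiffAt (𝓡 (p - k)) (𝓡 (p - k)) ∞ T.chart c :=
      contMDiffAt_of_mem_maximalAtlas (hat T) hc
    exact (T.contMDiffAt_slice _ (T.chart.map_source hc)).comp c h1
  · intro y hy
    have hy' := T.orbitMap_mem_image.1 hy
    refine ⟨T.contMDiffAt_elt y hy', ?_⟩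
    dsimp only
    rw [T.chart_orbitMap hy', T.elt_smul_slice y hy']

end OrbitSpaces

/-! ### Rules for derivatives of vector-valued functions. -/

section Derivations

variable {m : ℕ} {N : Type*} [TopologicalSpace N] [ChartedSpace (EuclideanSpace ℝ (Fin m)) N]
  {V : Type*} [NormedAddCommGroup V] [NormedSpace ℝ V] {V' : Type*} [NormedAddCommGroup V']
  [NormedSpace ℝ V']

theorem mvfderiv_add_apply {f g : N → V} {x : N} (hf : MDifferentiableAt (𝓡 m) 𝓘(ℝ, V) f x)
    (hg : MDifferentiableAt (𝓡 m) 𝓘(ℝ, V) g x) (u : TangentSpace (𝓡 m) x) :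
    mvfderiv (𝓡 m) (fun y => f y + g y) x u = mvfderiv (𝓡 m) f x u + mvfderiv (𝓡 m) g x u :=
  congrArg (fun L => L u) (mvfderiv_add hf hg)

theorem mvfderiv_sub_apply {f g : N → V} {x : N} (hf : MDifferentiableAt (𝓡 m) 𝓘(ℝ, V) f x)
    (hg : MDifferentiableAt (𝓡 m) 𝓘(ℝ, V) g x) (u : TangentSpace (𝓡 m) x) :
    mvfderiv (𝓡 m) (fun y => f y - g y) x u = mvfderiv (𝓡 m) f x u - mvfderiv (𝓡 m) g x u :=
  congrArg (fun L => L u) (mvfderiv_sub hf hg)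

theorem mvfderiv_mul_apply {f g : N → ℝ} {x : N} (hf : MDifferentiableAt (𝓡 m) 𝓘(ℝ, ℝ) f x)
    (hg : MDifferentiableAt (𝓡 m) 𝓘(ℝ, ℝ) g x) (u : TangentSpace (𝓡 m) x) :
    mvfderiv (𝓡 m) (fun y => f y * g y) x u =
      f x * mvfderiv (𝓡 m) g x u + g x * mvfderiv (𝓡 m) f x u :=
  congrArg (fun L => L u) (mvfderiv_mul hf hg)

theorem mvfderiv_const_apply (c : V) (x : N) (u : TangentSpace (𝓡 m) x) :
    mvfderiv (𝓡 m) (fun _ : N => c) x u = 0 :=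
  congrArg (fun L => L u) (mvfderiv_const (I := 𝓡 m) c)

theorem MDifferentiableAt.finset_sum {κ : Type*} {s : Finset κ} {f : κ → N → V} {x : N}
    (hf : ∀ i ∈ s, MDifferentiableAt (𝓡 m) 𝓘(ℝ, V) (f i) x) :
    MDifferentiableAt (𝓡 m) 𝓘(ℝ, V) (fun y => ∑ i ∈ s, f i y) x := by
  classical
  induction s using Finset.induction_on with
  | empty => simpa using mdifferentiableAt_const
  | insert i s hi ih =>
    simp only [Finset.sum_insert hi]
    exact (hf i (by simp)).add (ih fun j hj => hf j (by simp [hj]))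

theorem mvfderiv_sum_apply {κ : Type*} {s : Finset κ} {f : κ → N → V} {x : N}
    (hf : ∀ i ∈ s, MDifferentiableAt (𝓡 m) 𝓘(ℝ, V) (f i) x) (u : TangentSpace (𝓡 m) x) :
    mvfderiv (𝓡 m) (fun y => ∑ i ∈ s, f i y) x u = ∑ i ∈ s, mvfderiv (𝓡 m) (f i) x u := by
  classical
  induction s using Finset.induction_on with
  | empty => simpa using mvfderiv_const_apply (0 : V) x u
  | insert i s hi ih =>
    simp only [Finset.sum_insert hi]
    rw [mvfderiv_add_apply (hf i (by simp))
      (MDifferentiableAt.finset_sum fun j hj => hf j (by simp [hj])),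
      ih fun j hj => hf j (by simp [hj])]

theorem mvfderiv_clm_apply (L : V →L[ℝ] V') {f : N → V} {x : N}
    (hf : MDifferentiableAt (𝓡 m) 𝓘(ℝ, V) f x) (u : TangentSpace (𝓡 m) x) :
    mvfderiv (𝓡 m) (fun y => L (f y)) x u = L (mvfderiv (𝓡 m) f x u) := by
  have h := mfderiv_comp_apply x
    (((L.contMDiff (n := ∞)).contMDiffAt (x := f x)).mdifferentiableAt (by simp)) hf u
  refine h.trans ?_
  change mfderiv 𝓘(ℝ, V) 𝓘(ℝ, V') L (f x) _ = _
  rw [mfderiv_eq_fderiv, L.fderiv]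
  rfl

theorem Filter.EventuallyEq.mvfderiv_eq {f g : N → V} {x : N} (h : f =ᶠ[𝓝 x] g) :
    mvfderiv (𝓡 m) f x = mvfderiv (𝓡 m) g x := by
  have h1 : mfderiv (𝓡 m) 𝓘(ℝ, V) f x = mfderiv (𝓡 m) 𝓘(ℝ, V) g x := h.mfderiv_eq
  exact h1

end Derivations

/-! ### The infinitesimal action on functions. -/

section Infinitesimal

variable {k n : ℕ}
  {G : Type*} [TopologicalSpace G] [ChartedSpace (EuclideanSpace ℝ (Fin k)) G] [Group G]
  [LieGroup (𝓡 k) ∞ G]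
  {V : Type*} [NormedAddCommGroup V] [NormedSpace ℝ V]

/-- Differentiate `g g⁻¹ = 1` at the identity. -/
theorem mfderiv_inv_one (u : GroupLieAlgebra (𝓡 k) G) :
    (mfderiv (𝓡 k) (𝓡 k) (fun g : G => g⁻¹) 1 u : EuclideanSpace ℝ (Fin k)) =
      -(u : EuclideanSpace ℝ (Fin k)) := by
  have hi : MDifferentiableAt (𝓡 k) (𝓡 k) (fun g : G => g⁻¹) 1 :=
    (contMDiff_inv (𝓡 k) ∞).contMDiffAt.mdifferentiableAt (by simp)
  have hm : MDifferentiableAt ((𝓡 k).prod (𝓡 k)) (𝓡 k) (fun z : G × G => z.1 * z.2)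
      ((1 : G), (1 : G)⁻¹) :=
    (contMDiff_mul (𝓡 k) ∞).contMDiffAt.mdifferentiableAt (by simp)
  have hp : MDifferentiableAt (𝓡 k) ((𝓡 k).prod (𝓡 k)) (fun g : G => (g, g⁻¹)) 1 :=
    mdifferentiableAt_id.prodMk hi
  have h1 := mfderiv_comp_apply 1 hm hp u
  have h2 : (fun z : G × G => z.1 * z.2) ∘ (fun g : G => (g, g⁻¹)) = fun _ => 1 := by
    ext g; simp
  rw [h2, mfderiv_const, mfderiv_prod_eq_add_apply hm] at h1
  have h3 : (fun z : G => z * (1 : G)⁻¹) = id := by ext; simp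
  have h4 : (fun z : G => (1 : G) * z) = id := by ext; simp
  dsimp only at h1
  rw [h3, h4, mfderiv_id, mfderiv_id] at h1
  have h6 : (mfderiv (𝓡 k) ((𝓡 k).prod (𝓡 k)) (fun g : G => (g, g⁻¹)) 1 u :
      EuclideanSpace ℝ (Fin k) × EuclideanSpace ℝ (Fin k)) =
      (u, mfderiv (𝓡 k) (𝓡 k) (fun g : G => g⁻¹) 1 u) := by
    have h7 := mdifferentiableAt_id.mfderiv_prod hi
    rw [mfderiv_id] at h7
    exact congrArg (fun L => L u) h7
  have h5 : (0 : EuclideanSpace ℝ (Fin k)) =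
      (mfderiv (𝓡 k) ((𝓡 k).prod (𝓡 k)) (fun g : G => (g, g⁻¹)) 1 u :
        EuclideanSpace ℝ (Fin k) × EuclideanSpace ℝ (Fin k)).1 +
      (mfderiv (𝓡 k) ((𝓡 k).prod (𝓡 k)) (fun g : G => (g, g⁻¹)) 1 u :
        EuclideanSpace ℝ (Fin k) × EuclideanSpace ℝ (Fin k)).2 := h1
  rw [h6] at h5
  exact (neg_eq_of_add_eq_zero_right h5.symm).symm

theorem mvfderiv_comp_inv {l : G → V} (hl : MDifferentiableAt (𝓡 k) 𝓘(ℝ, V) l 1)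
    (u : GroupLieAlgebra (𝓡 k) G) :
    mvfderiv (𝓡 k) (fun g => l g⁻¹) 1 u = -mvfderiv (𝓡 k) l 1 u := by
  have hi : MDifferentiableAt (𝓡 k) (𝓡 k) (fun g : G => g⁻¹) 1 :=
    (contMDiff_inv (𝓡 k) ∞).contMDiffAt.mdifferentiableAt (by simp)
  have h1 := mfderiv_comp_apply_of_eq (f := fun g : G => g⁻¹) 1 hl hi inv_one u
  refine h1.trans ?_
  refine (congrArg (mvfderiv (𝓡 k) l 1) (mfderiv_inv_one u)).trans ?_
  exact map_neg (mvfderiv (𝓡 k) l 1) u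

variable {M : Type*} [TopologicalSpace M] [ChartedSpace (EuclideanSpace ℝ (Fin n)) M]
  [MulAction G M] [ContMDiffSMul (𝓡 k) (𝓡 n) ∞ G M]

/-- The sign in `infinitesimalAction` is absorbed by inversion. The resulting form `φ(g⁻¹ x)`
matches the transport `g v(g⁻¹ x)` of sections. -/
theorem mvfderiv_infinitesimalAction {φ : M → V} {x : M}
    (hφ : MDifferentiableAt (𝓡 n) 𝓘(ℝ, V) φ x) (u : GroupLieAlgebra (𝓡 k) G) :
    mvfderiv (𝓡 n) φ x (infinitesimalAction u x) =
      mvfderiv (𝓡 k) (fun g : G => φ (g⁻¹ • x)) 1 u := by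
  have hO : MDifferentiableAt (𝓡 k) (𝓡 n) (fun g : G => g • x) 1 :=
    (contMDiff_orbit k n x).contMDiffAt.mdifferentiableAt (by simp)
  have h1 := mfderiv_comp_apply_of_eq (f := fun g : G => g • x) 1 hφ hO (one_smul G x) u
  have h2 : MDifferentiableAt (𝓡 k) 𝓘(ℝ, V) (fun g : G => φ (g • x)) 1 :=
    MDifferentiableAt.comp_of_eq (1 : G) hφ hO (one_smul G x)
  rw [mvfderiv_comp_inv h2]
  have h3 : mvfderiv (𝓡 k) (fun g : G => φ (g • x)) 1 u =
    mvfderiv (𝓡 n) φ x (mfderiv (𝓡 k) (𝓡 n) (fun g : G => g • x) 1 u : EuclideanSpace ℝ (Fin n)) :=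
    h1
  rw [h3]
  exact map_neg (mvfderiv (𝓡 n) φ x) _

end Infinitesimal

/-! ### Transport of sections by the group. -/

namespace ExtendedAction

variable {k n : ℕ}
  {G : Type*} [TopologicalSpace G] [ChartedSpace (EuclideanSpace ℝ (Fin k)) G] [Group G]
  [LieGroup (𝓡 k) ∞ G]
  {M : Type*} [TopologicalSpace M] [ChartedSpace (EuclideanSpace ℝ (Fin n)) M]
  [IsManifold (𝓡 n) ∞ M] [MulAction G M]
  {F : Type*} [NormedAddCommGroup F] [NormedSpace ℝ F]
  {E : M → Type*} [TopologicalSpace (TotalSpace F E)] [∀ x, AddCommGroup (E x)]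
  [∀ x, Module ℝ (E x)] [∀ x, TopologicalSpace (E x)] [FiberBundle F E] [VectorBundle ℝ F E]
  [ContMDiffVectorBundle ∞ F E (𝓡 n)]
  {𝔞 : Type*} [AddCommGroup 𝔞] [Module ℝ 𝔞]
  {C : CourantAlgebroid n F E} {A : CourantAlgebra (GroupLieAlgebra (𝓡 k) G) 𝔞}
  (R : ExtendedAction C A)

/-- The action of `g` between fibres, with a specified target point. -/
def actTo (g : G) {x y : M} (h : g • x = y) : E x →ₗ[ℝ] E y := by
  subst h
  exact R.act g x

theorem mk_actTo (g : G) {x y : M} (h : g • x = y) (v : E x) :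
    (⟨y, R.actTo g h v⟩ : TotalSpace F E) = ⟨g • x, R.act g x v⟩ := by
  subst h
  rfl

omit [IsManifold (𝓡 n) ∞ M] [∀ x, AddCommGroup (E x)] [∀ x, Module ℝ (E x)]
  [∀ x, TopologicalSpace (E x)] [TopologicalSpace (TotalSpace F E)] [NormedAddCommGroup F]
  [NormedSpace ℝ F] [TopologicalSpace M] [ChartedSpace (EuclideanSpace ℝ (Fin n)) M] in
theorem _root_.Bundle.TotalSpace.mk_right_injective {x : M} {v w : E x}
    (h : (⟨x, v⟩ : TotalSpace F E) = ⟨x, w⟩) : v = w := by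
  cases h
  rfl

theorem actTo_one {x : M} (h : (1 : G) • x = x) (v : E x) : R.actTo 1 h v = v :=
  TotalSpace.mk_right_injective (F := F) ((R.mk_actTo 1 h v).trans (R.act_one x v))

theorem actTo_mul (g g' : G) {x y z : M} (h : g' • x = y) (h' : g • y = z)
    (h'' : (g * g') • x = z) (v : E x) : R.actTo (g * g') h'' v = R.actTo g h' (R.actTo g' h v) := by
  refine TotalSpace.mk_right_injective (F := F) ((R.mk_actTo _ h'' v).trans ?_)
  rw [R.mk_actTo g h', R.act_mul]
  subst h
  rfl

theorem actTo_inv_actTo (g : G) {x y : M} (h : g • x = y) (h' : g⁻¹ • y = x) (v : E x) :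
    R.actTo g⁻¹ h' (R.actTo g h v) = v := by
  have h1 : (g⁻¹ * g) • x = x := by simp
  rw [← R.actTo_mul g⁻¹ g h h' h1]
  generalize hg : g⁻¹ * g = g' at h1 ⊢
  rw [inv_mul_cancel] at hg
  subst hg
  exact R.actTo_one _ v

theorem actTo_actTo_inv (g : G) {x y : M} (h : g • x = y) (h' : g⁻¹ • y = x) (v : E y) :
    R.actTo g h (R.actTo g⁻¹ h' v) = v := by
  have h1 : (g * g⁻¹) • y = y := by simp
  rw [← R.actTo_mul g g⁻¹ h' h h1]
  generalize hg : g * g⁻¹ = g' at h1 ⊢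
  rw [mul_inv_cancel] at hg
  subst hg
  exact R.actTo_one _ v

theorem actTo_congr {g g' : G} (hg : g = g') {x y : M} (h : g • x = y) (h' : g' • x = y) (v : E x) :
    R.actTo g h v = R.actTo g' h' v := by
  subst hg
  rfl

/-- The value at `x` of the section `v` transported by `g`. -/
def push (g : G) (v : Cₛ^∞⟮𝓡 n; F, E⟯) (x : M) : E x :=
  R.actTo g (smul_inv_smul g x) (v (g⁻¹ • x))

theorem push_one (v : Cₛ^∞⟮𝓡 n; F, E⟯) (x : M) : R.push 1 v x = v x := by
  refine TotalSpace.mk_right_injective (F := F) ((R.mk_actTo _ _ _).trans ?_)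
  rw [R.act_one]
  have h : ∀ y : M, y = x → (⟨y, v y⟩ : TotalSpace F E) = ⟨x, v x⟩ := by
    rintro y rfl
    rfl
  exact h _ (by simp)

theorem push_mul (g g' : G) (v : Cₛ^∞⟮𝓡 n; F, E⟯) (x : M) :
    R.push (g * g') v x = R.actTo g (smul_inv_smul g x) (R.push g' v (g⁻¹ • x)) := by
  have h1 : (g * g')⁻¹ • x = g'⁻¹ • g⁻¹ • x := by rw [mul_inv_rev, mul_smul]
  have h2 : ∀ (y : M) (h : (g * g')⁻¹ • x = y) (h' : g' • y = g⁻¹ • x),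
      R.push (g * g') v x = R.actTo g (smul_inv_smul g x) (R.actTo g' h' (v y)) := by
    rintro y rfl h'
    exact R.actTo_mul g g' h' _ _ _
  exact h2 _ h1 (smul_inv_smul g' _)

/-- Smoothness of the action on vectors over a moving base point. -/
theorem contMDiffAt_actTo {E' H' N : Type*} [NormedAddCommGroup E'] [NormedSpace ℝ E']
    [TopologicalSpace H'] {I' : ModelWithCorners ℝ E' H'} [TopologicalSpace N] [ChartedSpace H' N]
    {γ : N → G} {β β' : N → M} {v : ∀ z, E (β z)} {z : N} (h : ∀ z, γ z • β z = β' z)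
    (hγ : ContMDiffAt I' (𝓡 k) ∞ γ z)
    (hv : ContMDiffAt I' ((𝓡 n).prod 𝓘(ℝ, F)) ∞ (fun z => (⟨β z, v z⟩ : TotalSpace F E)) z) :
    ContMDiffAt I' ((𝓡 n).prod 𝓘(ℝ, F)) ∞
      (fun z => (⟨β' z, R.actTo (γ z) (h z) (v z)⟩ : TotalSpace F E)) z := by
  have h1 : (fun z => (⟨β' z, R.actTo (γ z) (h z) (v z)⟩ : TotalSpace F E)) =
      (fun z : G × TotalSpace F E =>
        (⟨z.1 • z.2.proj, R.act z.1 z.2.proj z.2.2⟩ : TotalSpace F E)) ∘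
      fun z => (γ z, (⟨β z, v z⟩ : TotalSpace F E)) := by
    funext z
    exact R.mk_actTo _ _ _
  rw [h1]
  exact R.act_smooth.contMDiffAt.comp z (hγ.prodMk hv)

/-- The base point stays at `x`, so this is a curve in a single fibre. Linear functionals of it are
ordinary functions on `G` and can be differentiated there. -/
theorem contMDiff_push [ContMDiffSMul (𝓡 k) (𝓡 n) ∞ G M] (v : Cₛ^∞⟮𝓡 n; F, E⟯) (x : M) :
    ContMDiff (𝓡 k) ((𝓡 n).prod 𝓘(ℝ, F)) ∞
      (fun g : G => (⟨x, R.push g v x⟩ : TotalSpace F E)) := by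
  intro g
  have h1 : ContMDiff (𝓡 k) (𝓡 n) ∞ (fun g : G => g⁻¹ • x) :=
    (contMDiff_inv (𝓡 k) ∞).smul contMDiff_const
  exact R.contMDiffAt_actTo (γ := fun g : G => g) (β := fun g : G => g⁻¹ • x) (β' := fun _ => x)
    (v := fun g => v (g⁻¹ • x)) (fun g => smul_inv_smul g x) contMDiffAt_id
    (v.contMDiff.contMDiffAt.comp g h1.contMDiffAt)

variable {V : Type*} [NormedAddCommGroup V] [NormedSpace ℝ V]

omit [IsManifold (𝓡 n) ∞ M] [TopologicalSpace G] [LieGroup (𝓡 k) ∞ G] [Group G] [MulAction G M]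
  [ContMDiffVectorBundle ∞ F E (𝓡 n)] [ChartedSpace (EuclideanSpace ℝ (Fin k)) G]
  [ChartedSpace (EuclideanSpace ℝ (Fin n)) M] in
/-- A linear map on a fibre factors through the trivialization. -/
theorem _root_.exists_clm_trivializationAt [FiniteDimensional ℝ F] {x : M} (l : E x →ₗ[ℝ] V) :
    ∃ L : F →L[ℝ] V, ∀ v : E x, l v = L (trivializationAt F E x ⟨x, v⟩).2 := by
  have hx := FiberBundle.mem_baseSet_trivializationAt' (F := F) (E := E) x
  let e := (trivializationAt F E x).linearEquivAt ℝ x hx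
  refine ⟨LinearMap.toContinuousLinearMap (l ∘ₗ e.symm.toLinearMap), fun v => ?_⟩
  change l v = l (e.symm (e v))
  rw [e.symm_apply_apply]

variable [FiniteDimensional ℝ F] [ContMDiffSMul (𝓡 k) (𝓡 n) ∞ G M]

theorem contMDiff_linear_push {x : M} (l : E x →ₗ[ℝ] V) (v : Cₛ^∞⟮𝓡 n; F, E⟯) :
    ContMDiff (𝓡 k) 𝓘(ℝ, V) ∞ (fun g : G => l (R.push g v x)) := by
  obtain ⟨L, hL⟩ := exists_clm_trivializationAt (F := F) l
  intro g
  simp only [hL]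
  have h1 := contMDiffAt_totalSpace.1 (R.contMDiff_push v x g)
  exact L.contMDiff.contMDiffAt.comp g h1.2

/-- The derivative of the transported sections along left-invariant vector fields is given by the
bracket. -/
theorem mvfderiv_linear_push {x : M} (l : E x →ₗ[ℝ] V) (v : Cₛ^∞⟮𝓡 n; F, E⟯) (a : 𝔞) (g : G) :
    mvfderiv (𝓡 k) (fun g : G => l (R.push g v x)) g (mulInvariantVectorField (A.proj a) g) =
      l (R.push g (C.bracket (R.toSection a) v) x) := by
  -- At the identity this is the integration axiom of the action. Since transport by `g h` is
  -- transport by `h` followed by `g`, the case of a general `g` is the identity case at `g⁻¹ x`,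
  -- with `l` composed with the action of `g`.
  have h0 : ∀ {x : M} (l : E x →ₗ[ℝ] V),
      mvfderiv (𝓡 k) (fun g : G => l (R.push g v x)) 1 (A.proj a) =
        l (C.bracket (R.toSection a) v x) := by
    intro x l
    obtain ⟨L, hL⟩ := exists_clm_trivializationAt (F := F) l
    have h1 := (contMDiffAt_totalSpace.1 (R.contMDiff_push v x 1)).2.mdifferentiableAt (by simp)
    have h2 := R.act_infinitesimal a v x
    have h3 : (fun g : G => (trivializationAt F E x (⟨g • g⁻¹ • x, R.act g (g⁻¹ • x)
        (v (g⁻¹ • x))⟩ : TotalSpace F E)).2) =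
        fun g : G => (trivializationAt F E x ⟨x, R.push g v x⟩).2 := by
      funext g
      rw [push, R.mk_actTo]
    rw [h3] at h2
    simp only [hL]
    rw [mvfderiv_clm_apply L h1, h2]
  have h1 : MDifferentiableAt (𝓡 k) 𝓘(ℝ, V) (fun g : G => l (R.push g v x)) g :=
    (R.contMDiff_linear_push l v).contMDiffAt.mdifferentiableAt (by simp)
  refine (mfderiv_mulInvariantVectorField h1 (A.proj a)).trans ?_
  have h2 : (fun h : G => l (R.push (g * h) v x)) =
      fun h : G => (l ∘ₗ R.actTo g (smul_inv_smul g x)) (R.push h v (g⁻¹ • x)) := by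
    funext h
    rw [R.push_mul]
    rfl
  rw [h2]
  exact h0 _

end ExtendedAction

/-! ### Fibres, and invariance of the pairing. -/

section FibreBasis

variable {M : Type*} [TopologicalSpace M]
  {F : Type*} [NormedAddCommGroup F] [NormedSpace ℝ F]
  {E : M → Type*} [TopologicalSpace (TotalSpace F E)] [∀ x, AddCommGroup (E x)]
  [∀ x, Module ℝ (E x)] [∀ x, TopologicalSpace (E x)] [FiberBundle F E] [VectorBundle ℝ F E]

variable (F) in
/-- The identification of a fibre with the typical fibre. -/
def fibreLinearEquiv (x : M) : E x ≃ₗ[ℝ] F :=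
  (trivializationAt F E x).linearEquivAt ℝ x (FiberBundle.mem_baseSet_trivializationAt' x)

variable (F) in
/-- A basis of a fibre of a vector bundle of finite rank. -/
def fibreBasis [FiniteDimensional ℝ F] (x : M) : Module.Basis (Fin (Module.finrank ℝ F)) ℝ (E x) :=
  (Module.finBasis ℝ F).map (fibreLinearEquiv F x).symm

variable (F E) in
theorem finiteDimensional_fibre [FiniteDimensional ℝ F] (x : M) : FiniteDimensional ℝ (E x) :=
  Module.Basis.finiteDimensional_of_finite (fibreBasis F x)

end FibreBasis

theorem CourantAlgebroid.pairing_congr {d : ℕ} {X : Type*} [TopologicalSpace X]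
    [ChartedSpace (EuclideanSpace ℝ (Fin d)) X] {F : Type*} [NormedAddCommGroup F]
    [NormedSpace ℝ F] {V : X → Type*} [TopologicalSpace (TotalSpace F V)]
    [∀ x, AddCommGroup (V x)] [∀ x, Module ℝ (V x)] [∀ x, TopologicalSpace (V x)]
    [FiberBundle F V] [VectorBundle ℝ F V] [IsManifold (𝓡 d) ∞ X]
    [ContMDiffVectorBundle ∞ F V (𝓡 d)] (C : CourantAlgebroid d F V) {x y : X} {v w : V x}
    {v' w' : V y} (h : (⟨x, v⟩ : TotalSpace F V) = ⟨y, v'⟩)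
    (h' : (⟨x, w⟩ : TotalSpace F V) = ⟨y, w'⟩) : C.pairing x v w = C.pairing y v' w' := by
  cases h
  cases h'
  rfl

namespace ExtendedAction

variable {k n : ℕ}
  {G : Type*} [TopologicalSpace G] [ChartedSpace (EuclideanSpace ℝ (Fin k)) G] [Group G]
  [LieGroup (𝓡 k) ∞ G]
  {M : Type*} [TopologicalSpace M] [ChartedSpace (EuclideanSpace ℝ (Fin n)) M]
  [IsManifold (𝓡 n) ∞ M] [T2Space M] [MulAction G M] [ContMDiffSMul (𝓡 k) (𝓡 n) ∞ G M]
  {F : Type*} [NormedAddCommGroup F] [NormedSpace ℝ F] [FiniteDimensional ℝ F]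
  {E : M → Type*} [TopologicalSpace (TotalSpace F E)] [∀ x, AddCommGroup (E x)]
  [∀ x, Module ℝ (E x)] [∀ x, TopologicalSpace (E x)] [FiberBundle F E] [VectorBundle ℝ F E]
  [ContMDiffVectorBundle ∞ F E (𝓡 n)]
  {𝔞 : Type*} [AddCommGroup 𝔞] [Module ℝ 𝔞]
  {C : CourantAlgebroid n F E} {A : CourantAlgebra (GroupLieAlgebra (𝓡 k) G) 𝔞}
  (R : ExtendedAction C A)

theorem contMDiff_pairing_act_inv (x : M) (v w : E x) :
    ContMDiff (𝓡 k) 𝓘(ℝ, ℝ) ∞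
      (fun g : G => C.pairing (g⁻¹ • x) (R.act g⁻¹ x v) (R.act g⁻¹ x w)) := by
  have h : ∀ v : E x, ContMDiff (𝓡 k) ((𝓡 n).prod 𝓘(ℝ, F)) ∞
      (fun g : G => (⟨g⁻¹ • x, R.act g⁻¹ x v⟩ : TotalSpace F E)) := by
    intro v
    have h1 : ContMDiff (𝓡 k) ((𝓡 k).prod ((𝓡 n).prod 𝓘(ℝ, F))) ∞
        (fun g : G => (g⁻¹, (⟨x, v⟩ : TotalSpace F E))) :=
      (contMDiff_inv (𝓡 k) ∞).prodMk contMDiff_const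
    exact R.act_smooth.comp h1
  exact fun g => C.contMDiffAt_pairing (h v g) (h w g)

/-- Let `K i j g = ⟨g⁻¹ b_i, g⁻¹ b_j⟩`, and let `m i l g` be the coordinates of `g s_i(g⁻¹ x)` in
the basis `b`. Then `⟨s_i, s_j⟩(g⁻¹ x) = ∑ m_il m_jl' K_ll'`. At `g = 1` the derivative of the left
side is given by (C4), and the derivatives of the `m` already account for both of its terms, so
nothing is left for `K`. -/
theorem mvfderiv_pairing_act_inv_one (x : M) (v w : E x) (u : GroupLieAlgebra (𝓡 k) G) :
    mvfderiv (𝓡 k) (fun g : G => C.pairing (g⁻¹ • x) (R.act g⁻¹ x v) (R.act g⁻¹ x w)) 1 u = 0 := by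
  obtain ⟨a, rfl⟩ := R.exact.proj_surjective u
  let b := fibreBasis (E := E) F x
  let K := fun i j (g : G) => C.pairing (g⁻¹ • x) (R.act g⁻¹ x (b i)) (R.act g⁻¹ x (b j))
  have hK : ∀ i j, MDifferentiableAt (𝓡 k) 𝓘(ℝ, ℝ) (K i j) 1 := fun i j =>
    (R.contMDiff_pairing_act_inv x (b i) (b j)).contMDiffAt.mdifferentiableAt (by simp)
  have hK1 : ∀ i j, K i j 1 = C.pairing x (b i) (b j) := by
    intro i j
    refine C.pairing_congr ?_ ?_ <;> · rw [inv_one]; exact R.act_one _ _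
  choose s hs using fun i => exists_section_eq (m := n) (F := F) (V := E) x (b i)
  let m := fun i l (g : G) => b.coord l (R.push g (s i) x)
  have hm : ∀ i l, MDifferentiableAt (𝓡 k) 𝓘(ℝ, ℝ) (m i l) 1 := fun i l =>
    (R.contMDiff_linear_push (b.coord l) (s i)).contMDiffAt.mdifferentiableAt (by simp)
  have hm1 : ∀ i l, m i l 1 = if i = l then 1 else 0 := by
    intro i l
    simp only [m]
    rw [R.push_one, hs, b.coord_apply, b.repr_self, Finsupp.single_apply]
  have hmd : ∀ i l, mvfderiv (𝓡 k) (m i l) 1 (A.proj a) =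
      b.coord l (C.bracket (R.toSection a) (s i) x) := by
    intro i l
    have h1 := R.mvfderiv_linear_push (b.coord l) (s i) a 1
    rw [R.push_one] at h1
    have h8 : mulInvariantVectorField (A.proj a) (1 : G) = A.proj a := by
      have : (fun h : G => 1 * h) = id := by ext; simp
      unfold mulInvariantVectorField
      rw [this, mfderiv_id]
      rfl
    rw [h8] at h1
    exact h1
  have key : ∀ i j, mvfderiv (𝓡 k) (K i j) 1 (A.proj a) = 0 := by
    intro i j
    have e1 : (fun g : G => C.pairing (g⁻¹ • x) (s i (g⁻¹ • x)) (s j (g⁻¹ • x))) =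
        fun g => ∑ l, ∑ l', m i l g * (m j l' g * K l l' g) := by
      funext g
      have e2 : ∀ i, s i (g⁻¹ • x) = ∑ l, m i l g • R.act g⁻¹ x (b l) := by
        intro i
        have h1 := R.actTo_inv_actTo g (smul_inv_smul g x) rfl (s i (g⁻¹ • x))
        refine h1.symm.trans ?_
        change R.act g⁻¹ x (R.push g (s i) x) = _
        conv_lhs => rw [← b.sum_repr (R.push g (s i) x)]
        simp only [map_sum, map_smul]
        rfl
      rw [e2 i, e2 j]
      simp only [map_sum, map_smul, LinearMap.sum_apply, LinearMap.smul_apply, smul_eq_mul,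
        Finset.mul_sum]
      rw [Finset.sum_comm]
      refine Finset.sum_congr rfl fun l _ => Finset.sum_congr rfl fun l' _ => ?_
      simp only [K]
      ring
    have e3 := mvfderiv_infinitesimalAction (x := x)
      (((C.pairing_smooth (s i) (s j)).contMDiffAt (x := x)).mdifferentiableAt (by simp)) (A.proj a)
    -- The derivative of `⟨s_i, s_j⟩` is now computed in two ways: by (C4), and by the product rule
    -- in the transported frame.
    rw [e1, ← R.anchor_toSection, C.invariance] at e3
    have d1 : ∀ l l', MDifferentiableAt (𝓡 k) 𝓘(ℝ, ℝ) (fun g => m j l' g * K l l' g) 1 :=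
      fun l l' => (hm j l').mul (hK l l')
    have d2 : ∀ l l', MDifferentiableAt (𝓡 k) 𝓘(ℝ, ℝ)
        (fun g => m i l g * (m j l' g * K l l' g)) 1 := fun l l' => (hm i l).mul (d1 l l')
    rw [mvfderiv_sum_apply fun l _ => MDifferentiableAt.finset_sum fun l' _ => d2 l l'] at e3
    have e4 : ∀ l, mvfderiv (𝓡 k) (fun g => ∑ l', m i l g * (m j l' g * K l l' g)) 1 (A.proj a) =
        ∑ l', (m i l 1 * (m j l' 1 * mvfderiv (𝓡 k) (K l l') 1 (A.proj a) +
          K l l' 1 * mvfderiv (𝓡 k) (m j l') 1 (A.proj a)) +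
          m j l' 1 * K l l' 1 * mvfderiv (𝓡 k) (m i l) 1 (A.proj a)) := by
      intro l
      rw [mvfderiv_sum_apply fun l' _ => d2 l l']
      refine Finset.sum_congr rfl fun l' _ => ?_
      rw [mvfderiv_mul_apply (hm i l) (d1 l l'), mvfderiv_mul_apply (hm j l') (hK l l')]
    simp only [e4, hm1, hmd, hK1, Finset.sum_add_distrib, ite_mul, one_mul, zero_mul,
      Finset.sum_ite_eq, Finset.mem_univ, if_true, mul_add, Finset.sum_ite_irrel,
      Finset.sum_const_zero] at e3
    have e5 : ∑ l, C.pairing x (b i) (b l) * b.coord l (C.bracket (R.toSection a) (s j) x) =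
        C.pairing x (b i) (C.bracket (R.toSection a) (s j) x) := by
      conv_rhs => rw [← b.sum_repr (C.bracket (R.toSection a) (s j) x)]
      simp only [map_sum, map_smul, smul_eq_mul]
      exact Finset.sum_congr rfl fun l _ => mul_comm _ _
    have e6 : ∑ l, C.pairing x (b l) (b j) * b.coord l (C.bracket (R.toSection a) (s i) x) =
        C.pairing x (C.bracket (R.toSection a) (s i) x) (b j) := by
      conv_rhs => rw [← b.sum_repr (C.bracket (R.toSection a) (s i) x)]
      simp only [map_sum, map_smul, LinearMap.sum_apply, LinearMap.smul_apply, smul_eq_mul]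
      exact Finset.sum_congr rfl fun l _ => mul_comm _ _
    rw [e5, e6, hs, hs] at e3
    linarith
  have e7 : (fun g : G => C.pairing (g⁻¹ • x) (R.act g⁻¹ x v) (R.act g⁻¹ x w)) =
      fun g => ∑ i, ∑ j, (b.repr v i * b.repr w j) • K i j g := by
    funext g
    conv_lhs => rw [← b.sum_repr v, ← b.sum_repr w]
    simp only [map_sum, map_smul, LinearMap.sum_apply, LinearMap.smul_apply, smul_eq_mul,
      Finset.mul_sum]
    rw [Finset.sum_comm]
    refine Finset.sum_congr rfl fun l _ => Finset.sum_congr rfl fun l' _ => ?_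
    simp only [K]
    ring
  have d3 : ∀ i j, MDifferentiableAt (𝓡 k) 𝓘(ℝ, ℝ)
      (fun g => (b.repr v i * b.repr w j) • K i j g) 1 := fun i j => (hK i j).const_smul _
  rw [e7, mvfderiv_sum_apply fun l _ => MDifferentiableAt.finset_sum fun l' _ => d3 l l']
  refine Finset.sum_eq_zero fun i _ => ?_
  rw [mvfderiv_sum_apply fun l' _ => d3 i l']
  refine Finset.sum_eq_zero fun j _ => ?_
  have h := mvfderiv_clm_apply ((b.repr v i * b.repr w j) • ContinuousLinearMap.id ℝ ℝ) (hK i j)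
    (A.proj a)
  rw [key i j, map_zero] at h
  exact h

/-- The action preserves the pairing. -/
theorem pairing_actTo [ConnectedSpace G] (g : G) {x y : M} (h : g • x = y) (v w : E x) :
    C.pairing y (R.actTo g h v) (R.actTo g h w) = C.pairing x v w := by
  have hd := R.contMDiff_pairing_act_inv x v w
  have h1 := eq_of_mulInvariant_derivative_eq_zero (k := k) (l := fun g : G =>
    C.pairing (g⁻¹ • x) (R.act g⁻¹ x v) (R.act g⁻¹ x w))
    (fun g => hd.contMDiffAt.mdifferentiableAt (by simp)) (fun g u => by
      refine (mfderiv_mulInvariantVectorField (hd.contMDiffAt.mdifferentiableAt (by simp))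
        u).trans ?_
      have h2 : (fun h : G => C.pairing ((g * h)⁻¹ • x) (R.act (g * h)⁻¹ x v)
          (R.act (g * h)⁻¹ x w)) = fun h : G => C.pairing (h⁻¹ • g⁻¹ • x)
          (R.act h⁻¹ (g⁻¹ • x) (R.act g⁻¹ x v)) (R.act h⁻¹ (g⁻¹ • x) (R.act g⁻¹ x w)) := by
        funext h
        refine C.pairing_congr ?_ ?_ <;> · rw [mul_inv_rev]; exact R.act_mul _ _ _ _
      rw [h2]
      exact R.mvfderiv_pairing_act_inv_one (g⁻¹ • x) _ _ u) g⁻¹ 1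
  refine Eq.trans ?_ (h1.trans ?_)
  · refine C.pairing_congr ?_ ?_ <;> · rw [inv_inv]; exact R.mk_actTo _ _ _
  · refine C.pairing_congr ?_ ?_ <;> · rw [inv_one]; exact R.act_one _ _

end ExtendedAction

/-! ### Dual families for the pairing. -/

namespace CourantAlgebroid

variable {d : ℕ} {X : Type*} [TopologicalSpace X] [ChartedSpace (EuclideanSpace ℝ (Fin d)) X]
  [IsManifold (𝓡 d) ∞ X]
  {F : Type*} [NormedAddCommGroup F] [NormedSpace ℝ F]
  {V : X → Type*} [TopologicalSpace (TotalSpace F V)] [∀ x, AddCommGroup (V x)]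
  [∀ x, Module ℝ (V x)] [∀ x, TopologicalSpace (V x)] [FiberBundle F V] [VectorBundle ℝ F V]
  [ContMDiffVectorBundle ∞ F V (𝓡 d)] (C : CourantAlgebroid d F V)

omit [IsManifold (𝓡 d) ∞ X] [ContMDiffVectorBundle ∞ F V (𝓡 d)] in
theorem _root_.sum_section_apply {κ : Type*} (s : Finset κ) (σ : κ → Cₛ^∞⟮𝓡 d; F, V⟯) (x : X) :
    (∑ i ∈ s, σ i) x = ∑ i ∈ s, σ i x :=
  map_sum (sectionEval F V x) σ s

theorem exists_pairing_eq [FiniteDimensional ℝ F] (x : X) (f : V x →ₗ[ℝ] ℝ) :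
    ∃ e : V x, ∀ w, C.pairing x e w = f w := by
  haveI := finiteDimensional_fibre F V x
  have hinj : Function.Injective (C.pairing x) :=
    (injective_iff_map_eq_zero _).2 fun e he =>
      C.pairing_nondegenerate x e fun w => by rw [he]; rfl
  have hd : Module.finrank ℝ (V x) = Module.finrank ℝ (V x →ₗ[ℝ] ℝ) :=
    (Subspace.dual_finrank_eq (K := ℝ) (V := V x)).symm
  obtain ⟨e, he⟩ := (LinearMap.injective_iff_surjective_of_finrank_eq_finrank hd).1 hinj f
  exact ⟨e, fun w => by rw [he]⟩

/-- A left inverse of `c ↦ ∑ c_j v_j` provides the coordinate functionals, which nondegeneracy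
represents by vectors. -/
theorem exists_dual_family [FiniteDimensional ℝ F] {x : X} {t : ℕ} {v : Fin t → V x}
    (hv : LinearIndependent ℝ v) :
    ∃ e : Fin t → V x, ∀ i j, C.pairing x (e i) (v j) = if i = j then 1 else 0 := by
  let L : (Fin t → ℝ) →ₗ[ℝ] V x := Fintype.linearCombination ℝ v
  have hL : LinearMap.ker L = ⊥ := by
    rw [LinearMap.ker_eq_bot']
    intro c hc
    funext i
    exact Fintype.linearIndependent_iff.1 hv c (by simpa [L, Fintype.linearCombination_apply] using hc) i
  obtain ⟨r, hr⟩ := L.exists_leftInverse_of_injective hL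
  choose e he using fun i => C.exists_pairing_eq x (LinearMap.proj i ∘ₗ r)
  refine ⟨e, fun i j => ?_⟩
  rw [he]
  have h1 : v j = L (Pi.single j 1) := by simp [L, Fintype.linearCombination_apply_single]
  have h2 : r (L (Pi.single j 1)) = Pi.single j 1 := LinearMap.congr_fun hr _
  rw [LinearMap.comp_apply, h1, h2]
  simp [Pi.single_apply]

theorem smoothNear_pairing (e e' : Cₛ^∞⟮𝓡 d; F, V⟯) (x : X) :
    SmoothNear d (fun y => C.pairing y (e y) (e' y)) x :=
  (C.pairing_smooth e e').smoothNear x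

/-- Local dual sections of a linearly independent family. -/
theorem exists_dual_sections [FiniteDimensional ℝ F] [T2Space X] {x : X} {t : ℕ}
    {σ : Fin t → Cₛ^∞⟮𝓡 d; F, V⟯} (hσ : LinearIndependent ℝ fun i => σ i x) :
    ∃ θ : Fin t → Cₛ^∞⟮𝓡 d; F, V⟯, ∀ᶠ z in 𝓝 x, ∀ i j,
      C.pairing z (θ i z) (σ j z) = if i = j then 1 else 0 := by
  obtain ⟨e, he⟩ := C.exists_dual_family hσ
  choose s hs using fun i => exists_section_eq (m := d) (F := F) (V := V) x (e i)
  -- Extending the dual vectors from `x` keeps duality only at `x`. The matrix of pairings is the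
  -- identity there, and multiplying by its inverse restores duality nearby.
  let N : X → Matrix (Fin t) (Fin t) ℝ := fun z => Matrix.of fun i j =>
    C.pairing z (s i z) (σ j z)
  have hN : ∀ i j, SmoothNear d (fun z => N z i j) x := fun i j =>
    C.smoothNear_pairing (s i) (σ j) x
  have hN1 : N x = 1 := by
    ext i j
    simp only [N, Matrix.of_apply, hs, he, Matrix.one_apply]
  have hdet : (N x).det ≠ 0 := by rw [hN1]; simp
  choose f hf using fun i j => (SmoothNear.matrix_inv hN hdet i j).exists_contMDiffMap
  refine ⟨fun i => ∑ l, funSMulSection (f i l) (s l), ?_⟩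
  have hdet' : ∀ᶠ z in 𝓝 x, (N z).det ≠ 0 :=
    (SmoothNear.matrix_det hN).continuousAt.eventually_ne hdet
  filter_upwards [eventually_all.2 fun i => eventually_all.2 fun j => hf i j, hdet']
    with z hz hz' i j
  rw [sum_section_apply]
  have h1 : ∀ l, funSMulSection (f i l) (s l) z = (N z)⁻¹ i l • s l z := fun l => by
    change f i l z • s l z = _
    rw [hz]
  simp only [h1, map_sum, map_smul, LinearMap.sum_apply, LinearMap.smul_apply, smul_eq_mul]
  have h2 : (N z)⁻¹ * N z = 1 := Matrix.nonsing_inv_mul _ (isUnit_iff_ne_zero.2 hz')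
  have h3 := congrFun (congrFun h2 i) j
  rw [Matrix.mul_apply, Matrix.one_apply] at h3
  exact h3

end CourantAlgebroid

/-- A connected integral manifold of the big distribution which is invariant under a free action of
`G`, and along which the image of the ideal has constant rank. -/
structure IsReductionLeaf {k n : ℕ} (p m : ℕ)
    {G : Type*} [TopologicalSpace G] [ChartedSpace (EuclideanSpace ℝ (Fin k)) G] [Group G]
    [LieGroup (𝓡 k) ∞ G]
    {M : Type*} [TopologicalSpace M] [ChartedSpace (EuclideanSpace ℝ (Fin n)) M]
    [IsManifold (𝓡 n) ∞ M] [MulAction G M]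
    {F : Type*} [NormedAddCommGroup F] [NormedSpace ℝ F]
    {E : M → Type*} [TopologicalSpace (TotalSpace F E)] [∀ x, AddCommGroup (E x)]
    [∀ x, Module ℝ (E x)] [∀ x, TopologicalSpace (E x)] [FiberBundle F E] [VectorBundle ℝ F E]
    [ContMDiffVectorBundle ∞ F E (𝓡 n)]
    {𝔞 : Type*} [AddCommGroup 𝔞] [Module ℝ 𝔞]
    {C : CourantAlgebroid n F E} {A : CourantAlgebra (GroupLieAlgebra (𝓡 k) G) 𝔞}
    (R : ExtendedAction C A)
    {P : Type*} [TopologicalSpace P] [ChartedSpace (EuclideanSpace ℝ (Fin p)) P] [MulAction G P]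
    (ι : P → M) : Prop where
  integral : IsIntegralManifold n p R.bigDistribution ι
  equivariant : ∀ (g : G) (x : P), ι (g • x) = g • ι x
  free : ∀ (g : G) (x : P), g • x = x → g = 1
  rank : ∀ x : P, Module.finrank ℝ (R.idealImage (ι x)) = m

/-! ### The rank and local frames of `K` along the leaf. -/

section Leaf

variable {k n p m : ℕ}
  {G : Type*} [TopologicalSpace G] [ChartedSpace (EuclideanSpace ℝ (Fin k)) G] [Group G]
  [LieGroup (𝓡 k) ∞ G]
  {M : Type*} [TopologicalSpace M] [ChartedSpace (EuclideanSpace ℝ (Fin n)) M]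
  [IsManifold (𝓡 n) ∞ M] [T2Space M] [MulAction G M] [ContMDiffSMul (𝓡 k) (𝓡 n) ∞ G M]
  {F : Type*} [NormedAddCommGroup F] [NormedSpace ℝ F] [FiniteDimensional ℝ F]
  {E : M → Type*} [TopologicalSpace (TotalSpace F E)] [∀ x, AddCommGroup (E x)]
  [∀ x, Module ℝ (E x)] [∀ x, TopologicalSpace (E x)] [FiberBundle F E] [VectorBundle ℝ F E]
  [ContMDiffVectorBundle ∞ F E (𝓡 n)]
  {𝔞 : Type*} [AddCommGroup 𝔞] [Module ℝ 𝔞]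
  {C : CourantAlgebroid n F E} {A : CourantAlgebra (GroupLieAlgebra (𝓡 k) G) 𝔞}
  {R : ExtendedAction C A}
  {P : Type*} [TopologicalSpace P] [ChartedSpace (EuclideanSpace ℝ (Fin p)) P]
  [IsManifold (𝓡 p) ∞ P] [MulAction G P]
  {ι : P → M}

omit [IsManifold (𝓡 n) ∞ M] [IsManifold (𝓡 p) ∞ P] [LieGroup (𝓡 k) ∞ G] [T2Space M] in
/-- A continuous action on an immersed manifold which is induced by a smooth action is smooth. -/
theorem Manifold.IsImmersion.contMDiffSMul (h : Manifold.IsImmersion (𝓡 p) (𝓡 n) ∞ ι)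
    [ContinuousSMul G P] (hι : ∀ (g : G) (x : P), ι (g • x) = g • ι x) :
    ContMDiffSMul (𝓡 k) (𝓡 p) ∞ G P where
  contMDiff_smul := by
    intro z
    refine h.contMDiffAt_iff continuous_smul.continuousAt ?_
    have h1 : (ι ∘ fun z : G × P => z.1 • z.2) = fun z => z.1 • ι z.2 := by
      funext z
      exact hι _ _
    rw [h1]
    exact contMDiffAt_fst.smul (h.contMDiff.contMDiffAt.comp z contMDiffAt_snd)

omit [IsManifold (𝓡 n) ∞ M] [T2Space M] [IsManifold (𝓡 p) ∞ P] in
theorem mfderiv_infinitesimalAction [ContMDiffSMul (𝓡 k) (𝓡 p) ∞ G P]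
    (hs : ContMDiff (𝓡 p) (𝓡 n) ∞ ι) (hι : ∀ (g : G) (x : P), ι (g • x) = g • ι x)
    (u : GroupLieAlgebra (𝓡 k) G) (y : P) :
    mfderiv (𝓡 p) (𝓡 n) ι y (infinitesimalAction u y) = infinitesimalAction u (ι y) := by
  have hO : MDifferentiableAt (𝓡 k) (𝓡 p) (fun g : G => g • y) 1 :=
    (contMDiff_orbit k p y).contMDiffAt.mdifferentiableAt (by simp)
  have h1 := mfderiv_comp_apply_of_eq (f := fun g : G => g • y) 1
    (hs.contMDiffAt.mdifferentiableAt (by simp)) hO (one_smul G y) u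
  have h2 : (ι ∘ fun g : G => g • y) = fun g => g • ι y := by
    funext g
    exact hι g y
  rw [h2] at h1
  refine (map_neg (mfderiv (𝓡 p) (𝓡 n) ι y) _).trans ?_
  exact congrArg (fun w : EuclideanSpace ℝ (Fin n) => -w) h1.symm

theorem infinitesimalAction_injective [IsManifold (𝓡 p) ∞ P] [ContMDiffSMul (𝓡 k) (𝓡 p) ∞ G P]
    {y : P} (hfree : ∀ g : G, g • y = y → g = 1) {u : GroupLieAlgebra (𝓡 k) G}
    (hu : infinitesimalAction (n := p) u y = 0) : u = 0 := by
  have h1 : mfderiv (𝓡 k) (𝓡 p) (fun g : G => g • y) 1 u = 0 := neg_eq_zero.1 hu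
  exact (injective_iff_map_eq_zero _).1 (mfderiv_orbit_injective k p hfree) u h1

namespace IsReductionLeaf

variable (h : IsReductionLeaf p m R ι)
include h

omit [T2Space M] [FiniteDimensional ℝ F] [ContMDiffSMul (𝓡 k) (𝓡 n) ∞ G M]
  [IsManifold (𝓡 p) ∞ P] in
theorem contMDiff : ContMDiff (𝓡 p) (𝓡 n) ∞ ι := h.integral.immersion.contMDiff

omit [T2Space M] [FiniteDimensional ℝ F] [ContMDiffSMul (𝓡 k) (𝓡 n) ∞ G M]
  [IsManifold (𝓡 p) ∞ P] in
theorem continuousAt (x : P) : ContinuousAt ι x := h.contMDiff.continuous.continuousAt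

-- Here freeness enters: `π(ρ(a))` is the image under the immersion of the infinitesimal action on
-- `P`, which is injective in `A.proj a`. Hence the kernel of `π` on `K` is `ρ(𝔥)`.
omit [T2Space M] [FiniteDimensional ℝ F] in
theorem proj_eq_zero [ContMDiffSMul (𝓡 k) (𝓡 p) ∞ G P] {y : P} {a : 𝔞}
    (ha : C.anchor (ι y) (R.toSection a (ι y)) = 0) : A.proj a = 0 := by
  rw [R.anchor_toSection, ← mfderiv_infinitesimalAction h.contMDiff h.equivariant] at ha
  exact infinitesimalAction_injective (h.free · y)
    ((injective_iff_map_eq_zero _).1 (h.integral.immersion.mfderiv_injective y) _ ha)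

-- Rank and nullity of `π` on `K`: the kernel is `ρ(𝔥)`, of dimension `m`, and the image is `ψ(𝔤)`,
-- of dimension `k`.
omit [T2Space M] in
theorem finrank_K [ContMDiffSMul (𝓡 k) (𝓡 p) ∞ G P] (y : P) :
    Module.finrank ℝ (R.K (ι y)) = m + k := by
  haveI := finiteDimensional_fibre F E (ι y)
  let f : R.K (ι y) →ₗ[ℝ] TangentSpace (𝓡 n) (ι y) := (C.anchor (ι y)).domRestrict (R.K (ι y))
  have hk : (LinearMap.ker f).map (R.K (ι y)).subtype = R.idealImage (ι y) := by
    ext v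
    constructor
    · rintro ⟨⟨w, a, rfl⟩, hw, rfl⟩
      exact ⟨a, h.proj_eq_zero hw, rfl⟩
    · rintro ⟨a, ha, rfl⟩
      refine ⟨⟨R.toSection a (ι y), a, rfl⟩, ?_, rfl⟩
      change C.anchor (ι y) (R.toSection a (ι y)) = 0
      rw [R.anchor_toSection, show A.proj a = 0 from ha]
      change -(mfderiv (𝓡 k) (𝓡 n) (fun g : G => g • ι y) 1 0 : EuclideanSpace ℝ (Fin n)) = 0
      exact neg_eq_zero.2 (map_zero _)
  have hkd : Module.finrank ℝ (LinearMap.ker f) = m := by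
    rw [← h.rank y, ← hk]
    exact (LinearEquiv.finrank_eq (Submodule.equivMapOfInjective _ (Submodule.subtype_injective _) _))
  let ψ : GroupLieAlgebra (𝓡 k) G →ₗ[ℝ] TangentSpace (𝓡 n) (ι y) :=
    -(mfderiv (𝓡 k) (𝓡 n) (fun g : G => g • ι y) 1).toLinearMap
  have hψ : ∀ u, ψ u = infinitesimalAction u (ι y) := fun u => rfl
  have hψi : Function.Injective ψ := by
    refine (injective_iff_map_eq_zero _).2 fun u hu => ?_
    obtain ⟨a, rfl⟩ := R.exact.proj_surjective u
    refine h.proj_eq_zero (y := y) (a := a) ?_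
    rw [R.anchor_toSection]
    exact hu
  have hr : LinearMap.range f = LinearMap.range ψ := by
    ext v
    constructor
    · rintro ⟨⟨w, a, rfl⟩, rfl⟩
      exact ⟨A.proj a, (R.anchor_toSection a (ι y)).symm⟩
    · rintro ⟨u, rfl⟩
      obtain ⟨a, rfl⟩ := R.exact.proj_surjective u
      exact ⟨⟨R.toSection a (ι y), a, rfl⟩, R.anchor_toSection a (ι y)⟩
  have h1 := f.finrank_range_add_finrank_ker
  rw [hkd, hr, LinearMap.finrank_range_of_inj hψi] at h1
  have h2 : Module.finrank ℝ (GroupLieAlgebra (𝓡 k) G) = k := finrank_euclideanSpace_fin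
  omega

/-- A local frame of `K` along `P`, with dual sections. -/
theorem exists_frame_K [ContMDiffSMul (𝓡 k) (𝓡 p) ∞ G P] (x : P) :
    ∃ (a : Fin (m + k) → 𝔞) (θ : Fin (m + k) → Cₛ^∞⟮𝓡 n; F, E⟯),
      (∀ᶠ z in 𝓝 (ι x), ∀ i j,
        C.pairing z (θ i z) (R.toSection (a j) z) = if i = j then 1 else 0) ∧
      ∀ᶠ y in 𝓝 x, ∀ v ∈ R.K (ι y),
        v = ∑ j, C.pairing (ι y) (θ j (ι y)) v • R.toSection (a j) (ι y) := by
  haveI := finiteDimensional_fibre F E (ι x)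
  let b := Module.finBasisOfFinrankEq ℝ (R.K (ι x)) (h.finrank_K x)
  choose a ha using fun i => (b i).2
  have hli : LinearIndependent ℝ fun i => R.toSection (a i) (ι x) := by
    have h1 : (fun i => R.toSection (a i) (ι x)) = (R.K (ι x)).subtype ∘ b := funext ha
    rw [h1]
    exact b.linearIndependent.map' _ (Submodule.ker_subtype _)
  obtain ⟨θ, hθ⟩ := C.exists_dual_sections hli
  refine ⟨a, θ, hθ, ?_⟩
  filter_upwards [(h.continuousAt x).eventually hθ] with y hy v hv
  haveI := finiteDimensional_fibre F E (ι y)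
  let v' : Fin (m + k) → R.K (ι y) := fun i => ⟨R.toSection (a i) (ι y), a i, rfl⟩
  -- The dual sections keep the `ρ(a_j)` independent at nearby points, and there the constant rank
  -- `m + k` makes them a basis of `K`.
  have hli' : LinearIndependent ℝ v' := by
    rw [Fintype.linearIndependent_iff]
    intro c hc i
    have h1 := congrArg (fun w : R.K (ι y) => C.pairing (ι y) (θ i (ι y)) w) hc
    simpa [v', hy] using h1
  have hspan : ⊤ ≤ Submodule.span ℝ (range v') := by
    rw [hli'.span_eq_top_of_card_eq_finrank' (by rw [h.finrank_K y]; simp)]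
  obtain ⟨c, hc⟩ := (Submodule.mem_span_range_iff_exists_fun ℝ).1
    (hspan (x := ⟨v, hv⟩) trivial)
  have hc' : v = ∑ j, c j • R.toSection (a j) (ι y) := by
    have := congrArg (R.K (ι y)).subtype hc
    simpa [v'] using this.symm
  conv_lhs => rw [hc']
  refine Finset.sum_congr rfl fun j _ => ?_
  congr 1
  rw [hc']
  simp [hy]

end IsReductionLeaf

end Leaf

/-! ### Invariance of `K` and `K^⊥` under the group. -/

section Leaf

variable {k n p m : ℕ}
  {G : Type*} [TopologicalSpace G] [ChartedSpace (EuclideanSpace ℝ (Fin k)) G] [Group G]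
  [LieGroup (𝓡 k) ∞ G]
  {M : Type*} [TopologicalSpace M] [ChartedSpace (EuclideanSpace ℝ (Fin n)) M]
  [IsManifold (𝓡 n) ∞ M] [T2Space M] [MulAction G M] [ContMDiffSMul (𝓡 k) (𝓡 n) ∞ G M]
  {F : Type*} [NormedAddCommGroup F] [NormedSpace ℝ F] [FiniteDimensional ℝ F]
  {E : M → Type*} [TopologicalSpace (TotalSpace F E)] [∀ x, AddCommGroup (E x)]
  [∀ x, Module ℝ (E x)] [∀ x, TopologicalSpace (E x)] [FiberBundle F E] [VectorBundle ℝ F E]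
  [ContMDiffVectorBundle ∞ F E (𝓡 n)]
  {𝔞 : Type*} [AddCommGroup 𝔞] [Module ℝ 𝔞]
  {C : CourantAlgebroid n F E} {A : CourantAlgebra (GroupLieAlgebra (𝓡 k) G) 𝔞}
  {R : ExtendedAction C A}
  {P : Type*} [TopologicalSpace P] [ChartedSpace (EuclideanSpace ℝ (Fin p)) P]
  [IsManifold (𝓡 p) ∞ P] [MulAction G P] [ContMDiffSMul (𝓡 k) (𝓡 p) ∞ G P]
  {ι : P → M}

namespace ExtendedAction

omit [T2Space M] [FiniteDimensional ℝ F] [ContMDiffSMul (𝓡 k) (𝓡 n) ∞ G M] in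
variable (R) in
theorem toSection_mem_K (a : 𝔞) (x : M) : R.toSection a x ∈ R.K x := ⟨a, rfl⟩

omit [T2Space M] [FiniteDimensional ℝ F] [ContMDiffSMul (𝓡 k) (𝓡 n) ∞ G M] in
theorem mem_Kperp_iff {x : M} {v : E x} :
    v ∈ R.Kperp x ↔ ∀ a, C.pairing x v (R.toSection a x) = 0 := by
  constructor
  · intro h a
    rw [C.pairing_symm]
    exact h _ (R.toSection_mem_K a x)
  · rintro h _ ⟨a, rfl⟩
    change C.pairing x (R.toSection a x) v = 0
    rw [C.pairing_symm]
    exact h a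

omit [T2Space M] [FiniteDimensional ℝ F] [ContMDiffSMul (𝓡 k) (𝓡 n) ∞ G M] in
theorem pairing_eq_zero {x : M} {v w : E x} (hv : v ∈ R.Kperp x) (hw : w ∈ R.K x) :
    C.pairing x v w = 0 := by
  rw [C.pairing_symm]
  exact hv _ hw

-- This is `K^⊥⊥ = K`, from nondegeneracy in finite dimension. It is the standard test for
-- membership in `K` below.
omit [T2Space M] [ContMDiffSMul (𝓡 k) (𝓡 n) ∞ G M] in
theorem mem_K_of_forall_pairing {x : M} {v : E x}
    (h : ∀ w ∈ R.Kperp x, C.pairing x w v = 0) : v ∈ R.K x := by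
  haveI := finiteDimensional_fibre F E x
  have h1 : (C.pairing x).orthogonal ((C.pairing x).orthogonal (R.K x)) = R.K x := by
    refine LinearMap.BilinForm.orthogonal_orthogonal ?_ ?_ _
    · refine ⟨fun e he => C.pairing_nondegenerate x e he, fun e he => ?_⟩
      exact C.pairing_nondegenerate x e fun w => by rw [C.pairing_symm]; exact he w
    · intro e w hew
      rw [C.pairing_symm]
      exact hew
  rw [← h1]
  exact h

end ExtendedAction

namespace IsReductionLeaf

variable (h : IsReductionLeaf p m R ι)
include h

/-- The local projection to `K^⊥` along dual sections of a frame of `K`. -/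
theorem exists_Kperp_section (x : P) (w : Cₛ^∞⟮𝓡 n; F, E⟯) :
    ∃ w' : Cₛ^∞⟮𝓡 n; F, E⟯, ∀ᶠ y in 𝓝 x, w' (ι y) ∈ R.Kperp (ι y) ∧
      (w (ι y) ∈ R.Kperp (ι y) → w' (ι y) = w (ι y)) := by
  obtain ⟨a, θ, hθ, hK⟩ := h.exists_frame_K x
  let f : Fin (m + k) → C^∞⟮𝓡 n, M; 𝓘(ℝ, ℝ), ℝ⟯ := fun j =>
    ⟨fun z => C.pairing z (w z) (R.toSection (a j) z), C.pairing_smooth w (R.toSection (a j))⟩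
  -- Subtracting `∑ ⟨w, ρ(a_j)⟩ θ_j` cancels the pairings with the frame of `K`, and changes nothing
  -- where these already vanish.
  refine ⟨w - ∑ j, funSMulSection (f j) (θ j), ?_⟩
  have hw' : ∀ z, (w - ∑ j, funSMulSection (f j) (θ j)) z =
      w z - ∑ j, C.pairing z (w z) (R.toSection (a j) z) • θ j z := by
    intro z
    change w z - (∑ j, funSMulSection (f j) (θ j)) z = _
    rw [sum_section_apply]
    rfl
  filter_upwards [(h.continuousAt x).eventually hθ, hK] with y hy hKy
  rw [hw']
  constructor
  · intro v hv
    change C.pairing (ι y) v _ = 0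
    rw [C.pairing_symm, hKy v hv]
    simp only [map_sum, map_smul, map_sub, LinearMap.sub_apply, LinearMap.sum_apply,
      LinearMap.smul_apply, smul_eq_mul, hy]
    refine Finset.sum_eq_zero fun j _ => ?_
    simp
  · intro hw
    rw [Finset.sum_eq_zero, sub_zero]
    intro j _
    rw [R.pairing_eq_zero hw (R.toSection_mem_K _ _), zero_smul]

/-- Every element of `K^⊥` extends to a section which lies in `K^⊥` along `P`. -/
theorem exists_Kperp_section_eq (x : P) {v : E (ι x)} (hv : v ∈ R.Kperp (ι x)) :
    ∃ w : Cₛ^∞⟮𝓡 n; F, E⟯, w (ι x) = v ∧ ∀ᶠ y in 𝓝 x, w (ι y) ∈ R.Kperp (ι y) := by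
  obtain ⟨s, rfl⟩ := exists_section_eq (m := n) (F := F) (V := E) (ι x) v
  obtain ⟨w, hw⟩ := h.exists_Kperp_section x s
  exact ⟨w, hw.self_of_nhds.2 hv, hw.mono fun y hy => hy.1⟩

/-- The classes of the vectors `g ρ(a_j)` modulo the transported space at `g₀` vanish at `g₀`. Their
derivatives along invariant fields are the classes of `g ρ([b_i, a_j])`, which are combinations of
the same classes with continuous coefficients, so Gronwall makes them vanish near `g₀`. -/
theorem eventually_push_mem (y : P) (g₀ : G) :
    ∀ᶠ g in 𝓝 g₀, ∀ a, R.push g (R.toSection a) (ι y) ∈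
      (R.K (g₀⁻¹ • ι y)).map (R.actTo g₀ (smul_inv_smul g₀ (ι y))) := by
  haveI := finiteDimensional_fibre F E (ι y)
  let S := (R.K (g₀⁻¹ • ι y)).map (R.actTo g₀ (smul_inv_smul g₀ (ι y)))
  let N := Module.finrank ℝ (E (ι y) ⧸ S)
  -- Coordinates on the quotient by `S`, a linear map with kernel exactly `S`.
  let lam : E (ι y) →ₗ[ℝ] (Fin N → ℝ) :=
    (Module.finBasis ℝ (E (ι y) ⧸ S)).equivFun.toLinearMap ∘ₗ S.mkQ
  have hlam : ∀ v, lam v = 0 ↔ v ∈ S := by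
    intro v
    simp [lam]
  obtain ⟨a, θ, hθ, hK⟩ := h.exists_frame_K (g₀⁻¹ • y)
  have hc : ContinuousAt (fun g : G => g⁻¹ • y) g₀ :=
    ((contMDiff_inv (𝓡 k) ∞).smul (contMDiff_const (I' := 𝓡 p))).continuous.continuousAt
  have hKg : ∀ᶠ g in 𝓝 g₀, ∀ b, R.push g (R.toSection b) (ι y) = ∑ j,
      C.pairing (g⁻¹ • ι y) (θ j (g⁻¹ • ι y)) (R.toSection b (g⁻¹ • ι y)) •
        R.push g (R.toSection (a j)) (ι y) := by
    filter_upwards [hc.eventually hK] with g hg b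
    rw [h.equivariant] at hg
    have h1 := hg _ (R.toSection_mem_K b _)
    rw [ExtendedAction.push]
    conv_lhs => rw [h1]
    simp only [map_sum, map_smul]
    rfl
  choose b hb using fun i : Fin k => R.exact.proj_surjective
    ((EuclideanSpace.basisFun (Fin k) ℝ).toBasis i : EuclideanSpace ℝ (Fin k))
  let u : Module.Basis (Fin k) ℝ (GroupLieAlgebra (𝓡 k) G) :=
    (EuclideanSpace.basisFun (Fin k) ℝ).toBasis
  let co : Fin k → Fin (m + k) → Fin (m + k) → G → ℝ := fun i j l g =>
    C.pairing (g⁻¹ • ι y) (θ l (g⁻¹ • ι y)) (R.toSection (A.bracket (b i) (a j)) (g⁻¹ • ι y))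
  have hco : ∀ i j l, ContinuousAt (co i j l) g₀ := by
    intro i j l
    have h1 : ContMDiff (𝓡 k) (𝓡 n) ∞ (fun g : G => g⁻¹ • ι y) :=
      (contMDiff_inv (𝓡 k) ∞).smul contMDiff_const
    exact ((C.pairing_smooth (θ l)
      (R.toSection (A.bracket (b i) (a j)))).comp h1).continuous.continuousAt
  let l : G → (Fin (m + k) → Fin N → ℝ) := fun g j => lam (R.push g (R.toSection (a j)) (ι y))
  have hls : ∀ j, ContMDiff (𝓡 k) 𝓘(ℝ, Fin N → ℝ) ∞ fun g => l g j := fun j =>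
    R.contMDiff_linear_push lam (R.toSection (a j))
  have hl : ContMDiff (𝓡 k) 𝓘(ℝ, Fin (m + k) → Fin N → ℝ) ∞ l := contMDiff_pi_space.2 hls
  -- A crude common bound: near `g₀` each coefficient exceeds its value at `g₀` by at most `1` in
  -- absolute value, and the full sum dominates each row.
  let B : ℝ := ∑ i, ∑ j, ∑ l, (|co i j l g₀| + 1)
  have hB : ∀ᶠ g in 𝓝 g₀, ∀ i j l, |co i j l g| ≤ |co i j l g₀| + 1 := by
    refine eventually_all.2 fun i => eventually_all.2 fun j => eventually_all.2 fun l => ?_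
    filter_upwards [(hco i j l).abs.eventually (gt_mem_nhds (lt_add_one _))] with g hg using hg.le
  have hbound : ∀ᶠ g in 𝓝 g₀, ∀ i,
      ‖mvfderiv (𝓡 k) l g (mulInvariantVectorField (u i) g)‖ ≤ B * ‖l g‖ := by
    filter_upwards [hKg, hB] with g hg hBg i
    have hB0 : 0 ≤ B := by positivity
    refine (pi_norm_le_iff_of_nonneg (by positivity)).2 fun j => ?_
    have h1 : mvfderiv (𝓡 k) l g (mulInvariantVectorField (u i) g) j =
        ∑ l', co i j l' g • l g l' := by
      have h2 := mvfderiv_clm_apply (ContinuousLinearMap.proj (R := ℝ)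
        (φ := fun _ : Fin (m + k) => Fin N → ℝ) j)
        (hl.contMDiffAt.mdifferentiableAt (x := g) (by simp)) (mulInvariantVectorField (u i) g)
      have h3 := R.mvfderiv_linear_push lam (R.toSection (a j)) (b i) g
      rw [show A.proj (b i) = u i from hb i, ← R.map_bracket, hg] at h3
      refine h2.symm.trans (h3.trans ?_)
      simp only [map_sum, map_smul]
      rfl
    rw [h1]
    refine (norm_sum_le _ _).trans ?_
    have h4 : ∀ l' ∈ Finset.univ, ‖co i j l' g • l g l'‖ ≤ (|co i j l' g₀| + 1) * ‖l g‖ := by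
      intro l' _
      rw [norm_smul, Real.norm_eq_abs]
      gcongr
      · exact hBg i j l'
      · exact norm_le_pi_norm (l g) l'
    refine (Finset.sum_le_sum h4).trans ?_
    rw [← Finset.sum_mul]
    gcongr
    have h5 : ∀ i j, 0 ≤ ∑ l, (|co i j l g₀| + 1) := fun i j =>
      Finset.sum_nonneg fun l _ => add_nonneg (abs_nonneg _) zero_le_one
    refine le_trans ?_ (Finset.single_le_sum (f := fun i => ∑ j, ∑ l, (|co i j l g₀| + 1))
      (fun i _ => Finset.sum_nonneg fun j _ => h5 i j) (Finset.mem_univ i))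
    exact Finset.single_le_sum (f := fun j => ∑ l, (|co i j l g₀| + 1))
      (fun j _ => h5 i j) (Finset.mem_univ j)
  have h0 : l g₀ = 0 := by
    funext j
    refine (hlam _).2 ⟨_, R.toSection_mem_K (a j) _, rfl⟩
  have hz := eventually_eq_zero_of_mulInvariant_bound
    (Eventually.of_forall fun g => hl.contMDiffAt.mdifferentiableAt (by simp)) u hbound h0
  filter_upwards [hz, hKg] with g hg hg' a'
  rw [hg']
  refine Submodule.sum_mem _ fun j _ => Submodule.smul_mem _ _ ((hlam _).1 ?_)
  exact congrFun hg j

/-- For `g` near `g₀` the transported space `W g` lies in `W g₀`, and both have dimension `m + k`.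
So `W` is locally constant on a connected group, with value `K` at the identity. -/
theorem map_actTo_K [ConnectedSpace G] (y : P) (g : G) :
    (R.K (g⁻¹ • ι y)).map (R.actTo g (smul_inv_smul g (ι y))) = R.K (ι y) := by
  let W : G → Submodule ℝ (E (ι y)) := fun g =>
    (R.K (g⁻¹ • ι y)).map (R.actTo g (smul_inv_smul g (ι y)))
  have hd : ∀ g, Module.finrank ℝ (W g) = m + k := by
    intro g
    have hinj : Function.Injective (R.actTo g (smul_inv_smul g (ι y))) := by
      intro v w hvw
      have h1 := congrArg (R.actTo g⁻¹ rfl) hvw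
      rwa [R.actTo_inv_actTo, R.actTo_inv_actTo] at h1
    rw [← h.finrank_K (g⁻¹ • y), h.equivariant]
    exact (LinearEquiv.finrank_eq (Submodule.equivMapOfInjective _ hinj _)).symm
  have hloc : IsLocallyConstant W := by
    rw [IsLocallyConstant.iff_eventually_eq]
    intro g₀
    filter_upwards [h.eventually_push_mem y g₀] with g hg
    haveI := finiteDimensional_fibre F E (ι y)
    refine Submodule.eq_of_le_of_finrank_eq ?_ (by rw [hd, hd])
    rintro _ ⟨_, ⟨a, rfl⟩, rfl⟩
    exact hg a
  have h1 : W g = W 1 := hloc.apply_eq_of_preconnectedSpace g 1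
  refine h1.trans ?_
  have h2 : W 1 ≤ R.K (ι y) := by
    rintro _ ⟨_, ⟨a, rfl⟩, rfl⟩
    change R.push 1 (R.toSection a) (ι y) ∈ _
    rw [R.push_one]
    exact R.toSection_mem_K a _
  haveI := finiteDimensional_fibre F E (ι y)
  exact Submodule.eq_of_le_of_finrank_eq h2 (by rw [hd, h.finrank_K])

/-- The action preserves `K` along `P`. -/
theorem actTo_mem_K [ConnectedSpace G] {y y' : P} (g : G) (hg : g • ι y = ι y') {v : E (ι y)}
    (hv : v ∈ R.K (ι y)) : R.actTo g hg v ∈ R.K (ι y') := by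
  rw [← h.map_actTo_K y' g]
  have h1 : ∀ (z : M) (hz : z = ι y) (hz' : g • z = ι y'),
      R.actTo g hg v ∈ (R.K z).map (R.actTo g hz') := by
    rintro _ rfl hz'
    exact ⟨v, hv, rfl⟩
  exact h1 _ (by rw [← hg, inv_smul_smul]) _

/-- The action preserves `K^⊥` along `P`. -/
theorem actTo_mem_Kperp [ConnectedSpace G] {y y' : P} (g : G) (hg : g • ι y = ι y') {v : E (ι y)}
    (hv : v ∈ R.Kperp (ι y)) : R.actTo g hg v ∈ R.Kperp (ι y') := by
  intro w hw
  have hg' : g⁻¹ • ι y' = ι y := by rw [← hg, inv_smul_smul]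
  have h1 := h.actTo_mem_K g⁻¹ hg' hw
  have h2 : C.pairing (ι y) (R.actTo g⁻¹ hg' w) v = 0 := hv _ h1
  rwa [← R.pairing_actTo g hg, R.actTo_actTo_inv] at h2

end IsReductionLeaf

end Leaf

/-! ### Constancy of rank for solutions of `dS = B S + S B'`. -/

section LocallyConstantRank

variable {κ : Type*} [Fintype κ] [DecidableEq κ]

/-- A square matrix `S` has a generalized complement: a matrix `J` of complementary rank such that
`S + J` is invertible and `S (S + J)⁻¹ J = 0`. -/
theorem Matrix.exists_complement (S : Matrix κ κ ℝ) :
    ∃ J : Matrix κ κ ℝ, (S + J).det ≠ 0 ∧ S * (S + J)⁻¹ * J = 0 ∧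
      S.rank + J.rank = Fintype.card κ := by
  obtain ⟨L, L', D, hS⟩ := Matrix.Pivot.exists_list_transvec_mul_diagonal_mul_list_transvec S
  set U := (L.map Matrix.TransvectionStruct.toMatrix).prod with hU
  set V := (L'.map Matrix.TransvectionStruct.toMatrix).prod with hV
  have hUd : IsUnit U.det := by simp [hU]
  have hVd : IsUnit V.det := by simp [hV]
  -- With `S = U D V`, `D` diagonal and `U`, `V` invertible, the complement `J = U D' V` fills
  -- exactly the zero diagonal entries. Then `D + D'` is invertible and `D (D + D')⁻¹ D' = 0`.
  let D' : κ → ℝ := fun i => if D i = 0 then 1 else 0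
  have hDD : ∀ i, D i + D' i ≠ 0 := by
    intro i
    by_cases h : D i = 0 <;> simp [D', h]
  have hsum : S + U * Matrix.diagonal D' * V = U * Matrix.diagonal (D + D') * V := by
    rw [hS, ← Matrix.add_mul, ← Matrix.mul_add, Matrix.diagonal_add]
    rfl
  have hdd : IsUnit (Matrix.diagonal (D + D')).det := by
    rw [Matrix.det_diagonal, isUnit_iff_ne_zero]
    exact Finset.prod_ne_zero_iff.2 fun i _ => hDD i
  have hdd' : (Matrix.diagonal (D + D'))⁻¹ = Matrix.diagonal (fun i => (D i + D' i)⁻¹) := by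
    refine Matrix.inv_eq_right_inv ?_
    rw [Matrix.diagonal_mul_diagonal, ← Matrix.diagonal_one]
    congr 1
    funext i
    exact mul_inv_cancel₀ (hDD i)
  refine ⟨U * Matrix.diagonal D' * V, ?_, ?_, ?_⟩
  · rw [hsum, Matrix.det_mul, Matrix.det_mul]
    exact ((hUd.mul hdd).mul hVd).ne_zero
  · rw [hsum, Matrix.mul_inv_rev, Matrix.mul_inv_rev, hdd']
    have h1 : Matrix.diagonal D * (Matrix.diagonal fun i => (D i + D' i)⁻¹) *
        Matrix.diagonal D' = 0 := by
      rw [Matrix.diagonal_mul_diagonal, Matrix.diagonal_mul_diagonal, Matrix.diagonal_eq_zero]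
      funext i
      by_cases h : D i = 0 <;> simp [D', h]
    calc S * (V⁻¹ * ((Matrix.diagonal fun i => (D i + D' i)⁻¹) * U⁻¹)) *
          (U * Matrix.diagonal D' * V)
        = U * Matrix.diagonal D * (V * V⁻¹) * (Matrix.diagonal fun i => (D i + D' i)⁻¹) *
            (U⁻¹ * U) * Matrix.diagonal D' * V := by rw [hS]; simp only [Matrix.mul_assoc]
      _ = U * (Matrix.diagonal D * (Matrix.diagonal fun i => (D i + D' i)⁻¹) *
            Matrix.diagonal D') * V := by
          rw [Matrix.mul_nonsing_inv _ hVd, Matrix.nonsing_inv_mul _ hUd]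
          simp only [Matrix.mul_assoc, Matrix.mul_one, Matrix.one_mul]
      _ = 0 := by rw [h1]; simp
  · have hr : ∀ W : Matrix κ κ ℝ, (U * W * V).rank = W.rank := fun W => by
      rw [Matrix.rank_mul_eq_left_of_isUnit_det _ _ hVd,
        Matrix.rank_mul_eq_right_of_isUnit_det _ _ hUd]
    have hc : (Finset.univ.filter fun i => D' i ≠ 0) = Finset.univ.filter fun i => D i = 0 := by
      ext i
      by_cases h : D i = 0 <;> simp [D', h]
    rw [hS, hr, hr, Matrix.rank_diagonal, Matrix.rank_diagonal, Fintype.card_subtype,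
      Fintype.card_subtype, hc, add_comm]
    simpa using Finset.card_filter_add_card_filter_not (s := Finset.univ) (fun i => D i = 0)

/-- Invertibility of `S + J` gives `rank S + rank J ≥ card κ`; the vanishing product `S ((S + J)⁻¹
J)` gives the opposite inequality. -/
theorem Matrix.rank_eq_of_complement {S J : Matrix κ κ ℝ} {r : ℕ} (hJ : r + J.rank = Fintype.card κ)
    (hd : (S + J).det ≠ 0) (h : S * (S + J)⁻¹ * J = 0) : S.rank = r := by
  have hu : IsUnit (S + J).det := isUnit_iff_ne_zero.2 hd
  have h1 : (S + J).rank = Fintype.card κ :=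
    Matrix.rank_of_isUnit _ ((Matrix.isUnit_iff_isUnit_det _).2 hu)
  have h2 : (S + J).rank ≤ S.rank + J.rank := by
    rw [Matrix.rank, Matrix.mulVecLin_add]
    exact (Submodule.finrank_mono (LinearMap.range_add_le S.mulVecLin J.mulVecLin)).trans
      (Submodule.finrank_add_le_finrank_add_finrank (LinearMap.range S.mulVecLin)
        (LinearMap.range J.mulVecLin))
  have h3 : ((S + J)⁻¹ * J).rank = J.rank :=
    Matrix.rank_mul_eq_right_of_isUnit_det _ _ (Matrix.isUnit_nonsing_inv_det _ hu)
  have h4 := Matrix.rank_add_rank_le_card_of_mul_eq_zero (A := S) (B := (S + J)⁻¹ * J)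
    (by rw [← Matrix.mul_assoc, h])
  omega

variable {d : ℕ} {N : Type*} [TopologicalSpace N] [ChartedSpace (EuclideanSpace ℝ (Fin d)) N]

omit [DecidableEq κ] in
theorem mvfderiv_matrix_mul_apply {S T : N → Matrix κ κ ℝ} {x : N}
    (hS : ∀ i j, MDifferentiableAt (𝓡 d) 𝓘(ℝ, ℝ) (fun y => S y i j) x)
    (hT : ∀ i j, MDifferentiableAt (𝓡 d) 𝓘(ℝ, ℝ) (fun y => T y i j) x)
    (u : TangentSpace (𝓡 d) x) (i j : κ) :
    mvfderiv (𝓡 d) (fun y => (S y * T y) i j) x u =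
      ((Matrix.of fun i j => mvfderiv (𝓡 d) (fun y => S y i j) x u) * T x +
        S x * Matrix.of fun i j => mvfderiv (𝓡 d) (fun y => T y i j) x u) i j := by
  have h1 := mvfderiv_sum_apply (s := Finset.univ) (f := fun l y => S y i l * T y l j) (x := x)
    (fun l _ => (hS i l).mul (hT l j)) u
  refine h1.trans ?_
  rw [Matrix.add_apply, Matrix.mul_apply, Matrix.mul_apply, ← Finset.sum_add_distrib]
  refine Finset.sum_congr rfl fun l _ => ?_
  rw [mvfderiv_mul_apply (hS i l) (hT l j) u]
  simp only [Matrix.of_apply]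
  ring

/-- Differentiate `T⁻¹ T = 1`, which holds on a neighbourhood of the point. -/
theorem mvfderiv_matrix_inv_apply {T : N → Matrix κ κ ℝ} {x : N}
    (hT : ∀ i j, SmoothNear d (fun y => T y i j) x) (h0 : (T x).det ≠ 0)
    (u : TangentSpace (𝓡 d) x) :
    (Matrix.of fun i j => mvfderiv (𝓡 d) (fun y => (T y)⁻¹ i j) x u) =
      -((T x)⁻¹ * (Matrix.of fun i j => mvfderiv (𝓡 d) (fun y => T y i j) x u) * (T x)⁻¹) := by
  have hu : IsUnit (T x).det := isUnit_iff_ne_zero.2 h0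
  set dH := Matrix.of fun i j => mvfderiv (𝓡 d) (fun y => (T y)⁻¹ i j) x u with hdH
  set dT := Matrix.of fun i j => mvfderiv (𝓡 d) (fun y => T y i j) x u with hdT
  have h1 : dH * T x + (T x)⁻¹ * dT = 0 := by
    ext i j
    refine (mvfderiv_matrix_mul_apply
      (fun i j => (SmoothNear.matrix_inv hT h0 i j).mdifferentiableAt)
      (fun i j => (hT i j).mdifferentiableAt) u i j).symm.trans ?_
    have h2 : (fun z => ((T z)⁻¹ * T z) i j) =ᶠ[𝓝 x] fun _ => (1 : Matrix κ κ ℝ) i j := by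
      filter_upwards [(SmoothNear.matrix_det hT).continuousAt.eventually_ne h0] with z hz
      rw [Matrix.nonsing_inv_mul _ (isUnit_iff_ne_zero.2 hz)]
    rw [Filter.EventuallyEq.mvfderiv_eq h2, mvfderiv_const_apply]
    rfl
  have h3 := congrArg (fun W => W * (T x)⁻¹) h1
  rw [Matrix.add_mul, Matrix.mul_assoc dH, Matrix.mul_nonsing_inv _ hu, Matrix.mul_one,
    Matrix.zero_mul] at h3
  exact eq_neg_of_add_eq_zero_left h3

theorem mvfderiv_sub_matrix_mul_inv_mul_apply {T : N → Matrix κ κ ℝ} {x : N}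
    (hT : ∀ i j, SmoothNear d (fun y => T y i j) x) (h0 : (T x).det ≠ 0) (J : Matrix κ κ ℝ)
    (u : TangentSpace (𝓡 d) x) (i j : κ) :
    mvfderiv (𝓡 d) (fun y => (J - J * (T y)⁻¹ * J) i j) x u =
      (J * (T x)⁻¹ * (Matrix.of fun i j => mvfderiv (𝓡 d) (fun y => T y i j) x u) *
        (T x)⁻¹ * J) i j := by
  have h1 : ∀ i j, SmoothNear d (fun y => (T y)⁻¹ i j) x := SmoothNear.matrix_inv hT h0
  have hJH : ∀ i j, SmoothNear d (fun y => (J * (T y)⁻¹) i j) x := fun i j =>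
    SmoothNear.sum (F := fun l y => J i l * (T y)⁻¹ l j) fun l _ =>
      (SmoothNear.const _).mul (h1 _ _)
  have hJHJ : SmoothNear d (fun y => (J * (T y)⁻¹ * J) i j) x :=
    SmoothNear.sum (F := fun l y => (J * (T y)⁻¹) i l * J l j) fun l _ =>
      (hJH _ _).mul (SmoothNear.const _)
  have hz : (Matrix.of fun i j => mvfderiv (𝓡 d) (fun _ : N => J i j) x u) = 0 := by
    ext i j
    exact mvfderiv_const_apply _ _ _
  refine (mvfderiv_sub_apply mdifferentiableAt_const hJHJ.mdifferentiableAt _).trans ?_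
  rw [mvfderiv_const_apply, zero_sub]
  have h2 := mvfderiv_matrix_mul_apply (S := fun y => J * (T y)⁻¹) (T := fun _ => J)
    (fun i j => (hJH i j).mdifferentiableAt) (fun i j => mdifferentiableAt_const) u i j
  have h3 : (Matrix.of fun i j => mvfderiv (𝓡 d) (fun y => (J * (T y)⁻¹) i j) x u) =
      J * Matrix.of fun i j => mvfderiv (𝓡 d) (fun y => (T y)⁻¹ i j) x u := by
    ext i j
    refine (mvfderiv_matrix_mul_apply (S := fun _ => J) (fun i j => mdifferentiableAt_const)
      (fun i j => (h1 i j).mdifferentiableAt) _ i j).trans ?_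
    rw [hz, Matrix.zero_mul, zero_add]
  rw [hz, h3, Matrix.mul_zero, add_zero, mvfderiv_matrix_inv_apply hT h0] at h2
  rw [h2, ← Matrix.neg_apply]
  simp only [Matrix.mul_neg, Matrix.neg_mul, neg_neg, Matrix.mul_assoc]

/-- The rank of a matrix of functions is locally constant if its derivatives along a frame are
given by multiplication on either side. -/
theorem Matrix.eventually_rank_eq [IsManifold (𝓡 d) ∞ N] {μ : Type*} [Fintype μ]
    {S : N → Matrix κ κ ℝ} {x₀ : N} (hS : ∀ i j, SmoothNear d (fun y => S y i j) x₀)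
    {X : μ → ∀ y : N, TangentSpace (𝓡 d) y}
    (hX : ∀ i, ContinuousAt (fun y => (⟨y, X i y⟩ : TangentBundle (𝓡 d) N)) x₀)
    (hspan : ⊤ ≤ Submodule.span ℝ (Set.range fun i => X i x₀))
    {B B' : μ → N → Matrix κ κ ℝ} (hB : ∀ a i j, ContinuousAt (fun y => B a y i j) x₀)
    (hB' : ∀ a i j, ContinuousAt (fun y => B' a y i j) x₀)
    (hd : ∀ᶠ y in 𝓝 x₀, ∀ a i j, mvfderiv (𝓡 d) (fun y => S y i j) y (X a y) =
      (B a y * S y + S y * B' a y) i j) :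
    ∀ᶠ y in 𝓝 x₀, (S y).rank = (S x₀).rank := by
  obtain ⟨J, hJd, hJ0, hJr⟩ := (S x₀).exists_complement
  set H : N → Matrix κ κ ℝ := fun y => (S y + J)⁻¹ with hH
  have hSJ : ∀ i j, SmoothNear d (fun y => (S y + J) i j) x₀ := fun i j =>
    (hS i j).add (SmoothNear.const (J i j))
  have hHs : ∀ i j, SmoothNear d (fun y => H y i j) x₀ := SmoothNear.matrix_inv hSJ hJd
  have hdet : ∀ᶠ y in 𝓝 x₀, (S y + J).det ≠ 0 :=
    (SmoothNear.matrix_det hSJ).continuousAt.eventually_ne hJd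
  -- `J` is the complement of `S x₀`, kept fixed. From `(S + J) H = H (S + J) = 1` one gets `c = S H
  -- J = J H S`, so `c` is the obstruction in `Matrix.rank_eq_of_complement`, and it vanishes at
  -- `x₀`.
  let c : N → κ → κ → ℝ := fun y i j => (J - J * H y * J) i j
  have hc : ∀ y, (S y + J).det ≠ 0 → S y * H y * J = J - J * H y * J ∧
      J * H y * S y = J - J * H y * J := by
    intro y hy
    have hu : IsUnit (S y + J).det := isUnit_iff_ne_zero.2 hy
    have h1 := Matrix.mul_nonsing_inv _ hu
    have h2 := Matrix.nonsing_inv_mul _ hu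
    rw [Matrix.add_mul] at h1
    rw [Matrix.mul_add] at h2
    constructor
    · rw [eq_sub_iff_add_eq, ← Matrix.add_mul, h1, Matrix.one_mul]
    · rw [eq_sub_iff_add_eq, Matrix.mul_assoc, Matrix.mul_assoc, ← Matrix.mul_add, h2,
        Matrix.mul_one]
  have hcs : ∀ i j, SmoothNear d (fun y => c y i j) x₀ := fun i j =>
    (SmoothNear.const (J i j)).sub (SmoothNear.sum fun l _ =>
      (SmoothNear.sum fun l' _ => (SmoothNear.const _).mul (hHs _ _)).mul (SmoothNear.const _))
  -- Since `dH = -H dS H`, the derivative of `c` is `J H (B S + S B') H J = (J H B) c + c (B' H J)`: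
  -- the obstruction satisfies a linear equation of the same kind.
  have hder : ∀ᶠ y in 𝓝 x₀, ∀ a i j, mvfderiv (𝓡 d) (fun y => c y i j) y (X a y) =
      ((J * H y * B a y) * (Matrix.of (c y)) + (Matrix.of (c y)) * (B' a y * H y * J)) i j := by
    have hs1 := eventually_all.2 fun i => eventually_all.2 fun j => (hSJ i j).eventually
    have hs2 := eventually_all.2 fun i => eventually_all.2 fun j => (hS i j).eventually
    filter_upwards [hd, hs1, hs2, hdet] with y hy h1 h2 h3 a i j
    have hdS : (Matrix.of fun i j => mvfderiv (𝓡 d) (fun y => (S y + J) i j) y (X a y)) =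
        B a y * S y + S y * B' a y := by
      ext i j
      rw [← hy a i j, Matrix.of_apply]
      refine (mvfderiv_add_apply (h2 i j).mdifferentiableAt mdifferentiableAt_const _).trans ?_
      rw [mvfderiv_const_apply, add_zero]
    have hcy : Matrix.of (c y) = J - J * H y * J := rfl
    refine (mvfderiv_sub_matrix_mul_inv_mul_apply h1 h3 J (X a y) i j).trans ?_
    obtain ⟨hc1, hc2⟩ := hc y h3
    rw [hdS, hcy]
    nth_rewrite 1 [← hc1]
    rw [← hc2]
    simp only [Matrix.mul_add, Matrix.add_mul, Matrix.mul_assoc, hH]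
  have hcont : ∀ {A A' : N → Matrix κ κ ℝ}, (∀ i j, ContinuousAt (fun y => A y i j) x₀) →
      (∀ i j, ContinuousAt (fun y => A' y i j) x₀) →
      ∀ i j, ContinuousAt (fun y => (A y * A' y) i j) x₀ := fun hA hA' i j =>
    tendsto_finsetSum _ fun l _ => (hA i l).mul (hA' l j)
  have hHc : ∀ i j, ContinuousAt (fun y => H y i j) x₀ := fun i j => (hHs i j).continuousAt
  have hJc : ∀ i j, ContinuousAt (fun _ : N => J i j) x₀ := fun i j => continuousAt_const
  have hbd : ∀ {A : μ → N → Matrix κ κ ℝ}, (∀ a i j, ContinuousAt (fun y => A a y i j) x₀) →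
      ∃ K, 0 ≤ K ∧ ∀ᶠ y in 𝓝 x₀, ∀ a i j, |A a y i j| ≤ K := by
    intro A hA
    refine ⟨∑ a, ∑ i, ∑ j, (|A a x₀ i j| + 1), by positivity, ?_⟩
    refine eventually_all.2 fun a => eventually_all.2 fun i => eventually_all.2 fun j => ?_
    have h1 : ∀ᶠ y in 𝓝 x₀, |A a y i j| < |A a x₀ i j| + 1 :=
      (hA a i j).abs.eventually_lt_const (lt_add_one _)
    filter_upwards [h1] with y hy
    refine hy.le.trans ?_
    refine (Finset.single_le_sum (f := fun j => |A a x₀ i j| + 1) (fun _ _ => by positivity)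
      (Finset.mem_univ j)).trans ?_
    refine (Finset.single_le_sum (f := fun i => ∑ j, (|A a x₀ i j| + 1))
      (fun _ _ => by positivity) (Finset.mem_univ i)).trans ?_
    exact Finset.single_le_sum (f := fun a => ∑ i, ∑ j, (|A a x₀ i j| + 1))
      (fun _ _ => by positivity) (Finset.mem_univ a)
  obtain ⟨K₁, hK₁, hb₁⟩ := hbd (A := fun a y => J * H y * B a y) fun a =>
    hcont (hcont hJc hHc) (hB a)
  obtain ⟨K₂, hK₂, hb₂⟩ := hbd (A := fun a y => B' a y * H y * J) fun a =>
    hcont (hcont (hB' a) hHc) hJc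
  have hcd : ∀ᶠ y in 𝓝 x₀, SmoothNear d c y := by
    have h1 := eventually_all.2 fun i => eventually_all.2 fun j => (hcs i j).eventually
    filter_upwards [h1] with y hy
    have h2 := eventually_all.2 fun i => eventually_all.2 fun j => hy i j
    filter_upwards [h2] with z hz
    exact contMDiffAt_pi_space.2 fun i => contMDiffAt_pi_space.2 fun j => hz i j
  have h0 : c x₀ = 0 := by
    funext i j
    change (J - J * H x₀ * J) i j = 0
    rw [← (hc x₀ hJd).1, hH]
    simp only
    rw [hJ0]
    rfl
  -- Each entry of the two products is a sum of `card κ` terms, with coefficients bounded by `K₁`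
  -- and `K₂`.
  have hkey := eventually_eq_zero_of_frame_bound (l := c) (K := Fintype.card κ * (K₁ + K₂))
    (by filter_upwards [hcd] with y hy using hy.mdifferentiableAt) hX hspan ?_ h0
  · filter_upwards [hkey, hdet] with y hy hy'
    refine Matrix.rank_eq_of_complement hJr hy' ?_
    have h1 := (hc y hy').1
    rw [hH] at h1
    simp only at h1
    rw [h1]
    ext i j
    exact congrFun (congrFun hy i) j
  · filter_upwards [hder, hcd, hb₁, hb₂] with y hy hcy h₁ h₂ a
    have hnn : 0 ≤ Fintype.card κ * (K₁ + K₂) * ‖c y‖ := by positivity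
    have hent : ∀ i j, ‖c y i j‖ ≤ ‖c y‖ := fun i j =>
      (norm_le_pi_norm (c y i) j).trans (norm_le_pi_norm (c y) i)
    refine (pi_norm_le_iff_of_nonneg hnn).2 fun i => (pi_norm_le_iff_of_nonneg hnn).2 fun j => ?_
    have h5 : mvfderiv (𝓡 d) c y (X a y) i j = mvfderiv (𝓡 d) (fun y => c y i j) y (X a y) :=
      (mvfderiv_clm_apply ((ContinuousLinearMap.proj (R := ℝ) (φ := fun _ : κ => ℝ) j).comp
        (ContinuousLinearMap.proj (R := ℝ) (φ := fun _ : κ => κ → ℝ) i))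
        hcy.mdifferentiableAt (X a y)).symm
    rw [h5, hy a i j, Matrix.add_apply, Matrix.mul_apply, Matrix.mul_apply]
    refine (norm_add_le _ _).trans ?_
    have h6 : ∀ (K : ℝ) (s : κ → ℝ) (i' j' : κ → κ), (∀ l, |s l| ≤ K) →
      ‖∑ l, s l * c y (i' l) (j' l)‖ ≤ Fintype.card κ * (K * ‖c y‖) := by
      intro K s i' j' hs
      refine (norm_sum_le _ _).trans ?_
      rw [← nsmul_eq_mul, Fintype.card]
      refine Finset.sum_le_card_nsmul _ _ _ fun l _ => ?_
      rw [norm_mul]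
      exact mul_le_mul (hs l) (hent _ _) (norm_nonneg _) ((abs_nonneg _).trans (hs l))
    have h7 := h6 K₁ (fun l => (J * H y * B a y) i l) (fun l => l) (fun _ => j) (h₁ a i)
    have h8 := h6 K₂ (fun l => (B' a y * H y * J) l j) (fun _ => i) (fun l => l)
      (fun l => h₂ a l j)
    simp only [mul_comm ((B' a y * H y * J) _ j)] at h8
    calc _ ≤ Fintype.card κ * (K₁ * ‖c y‖) + Fintype.card κ * (K₂ * ‖c y‖) := add_le_add h7 h8
      _ = _ := by ring

end LocallyConstantRank

/-! ### Tangent vectors of the leaf and derivatives along `K + K^⊥`. -/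

section Leaf

variable {k n p m : ℕ}
  {G : Type*} [TopologicalSpace G] [ChartedSpace (EuclideanSpace ℝ (Fin k)) G] [Group G]
  [LieGroup (𝓡 k) ∞ G]
  {M : Type*} [TopologicalSpace M] [ChartedSpace (EuclideanSpace ℝ (Fin n)) M]
  [IsManifold (𝓡 n) ∞ M] [T2Space M] [MulAction G M] [ContMDiffSMul (𝓡 k) (𝓡 n) ∞ G M]
  {F : Type*} [NormedAddCommGroup F] [NormedSpace ℝ F] [FiniteDimensional ℝ F]
  {E : M → Type*} [TopologicalSpace (TotalSpace F E)] [∀ x, AddCommGroup (E x)]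
  [∀ x, Module ℝ (E x)] [∀ x, TopologicalSpace (E x)] [FiberBundle F E] [VectorBundle ℝ F E]
  [ContMDiffVectorBundle ∞ F E (𝓡 n)]
  {𝔞 : Type*} [AddCommGroup 𝔞] [Module ℝ 𝔞]
  {C : CourantAlgebroid n F E} {A : CourantAlgebra (GroupLieAlgebra (𝓡 k) G) 𝔞}
  {R : ExtendedAction C A}
  {P : Type*} [TopologicalSpace P] [ChartedSpace (EuclideanSpace ℝ (Fin p)) P]
  [IsManifold (𝓡 p) ∞ P] [MulAction G P] [ContMDiffSMul (𝓡 k) (𝓡 p) ∞ G P]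
  {ι : P → M}

omit [T2Space M] [MulAction G M] [ContMDiffSMul (𝓡 k) (𝓡 n) ∞ G M] in
theorem ContMDiff.contMDiffAt_mvfderiv {f : M → ℝ} (hf : ContMDiff (𝓡 n) 𝓘(ℝ, ℝ) ∞ f)
    {X : ∀ y : M, TangentSpace (𝓡 n) y} {x : M}
    (hX : ContMDiffAt (𝓡 n) (𝓡 n).tangent ∞ (fun y => (⟨y, X y⟩ : TangentBundle (𝓡 n) M)) x) :
    ContMDiffAt (𝓡 n) 𝓘(ℝ, ℝ) ∞ (fun y => mvfderiv (𝓡 n) f y (X y)) x := by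
  have h1 := (hf.contMDiff_tangentMap (m := ∞) (by simp)).contMDiffAt.comp x hX
  exact (contMDiff_snd_tangentBundle_modelSpace ℝ 𝓘(ℝ, ℝ)).contMDiffAt.comp x h1

omit [T2Space M] [FiniteDimensional ℝ F] in
theorem CourantAlgebroid.contMDiff_mvfderiv_anchor (C : CourantAlgebroid n F E)
    (Φ : C^∞⟮𝓡 n, M; 𝓘(ℝ, ℝ), ℝ⟯) (v : Cₛ^∞⟮𝓡 n; F, E⟯) :
    ContMDiff (𝓡 n) 𝓘(ℝ, ℝ) ∞ fun z => mvfderiv (𝓡 n) Φ z (C.anchor z (v z)) := fun z =>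
  Φ.contMDiff.contMDiffAt_mvfderiv (C.anchor_smooth.comp v.contMDiff).contMDiffAt

namespace CourantAlgebroid

variable (C) in
/-- The vector tangent to `P` at `y` determined by the anchor of an element of `E` whose anchor is
tangent to `P`. -/
def leafAnchor (p : ℕ) {P : Type*} [TopologicalSpace P]
    [ChartedSpace (EuclideanSpace ℝ (Fin p)) P] (ι : P → M) (y : P) :
    E (ι y) →ₗ[ℝ] TangentSpace (𝓡 p) y :=
  (mfderiv (𝓡 p) (𝓡 n) ι y).toLinearMap.leftInverse ∘ₗ C.anchor (ι y)

variable (C) in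
/-- Polarization of the axiom for `[e, e]`. -/
theorem pairing_bracket_add_bracket (e e' : Cₛ^∞⟮𝓡 n; F, E⟯) (x : M) (w : E x) :
    C.pairing x (C.bracket e e' x) w + C.pairing x (C.bracket e' e x) w =
      mvfderiv (𝓡 n) (fun y => C.pairing y (e y) (e' y)) x (C.anchor x w) := by
  have hd : ∀ e e' : Cₛ^∞⟮𝓡 n; F, E⟯, MDifferentiableAt (𝓡 n) 𝓘(ℝ, ℝ)
      (fun y => C.pairing y (e y) (e' y)) x := fun e e' =>
    (C.smoothNear_pairing e e' x).mdifferentiableAt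
  have h1 := C.bracket_self (e + e') x w
  have h2 := C.bracket_self e x w
  have h3 := C.bracket_self e' x w
  have h4 : (fun y => C.pairing y ((e + e') y) ((e + e') y)) =
      fun y => C.pairing y (e y) (e y) + (C.pairing y (e y) (e' y) + C.pairing y (e y) (e' y)) +
        C.pairing y (e' y) (e' y) := by
    funext y
    change C.pairing y (e y + e' y) (e y + e' y) = _
    simp only [map_add, LinearMap.add_apply, C.pairing_symm y (e' y) (e y)]
    ring
  have h5 : C.bracket (e + e') (e + e') x = C.bracket e e x + C.bracket e e' x +
      (C.bracket e' e x + C.bracket e' e' x) := by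
    simp only [map_add, LinearMap.add_apply]
    change (C.bracket e e + C.bracket e' e + (C.bracket e e' + C.bracket e' e')) x = _
    change C.bracket e e x + C.bracket e' e x + (C.bracket e e' x + C.bracket e' e' x) = _
    abel
  rw [h4, h5] at h1
  have h6 := mvfderiv_add_apply (((hd e e).add ((hd e e').add (hd e e')))) (hd e' e')
    (C.anchor x w)
  have h7 := mvfderiv_add_apply (hd e e) ((hd e e').add (hd e e')) (C.anchor x w)
  have h8 := mvfderiv_add_apply (hd e e') (hd e e') (C.anchor x w)
  have h9 := h1.trans (congrArg (fun t : ℝ => 1 / 2 * t)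
    (h6.trans (congrArg (· + _) (h7.trans (congrArg (_ + ·) h8)))))
  simp only [map_add, LinearMap.add_apply] at h9
  linarith

end CourantAlgebroid

namespace IsReductionLeaf

variable (h : IsReductionLeaf p m R ι)
include h

theorem mfderiv_leafAnchor {y : P} {v : E (ι y)} (hv : v ∈ R.K (ι y) ⊔ R.Kperp (ι y)) :
    mfderiv (𝓡 p) (𝓡 n) ι y (C.leafAnchor p ι y v) = C.anchor (ι y) v := by
  have h1 : C.anchor (ι y) v ∈ LinearMap.range (mfderiv (𝓡 p) (𝓡 n) ι y).toLinearMap := by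
    rw [h.integral.tangent]
    exact ⟨v, hv, rfl⟩
  obtain ⟨u, hu⟩ := h1
  have h2 : C.leafAnchor p ι y v = u := by
    change (mfderiv (𝓡 p) (𝓡 n) ι y).toLinearMap.leftInverse (C.anchor (ι y) v) = u
    rw [← hu]
    exact LinearMap.leftInverse_apply_of_inj
      (LinearMap.ker_eq_bot.2 (h.integral.immersion.mfderiv_injective y)) u
  rw [h2]
  exact hu

theorem leafAnchor_eq {y : P} {v : E (ι y)} {u : TangentSpace (𝓡 p) y}
    (hu : mfderiv (𝓡 p) (𝓡 n) ι y u = C.anchor (ι y) v) : C.leafAnchor p ι y v = u := by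
  change (mfderiv (𝓡 p) (𝓡 n) ι y).toLinearMap.leftInverse (C.anchor (ι y) v) = u
  rw [← hu]
  exact LinearMap.leftInverse_apply_of_inj
    (LinearMap.ker_eq_bot.2 (h.integral.immersion.mfderiv_injective y)) u

theorem leafAnchor_toSection (a : 𝔞) (y : P) :
    C.leafAnchor p ι y (R.toSection a (ι y)) = infinitesimalAction (A.proj a) y :=
  h.leafAnchor_eq ((mfderiv_infinitesimalAction h.contMDiff h.equivariant _ _).trans
    (R.anchor_toSection a (ι y)).symm)

/-- The other half of tangency: besides `π(K + K^⊥)` being tangent to `P`, it exhausts the tangent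
space. -/
theorem exists_leafAnchor_eq (y : P) (u : TangentSpace (𝓡 p) y) :
    ∃ (a : 𝔞) (w : E (ι y)), w ∈ R.Kperp (ι y) ∧
      C.leafAnchor p ι y (R.toSection a (ι y) + w) = u := by
  have h1 : mfderiv (𝓡 p) (𝓡 n) ι y u ∈
      LinearMap.range (mfderiv (𝓡 p) (𝓡 n) ι y).toLinearMap := ⟨u, rfl⟩
  rw [h.integral.tangent] at h1
  obtain ⟨v, hv, hvu⟩ := h1
  obtain ⟨_, ⟨a, rfl⟩, w, hw, rfl⟩ := Submodule.mem_sup.1 hv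
  exact ⟨a, w, hw, h.leafAnchor_eq hvu.symm⟩

/-- Derivatives of a function on `P` along `K + K^⊥` are those of its extensions to `M`. -/
theorem mvfderiv_leafAnchor {y : P} {v : E (ι y)} (hv : v ∈ R.K (ι y) ⊔ R.Kperp (ι y))
    {Φ : M → ℝ} (hΦ : MDifferentiableAt (𝓡 n) 𝓘(ℝ, ℝ) Φ (ι y)) {f : P → ℝ}
    (hf : ∀ᶠ z in 𝓝 y, Φ (ι z) = f z) :
    mvfderiv (𝓡 p) f y (C.leafAnchor p ι y v) = mvfderiv (𝓡 n) Φ (ι y) (C.anchor (ι y) v) := by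
  have h1 : f =ᶠ[𝓝 y] Φ ∘ ι := by
    filter_upwards [hf] with z hz using hz.symm
  rw [h1.mvfderiv_eq]
  have h2 := mfderiv_comp_apply y hΦ (h.contMDiff.contMDiffAt.mdifferentiableAt (by simp))
    (C.leafAnchor p ι y v)
  refine h2.trans ?_
  exact congrArg (mvfderiv (𝓡 n) Φ (ι y)) (h.mfderiv_leafAnchor hv)

/-- Functions vanishing along `P` have zero derivatives along `K + K^⊥`. -/
theorem mvfderiv_anchor_eq_zero {y : P} {v : E (ι y)} (hv : v ∈ R.K (ι y) ⊔ R.Kperp (ι y))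
    {Φ : M → ℝ} (hΦ : MDifferentiableAt (𝓡 n) 𝓘(ℝ, ℝ) Φ (ι y))
    (hf : ∀ᶠ z in 𝓝 y, Φ (ι z) = 0) : mvfderiv (𝓡 n) Φ (ι y) (C.anchor (ι y) v) = 0 := by
  rw [← h.mvfderiv_leafAnchor hv hΦ hf]
  exact mvfderiv_const_apply _ _ _

/-- The vector field on `P` defined by a section in `K + K^⊥`. -/
theorem contMDiffAt_leafAnchor {x : P} {v : Cₛ^∞⟮𝓡 n; F, E⟯}
    (hv : ∀ᶠ y in 𝓝 x, v (ι y) ∈ R.K (ι y) ⊔ R.Kperp (ι y)) :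
    ContMDiffAt (𝓡 p) (𝓡 p).tangent ∞
      (fun y => (⟨y, C.leafAnchor p ι y (v (ι y))⟩ : TangentBundle (𝓡 p) P)) x := by
  refine contMDiffAt_vectorField_of_mvfderiv fun f hf => ?_
  -- Smoothness is tested on functions of `P`; after extension to `M` the derivative is that of `Φ`
  -- along a smooth vector field on `M`.
  obtain ⟨Φ, hΦ⟩ := h.integral.immersion.exists_extension hf
  refine ((C.contMDiff_mvfderiv_anchor Φ v).contMDiffAt.comp x h.contMDiff.contMDiffAt).congr_of_eventuallyEq ?_
  filter_upwards [hv, hΦ.eventually_nhds] with y hy hy'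
  exact h.mvfderiv_leafAnchor hy (Φ.contMDiff.contMDiffAt.mdifferentiableAt (by simp)) hy'

end IsReductionLeaf

end Leaf

/-! ### Constancy of the rank of `K ∩ K^⊥`. -/

section Leaf

variable {k n p m : ℕ}
  {G : Type*} [TopologicalSpace G] [ChartedSpace (EuclideanSpace ℝ (Fin k)) G] [Group G]
  [LieGroup (𝓡 k) ∞ G]
  {M : Type*} [TopologicalSpace M] [ChartedSpace (EuclideanSpace ℝ (Fin n)) M]
  [IsManifold (𝓡 n) ∞ M] [T2Space M] [MulAction G M] [ContMDiffSMul (𝓡 k) (𝓡 n) ∞ G M]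
  {F : Type*} [NormedAddCommGroup F] [NormedSpace ℝ F] [FiniteDimensional ℝ F]
  {E : M → Type*} [TopologicalSpace (TotalSpace F E)] [∀ x, AddCommGroup (E x)]
  [∀ x, Module ℝ (E x)] [∀ x, TopologicalSpace (E x)] [FiberBundle F E] [VectorBundle ℝ F E]
  [ContMDiffVectorBundle ∞ F E (𝓡 n)]
  {𝔞 : Type*} [AddCommGroup 𝔞] [Module ℝ 𝔞]
  {C : CourantAlgebroid n F E} {A : CourantAlgebra (GroupLieAlgebra (𝓡 k) G) 𝔞}
  {R : ExtendedAction C A}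
  {P : Type*} [TopologicalSpace P] [ChartedSpace (EuclideanSpace ℝ (Fin p)) P]
  [IsManifold (𝓡 p) ∞ P] [MulAction G P] [ContMDiffSMul (𝓡 k) (𝓡 p) ∞ G P]
  {ι : P → M}

namespace ExtendedAction

variable (R) in
/-- The Gram matrix of the elements `ρ(a_i)`. -/
def gram {t : ℕ} (a : Fin t → 𝔞) (x : M) : Matrix (Fin t) (Fin t) ℝ :=
  Matrix.of fun i j => C.pairing x (R.toSection (a i) x) (R.toSection (a j) x)

variable (R) in
theorem mvfderiv_gram (b a a' : 𝔞) (x : M) :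
    mvfderiv (𝓡 n) (fun z => C.pairing z (R.toSection a z) (R.toSection a' z)) x
      (C.anchor x (R.toSection b x)) =
    C.pairing x (R.toSection (A.bracket b a) x) (R.toSection a' x) +
      C.pairing x (R.toSection a x) (R.toSection (A.bracket b a') x) := by
  rw [C.invariance, R.map_bracket, R.map_bracket]

-- By polarized (C5) the derivative is the pairing of `w` with `[ρ(a), ρ(a')] + [ρ(a'), ρ(a)]`, an
-- element of `K`.
variable (R) in
theorem mvfderiv_gram_Kperp (a a' : 𝔞) {x : M} {w : E x} (hw : w ∈ R.Kperp x) :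
    mvfderiv (𝓡 n) (fun z => C.pairing z (R.toSection a z) (R.toSection a' z)) x
      (C.anchor x w) = 0 := by
  rw [← C.pairing_bracket_add_bracket, ← R.map_bracket, ← R.map_bracket, C.pairing_symm,
    C.pairing_symm x (R.toSection _ x) w, pairing_eq_zero hw (R.toSection_mem_K _ _),
    pairing_eq_zero hw (R.toSection_mem_K _ _), add_zero]

end ExtendedAction

namespace IsReductionLeaf

variable (h : IsReductionLeaf p m R ι)
include h

/-- Along `ρ(b)` plus an element of `K^⊥`, only `ρ(b)` contributes to the derivative of the Gram
matrix. Expanding the `ρ([b, a_j])` in the frame of `K` turns it into `B S + S Bᵀ`. -/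
theorem eventually_rank_gram_eq {x : P} {a : Fin (m + k) → 𝔞}
    {θ : Fin (m + k) → Cₛ^∞⟮𝓡 n; F, E⟯}
    (hK : ∀ᶠ y in 𝓝 x, ∀ v ∈ R.K (ι y),
        v = ∑ j, C.pairing (ι y) (θ j (ι y)) v • R.toSection (a j) (ι y)) :
    ∀ᶠ y in 𝓝 x, (R.gram a (ι y)).rank = (R.gram a (ι x)).rank := by
  let u : Module.Basis (Fin p) ℝ (TangentSpace (𝓡 p) x) :=
    (EuclideanSpace.basisFun (Fin p) ℝ).toBasis
  -- A frame of `T P` adapted to the problem: each basis vector at `x` is the anchor of some `ρ(b_i)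
  -- + w_i` with `w_i ∈ K^⊥`, and `w_i` extends within `K^⊥`.
  choose b w₀ hw₀ hu using fun i => h.exists_leafAnchor_eq x (u i)
  choose w hwx hw using fun i => h.exists_Kperp_section_eq x (hw₀ i)
  let X : Fin p → ∀ y : P, TangentSpace (𝓡 p) y := fun i y =>
    C.leafAnchor p ι y ((R.toSection (b i) + w i) (ι y))
  have hmem : ∀ i, ∀ᶠ y in 𝓝 x, (R.toSection (b i) + w i) (ι y) ∈
      R.K (ι y) ⊔ R.Kperp (ι y) := by
    intro i
    filter_upwards [hw i] with y hy
    exact Submodule.add_mem_sup (R.toSection_mem_K _ _) hy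
  let B : Fin p → P → Matrix (Fin (m + k)) (Fin (m + k)) ℝ := fun i y => Matrix.of fun j l =>
    C.pairing (ι y) (θ l (ι y)) (R.toSection (A.bracket (b i) (a j)) (ι y))
  have hB : ∀ i j l, ContinuousAt (fun y => B i y j l) x := fun i j l =>
    ((C.pairing_smooth (θ l) (R.toSection (A.bracket (b i) (a j)))).comp
      h.contMDiff).continuous.continuousAt
  refine Matrix.eventually_rank_eq (d := p) (S := fun y => R.gram a (ι y)) (X := X) (B := B)
    (B' := fun i y => (B i y).transpose) (fun i j => ?_) (fun i => ?_) ?_ hB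
    (fun i j l => hB i l j) ?_
  · exact ((C.pairing_smooth _ _).comp h.contMDiff).smoothNear x
  · exact (h.contMDiffAt_leafAnchor (hmem i)).continuousAt
  · have h1 : (fun i => X i x) = u := by
      funext i
      rw [← hu]
      change C.leafAnchor p ι x (R.toSection (b i) (ι x) + w i (ι x)) = _
      rw [hwx]
    rw [h1, u.span_eq]
  · filter_upwards [hK, eventually_all.2 hw, eventually_all.2 hmem] with y hKy hwy hmy i j l
    have h1 : mvfderiv (𝓡 p) (fun y => R.gram a (ι y) j l) y (X i y) = _ :=
      h.mvfderiv_leafAnchor (hmy i)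
        (C.smoothNear_pairing (R.toSection (a j)) (R.toSection (a l)) (ι y)).mdifferentiableAt
        (Eventually.of_forall fun z => rfl)
    refine h1.trans ?_
    have h2 : C.anchor (ι y) ((R.toSection (b i) + w i) (ι y)) =
        C.anchor (ι y) (R.toSection (b i) (ι y)) + C.anchor (ι y) (w i (ι y)) :=
      map_add _ _ _
    rw [h2]
    refine (map_add _ _ _).trans ?_
    rw [R.mvfderiv_gram_Kperp _ _ (hwy i), add_zero, R.mvfderiv_gram,
      hKy _ (R.toSection_mem_K (A.bracket (b i) (a j)) _),
      hKy _ (R.toSection_mem_K (A.bracket (b i) (a l)) _)]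
    simp only [map_sum, map_smul, LinearMap.sum_apply, LinearMap.smul_apply, smul_eq_mul,
      Matrix.add_apply, Matrix.mul_apply, Matrix.transpose_apply]
    congr 1
    refine Finset.sum_congr rfl fun j' _ => ?_
    exact mul_comm _ _

-- The frame maps the kernel of the Gram matrix isomorphically onto `K ∩ K^⊥`.
omit h in
theorem finrank_inf_Kperp {y : P} {t : ℕ} {a : Fin t → 𝔞}
    (hli : LinearIndependent ℝ fun i => R.toSection (a i) (ι y))
    (hK : R.K (ι y) ≤ Submodule.span ℝ (range fun i => R.toSection (a i) (ι y))) :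
    Module.finrank ℝ (R.K (ι y) ⊓ R.Kperp (ι y) : Submodule ℝ (E (ι y))) +
      (R.gram a (ι y)).rank = t := by
  let L : (Fin t → ℝ) →ₗ[ℝ] E (ι y) :=
    Fintype.linearCombination ℝ fun i => R.toSection (a i) (ι y)
  have hL : ∀ c, L c = ∑ i, c i • R.toSection (a i) (ι y) := fun c =>
    Fintype.linearCombination_apply _ _ _
  have hinj : Function.Injective L := by
    refine (injective_iff_map_eq_zero _).2 fun c hc => ?_
    rw [hL] at hc
    funext i
    exact Fintype.linearIndependent_iff.1 hli c hc i
  have hg : ∀ c i, (R.gram a (ι y)).mulVec c i =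
      C.pairing (ι y) (R.toSection (a i) (ι y)) (L c) := by
    intro c i
    rw [hL]
    simp only [map_sum, map_smul, smul_eq_mul, Matrix.mulVec, dotProduct,
      ExtendedAction.gram, Matrix.of_apply]
    exact Finset.sum_congr rfl fun j _ => mul_comm _ _
  have hmap : (LinearMap.ker (R.gram a (ι y)).mulVecLin).map L =
      (R.K (ι y) ⊓ R.Kperp (ι y) : Submodule ℝ (E (ι y))) := by
    ext v
    constructor
    · rintro ⟨c, hc, rfl⟩
      refine ⟨?_, ?_⟩
      · rw [hL]
        exact Submodule.sum_mem _ fun i _ => Submodule.smul_mem _ _ (R.toSection_mem_K _ _)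
      · intro w hw
        obtain ⟨e, rfl⟩ := (Submodule.mem_span_range_iff_exists_fun ℝ).1 (hK hw)
        change C.pairing (ι y) (∑ i, e i • R.toSection (a i) (ι y)) (L c) = 0
        simp only [map_sum, map_smul, LinearMap.sum_apply, LinearMap.smul_apply]
        refine Finset.sum_eq_zero fun i _ => ?_
        rw [← hg]
        have h1 : (R.gram a (ι y)).mulVec c = 0 := hc
        rw [h1]
        exact smul_zero _
    · rintro ⟨hv, hv'⟩
      obtain ⟨c, rfl⟩ := (Submodule.mem_span_range_iff_exists_fun ℝ).1 (hK hv)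
      refine ⟨c, ?_, hL c⟩
      funext i
      refine (hg c i).trans ?_
      rw [hL]
      exact hv' _ (R.toSection_mem_K _ _)
  have h1 := (R.gram a (ι y)).mulVecLin.finrank_range_add_finrank_ker
  rw [← hmap, (LinearEquiv.finrank_eq (Submodule.equivMapOfInjective L hinj _)).symm]
  rw [Module.finrank_fintype_fun_eq_card, Fintype.card_fin] at h1
  rw [Matrix.rank]
  omega

theorem finrank_Kperp (y : P) :
    Module.finrank ℝ (R.Kperp (ι y)) + (m + k) = Module.finrank ℝ F := by
  haveI := finiteDimensional_fibre F E (ι y)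
  have hnd : (C.pairing (ι y)).Nondegenerate :=
    ⟨fun e he => C.pairing_nondegenerate _ e he, fun e he =>
      C.pairing_nondegenerate _ e fun w => by rw [C.pairing_symm]; exact he w⟩
  have h1 := LinearMap.BilinForm.finrank_orthogonal hnd (R.K (ι y))
  rw [h.finrank_K y, (fibreLinearEquiv F (ι y)).finrank_eq] at h1
  have h2 := Submodule.finrank_le (R.K (ι y))
  rw [h.finrank_K y, (fibreLinearEquiv F (ι y)).finrank_eq] at h2
  rw [ExtendedAction.Kperp]
  omega

omit h in
theorem finrank_quotFiber (y : P) :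
    Module.finrank ℝ (R.QuotFiber (ι y)) +
      Module.finrank ℝ (R.K (ι y) ⊓ R.Kperp (ι y) : Submodule ℝ (E (ι y))) =
      Module.finrank ℝ (R.Kperp (ι y)) := by
  haveI := finiteDimensional_fibre F E (ι y)
  rw [← (Submodule.submoduleOfEquivOfLe
    (inf_le_right : R.K (ι y) ⊓ R.Kperp (ι y) ≤ R.Kperp (ι y))).finrank_eq]
  exact Submodule.finrank_quotient_add_finrank _

theorem eventually_finrank_quotFiber (x : P) :
    ∀ᶠ y in 𝓝 x, Module.finrank ℝ (R.QuotFiber (ι y)) =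
      Module.finrank ℝ (R.QuotFiber (ι x)) := by
  obtain ⟨a, θ, hθ, hK⟩ := h.exists_frame_K x
  have hli : ∀ᶠ y in 𝓝 x, (LinearIndependent ℝ fun i => R.toSection (a i) (ι y)) ∧
      R.K (ι y) ≤ Submodule.span ℝ (range fun i => R.toSection (a i) (ι y)) := by
    filter_upwards [(h.continuousAt x).eventually hθ, hK] with y hy hKy
    refine ⟨Fintype.linearIndependent_iff.2 fun c hc i => ?_, fun v hv => ?_⟩
    · have h1 := congrArg (C.pairing (ι y) (θ i (ι y))) hc
      simpa [hy] using h1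
    · rw [hKy v hv]
      exact Submodule.sum_mem _ fun j _ => Submodule.smul_mem _ _
        (Submodule.subset_span ⟨j, rfl⟩)
  filter_upwards [hli, h.eventually_rank_gram_eq hK] with y hy hr
  have h1 := finrank_inf_Kperp hy.1 hy.2
  have h2 := finrank_inf_Kperp hli.self_of_nhds.1 hli.self_of_nhds.2
  have h3 := finrank_quotFiber (R := R) (ι := ι) y
  have h4 := finrank_quotFiber (R := R) (ι := ι) x
  have h5 := h.finrank_Kperp x
  have h6 := h.finrank_Kperp y
  omega

theorem exists_finrank_quotFiber :
    ∃ r, ∀ x : P, Module.finrank ℝ (R.QuotFiber (ι x)) = r := by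
  haveI := h.integral.connected
  have hloc : IsLocallyConstant fun x : P => Module.finrank ℝ (R.QuotFiber (ι x)) := by
    rw [IsLocallyConstant.iff_eventually_eq]
    exact h.eventually_finrank_quotFiber
  obtain ⟨x₀⟩ := (inferInstance : Nonempty P)
  exact ⟨_, fun x => hloc.apply_eq_of_preconnectedSpace x x₀⟩

end IsReductionLeaf

end Leaf

/-! ### Dual frames of `K^⊥/(K ∩ K^⊥)` and brackets of invariant lifts. -/

section Leaf

variable {k n p m : ℕ}
  {G : Type*} [TopologicalSpace G] [ChartedSpace (EuclideanSpace ℝ (Fin k)) G] [Group G]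
  [LieGroup (𝓡 k) ∞ G]
  {M : Type*} [TopologicalSpace M] [ChartedSpace (EuclideanSpace ℝ (Fin n)) M]
  [IsManifold (𝓡 n) ∞ M] [T2Space M] [MulAction G M] [ContMDiffSMul (𝓡 k) (𝓡 n) ∞ G M]
  {F : Type*} [NormedAddCommGroup F] [NormedSpace ℝ F] [FiniteDimensional ℝ F]
  {E : M → Type*} [TopologicalSpace (TotalSpace F E)] [∀ x, AddCommGroup (E x)]
  [∀ x, Module ℝ (E x)] [∀ x, TopologicalSpace (E x)] [FiberBundle F E] [VectorBundle ℝ F E]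
  [ContMDiffVectorBundle ∞ F E (𝓡 n)]
  {𝔞 : Type*} [AddCommGroup 𝔞] [Module ℝ 𝔞]
  {C : CourantAlgebroid n F E} {A : CourantAlgebra (GroupLieAlgebra (𝓡 k) G) 𝔞}
  {R : ExtendedAction C A}
  {P : Type*} [TopologicalSpace P] [ChartedSpace (EuclideanSpace ℝ (Fin p)) P]
  [IsManifold (𝓡 p) ∞ P] [MulAction G P] [ContMDiffSMul (𝓡 k) (𝓡 p) ∞ G P]
  {ι : P → M}

namespace IsReductionLeaf

variable (h : IsReductionLeaf p m R ι)
include h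

/-- Sections `w i` and `w' i` are dual frames of `K^⊥ / (K ∩ K^⊥)` at `y`. -/
structure _root_.IsDualFrameAt (R : ExtendedAction C A) (x : M) {r : ℕ}
    (w w' : Fin r → Cₛ^∞⟮𝓡 n; F, E⟯) : Prop where
  mem : ∀ i, w i x ∈ R.Kperp x
  mem' : ∀ i, w' i x ∈ R.Kperp x
  dual : ∀ i j, C.pairing x (w i x) (w' j x) = if i = j then 1 else 0
  complete : ∀ v ∈ R.Kperp x, v - ∑ i, C.pairing x v (w' i x) • w i x ∈ R.K x

/-- The form induced on `K^⊥/(K ∩ K^⊥)` is nondegenerate, because the radical of `K^⊥` is contained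
in `K^⊥⊥ = K`. A basis and its dual at `x` extend to sections of `K^⊥`, one family is corrected by
the inverse matrix of pairings, and constancy of the rank `r` keeps the frame complete nearby. -/
theorem exists_dualFrame {r : ℕ} (hr : ∀ x : P, Module.finrank ℝ (R.QuotFiber (ι x)) = r) (x : P) :
    ∃ w w' : Fin r → Cₛ^∞⟮𝓡 n; F, E⟯, ∀ᶠ y in 𝓝 x, IsDualFrameAt R (ι y) w w' := by
  haveI := fun y => finiteDimensional_fibre F E y
  let b : Module.Basis (Fin r) ℝ (R.QuotFiber (ι x)) := Module.finBasisOfFinrankEq ℝ _ (hr x)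
  choose z hz using fun i => Submodule.Quotient.mk_surjective _ (b i)
  have hdual : ∃ z' : Fin r → R.Kperp (ι x), ∀ i j,
      C.pairing (ι x) (z i) (z' j) = if i = j then 1 else 0 := by
    -- Pairing with the basis. Its kernel lies in `K ∩ K^⊥`, so it is onto by a dimension count, and
    -- preimages of the unit vectors form the dual family.
    let Θ : R.Kperp (ι x) →ₗ[ℝ] (Fin r → ℝ) :=
      LinearMap.pi fun i => (C.pairing (ι x) (z i)).domRestrict (R.Kperp (ι x))
    have hker : LinearMap.ker Θ ≤ (R.K (ι x) ⊓ R.Kperp (ι x)).submoduleOf (R.Kperp (ι x)) := by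
      intro v hv
      refine ⟨R.mem_K_of_forall_pairing fun w hw => ?_, v.2⟩
      obtain ⟨c, hc⟩ : ∃ c : Fin r → ℝ, ∑ i, c i • b i = Submodule.Quotient.mk ⟨w, hw⟩ :=
        ⟨b.repr _, b.sum_repr _⟩
      have h1 : (Submodule.Quotient.mk (∑ i, c i • z i) : R.QuotFiber (ι x)) =
          Submodule.Quotient.mk ⟨w, hw⟩ := by
        rw [← hc]
        simp only [← hz]
        exact map_sum ((R.K (ι x) ⊓ R.Kperp (ι x)).submoduleOf (R.Kperp (ι x))).mkQ _ _
      have h2 := ((Submodule.Quotient.eq _).1 h1).1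
      have h3 := R.pairing_eq_zero v.2 h2
      have h4 : ∀ i, C.pairing (ι x) (z i) v = 0 := fun i => congrFun hv i
      rw [C.pairing_symm] at h3
      simpa [h4, eq_comm] using h3
    have hsurj : Function.Surjective Θ := by
      rw [← LinearMap.range_eq_top]
      refine Submodule.eq_top_of_finrank_eq (le_antisymm (Submodule.finrank_le _) ?_)
      have h1 := Θ.finrank_range_add_finrank_ker
      have h2 := Submodule.finrank_quotient_add_finrank
        ((R.K (ι x) ⊓ R.Kperp (ι x)).submoduleOf (R.Kperp (ι x)))
      have h3 := Submodule.finrank_mono hker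
      have h4 : Module.finrank ℝ (R.Kperp (ι x) ⧸
        (R.K (ι x) ⊓ R.Kperp (ι x)).submoduleOf (R.Kperp (ι x))) = r := hr x
      rw [Module.finrank_fintype_fun_eq_card, Fintype.card_fin]
      omega
    choose z' hz' using fun j => hsurj (Pi.single j 1)
    refine ⟨z', fun i j => ?_⟩
    have h1 : C.pairing (ι x) (z i) (z' j) = (Pi.single j 1 : Fin r → ℝ) i := congrFun (hz' j) i
    rw [h1, Pi.single_apply]
  obtain ⟨z', hzz'⟩ := hdual
  choose w hwx hw using fun i => h.exists_Kperp_section_eq x (z i).2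
  choose u hux hu using fun i => h.exists_Kperp_section_eq x (z' i).2
  let N : M → Matrix (Fin r) (Fin r) ℝ := fun y => Matrix.of fun i j =>
    C.pairing y (w i y) (u j y)
  have hN : ∀ i j, SmoothNear n (fun y => N y i j) (ι x) := fun i j =>
    C.smoothNear_pairing (w i) (u j) (ι x)
  have hN1 : N (ι x) = 1 := by
    ext i j
    simp only [N, Matrix.of_apply, hwx, hux, hzz', Matrix.one_apply]
  have hdet : (N (ι x)).det ≠ 0 := by rw [hN1]; simp
  choose f hf using fun i j => (SmoothNear.matrix_inv hN hdet i j).exists_contMDiffMap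
  have hdet' : ∀ᶠ y in 𝓝 (ι x), (N y).det ≠ 0 :=
    (SmoothNear.matrix_det hN).continuousAt.eventually_ne hdet
  refine ⟨w, fun j => ∑ l, funSMulSection (f l j) (u l), ?_⟩
  have hfe := eventually_all.2 fun i => eventually_all.2 fun j => hf i j
  filter_upwards [(h.continuousAt x).eventually hfe, (h.continuousAt x).eventually hdet',
    eventually_all.2 hw, eventually_all.2 hu] with y hfy hdy hwy huy
  have hw' : ∀ j, (∑ l, funSMulSection (f l j) (u l)) (ι y) =
      ∑ l, (N (ι y))⁻¹ l j • u l (ι y) := by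
    intro j
    rw [sum_section_apply]
    refine Finset.sum_congr rfl fun l _ => ?_
    change f l j (ι y) • u l (ι y) = _
    rw [hfy]
  have hmem' : ∀ j, (∑ l, funSMulSection (f l j) (u l)) (ι y) ∈ R.Kperp (ι y) := fun j => by
    rw [hw']
    exact Submodule.sum_mem _ fun l _ => Submodule.smul_mem _ _ (huy l)
  have hd : ∀ i j, C.pairing (ι y) (w i (ι y)) ((∑ l, funSMulSection (f l j) (u l)) (ι y)) =
      if i = j then 1 else 0 := by
    intro i j
    rw [hw']
    have h2 : N (ι y) * (N (ι y))⁻¹ = 1 := Matrix.mul_nonsing_inv _ (isUnit_iff_ne_zero.2 hdy)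
    have h3 := congrFun (congrFun h2 i) j
    rw [Matrix.mul_apply, Matrix.one_apply] at h3
    simp only [map_sum, map_smul, smul_eq_mul]
    rw [← h3]
    exact Finset.sum_congr rfl fun l _ => mul_comm _ _
  refine ⟨hwy, hmem', hd, fun v hv => ?_⟩
  let q : Fin r → R.QuotFiber (ι y) := fun i => Submodule.Quotient.mk ⟨w i (ι y), hwy i⟩
  have hq : ∀ c : Fin r → ℝ, ∑ i, c i • q i =
      Submodule.Quotient.mk (∑ i, c i • (⟨w i (ι y), hwy i⟩ : R.Kperp (ι y))) := by
    intro c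
    exact (map_sum ((R.K (ι y) ⊓ R.Kperp (ι y)).submoduleOf (R.Kperp (ι y))).mkQ _ _).symm
  have hqc : ∀ (c : Fin r → ℝ) (v : R.Kperp (ι y)),
      ∑ i, c i • q i = Submodule.Quotient.mk v → (∑ i, c i • w i (ι y)) - v ∈ R.K (ι y) := by
    intro c v hc
    rw [hq, Submodule.Quotient.eq] at hc
    have h1 := hc.1
    simpa using h1
  have hco : ∀ (c : Fin r → ℝ) (v : E (ι y)), (∑ i, c i • w i (ι y)) - v ∈ R.K (ι y) →
      ∀ j, C.pairing (ι y) v ((∑ l, funSMulSection (f l j) (u l)) (ι y)) = c j := by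
    intro c v hc j
    have h1 := R.pairing_eq_zero (hmem' j) hc
    rw [C.pairing_symm] at h1
    simp only [map_sub, LinearMap.sub_apply, map_sum, LinearMap.sum_apply, map_smul,
      LinearMap.smul_apply, hd, smul_eq_mul] at h1
    exact (sub_eq_zero.1 (by simpa using h1)).symm
  have hli : LinearIndependent ℝ q := by
    rw [Fintype.linearIndependent_iff]
    intro c hc i
    have h1 := hqc c 0 (hc.trans (Submodule.Quotient.mk_zero _).symm)
    have h2 := hco c 0 h1 i
    simpa using h2.symm
  -- The only place where the rank at `y`, and not just at `x`, is needed.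
  have hspan := hli.span_eq_top_of_card_eq_finrank' (by rw [hr y]; simp)
  obtain ⟨c, hc⟩ := (Submodule.mem_span_range_iff_exists_fun ℝ).1
    (hspan.ge (x := Submodule.Quotient.mk ⟨v, hv⟩) trivial)
  have h1 := hqc c _ hc
  have h2 := hco c _ h1
  simp only at h2 h1
  simp only [h2]
  rw [← neg_sub]
  exact Submodule.neg_mem _ h1

/-- The brackets of `v` with the sections `ρ(a)` lie in `K` along `P` near `x`, where `v` lies in
`K^⊥`. -/
def _root_.IsInvariantNear (R : ExtendedAction C A) {P : Type*} [TopologicalSpace P] (ι : P → M)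
    (x : P) (v : Cₛ^∞⟮𝓡 n; F, E⟯) : Prop :=
  ∀ᶠ y in 𝓝 x, v (ι y) ∈ R.Kperp (ι y) ∧
    ∀ a, C.bracket (R.toSection a) v (ι y) ∈ R.K (ι y) ⊓ R.Kperp (ι y)

omit h in
theorem _root_.CourantAlgebroid.mdifferentiableAt_pairing (C : CourantAlgebroid n F E)
    (e e' : Cₛ^∞⟮𝓡 n; F, E⟯) (x : M) :
    MDifferentiableAt (𝓡 n) 𝓘(ℝ, ℝ) (fun z => C.pairing z (e z) (e' z)) x :=
  (C.smoothNear_pairing e e' x).mdifferentiableAt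

theorem mvfderiv_pairing_eq_zero {x : P} {e e' : Cₛ^∞⟮𝓡 n; F, E⟯}
    (hee : ∀ᶠ y in 𝓝 x, C.pairing (ι y) (e (ι y)) (e' (ι y)) = 0) {w : E (ι x)}
    (hw : w ∈ R.Kperp (ι x)) :
    mvfderiv (𝓡 n) (fun z => C.pairing z (e z) (e' z)) (ι x) (C.anchor (ι x) w) = 0 :=
  h.mvfderiv_anchor_eq_zero (Submodule.mem_sup_right hw) (C.mdifferentiableAt_pairing e e' _) hee

theorem pairing_toSection_eventually {x : P} {v : Cₛ^∞⟮𝓡 n; F, E⟯}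
    (hv : ∀ᶠ y in 𝓝 x, v (ι y) ∈ R.Kperp (ι y)) (a : 𝔞) :
    ∀ᶠ y in 𝓝 x, C.pairing (ι y) (v (ι y)) (R.toSection a (ι y)) = 0 := by
  filter_upwards [hv] with y hy using R.pairing_eq_zero hy (R.toSection_mem_K _ _)

/-- `⟨[v, ρ(a)], w⟩ = 0` for `w ∈ K^⊥`. -/
theorem pairing_bracket_toSection {x : P} {v : Cₛ^∞⟮𝓡 n; F, E⟯} (hv : IsInvariantNear R ι x v)
    (a : 𝔞) {w : E (ι x)} (hw : w ∈ R.Kperp (ι x)) :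
    C.pairing (ι x) (C.bracket v (R.toSection a) (ι x)) w = 0 := by
  -- Since `⟨v, ρ(a)⟩` vanishes along `P`, polarized (C5) trades `[v, ρ(a)]` for `-[ρ(a), v]`, which
  -- lies in `K`.
  have h1 := C.pairing_bracket_add_bracket v (R.toSection a) (ι x) w
  rw [h.mvfderiv_pairing_eq_zero (h.pairing_toSection_eventually (hv.mono fun y hy => hy.1) a) hw,
    C.pairing_symm _ (C.bracket (R.toSection a) v (ι x)),
    R.pairing_eq_zero hw (hv.self_of_nhds.2 a).1, add_zero] at h1
  exact h1

/-- The bracket of invariant sections of `K^⊥` lies in `K^⊥`. -/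
theorem bracket_mem_Kperp {x : P} {v₁ v₂ : Cₛ^∞⟮𝓡 n; F, E⟯} (h₁ : IsInvariantNear R ι x v₁)
    (h₂ : ∀ᶠ y in 𝓝 x, v₂ (ι y) ∈ R.Kperp (ι y)) :
    C.bracket v₁ v₂ (ι x) ∈ R.Kperp (ι x) := by
  rw [R.mem_Kperp_iff]
  intro a
  have h3 := C.invariance v₁ v₂ (R.toSection a) (ι x)
  rw [h.mvfderiv_pairing_eq_zero (h.pairing_toSection_eventually h₂ a) h₁.self_of_nhds.1,
    C.pairing_symm _ (v₂ (ι x)), h.pairing_bracket_toSection h₁ a h₂.self_of_nhds, add_zero] at h3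
  exact h3.symm

/-- Brackets of invariant sections with sections of `K ∩ K^⊥` lie in `K`. -/
theorem bracket_mem_K {x : P} {v₁ v₂ : Cₛ^∞⟮𝓡 n; F, E⟯} (h₁ : IsInvariantNear R ι x v₁)
    (h₂ : ∀ᶠ y in 𝓝 x, v₂ (ι y) ∈ R.K (ι y) ⊓ R.Kperp (ι y)) :
    C.bracket v₁ v₂ (ι x) ∈ R.K (ι x) ∧ C.bracket v₂ v₁ (ι x) ∈ R.K (ι x) := by
  have key : ∀ w ∈ R.Kperp (ι x), C.pairing (ι x) w (C.bracket v₁ v₂ (ι x)) = 0 := by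
    intro w₀ hw₀
    obtain ⟨w, rfl, hw⟩ := h.exists_Kperp_section_eq x hw₀
    rw [C.pairing_symm]
    have h3 := C.invariance v₁ v₂ w (ι x)
    have h4 : ∀ᶠ y in 𝓝 x, C.pairing (ι y) (v₂ (ι y)) (w (ι y)) = 0 := by
      filter_upwards [h₂, hw] with y hy hwy
      rw [C.pairing_symm]
      exact R.pairing_eq_zero hwy hy.1
    -- `[v₁, w]` lies in `K^⊥` by the previous lemma, while `v₂` lies in `K`.
    have h5 : C.pairing (ι x) (v₂ (ι x)) (C.bracket v₁ w (ι x)) = 0 := by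
      rw [C.pairing_symm]
      exact R.pairing_eq_zero (h.bracket_mem_Kperp h₁ hw) h₂.self_of_nhds.1
    rw [h.mvfderiv_pairing_eq_zero h4 h₁.self_of_nhds.1, h5, add_zero] at h3
    exact h3.symm
  refine ⟨R.mem_K_of_forall_pairing key, R.mem_K_of_forall_pairing fun w hw => ?_⟩
  have h6 := C.pairing_bracket_add_bracket v₁ v₂ (ι x) w
  have h7 : ∀ᶠ y in 𝓝 x, C.pairing (ι y) (v₁ (ι y)) (v₂ (ι y)) = 0 := by
    filter_upwards [h₁, h₂] with y hy hy'
    exact R.pairing_eq_zero hy.1 hy'.1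
  rw [h.mvfderiv_pairing_eq_zero h7 hw, C.pairing_symm, key w hw, zero_add,
    C.pairing_symm] at h6
  exact h6

end IsReductionLeaf

end Leaf

/-! ### Representatives of elements of the reduced fibres. -/

section Leaf

variable {k n p m : ℕ}
  {G : Type*} [TopologicalSpace G] [ChartedSpace (EuclideanSpace ℝ (Fin k)) G] [Group G]
  [LieGroup (𝓡 k) ∞ G]
  {M : Type*} [TopologicalSpace M] [ChartedSpace (EuclideanSpace ℝ (Fin n)) M]
  [IsManifold (𝓡 n) ∞ M] [T2Space M] [MulAction G M] [ContMDiffSMul (𝓡 k) (𝓡 n) ∞ G M]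
  {F : Type*} [NormedAddCommGroup F] [NormedSpace ℝ F] [FiniteDimensional ℝ F]
  {E : M → Type*} [TopologicalSpace (TotalSpace F E)] [∀ x, AddCommGroup (E x)]
  [∀ x, Module ℝ (E x)] [∀ x, TopologicalSpace (E x)] [FiberBundle F E] [VectorBundle ℝ F E]
  [ContMDiffVectorBundle ∞ F E (𝓡 n)]
  {𝔞 : Type*} [AddCommGroup 𝔞] [Module ℝ 𝔞]
  {C : CourantAlgebroid n F E} {A : CourantAlgebra (GroupLieAlgebra (𝓡 k) G) 𝔞}
  {R : ExtendedAction C A}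
  {P : Type*} [TopologicalSpace P] [ChartedSpace (EuclideanSpace ℝ (Fin p)) P]
  [IsManifold (𝓡 p) ∞ P] [MulAction G P] [ContMDiffSMul (𝓡 k) (𝓡 p) ∞ G P]
  {ι : P → M}

namespace ExtendedAction

variable (R ι) in
/-- The vector `v ∈ E_{ι(y)}` lies in `K^⊥` and represents the element `e` of the fibre of `E_red`
over the orbit `c` of `y`. -/
def RepresentsAt (hι : ∀ (g : G) (p : P), ι (g • p) = g • ι p)
    {c : MulAction.orbitRel.Quotient G P} {y : P} (hy : orbitMap G y = c) (v : E (ι y))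
    (e : R.ReducedFiber ι hι c) : Prop :=
  ∃ hv : v ∈ R.Kperp (ι y), (Submodule.Quotient.mk ⟨v, hv⟩ : R.QuotFiber (ι y)) =
    (e : R.reducedSubmodule ι hι c).1 ⟨y, hy⟩

variable {hι : ∀ (g : G) (p : P), ι (g • p) = g • ι p} {c : MulAction.orbitRel.Quotient G P}
  {y : P} {hy : orbitMap G y = c}

theorem exists_representsAt (hy : orbitMap G y = c) (e : R.ReducedFiber ι hι c) :
    ∃ v, R.RepresentsAt ι hι hy v e := by
  obtain ⟨v, hv⟩ := Submodule.Quotient.mk_surjective _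
    ((e : R.reducedSubmodule ι hι c).1 ⟨y, hy⟩)
  exact ⟨v, v.2, hv⟩

namespace RepresentsAt

variable {v v' : E (ι y)} {e e' : R.ReducedFiber ι hι c}

theorem sub_mem (hv : R.RepresentsAt ι hι hy v e) (hv' : R.RepresentsAt ι hι hy v' e) :
    v - v' ∈ R.K (ι y) :=
  ((Submodule.Quotient.eq _).1 (hv.2.trans hv'.2.symm)).1

theorem of_sub_mem (hv : R.RepresentsAt ι hι hy v e) (hv' : v' ∈ R.Kperp (ι y))
    (hs : v - v' ∈ R.K (ι y)) : R.RepresentsAt ι hι hy v' e := by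
  have h1 : (⟨v, hv.1⟩ - ⟨v', hv'⟩ : R.Kperp (ι y)) ∈
      (R.K (ι y) ⊓ R.Kperp (ι y)).submoduleOf (R.Kperp (ι y)) :=
    ⟨hs, Submodule.sub_mem _ hv.1 hv'⟩
  exact ⟨hv', ((Submodule.Quotient.eq _).2 h1).symm.trans hv.2⟩

theorem add (hv : R.RepresentsAt ι hι hy v e) (hv' : R.RepresentsAt ι hι hy v' e') :
    R.RepresentsAt ι hι hy (v + v') (e + e') :=
  ⟨Submodule.add_mem _ hv.1 hv'.1, congrArg₂ (· + ·) hv.2 hv'.2⟩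

theorem smul (t : ℝ) (hv : R.RepresentsAt ι hι hy v e) :
    R.RepresentsAt ι hι hy (t • v) (t • e) :=
  ⟨Submodule.smul_mem _ t hv.1, congrArg (t • ·) hv.2⟩

variable (hy) in
theorem zero : R.RepresentsAt ι hι hy 0 (0 : R.ReducedFiber ι hι c) :=
  ⟨Submodule.zero_mem _, rfl⟩

/-- Equivariance of `e` only asserts that some representative is transported to a representative.
Any other differs from it by an element of `K`, and the action preserves `K` along `P`. -/
theorem actTo [ConnectedSpace G] (h : IsReductionLeaf p m R ι)
    (hv : R.RepresentsAt ι hι hy v e) {y' : P} (g : G) (hg : g • ι y = ι y') :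
    ∃ hy' : orbitMap G y' = c, R.RepresentsAt ι hι hy' (R.actTo g hg v) e := by
  have hgy : g • y = y' := h.integral.injective (by rw [hι, hg])
  subst hgy
  have hy' : orbitMap G (g • y) = c := (orbitMap_smul g y).trans hy
  obtain ⟨w, w', h₁, h₂, h₃⟩ := (e : R.reducedSubmodule ι hι c).2 g y hy hy'
  have h4 : (w' : E (ι (g • y))) = R.actTo g hg w :=
    TotalSpace.mk_right_injective (F := F) (h₃.trans (R.mk_actTo g hg w).symm)
  have h5 : v - w ∈ R.K (ι y) := hv.sub_mem ⟨w.2, h₁.symm⟩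
  refine ⟨hy', of_sub_mem (v := (w' : E (ι (g • y)))) ⟨w'.2, h₂.symm⟩
    (h.actTo_mem_Kperp g hg hv.1) ?_⟩
  rw [h4, ← map_sub, ← neg_sub, map_neg]
  exact Submodule.neg_mem _ (h.actTo_mem_K g hg h5)

/-- Transport along the orbit determines an equivariant section from its value at one point. -/
theorem ext [ConnectedSpace G] (h : IsReductionLeaf p m R ι)
    (hv : R.RepresentsAt ι hι hy v e) (hv' : R.RepresentsAt ι hι hy v e') : e = e' := by
  refine Subtype.ext (funext fun ⟨y', hy'⟩ => ?_)
  obtain ⟨g, rfl⟩ := exists_smul_eq_of_orbitMap_eq (hy'.trans hy.symm)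
  obtain ⟨_, h1⟩ := hv.actTo h g (hι g y).symm
  obtain ⟨_, h2⟩ := hv'.actTo h g (hι g y).symm
  exact h1.2.symm.trans h2.2

theorem ext_of_sub_mem [ConnectedSpace G] (h : IsReductionLeaf p m R ι)
    (hv : R.RepresentsAt ι hι hy v e) (hv' : R.RepresentsAt ι hι hy v' e')
    (hs : v - v' ∈ R.K (ι y)) : e = e' :=
  (hv.of_sub_mem hv'.1 hs).ext h hv'

theorem pairing_eq (hv : R.RepresentsAt ι hι hy v e) (hv' : R.RepresentsAt ι hι hy v' e)
    {w : E (ι y)} (hw : w ∈ R.Kperp (ι y)) : C.pairing (ι y) v w = C.pairing (ι y) v' w := by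
  have h1 := R.pairing_eq_zero hw (hv.sub_mem hv')
  rw [C.pairing_symm, map_sub, LinearMap.sub_apply] at h1
  exact sub_eq_zero.1 h1

theorem pairing_congr (hv : R.RepresentsAt ι hι hy v e) (hv' : R.RepresentsAt ι hι hy v' e)
    {w w' : E (ι y)} (hw : R.RepresentsAt ι hι hy w e') (hw' : R.RepresentsAt ι hι hy w' e') :
    C.pairing (ι y) v w = C.pairing (ι y) v' w' := by
  rw [hv.pairing_eq hv' hw.1, C.pairing_symm, hw.pairing_eq hw' hv'.1, C.pairing_symm]

end RepresentsAt

/-- Every element of `K^⊥` represents an element of `E_red`. -/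
theorem exists_representsAt_of_mem [ConnectedSpace G] (h : IsReductionLeaf p m R ι)
    (hι : ∀ (g : G) (p : P), ι (g • p) = g • ι p) (hy : orbitMap G y = c) {v : E (ι y)}
    (hv : v ∈ R.Kperp (ι y)) :
    ∃ e : R.ReducedFiber ι hι c, R.RepresentsAt ι hι hy v e := by
  have hex : ∀ y' : {y' : P // orbitMap G y' = c}, ∃ g : G, g • ι y = ι y' := fun y' => by
    obtain ⟨g, hg⟩ := exists_smul_eq_of_orbitMap_eq (y'.2.trans hy.symm)
    exact ⟨g, by rw [← hg, hι]⟩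
  choose γ hγ using hex
  -- By freeness the element moving `y` to a given point is unique. This makes the transported
  -- family consistent, hence equivariant.
  have huniq : ∀ g g' : G, g • ι y = g' • ι y → g = g' := by
    intro g g' hgg
    have h1 : g • y = g' • y := h.integral.injective (by rw [hι, hι, hgg])
    have h2 := h.free (g'⁻¹ * g) y (by rw [mul_smul, h1, inv_smul_smul])
    exact (inv_mul_eq_one.1 h2).symm
  let s : ∀ y' : {y' : P // orbitMap G y' = c}, R.QuotFiber (ι y') := fun y' =>
    Submodule.Quotient.mk ⟨R.actTo (γ y') (hγ y') v, h.actTo_mem_Kperp _ _ hv⟩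
  have hs : s ∈ R.reducedSubmodule ι hι c := by
    intro g y' hy' hgy'
    refine ⟨⟨R.actTo (γ ⟨y', hy'⟩) (hγ ⟨y', hy'⟩) v, h.actTo_mem_Kperp _ _ hv⟩,
      ⟨R.actTo (γ ⟨g • y', hgy'⟩) (hγ ⟨g • y', hgy'⟩) v, h.actTo_mem_Kperp _ _ hv⟩, rfl, rfl, ?_⟩
    have hg : g • ι y' = ι (g • y') := (hι g y').symm
    refine Eq.trans ?_ (R.mk_actTo g hg _)
    congr 1
    have h3 : γ ⟨g • y', hgy'⟩ = g * γ ⟨y', hy'⟩ := by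
      refine huniq _ _ ?_
      rw [hγ, mul_smul, hγ, hg]
    have h4 : (g * γ ⟨y', hy'⟩) • ι y = ι (g • y') := by rw [← h3, hγ]
    exact (R.actTo_congr h3 _ h4 v).trans (R.actTo_mul _ _ (hγ ⟨y', hy'⟩) hg h4 v)
  refine ⟨(⟨s, hs⟩ : R.reducedSubmodule ι hι c), hv, ?_⟩
  have h5 : γ ⟨y, hy⟩ = 1 := huniq _ _ (by rw [hγ, one_smul])
  change _ = s ⟨y, hy⟩
  have h6 : v = R.actTo (γ ⟨y, hy⟩) (hγ ⟨y, hy⟩) v :=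
    (R.actTo_one (one_smul _ _) v).symm.trans (R.actTo_congr h5.symm _ _ v)
  simp only [s]
  congr 2

theorem reducedEval_bijective [ConnectedSpace G] (h : IsReductionLeaf p m R ι)
    (hι : ∀ (g : G) (p : P), ι (g • p) = g • ι p) (y : P) :
    Function.Bijective (R.reducedEval ι hι y) := by
  constructor
  · intro e e' hee
    obtain ⟨v, hv⟩ := exists_representsAt (hι := hι) rfl e
    exact hv.ext h ⟨hv.1, hv.2.trans hee⟩
  · intro q
    obtain ⟨v, rfl⟩ := Submodule.Quotient.mk_surjective _ q
    obtain ⟨e, he⟩ := exists_representsAt_of_mem h hι rfl v.2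
    exact ⟨e, he.2.symm⟩

end ExtendedAction

end Leaf

/-! ### Smooth vector bundles from compatible fibre coordinates. -/

section BundleConstruction

variable {d r : ℕ} {X : Type*} [TopologicalSpace X] [ChartedSpace (EuclideanSpace ℝ (Fin d)) X]
  {V : X → Type*} [∀ c, AddCommGroup (V c)] [∀ c, Module ℝ (V c)]

variable (V) in
/-- Smoothly compatible local coordinates on a family of vector spaces. -/
structure FibreCoordinates (d r : ℕ) {X : Type*} [TopologicalSpace X]
    [ChartedSpace (EuclideanSpace ℝ (Fin d)) X]
    (V : X → Type*) [∀ c, AddCommGroup (V c)] [∀ c, Module ℝ (V c)] where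
  domain : X → Set X
  isOpen_domain : ∀ c, IsOpen (domain c)
  mem_domain : ∀ c, c ∈ domain c
  coord : ∀ c₀ c, c ∈ domain c₀ → V c ≃ₗ[ℝ] EuclideanSpace ℝ (Fin r)
  exists_change : ∀ c₀ c₁, ∃ a : Fin r → Fin r → X → ℝ,
    (∀ i j, ContMDiffOn (𝓡 d) 𝓘(ℝ, ℝ) ∞ (a i j) (domain c₀ ∩ domain c₁)) ∧
    ∀ c (h₀ : c ∈ domain c₀) (h₁ : c ∈ domain c₁) v j,
      coord c₁ c h₁ v j = ∑ i, a i j c * coord c₀ c h₀ v i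

namespace FibreCoordinates

variable (D : FibreCoordinates d r V)

open Classical in
/-- The pretrivialization given by the coordinates at `c₀`. -/
def pretrivialization (c₀ : X) : Pretrivialization (EuclideanSpace ℝ (Fin r))
    (π (EuclideanSpace ℝ (Fin r)) V) where
  toFun z := (z.1, if h : z.1 ∈ D.domain c₀ then D.coord c₀ z.1 h z.2 else 0)
  invFun z := ⟨z.1, if h : z.1 ∈ D.domain c₀ then (D.coord c₀ z.1 h).symm z.2 else 0⟩
  source := TotalSpace.proj ⁻¹' D.domain c₀
  target := D.domain c₀ ×ˢ univ
  map_source' z hz := ⟨hz, trivial⟩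
  map_target' z hz := hz.1
  left_inv' := by
    rintro ⟨c, v⟩ hc
    have hc' : c ∈ D.domain c₀ := hc
    simp [hc']
  right_inv' := by
    rintro ⟨c, v⟩ ⟨hc, -⟩
    have hc' : c ∈ D.domain c₀ := hc
    simp [hc']
  open_target := (D.isOpen_domain c₀).prod isOpen_univ
  baseSet := D.domain c₀
  open_baseSet := D.isOpen_domain c₀
  source_eq := rfl
  target_eq := rfl
  proj_toFun _ _ := rfl

theorem pretrivialization_apply {c₀ c : X} (hc : c ∈ D.domain c₀) (v : V c) :
    (D.pretrivialization c₀ ⟨c, v⟩).2 = D.coord c₀ c hc v :=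
  dif_pos hc

theorem pretrivialization_symm {c₀ c : X} (hc : c ∈ D.domain c₀)
    (z : EuclideanSpace ℝ (Fin r)) :
    (D.pretrivialization c₀).symm c z = (D.coord c₀ c hc).symm z := by
  apply (D.coord c₀ c hc).injective
  rw [← D.pretrivialization_apply hc, LinearEquiv.apply_symm_apply]
  have h1 := (D.pretrivialization c₀).apply_mk_symm (b := c) hc z
  rw [h1]

theorem exists_contMDiffOn_change (c₀ c₁ : X) :
    ∃ f : X → EuclideanSpace ℝ (Fin r) →L[ℝ] EuclideanSpace ℝ (Fin r),
      ContMDiffOn (𝓡 d) 𝓘(ℝ, EuclideanSpace ℝ (Fin r) →L[ℝ] EuclideanSpace ℝ (Fin r)) ∞ f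
        (D.domain c₀ ∩ D.domain c₁) ∧
      ∀ c ∈ D.domain c₀ ∩ D.domain c₁, ∀ z,
        f c z = (D.pretrivialization c₁ ⟨c, (D.pretrivialization c₀).symm c z⟩).2 := by
  obtain ⟨a, ha, hac⟩ := D.exists_change c₀ c₁
  let L : Fin r → Fin r → (EuclideanSpace ℝ (Fin r) →L[ℝ] EuclideanSpace ℝ (Fin r)) := fun i j =>
    (EuclideanSpace.proj i : EuclideanSpace ℝ (Fin r) →L[ℝ] ℝ).smulRight
      (EuclideanSpace.single j (1 : ℝ))
  refine ⟨fun c => ∑ i, ∑ j, a i j c • L i j, ?_, ?_⟩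
  · refine contMDiffOn_finset_sum fun i _ => contMDiffOn_finset_sum fun j _ => ?_
    exact (ha i j).smul contMDiffOn_const
  · rintro c ⟨h₀, h₁⟩ z
    rw [D.pretrivialization_apply h₁, D.pretrivialization_symm h₀]
    ext j
    rw [hac c h₀ h₁, LinearEquiv.apply_symm_apply]
    have h1 : (∑ i, ∑ j, a i j c • L i j) z = ∑ i, ∑ j, a i j c • L i j z := by
      simp [ContinuousLinearMap.sum_apply]
    rw [h1]
    simp [L, Finset.sum_apply, Pi.single_apply]

/-- The prebundle defined by smoothly compatible local coordinates. -/
def prebundle [∀ c, TopologicalSpace (V c)]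
    (ht : ∀ c, IsInducing (D.coord c c (D.mem_domain c))) :
    VectorPrebundle ℝ (EuclideanSpace ℝ (Fin r)) V where
  pretrivializationAtlas := range D.pretrivialization
  pretrivialization_linear' := by
    rintro _ ⟨c₀, rfl⟩
    refine ⟨fun c hc => ⟨fun v w => ?_, fun t v => ?_⟩⟩
    · have hc' : c ∈ D.domain c₀ := hc
      simp only [D.pretrivialization_apply hc', map_add]
    · have hc' : c ∈ D.domain c₀ := hc
      simp only [D.pretrivialization_apply hc', map_smul]
  pretrivializationAt := D.pretrivialization
  mem_base_pretrivializationAt := D.mem_domain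
  pretrivialization_mem_atlas c := ⟨c, rfl⟩
  exists_coordChange := by
    rintro _ ⟨c₀, rfl⟩ _ ⟨c₁, rfl⟩
    obtain ⟨f, hf, hfc⟩ := D.exists_contMDiffOn_change c₀ c₁
    exact ⟨f, hf.continuousOn, hfc⟩
  totalSpaceMk_isInducing c := by
    have h1 : (D.pretrivialization c ∘ TotalSpace.mk c) =
        (fun z => (c, z)) ∘ D.coord c c (D.mem_domain c) := by
      funext v
      exact Prod.ext rfl (D.pretrivialization_apply (D.mem_domain c) v)
    rw [h1]
    exact (isInducing_const_prod.2 IsInducing.id).comp (ht c)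

/-- Each fibre gets its topology from the coordinates centred at its own base point. Coordinates of
a section exist only over `domain c₀`, so the smoothness criterion is phrased with arbitrary
functions `f` that agree with them there. -/
theorem exists_vectorBundle [IsManifold (𝓡 d) ∞ X] :
    ∃ (_ : TopologicalSpace (TotalSpace (EuclideanSpace ℝ (Fin r)) V))
      (_ : ∀ c, TopologicalSpace (V c)) (_ : FiberBundle (EuclideanSpace ℝ (Fin r)) V)
      (_ : VectorBundle ℝ (EuclideanSpace ℝ (Fin r)) V)
      (_ : ContMDiffVectorBundle ∞ (EuclideanSpace ℝ (Fin r)) V (𝓡 d)),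
      ∀ (e : ∀ c, V c) (c₀ c' : X), c' ∈ D.domain c₀ → (
        ContMDiffAt (𝓡 d) ((𝓡 d).prod 𝓘(ℝ, EuclideanSpace ℝ (Fin r))) ∞
          (fun c => (⟨c, e c⟩ : TotalSpace (EuclideanSpace ℝ (Fin r)) V)) c' ↔
        ∀ f : Fin r → X → ℝ, (∀ c (hc : c ∈ D.domain c₀) i, D.coord c₀ c hc (e c) i = f i c) →
          ∀ i, ContMDiffAt (𝓡 d) 𝓘(ℝ, ℝ) ∞ (f i) c') := by
  letI : ∀ c, TopologicalSpace (V c) := fun c =>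
    TopologicalSpace.induced (D.coord c c (D.mem_domain c)) inferInstance
  let a := D.prebundle fun c => ⟨rfl⟩
  haveI : a.IsContMDiff (𝓡 d) ∞ := ⟨by
    rintro _ ⟨c₀, rfl⟩ _ ⟨c₁, rfl⟩
    exact D.exists_contMDiffOn_change c₀ c₁⟩
  letI := a.totalSpaceTopology
  letI := a.toFiberBundle
  letI := a.toVectorBundle
  haveI := a.contMDiffVectorBundle (n := ∞) (𝓡 d)
  refine ⟨_, _, a.toFiberBundle, a.toVectorBundle, a.contMDiffVectorBundle (𝓡 d), ?_⟩
  intro e c₀ c' hc'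
  have h0 : ContMDiffAt (𝓡 d) ((𝓡 d).prod 𝓘(ℝ, EuclideanSpace ℝ (Fin r))) ∞
      (fun c => (⟨c, e c⟩ : TotalSpace (EuclideanSpace ℝ (Fin r)) V)) c' ↔
      ContMDiffAt (𝓡 d) 𝓘(ℝ, EuclideanSpace ℝ (Fin r)) ∞
        (fun c => (D.pretrivialization c₀ ⟨c, e c⟩).2) c' :=
    (trivializationAt (EuclideanSpace ℝ (Fin r)) V c₀).contMDiffAt_section_iff hc'
  rw [h0]
  have hnhds := (D.isOpen_domain c₀).mem_nhds hc'
  constructor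
  · intro hs f hf i
    refine (((EuclideanSpace.proj i : EuclideanSpace ℝ (Fin r) →L[ℝ] ℝ).contMDiff
      (n := ∞)).contMDiffAt.comp c' hs).congr_of_eventuallyEq ?_
    filter_upwards [hnhds] with c hc
    rw [← hf c hc]
    change _ = (D.pretrivialization c₀ ⟨c, e c⟩).2 i
    rw [D.pretrivialization_apply hc]
  · intro hf
    have h2 := hf (fun i c => (D.pretrivialization c₀ ⟨c, e c⟩).2 i) fun c hc i => by
      rw [D.pretrivialization_apply hc]
    have h3 := contMDiffAt_pi_space.2 h2
    exact ((PiLp.continuousLinearEquiv 2 ℝ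
      (fun _ : Fin r => ℝ)).symm.toContinuousLinearMap.contMDiff (n := ∞)).contMDiffAt.comp c' h3

end FibreCoordinates

end BundleConstruction

/-! ### The reduced vector bundle. -/

section Leaf

variable {k n p m : ℕ}
  {G : Type*} [TopologicalSpace G] [ChartedSpace (EuclideanSpace ℝ (Fin k)) G] [Group G]
  [LieGroup (𝓡 k) ∞ G]
  {M : Type*} [TopologicalSpace M] [ChartedSpace (EuclideanSpace ℝ (Fin n)) M]
  [IsManifold (𝓡 n) ∞ M] [T2Space M] [MulAction G M] [ContMDiffSMul (𝓡 k) (𝓡 n) ∞ G M]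
  {F : Type*} [NormedAddCommGroup F] [NormedSpace ℝ F] [FiniteDimensional ℝ F]
  {E : M → Type*} [TopologicalSpace (TotalSpace F E)] [∀ x, AddCommGroup (E x)]
  [∀ x, Module ℝ (E x)] [∀ x, TopologicalSpace (E x)] [FiberBundle F E] [VectorBundle ℝ F E]
  [ContMDiffVectorBundle ∞ F E (𝓡 n)]
  {𝔞 : Type*} [AddCommGroup 𝔞] [Module ℝ 𝔞]
  {C : CourantAlgebroid n F E} {A : CourantAlgebra (GroupLieAlgebra (𝓡 k) G) 𝔞}
  {R : ExtendedAction C A}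
  {d r : ℕ} {P : Type*} [TopologicalSpace P] [ChartedSpace (EuclideanSpace ℝ (Fin p)) P]
  [IsManifold (𝓡 p) ∞ P] [MulAction G P] [ContMDiffSMul (𝓡 k) (𝓡 p) ∞ G P]
  [ChartedSpace (EuclideanSpace ℝ (Fin d)) (MulAction.orbitRel.Quotient G P)]
  {ι : P → M}

theorem ExtendedAction.pairing_act {x : M} {z : M} (g : G) (hg : g • x = z) (v : E x)
    (w : Cₛ^∞⟮𝓡 n; F, E⟯) :
    C.pairing (g • x) (R.act g x v) (w (g • x)) = C.pairing z (R.actTo g hg v) (w z) := by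
  subst hg
  rfl

theorem ExtendedAction.contMDiffAt_pairing_act (R : ExtendedAction C A) {E' H' N : Type*}
    [NormedAddCommGroup E'] [NormedSpace ℝ E'] [TopologicalSpace H'] {I' : ModelWithCorners ℝ E' H'}
    [TopologicalSpace N] [ChartedSpace H' N] {γ : N → G} {β : N → M} {z : N}
    (hγ : ContMDiffAt I' (𝓡 k) ∞ γ z) (hβ : ContMDiffAt I' (𝓡 n) ∞ β z)
    (v w : Cₛ^∞⟮𝓡 n; F, E⟯) :
    ContMDiffAt I' 𝓘(ℝ, ℝ) ∞ (fun z => C.pairing (γ z • β z)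
      (R.act (γ z) (β z) (v (β z))) (w (γ z • β z))) z :=
  C.contMDiffAt_pairing (β := fun z => γ z • β z)
    (R.contMDiffAt_actTo (β' := fun z => γ z • β z) (fun _ => rfl) hγ
      (v.contMDiff.contMDiffAt.comp z hβ))
    (w.contMDiff.contMDiffAt.comp z (hγ.smul hβ))

variable (p R d ι) in
/-- A local section of the orbit map with dual frames of `K^⊥ / (K ∩ K^⊥)` along it. -/
structure SliceFrame (r : ℕ) where
  domain : Set (MulAction.orbitRel.Quotient G P)
  isOpen_domain : IsOpen domain
  sec : MulAction.orbitRel.Quotient G P → P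
  elt : P → G
  w : Fin r → Cₛ^∞⟮𝓡 n; F, E⟯
  w' : Fin r → Cₛ^∞⟮𝓡 n; F, E⟯
  orbitMap_sec : ∀ c ∈ domain, orbitMap G (sec c) = c
  contMDiffAt_sec : ∀ c ∈ domain, ContMDiffAt (𝓡 d) (𝓡 p) ∞ sec c
  contMDiffAt_elt : ∀ y, orbitMap G y ∈ domain → ContMDiffAt (𝓡 p) (𝓡 k) ∞ elt y
  elt_smul : ∀ y, orbitMap G y ∈ domain → elt y • sec (orbitMap G y) = y
  frame : ∀ c ∈ domain, IsDualFrameAt R (ι (sec c)) w w'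

theorem IsReductionLeaf.exists_sliceFrame (h : IsReductionLeaf p m R ι)
    (hS : IsSmoothOrbitSpace k p d G P)
    (hr : ∀ x : P, Module.finrank ℝ (R.QuotFiber (ι x)) = r)
    (c : MulAction.orbitRel.Quotient G P) : ∃ T : SliceFrame p R d ι r, c ∈ T.domain := by
  obtain ⟨x, rfl⟩ := orbitMap_surjective G c
  obtain ⟨U, s, γ, hU, hxU, hsx, hs, hγ⟩ := hS.exists_section x
  obtain ⟨w, w', hw⟩ := h.exists_dualFrame hr x
  have h1 : ∀ᶠ c in 𝓝 (orbitMap G x), IsDualFrameAt R (ι (s c)) w w' := by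
    have h2 : Tendsto s (𝓝 (orbitMap G x)) (𝓝 x) := by
      have h3 := (hs _ hxU).2.continuousAt
      rwa [ContinuousAt, hsx] at h3
    exact h2.eventually hw
  obtain ⟨W, hW, hWo, hxW⟩ := eventually_nhds_iff.1 h1
  exact ⟨⟨U ∩ W, hU.inter hWo, s, γ, w, w', fun c hc => (hs c hc.1).1, fun c hc => (hs c hc.1).2,
    fun y hy => (hγ y hy.1).1, fun y hy => (hγ y hy.1).2, fun c hc => hW c hc.2⟩, hxU, hxW⟩

namespace SliceFrame

variable (T : SliceFrame p R d ι r) [ConnectedSpace G] (h : IsReductionLeaf p m R ι)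
  {hι : ∀ (g : G) (p : P), ι (g • p) = g • ι p} {c : MulAction.orbitRel.Quotient G P}

/-- The coordinates of an element of `E_red`. -/
def coordMap (hι : ∀ (g : G) (p : P), ι (g • p) = g • ι p) (hc : c ∈ T.domain) :
    R.ReducedFiber ι hι c →ₗ[ℝ] EuclideanSpace ℝ (Fin r) where
  -- The chosen representative is immaterial: two of them differ by an element of `K`, which pairs
  -- to zero with `w' i ∈ K^⊥`.
  toFun e := WithLp.toLp 2 fun i => C.pairing (ι (T.sec c))
    (ExtendedAction.exists_representsAt (T.orbitMap_sec c hc) e).choose (T.w' i (ι (T.sec c)))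
  map_add' e e' := by
    ext i
    have h1 := (ExtendedAction.exists_representsAt (T.orbitMap_sec c hc) e).choose_spec
    have h2 := (ExtendedAction.exists_representsAt (T.orbitMap_sec c hc) e').choose_spec
    have h3 := (ExtendedAction.exists_representsAt (T.orbitMap_sec c hc) (e + e')).choose_spec
    change C.pairing _ _ _ = C.pairing _ _ _ + C.pairing _ _ _
    rw [h3.pairing_eq (h1.add h2) ((T.frame c hc).mem' i), map_add, LinearMap.add_apply]
  map_smul' t e := by
    ext i
    have h1 := (ExtendedAction.exists_representsAt (T.orbitMap_sec c hc) e).choose_spec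
    have h3 := (ExtendedAction.exists_representsAt (T.orbitMap_sec c hc) (t • e)).choose_spec
    change C.pairing _ _ _ = t * C.pairing _ _ _
    rw [h3.pairing_eq (h1.smul t) ((T.frame c hc).mem' i), map_smul, LinearMap.smul_apply]
    rfl

theorem coordMap_apply (hc : c ∈ T.domain) {v : E (ι (T.sec c))} {e : R.ReducedFiber ι hι c}
    (hv : R.RepresentsAt ι hι (T.orbitMap_sec c hc) v e) (i : Fin r) :
    T.coordMap hι hc e i = C.pairing (ι (T.sec c)) v (T.w' i (ι (T.sec c))) :=
  (ExtendedAction.exists_representsAt (T.orbitMap_sec c hc) e).choose_spec.pairing_eq hv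
    ((T.frame c hc).mem' i)

theorem representsAt_sum (hc : c ∈ T.domain) (e : R.ReducedFiber ι hι c) :
    R.RepresentsAt ι hι (T.orbitMap_sec c hc)
      (∑ i, T.coordMap hι hc e i • T.w i (ι (T.sec c))) e := by
  obtain ⟨v, hv⟩ := ExtendedAction.exists_representsAt (T.orbitMap_sec c hc) e
  refine hv.of_sub_mem (Submodule.sum_mem _ fun i _ =>
    Submodule.smul_mem _ _ ((T.frame c hc).mem i)) ?_
  simp only [T.coordMap_apply hc hv]
  exact (T.frame c hc).complete v hv.1

include h in
theorem coordMap_bijective (hc : c ∈ T.domain) : Function.Bijective (T.coordMap hι hc) := by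
  constructor
  · refine (injective_iff_map_eq_zero _).2 fun e he => ?_
    have h1 := T.representsAt_sum hc e
    rw [he] at h1
    simp only [PiLp.zero_apply, zero_smul, Finset.sum_const_zero] at h1
    exact h1.ext h (ExtendedAction.RepresentsAt.zero _)
  · intro z
    obtain ⟨e, he⟩ := ExtendedAction.exists_representsAt_of_mem h hι (T.orbitMap_sec c hc)
      (v := ∑ i, z i • T.w i (ι (T.sec c))) (Submodule.sum_mem _ fun i _ =>
        Submodule.smul_mem _ _ ((T.frame c hc).mem i))
    refine ⟨e, ?_⟩
    ext i
    rw [T.coordMap_apply hc he]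
    simp [(T.frame c hc).dual]

include h in
/-- The element of the group which moves the point `T.sec c` to `y` transports the coordinates. -/
theorem representsAt_transport (hc : c ∈ T.domain) (e : R.ReducedFiber ι hι c) {y : P}
    (hy : orbitMap G y = c) :
    ∃ hg : T.elt y • ι (T.sec c) = ι y, R.RepresentsAt ι hι hy
      (∑ i, T.coordMap hι hc e i • R.actTo (T.elt y) hg (T.w i (ι (T.sec c)))) e := by
  subst hy
  have hg : T.elt y • ι (T.sec (orbitMap G y)) = ι y := by
    rw [← h.equivariant, T.elt_smul y hc]
  obtain ⟨_, h1⟩ := (T.representsAt_sum hc e).actTo h (T.elt y) hg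
  refine ⟨hg, ?_⟩
  simpa only [map_sum, map_smul] using h1

-- The two slices meet the orbit `c` in points that differ by `γ c = T.elt (T'.sec c)`. The
-- transition matrix pairs the transported frame of `T` with the dual frame of `T'`, and is smooth
-- because the action and the pairing are.
include h in
theorem exists_change (T' : SliceFrame p R d ι r) : ∃ a : Fin r → Fin r →
    MulAction.orbitRel.Quotient G P → ℝ,
    (∀ i j, ContMDiffOn (𝓡 d) 𝓘(ℝ, ℝ) ∞ (a i j) (T.domain ∩ T'.domain)) ∧
    ∀ c (h₀ : c ∈ T.domain) (h₁ : c ∈ T'.domain) (e : R.ReducedFiber ι hι c) j,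
      T'.coordMap hι h₁ e j = ∑ i, a i j c * T.coordMap hι h₀ e i := by
  let γ : MulAction.orbitRel.Quotient G P → G := fun c => T.elt (T'.sec c)
  refine ⟨fun i j c => C.pairing (γ c • ι (T.sec c)) (R.act (γ c) _ (T.w i (ι (T.sec c))))
    (T'.w' j (γ c • ι (T.sec c))), fun i j c hc => ?_, fun c h₀ h₁ e j => ?_⟩
  · have hγ : ContMDiffAt (𝓡 d) (𝓡 k) ∞ γ c :=
      (T.contMDiffAt_elt _ (by rw [T'.orbitMap_sec c hc.2]; exact hc.1)).comp c
        (T'.contMDiffAt_sec c hc.2)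
    exact (R.contMDiffAt_pairing_act hγ
      (h.contMDiff.contMDiffAt.comp c (T.contMDiffAt_sec c hc.1))
      (T.w i) (T'.w' j)).contMDiffWithinAt
  · obtain ⟨hg, h2⟩ := T.representsAt_transport h h₀ e (T'.orbitMap_sec c h₁)
    rw [T'.coordMap_apply h₁ h2]
    simp only [map_sum, map_smul, LinearMap.sum_apply, LinearMap.smul_apply, smul_eq_mul]
    refine Finset.sum_congr rfl fun i _ => ?_
    rw [ExtendedAction.pairing_act _ hg]
    exact mul_comm _ _

end SliceFrame

variable [ConnectedSpace G]

/-- Coordinates on `E_red` from slices. -/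
def sliceCoordinates (h : IsReductionLeaf p m R ι) (hι : ∀ (g : G) (p : P), ι (g • p) = g • ι p)
    (T : MulAction.orbitRel.Quotient G P → SliceFrame p R d ι r) (hT : ∀ c, c ∈ (T c).domain) :
    FibreCoordinates d r (R.ReducedFiber ι hι) where
  domain c := (T c).domain
  isOpen_domain c := (T c).isOpen_domain
  mem_domain := hT
  coord c₀ c hc := LinearEquiv.ofBijective ((T c₀).coordMap hι hc) ((T c₀).coordMap_bijective h hc)
  exists_change c₀ c₁ := (T c₀).exists_change h (T c₁)

/-- The reduced bundle. -/
theorem IsReductionLeaf.exists_isQuotientBundle (h : IsReductionLeaf p m R ι)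
    [IsManifold (𝓡 d) ∞ (MulAction.orbitRel.Quotient G P)]
    (hι : ∀ (g : G) (p : P), ι (g • p) = g • ι p) (hS : IsSmoothOrbitSpace k p d G P)
    (hr : ∀ x : P, Module.finrank ℝ (R.QuotFiber (ι x)) = r) :
    ∃ (_ : TopologicalSpace (TotalSpace (EuclideanSpace ℝ (Fin r)) (R.ReducedFiber ι hι)))
      (_ : ∀ c, TopologicalSpace (R.ReducedFiber ι hι c))
      (_ : FiberBundle (EuclideanSpace ℝ (Fin r)) (R.ReducedFiber ι hι))
      (_ : VectorBundle ℝ (EuclideanSpace ℝ (Fin r)) (R.ReducedFiber ι hι))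
      (_ : ContMDiffVectorBundle ∞ (EuclideanSpace ℝ (Fin r)) (R.ReducedFiber ι hι) (𝓡 d)),
      R.IsQuotientBundle ι hι d r := by
  choose T hT using h.exists_sliceFrame hS hr
  obtain ⟨i₁, i₂, i₃, i₄, i₅, hsec⟩ := (sliceCoordinates h hι T hT).exists_vectorBundle
  refine ⟨i₁, i₂, i₃, i₄, i₅, fun x => R.reducedEval_bijective h hι x, fun U hU e => ?_⟩
  have hq : Continuous (orbitMap G : P → MulAction.orbitRel.Quotient G P) :=
    hS.contMDiff.continuous
  constructor
  · intro hs x hx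
    set T₀ := T (orbitMap G x) with hT₀
    have hx₀ : orbitMap G x ∈ T₀.domain := hT _
    classical
    let f : Fin r → MulAction.orbitRel.Quotient G P → ℝ := fun i c =>
      if hc : c ∈ T₀.domain then T₀.coordMap hι hc (e c) i else 0
    have hfc : ∀ c (hc : c ∈ T₀.domain) i, f i c = T₀.coordMap hι hc (e c) i :=
      fun c hc i => dif_pos hc
    have hf : ∀ i c, c ∈ T₀.domain ∩ U → ContMDiffAt (𝓡 d) 𝓘(ℝ, ℝ) ∞ (f i) c := fun i c hc =>
      (hsec e (orbitMap G x) c hc.1).1 (hs.contMDiffAt (hU.mem_nhds hc.2)) f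
        (fun c hc i => (hfc c hc i).symm) i
    have hnear : ∀ᶠ y in 𝓝 x, orbitMap G y ∈ T₀.domain ∩ U :=
      hq.continuousAt.eventually ((T₀.isOpen_domain.inter hU).mem_nhds ⟨hx₀, hx⟩)
    obtain ⟨w, w', hw⟩ := h.exists_dualFrame hr x
    -- Coefficients, in a frame around `x`, of the representative transported from the slice. They
    -- are functions on `P` only; extending them to `M` produces the required section of `E`.
    let φ : Fin r → P → ℝ := fun j y => ∑ i, f i (orbitMap G y) *
      C.pairing (T₀.elt y • ι (T₀.sec (orbitMap G y)))
        (R.act (T₀.elt y) _ (T₀.w i (ι (T₀.sec (orbitMap G y)))))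
        (w' j (T₀.elt y • ι (T₀.sec (orbitMap G y))))
    have hφ : ∀ j, SmoothNear p (φ j) x := by
      intro j
      refine SmoothNear.sum fun i _ => ?_
      filter_upwards [hnear] with y hy
      refine ((hf i _ hy).comp y hS.contMDiff.contMDiffAt).mul ?_
      exact R.contMDiffAt_pairing_act (T₀.contMDiffAt_elt y hy.1)
        (h.contMDiff.contMDiffAt.comp y
          ((T₀.contMDiffAt_sec _ hy.1).comp y hS.contMDiff.contMDiffAt)) (T₀.w i) (w' j)
    choose Φ hΦ using fun j => h.integral.immersion.exists_extension (hφ j)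
    refine ⟨∑ j, funSMulSection (Φ j) (w j), ?_⟩
    filter_upwards [hnear, hw, eventually_all.2 hΦ] with y hy hwy hΦy
    obtain ⟨hg, h2⟩ := T₀.representsAt_transport h hy.1 (e (orbitMap G y)) rfl
    refine h2.of_sub_mem (v' := (∑ j, funSMulSection (Φ j) (w j)) (ι y)) ?_ ?_
    · rw [sum_section_apply]
      exact Submodule.sum_mem _ fun j _ => Submodule.smul_mem _ _ (hwy.mem j)
    · rw [sum_section_apply]
      refine (congrArg (fun u => _ - u ∈ R.K (ι y)) (Finset.sum_congr rfl fun j _ => ?_)).mpr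
        (hwy.complete _ h2.1)
      change Φ j (ι y) • w j (ι y) = _
      rw [hΦy]
      congr 1
      simp only [φ, map_sum, map_smul, LinearMap.sum_apply, LinearMap.smul_apply, smul_eq_mul]
      refine Finset.sum_congr rfl fun i _ => ?_
      rw [ExtendedAction.pairing_act _ hg]
      congr 1
      exact hfc _ hy.1 i
  · intro hl c hc
    refine ContMDiffAt.contMDiffWithinAt ?_
    refine (hsec e c c (hT c)).2 fun f hf i => ?_
    have hcc : c ∈ (T c).domain := hT c
    -- Conversely, a lift near the slice point computes the bundle coordinates as its pairings with
    -- the dual frame along the slice.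
    obtain ⟨v, hv⟩ := hl ((T c).sec c) (by rw [(T c).orbitMap_sec c hcc]; exact hc)
    have h1 : ContMDiffAt (𝓡 d) 𝓘(ℝ, ℝ) ∞ (fun c' => C.pairing (ι ((T c).sec c'))
        (v (ι ((T c).sec c'))) ((T c).w' i (ι ((T c).sec c')))) c :=
      (C.pairing_smooth v ((T c).w' i)).contMDiffAt.comp c
        (h.contMDiff.contMDiffAt.comp c ((T c).contMDiffAt_sec c hcc))
    refine h1.congr_of_eventuallyEq ?_
    filter_upwards [((T c).contMDiffAt_sec c hcc).continuousAt.eventually hv,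
      (T c).isOpen_domain.mem_nhds hcc] with c' hv' hc'
    rw [← hf c' hc' i]
    refine (T c).coordMap_apply hc' ?_ i
    have h2 : ∀ (c'' : MulAction.orbitRel.Quotient G P) (hc'' : orbitMap G ((T c).sec c') = c''),
        R.RepresentsAt ι hι hc'' (v (ι ((T c).sec c'))) (e c'') := by
      rintro _ rfl
      exact hv'
    exact h2 _ _

end Leaf

/-! ### Lifts of sections: invariance and equivariance of brackets. -/

section Leaf

variable {k n p m : ℕ}
  {G : Type*} [TopologicalSpace G] [ChartedSpace (EuclideanSpace ℝ (Fin k)) G] [Group G]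
  [LieGroup (𝓡 k) ∞ G]
  {M : Type*} [TopologicalSpace M] [ChartedSpace (EuclideanSpace ℝ (Fin n)) M]
  [IsManifold (𝓡 n) ∞ M] [T2Space M] [MulAction G M] [ContMDiffSMul (𝓡 k) (𝓡 n) ∞ G M]
  {F : Type*} [NormedAddCommGroup F] [NormedSpace ℝ F] [FiniteDimensional ℝ F]
  {E : M → Type*} [TopologicalSpace (TotalSpace F E)] [∀ x, AddCommGroup (E x)]
  [∀ x, Module ℝ (E x)] [∀ x, TopologicalSpace (E x)] [FiberBundle F E] [VectorBundle ℝ F E]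
  [ContMDiffVectorBundle ∞ F E (𝓡 n)]
  {𝔞 : Type*} [AddCommGroup 𝔞] [Module ℝ 𝔞]
  {C : CourantAlgebroid n F E} {A : CourantAlgebra (GroupLieAlgebra (𝓡 k) G) 𝔞}
  {R : ExtendedAction C A}
  {d : ℕ} {P : Type*} [TopologicalSpace P] [ChartedSpace (EuclideanSpace ℝ (Fin p)) P]
  [IsManifold (𝓡 p) ∞ P] [MulAction G P] [ContMDiffSMul (𝓡 k) (𝓡 p) ∞ G P]
  [ChartedSpace (EuclideanSpace ℝ (Fin d)) (MulAction.orbitRel.Quotient G P)]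
  {ι : P → M} {hι : ∀ (g : G) (p : P), ι (g • p) = g • ι p}

theorem eq_of_mvfderiv_infinitesimalAction_eq_zero [ConnectedSpace G] {L : P → ℝ}
    (hL : ∀ y, MDifferentiableAt (𝓡 p) 𝓘(ℝ, ℝ) L y)
    (h0 : ∀ y (u : GroupLieAlgebra (𝓡 k) G), mvfderiv (𝓡 p) L y (infinitesimalAction u y) = 0)
    (g : G) (x : P) : L (g • x) = L x := by
  have hO : ∀ g : G, MDifferentiableAt (𝓡 k) 𝓘(ℝ, ℝ) (fun g : G => L (g⁻¹ • x)) g := fun g =>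
    (hL _).comp g (((contMDiff_inv (𝓡 k) ∞).smul
      (contMDiff_const (I' := 𝓡 p))).contMDiffAt.mdifferentiableAt (by simp))
  have h1 := eq_of_mulInvariant_derivative_eq_zero (k := k) hO (fun g u => by
    refine (mfderiv_mulInvariantVectorField (hO g) u).trans ?_
    have h2 : (fun h : G => L ((g * h)⁻¹ • x)) = fun h : G => L (h⁻¹ • g⁻¹ • x) := by
      funext h
      rw [mul_inv_rev, mul_smul]
    rw [h2]
    exact (mvfderiv_infinitesimalAction (hL (g⁻¹ • x)) u).symm.trans (h0 _ _)) g⁻¹ 1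
  simpa using h1

theorem mvfderiv_comp_orbitMap_infinitesimalAction {φ : MulAction.orbitRel.Quotient G P → ℝ} {y : P}
    (hφ : MDifferentiableAt (𝓡 p) 𝓘(ℝ, ℝ) (fun y => φ (orbitMap G y)) y)
    (u : GroupLieAlgebra (𝓡 k) G) :
    mvfderiv (𝓡 p) (fun y => φ (orbitMap G y)) y (infinitesimalAction u y) = 0 := by
  rw [mvfderiv_infinitesimalAction hφ]
  simp only [orbitMap_smul]
  exact mvfderiv_const_apply _ _ _

/-- Coordinate functions, extended globally, separate tangent vectors. Identities between vectors on
`P/G` are checked by this test. -/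
theorem eq_of_forall_mvfderiv_eq {m : ℕ} {X : Type*} [TopologicalSpace X]
    [ChartedSpace (EuclideanSpace ℝ (Fin m)) X] [IsManifold (𝓡 m) ∞ X] [T2Space X] {c : X}
    {u u' : TangentSpace (𝓡 m) c}
    (h : ∀ φ : C^∞⟮𝓡 m, X; 𝓘(ℝ, ℝ), ℝ⟯, mvfderiv (𝓡 m) φ c u = mvfderiv (𝓡 m) φ c u') :
    u = u' := by
  have hsrc := (chartAt (EuclideanSpace ℝ (Fin m)) c).open_source.mem_nhds
    (mem_chart_source (EuclideanSpace ℝ (Fin m)) c)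
  have hφ : ∀ᶠ y in 𝓝 c, ContMDiffAt (𝓡 m) (𝓡 m) ∞ (extChartAt (𝓡 m) c) y := by
    filter_upwards [hsrc] with y hy using contMDiffAt_extChartAt' hy
  have hcoord : ∀ i (u : TangentSpace (𝓡 m) c), ∃ Φ : C^∞⟮𝓡 m, X; 𝓘(ℝ, ℝ), ℝ⟯,
      ∀ u : TangentSpace (𝓡 m) c, mvfderiv (𝓡 m) Φ c u = chartVector c u i := by
    intro i u
    let pr : EuclideanSpace ℝ (Fin m) →L[ℝ] ℝ := EuclideanSpace.proj i
    have hfs : SmoothNear m (fun y => pr (extChartAt (𝓡 m) c y)) c := by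
      filter_upwards [hφ] with y hy
      exact pr.contMDiff.contMDiffAt.comp y hy
    obtain ⟨Φ, hΦ⟩ := hfs.exists_contMDiffMap
    refine ⟨Φ, fun u => ?_⟩
    rw [Filter.EventuallyEq.mvfderiv_eq hΦ, chartVector_eq_mfderiv (mem_chart_source _ c)]
    exact mvfderiv_clm_apply pr (hφ.self_of_nhds.mdifferentiableAt (by simp)) u
  have h1 : chartVector c u = chartVector c u' := by
    ext i
    obtain ⟨Φ, hΦ⟩ := hcoord i u
    rw [← hΦ, ← hΦ, h]
  exact ((trivializationAt (EuclideanSpace ℝ (Fin m)) (TangentSpace (𝓡 m)) c).linearEquivAt ℝ c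
    (FiberBundle.mem_baseSet_trivializationAt' c)).injective h1

namespace ExtendedAction

theorem push_eq_actTo (R : ExtendedAction C A) {g : G} {x z : M} (hg : g • z = x)
    (v : Cₛ^∞⟮𝓡 n; F, E⟯) : R.push g v x = R.actTo g hg (v z) := by
  have h1 : ∀ z' (hz : z' = z) (hg' : g • z' = x), R.actTo g hg' (v z') = R.actTo g hg (v z) := by
    rintro _ rfl _
    rfl
  exact h1 _ (by rw [← hg, inv_smul_smul]) _

theorem IsLiftAt.eventually_representsAt {x : P} {v : Cₛ^∞⟮𝓡 n; F, E⟯}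
    {e : ∀ c : MulAction.orbitRel.Quotient G P, R.ReducedFiber ι hι c}
    (hv : R.IsLiftAt ι hι x v e) :
    ∀ᶠ y in 𝓝 x, ∀ c (hy : orbitMap G y = c), R.RepresentsAt ι hι hy (v (ι y)) (e c) := by
  filter_upwards [hv] with y hy
  rintro _ rfl
  exact hy

theorem IsLiftAt.eventually_isLiftAt {x : P} {v : Cₛ^∞⟮𝓡 n; F, E⟯}
    {e : ∀ c : MulAction.orbitRel.Quotient G P, R.ReducedFiber ι hι c}
    (hv : R.IsLiftAt ι hι x v e) : ∀ᶠ y in 𝓝 x, R.IsLiftAt ι hι y v e :=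
  eventually_eventually_nhds.2 hv

theorem IsLiftAt.representsAt {x : P} {v : Cₛ^∞⟮𝓡 n; F, E⟯}
    {e : ∀ c : MulAction.orbitRel.Quotient G P, R.ReducedFiber ι hι c}
    (hv : R.IsLiftAt ι hι x v e) {c : MulAction.orbitRel.Quotient G P} (hy : orbitMap G x = c) :
    R.RepresentsAt ι hι hy (v (ι x)) (e c) :=
  hv.eventually_representsAt.self_of_nhds c hy

end ExtendedAction

namespace IsReductionLeaf

variable [ConnectedSpace G] (h : IsReductionLeaf p m R ι)
include h

theorem eventually_inv_smul {S : P → Prop} {g₀ : G} {x : P} (hS : ∀ᶠ y in 𝓝 (g₀⁻¹ • x), S y) :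
    ∀ᶠ g in 𝓝 g₀, S (g⁻¹ • x) := by
  have hc : ContinuousAt (fun g : G => g⁻¹ • x) g₀ :=
    ((contMDiff_inv (𝓡 k) ∞).smul (contMDiff_const (I' := 𝓡 p))).continuous.continuousAt
  exact hc.eventually hS

/-- For `w ∈ K^⊥` the function `g ↦ ⟨w, g v(g⁻¹ x)⟩` is constant near `1`, since all these vectors
represent the same element; its derivative is `⟨w, [ρ(a), v]⟩`, which gives membership in `K`.
Membership in `K^⊥` is (C4) applied to `⟨v, ρ(b)⟩ = 0` along `P`. -/
theorem bracket_toSection_mem {x : P} {v : Cₛ^∞⟮𝓡 n; F, E⟯}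
    {e : ∀ c : MulAction.orbitRel.Quotient G P, R.ReducedFiber ι hι c}
    (hv : R.IsLiftAt ι hι x v e) (a : 𝔞) :
    C.bracket (R.toSection a) v (ι x) ∈ R.K (ι x) ⊓ R.Kperp (ι x) := by
  constructor
  · refine R.mem_K_of_forall_pairing fun w hw => ?_
    have h1 := R.mvfderiv_linear_push (C.pairing (ι x) w) v a 1
    rw [R.push_one] at h1
    rw [← h1]
    have h2 : (fun g : G => C.pairing (ι x) w (R.push g v (ι x))) =ᶠ[𝓝 1]
        fun _ => C.pairing (ι x) w (v (ι x)) := by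
      have h3 : ∀ᶠ y in 𝓝 ((1 : G)⁻¹ • x), ∀ c (hy : orbitMap G y = c),
          R.RepresentsAt ι hι hy (v (ι y)) (e c) := by
        rw [inv_one, one_smul]
        exact hv.eventually_representsAt
      filter_upwards [h.eventually_inv_smul h3] with g hg
      have hgx : g • ι (g⁻¹ • x) = ι x := by rw [← hι, smul_inv_smul]
      obtain ⟨_, h4⟩ := (hg (orbitMap G x) (orbitMap_smul _ _)).actTo h g hgx
      rw [R.push_eq_actTo hgx, C.pairing_symm, h4.pairing_eq (hv.representsAt rfl) hw,
        C.pairing_symm]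
    rw [h2.mvfderiv_eq]
    exact mvfderiv_const_apply _ _ _
  · refine R.mem_Kperp_iff.2 fun b => ?_
    have h1 := C.invariance (R.toSection a) v (R.toSection b) (ι x)
    have hK : ∀ᶠ y in 𝓝 x, v (ι y) ∈ R.Kperp (ι y) := by
      filter_upwards [hv] with y hy using hy.1
    rw [h.mvfderiv_anchor_eq_zero (Submodule.mem_sup_left (R.toSection_mem_K a _))
      (C.mdifferentiableAt_pairing v (R.toSection b) _) (h.pairing_toSection_eventually hK b),
      ← R.map_bracket, R.pairing_eq_zero hK.self_of_nhds (R.toSection_mem_K _ _), add_zero] at h1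
    exact h1.symm

/-- Lifts of sections of `E_red` are invariant. -/
theorem isInvariantNear {x : P} {v : Cₛ^∞⟮𝓡 n; F, E⟯}
    {e : ∀ c : MulAction.orbitRel.Quotient G P, R.ReducedFiber ι hι c}
    (hv : R.IsLiftAt ι hι x v e) : IsInvariantNear R ι x v := by
  filter_upwards [hv.eventually_isLiftAt] with y hy
  exact ⟨hy.self_of_nhds.1, fun a => h.bracket_toSection_mem hy a⟩

/-- The bracket of lifts only depends on the sections, modulo `K`. -/
theorem bracket_sub_bracket_mem_K {x : P} {v₁ v₁' v₂ v₂' : Cₛ^∞⟮𝓡 n; F, E⟯}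
    {e₁ e₂ : ∀ c : MulAction.orbitRel.Quotient G P, R.ReducedFiber ι hι c}
    (h₁ : R.IsLiftAt ι hι x v₁ e₁) (h₁' : R.IsLiftAt ι hι x v₁' e₁)
    (h₂ : R.IsLiftAt ι hι x v₂ e₂) (h₂' : R.IsLiftAt ι hι x v₂' e₂) :
    C.bracket v₁ v₂ (ι x) - C.bracket v₁' v₂' (ι x) ∈ R.K (ι x) := by
  have hnull : ∀ {v v' : Cₛ^∞⟮𝓡 n; F, E⟯}
      {e : ∀ c : MulAction.orbitRel.Quotient G P, R.ReducedFiber ι hι c},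
      R.IsLiftAt ι hι x v e → R.IsLiftAt ι hι x v' e →
      ∀ᶠ y in 𝓝 x, (v - v') (ι y) ∈ R.K (ι y) ⊓ R.Kperp (ι y) := by
    intro v v' e hv hv'
    filter_upwards [hv.eventually_representsAt, hv'.eventually_representsAt] with y hy hy'
    exact ⟨(hy _ rfl).sub_mem (hy' _ rfl), Submodule.sub_mem _ (hy _ rfl).1 (hy' _ rfl).1⟩
  -- Change one argument at a time: `[v₁, v₂ - v₂'] + [v₁ - v₁', v₂']`, where the differences lie in
  -- `K ∩ K^⊥` along `P`.
  have e1 := (h.bracket_mem_K (h.isInvariantNear h₁) (hnull h₂ h₂')).1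
  have e2 := (h.bracket_mem_K (h.isInvariantNear h₂') (hnull h₁ h₁')).2
  have e3 := Submodule.add_mem _ e1 e2
  rw [map_sub, map_sub, LinearMap.sub_apply] at e3
  have e4 : (C.bracket v₁ v₂ - C.bracket v₁ v₂') (ι x) +
      (C.bracket v₁ v₂' - C.bracket v₁' v₂') (ι x) =
      C.bracket v₁ v₂ (ι x) - C.bracket v₁' v₂' (ι x) := by
    change (C.bracket v₁ v₂ (ι x) - C.bracket v₁ v₂' (ι x)) +
      (C.bracket v₁ v₂' (ι x) - C.bracket v₁' v₂' (ι x)) = _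
    abel
  rwa [e4] at e3

/-- The bracket of lifts is equivariant, modulo `K`. -/
theorem actTo_bracket_sub_mem_K {x y : P} {g : G} (hg : g • ι x = ι y)
    {v₁ v₁' v₂ v₂' : Cₛ^∞⟮𝓡 n; F, E⟯}
    {e₁ e₂ : ∀ c : MulAction.orbitRel.Quotient G P, R.ReducedFiber ι hι c}
    (hl : ∀ z : P, orbitMap G z = orbitMap G x → ∃ v₁ v₂ : Cₛ^∞⟮𝓡 n; F, E⟯,
      R.IsLiftAt ι hι z v₁ e₁ ∧ R.IsLiftAt ι hι z v₂ e₂)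
    (h₁ : R.IsLiftAt ι hι x v₁ e₁) (h₂ : R.IsLiftAt ι hι x v₂ e₂)
    (h₁' : R.IsLiftAt ι hι y v₁' e₁) (h₂' : R.IsLiftAt ι hι y v₂' e₂) :
    R.actTo g hg (C.bracket v₁ v₂ (ι x)) - C.bracket v₁' v₂' (ι y) ∈ R.K (ι y) := by
  refine R.mem_K_of_forall_pairing fun w hw => ?_
  have hgy : g • x = y := h.integral.injective (by rw [hι, hg])
  have hl' : ∀ g : G, ∃ v₁ v₂ : Cₛ^∞⟮𝓡 n; F, E⟯,
      R.IsLiftAt ι hι (g⁻¹ • y) v₁ e₁ ∧ R.IsLiftAt ι hι (g⁻¹ • y) v₂ e₂ := fun g =>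
    hl _ (by rw [orbitMap_smul, ← hgy, orbitMap_smul])
  choose V₁ V₂ hV using hl'
  have hgz : ∀ g : G, g • ι (g⁻¹ • y) = ι y := fun g => by rw [← hι, smul_inv_smul]
  -- The transported bracket tested against `w`, with lifts chosen separately at each `g⁻¹ y`. The
  -- value does not depend on these choices, so near `g₀` the lifts chosen at `g₀` may be used and
  -- `l` is smooth.
  let l : G → ℝ := fun g => C.pairing (ι y) w
    (R.actTo g (hgz g) (C.bracket (V₁ g) (V₂ g) (ι (g⁻¹ • y))))
  have hloc : ∀ g₀ : G, l =ᶠ[𝓝 g₀] fun g =>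
      C.pairing (ι y) w (R.push g (C.bracket (V₁ g₀) (V₂ g₀)) (ι y)) := by
    intro g₀
    filter_upwards [h.eventually_inv_smul (hV g₀).1.eventually_isLiftAt,
      h.eventually_inv_smul (hV g₀).2.eventually_isLiftAt] with g hg1 hg2
    rw [R.push_eq_actTo (hgz g)]
    have h3 := h.bracket_sub_bracket_mem_K (hV g).1 hg1 (hV g).2 hg2
    have h4 := R.pairing_eq_zero hw (h.actTo_mem_K g (hgz g) h3)
    rw [map_sub, map_sub] at h4
    exact sub_eq_zero.1 h4
  have hls : ∀ g, MDifferentiableAt (𝓡 k) 𝓘(ℝ, ℝ) l g := fun g =>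
    ((R.contMDiff_linear_push (C.pairing (ι y) w)
      (C.bracket (V₁ g) (V₂ g))).contMDiffAt.congr_of_eventuallyEq (hloc g)).mdifferentiableAt
      (by simp)
  have hl0 : ∀ g (u : GroupLieAlgebra (𝓡 k) G),
      mvfderiv (𝓡 k) l g (mulInvariantVectorField u g) = 0 := by
    intro g u
    obtain ⟨a, rfl⟩ := R.exact.proj_surjective u
    -- The derivative is the transport of `[ρ(a), [V₁, V₂]]`. By (C1) this is `[[ρ(a), V₁], V₂] +
    -- [V₁, [ρ(a), V₂]]`, and both terms are brackets with sections of `K ∩ K^⊥`, hence in `K`.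
    rw [(hloc g).mvfderiv_eq, R.mvfderiv_linear_push, C.jacobi, R.push_eq_actTo (hgz g)]
    refine R.pairing_eq_zero hw (h.actTo_mem_K g (hgz g) ?_)
    have i₁ := h.isInvariantNear (hV g).1
    have i₂ := h.isInvariantNear (hV g).2
    exact Submodule.add_mem _ (h.bracket_mem_K i₂ (i₁.mono fun y hy => hy.2 a)).2
      (h.bracket_mem_K i₁ (i₂.mono fun y hy => hy.2 a)).1
  have h5 := eq_of_mulInvariant_derivative_eq_zero (k := k) hls hl0 g 1
  have h6 : l g = C.pairing (ι y) w (R.actTo g hg (C.bracket v₁ v₂ (ι x))) := by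
    have hx : g⁻¹ • y = x := by rw [← hgy, inv_smul_smul]
    have h7 : ∀ z (hz : z = x) (hgz : g • ι z = ι y) (W₁ W₂ : Cₛ^∞⟮𝓡 n; F, E⟯),
        R.IsLiftAt ι hι z W₁ e₁ → R.IsLiftAt ι hι z W₂ e₂ →
        C.pairing (ι y) w (R.actTo g hgz (C.bracket W₁ W₂ (ι z))) =
          C.pairing (ι y) w (R.actTo g hg (C.bracket v₁ v₂ (ι x))) := by
      rintro z rfl hgz W₁ W₂ hW₁ hW₂
      have h8 := R.pairing_eq_zero hw
        (h.actTo_mem_K g hgz (h.bracket_sub_bracket_mem_K hW₁ h₁ hW₂ h₂))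
      rw [map_sub, map_sub] at h8
      exact sub_eq_zero.1 h8
    exact h7 _ hx _ _ _ (hV g).1 (hV g).2
  have h6' : l 1 = C.pairing (ι y) w (C.bracket v₁' v₂' (ι y)) := by
    have h7 : ∀ z (hz : z = y) (hgz : (1 : G) • ι z = ι y) (W₁ W₂ : Cₛ^∞⟮𝓡 n; F, E⟯),
        R.IsLiftAt ι hι z W₁ e₁ → R.IsLiftAt ι hι z W₂ e₂ →
        C.pairing (ι y) w (R.actTo 1 hgz (C.bracket W₁ W₂ (ι z))) =
          C.pairing (ι y) w (C.bracket v₁' v₂' (ι y)) := by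
      rintro z rfl hgz W₁ W₂ hW₁ hW₂
      rw [R.actTo_one]
      have h8 := R.pairing_eq_zero hw (h.bracket_sub_bracket_mem_K hW₁ h₁' hW₂ h₂')
      rw [map_sub] at h8
      exact sub_eq_zero.1 h8
    exact h7 _ (by rw [inv_one, one_smul]) _ _ _ (hV 1).1 (hV 1).2
  rw [map_sub, ← h6, ← h6', h5, sub_self]

end IsReductionLeaf

end Leaf

theorem exists_linearMap_chartVector {m : ℕ} {N : Type*} [TopologicalSpace N]
    [ChartedSpace (EuclideanSpace ℝ (Fin m)) N] [IsManifold (𝓡 m) ∞ N] {x₀ y : N}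
    (hy : y ∈ (chartAt (EuclideanSpace ℝ (Fin m)) x₀).source) :
    ∃ L : TangentSpace (𝓡 m) y →ₗ[ℝ] EuclideanSpace ℝ (Fin m), ∀ u, L u = chartVector x₀ u :=
  ⟨(mfderiv (𝓡 m) (𝓡 m) (extChartAt (𝓡 m) x₀) y).toLinearMap, fun u =>
    (chartVector_eq_mfderiv hy u).symm⟩

/-- A fibrewise linear map to the tangent bundle is smooth if it maps smooth sections to smooth
vector fields. -/
theorem contMDiff_bundleMap_of_sections {m : ℕ} {X : Type*} [TopologicalSpace X]
    [ChartedSpace (EuclideanSpace ℝ (Fin m)) X] [IsManifold (𝓡 m) ∞ X] [T2Space X]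
    {F : Type*} [NormedAddCommGroup F] [NormedSpace ℝ F] [FiniteDimensional ℝ F]
    {V : X → Type*} [TopologicalSpace (TotalSpace F V)] [∀ x, AddCommGroup (V x)]
    [∀ x, Module ℝ (V x)] [∀ x, TopologicalSpace (V x)] [FiberBundle F V] [VectorBundle ℝ F V]
    [ContMDiffVectorBundle ∞ F V (𝓡 m)] (α : ∀ x, V x →ₗ[ℝ] TangentSpace (𝓡 m) x)
    (hα : ∀ (e : Cₛ^∞⟮𝓡 m; F, V⟯) x, ContMDiffAt (𝓡 m) (𝓡 m).tangent ∞
      (fun y => (⟨y, α y (e y)⟩ : TangentBundle (𝓡 m) X)) x) :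
    ContMDiff ((𝓡 m).prod 𝓘(ℝ, F)) (𝓡 m).tangent ∞
      (fun v : TotalSpace F V => (⟨v.proj, α v.proj v.2⟩ : TangentBundle (𝓡 m) X)) := by
  intro v₀
  let b := Module.finBasis ℝ F
  obtain ⟨s, hs⟩ := exists_local_frame (m := m) (V := V) b v₀.proj
  rw [contMDiffAt_totalSpace]
  have hproj : ContMDiffAt ((𝓡 m).prod 𝓘(ℝ, F)) (𝓡 m) ∞ (fun v : TotalSpace F V => v.proj) v₀ :=
    (contMDiff_proj V).contMDiffAt
  refine ⟨hproj, ?_⟩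
  have hid : ContMDiffAt ((𝓡 m).prod 𝓘(ℝ, F)) ((𝓡 m).prod 𝓘(ℝ, F)) ∞
      (fun v : TotalSpace F V => v) v₀ := contMDiffAt_id
  have hcoord : ContMDiffAt ((𝓡 m).prod 𝓘(ℝ, F)) 𝓘(ℝ, F) ∞
      (fun v : TotalSpace F V => (trivializationAt F V v₀.proj v).2) v₀ :=
    (contMDiffAt_totalSpace.1 hid).2
  have hsum : ContMDiffAt ((𝓡 m).prod 𝓘(ℝ, F)) 𝓘(ℝ, EuclideanSpace ℝ (Fin m)) ∞
      (fun v : TotalSpace F V => ∑ i, b.repr (trivializationAt F V v₀.proj v).2 i •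
        chartVector v₀.proj (α v.proj (s i v.proj))) v₀ := by
    refine ContMDiffAt.sum fun i _ => ?_
    let l : F →L[ℝ] ℝ := LinearMap.toContinuousLinearMap (b.coord i)
    have h0 : ContMDiffAt ((𝓡 m).prod 𝓘(ℝ, F)) 𝓘(ℝ, ℝ) ∞
        (fun v : TotalSpace F V => b.repr (trivializationAt F V v₀.proj v).2 i) v₀ :=
      l.contMDiff.contMDiffAt.comp v₀ hcoord
    have h1 : ContMDiffAt (𝓡 m) 𝓘(ℝ, EuclideanSpace ℝ (Fin m)) ∞
        (fun y => chartVector v₀.proj (α y (s i y))) v₀.proj :=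
      (contMDiffAt_totalSpace.1 (hα (s i) v₀.proj)).2
    exact h0.smul (h1.comp v₀ hproj)
  refine hsum.congr_of_eventuallyEq ?_
  have hsrc : ∀ᶠ v in 𝓝 v₀, v.proj ∈ (chartAt (EuclideanSpace ℝ (Fin m)) v₀.proj).source :=
    hproj.continuousAt.eventually ((chartAt (EuclideanSpace ℝ (Fin m)) v₀.proj).open_source.mem_nhds
      (mem_chart_source _ _))
  filter_upwards [hproj.continuousAt.eventually hs, hsrc] with v hv hv'
  obtain ⟨L, hL⟩ := exists_linearMap_chartVector hv'
  change chartVector v₀.proj (α v.proj v.2) = _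
  rw [← hL]
  simp only [← hL]
  conv_lhs => rw [hv v.2]
  rw [map_sum, map_sum]
  simp only [map_smul]

/-! ### The projected anchor. -/

section Leaf

variable {k n p m : ℕ}
  {G : Type*} [TopologicalSpace G] [ChartedSpace (EuclideanSpace ℝ (Fin k)) G] [Group G]
  [LieGroup (𝓡 k) ∞ G]
  {M : Type*} [TopologicalSpace M] [ChartedSpace (EuclideanSpace ℝ (Fin n)) M]
  [IsManifold (𝓡 n) ∞ M] [T2Space M] [MulAction G M] [ContMDiffSMul (𝓡 k) (𝓡 n) ∞ G M]
  {F : Type*} [NormedAddCommGroup F] [NormedSpace ℝ F] [FiniteDimensional ℝ F]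
  {E : M → Type*} [TopologicalSpace (TotalSpace F E)] [∀ x, AddCommGroup (E x)]
  [∀ x, Module ℝ (E x)] [∀ x, TopologicalSpace (E x)] [FiberBundle F E] [VectorBundle ℝ F E]
  [ContMDiffVectorBundle ∞ F E (𝓡 n)]
  {𝔞 : Type*} [AddCommGroup 𝔞] [Module ℝ 𝔞]
  {C : CourantAlgebroid n F E} {A : CourantAlgebra (GroupLieAlgebra (𝓡 k) G) 𝔞}
  {R : ExtendedAction C A}
  {d r : ℕ} {P : Type*} [TopologicalSpace P] [ChartedSpace (EuclideanSpace ℝ (Fin p)) P]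
  [IsManifold (𝓡 p) ∞ P] [MulAction G P] [ContMDiffSMul (𝓡 k) (𝓡 p) ∞ G P]
  [ChartedSpace (EuclideanSpace ℝ (Fin d)) (MulAction.orbitRel.Quotient G P)]
  {ι : P → M} {hι : ∀ (g : G) (p : P), ι (g • p) = g • ι p}
  [IsManifold (𝓡 d) ∞ (MulAction.orbitRel.Quotient G P)]
  [TopologicalSpace (TotalSpace (EuclideanSpace ℝ (Fin r)) (R.ReducedFiber ι hι))]
  [∀ c, TopologicalSpace (R.ReducedFiber ι hι c)]
  [FiberBundle (EuclideanSpace ℝ (Fin r)) (R.ReducedFiber ι hι)]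
  [VectorBundle ℝ (EuclideanSpace ℝ (Fin r)) (R.ReducedFiber ι hι)]

namespace ExtendedAction

theorem IsQuotientBundle.exists_isLiftAt (Q : R.IsQuotientBundle ι hι d r)
    (e : Cₛ^∞⟮𝓡 d; EuclideanSpace ℝ (Fin r), R.ReducedFiber ι hι⟯) (x : P) :
    ∃ v : Cₛ^∞⟮𝓡 n; F, E⟯, R.IsLiftAt ι hι x v e :=
  (Q.smooth_iff univ isOpen_univ e).1 e.contMDiff.contMDiffOn x (mem_univ _)

theorem IsQuotientBundle.exists_section_eq (Q : R.IsQuotientBundle ι hι d r)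
    (e : ∀ c : MulAction.orbitRel.Quotient G P, R.ReducedFiber ι hι c)
    (he : ∀ x : P, ∃ v : Cₛ^∞⟮𝓡 n; F, E⟯, R.IsLiftAt ι hι x v e) :
    ∃ s : Cₛ^∞⟮𝓡 d; EuclideanSpace ℝ (Fin r), R.ReducedFiber ι hι⟯, ∀ c, s c = e c :=
  ⟨⟨e, contMDiffOn_univ.1 ((Q.smooth_iff univ isOpen_univ e).2 fun x _ => he x)⟩, fun _ => rfl⟩

end ExtendedAction

namespace IsReductionLeaf

variable (C p d) in
/-- The vector tangent to the orbit space determined by the anchor of an element of `E` at a point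
of the orbit `c`. -/
def projAnchor (ι : P → M) {c : MulAction.orbitRel.Quotient G P} {y : P} (_ : orbitMap G y = c)
    (v : E (ι y)) : TangentSpace (𝓡 d) c :=
  mfderiv (𝓡 p) (𝓡 d) (orbitMap G) y (C.leafAnchor p ι y v)

variable {c : MulAction.orbitRel.Quotient G P} {y : P}

theorem projAnchor_add (hy : orbitMap G y = c) (v w : E (ι y)) :
    projAnchor p C d ι hy (v + w) =
      projAnchor p C d ι hy v + projAnchor p C d ι hy w := by
  subst hy
  exact (congrArg _ (map_add _ v w)).trans (map_add _ _ _)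

theorem projAnchor_smul (hy : orbitMap G y = c) (t : ℝ) (v : E (ι y)) :
    projAnchor p C d ι hy (t • v) = t • projAnchor p C d ι hy v := by
  subst hy
  exact (congrArg _ (map_smul _ t v)).trans (map_smul _ _ _)

theorem mvfderiv_projAnchor (hS : IsSmoothOrbitSpace k p d G P) (hy : orbitMap G y = c)
    (v : E (ι y)) {φ : MulAction.orbitRel.Quotient G P → ℝ}
    (hφ : MDifferentiableAt (𝓡 d) 𝓘(ℝ, ℝ) φ c) :
    mvfderiv (𝓡 d) φ c (projAnchor p C d ι hy v) =
      mvfderiv (𝓡 p) (fun y => φ (orbitMap G y)) y (C.leafAnchor p ι y v) := by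
  subst hy
  exact (mfderiv_comp_apply y hφ (hS.contMDiff.contMDiffAt.mdifferentiableAt (by simp)) _).symm

variable (h : IsReductionLeaf p m R ι)
include h

/-- Anchors of elements of `K` are infinitesimal actions, and functions pulled back from `P/G` are
constant on orbits. -/
theorem projAnchor_eq_zero (hS : IsSmoothOrbitSpace k p d G P) [T2Space (MulAction.orbitRel.Quotient G P)]
    (hy : orbitMap G y = c) {v : E (ι y)}
    (hv : v ∈ R.K (ι y)) : projAnchor p C d ι hy v = 0 := by
  obtain ⟨b, rfl⟩ := hv
  refine eq_of_forall_mvfderiv_eq fun φ => ?_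
  rw [mvfderiv_projAnchor hS hy _ (φ.contMDiff.contMDiffAt.mdifferentiableAt (by simp))]
  change mvfderiv (𝓡 p) _ y (C.leafAnchor p ι y (R.toSection b (ι y))) = _
  rw [h.leafAnchor_toSection, map_zero]
  exact mvfderiv_comp_orbitMap_infinitesimalAction
    ((φ.contMDiff.comp hS.contMDiff).contMDiffAt.mdifferentiableAt (by simp)) _

theorem projAnchor_congr (hS : IsSmoothOrbitSpace k p d G P)
    [T2Space (MulAction.orbitRel.Quotient G P)] (hy : orbitMap G y = c) {v v' : E (ι y)}
    (hv : v - v' ∈ R.K (ι y)) : projAnchor p C d ι hy v = projAnchor p C d ι hy v' := by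
  have h1 := projAnchor_add (p := p) (C := C) (d := d) hy (v - v') v'
  rw [h.projAnchor_eq_zero hS hy hv, zero_add, sub_add_cancel] at h1
  exact h1

/-- The derivative of a function `φ` on the orbit space along the projected anchor, in terms of an
extension `Φ` to `M` of its pullback to `P`. -/
theorem mvfderiv_projAnchor_eq (hS : IsSmoothOrbitSpace k p d G P) (hy : orbitMap G y = c)
    {v : E (ι y)} (hv : v ∈ R.K (ι y) ⊔ R.Kperp (ι y)) {φ : MulAction.orbitRel.Quotient G P → ℝ}
    (hφ : MDifferentiableAt (𝓡 d) 𝓘(ℝ, ℝ) φ c) {Φ : M → ℝ}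
    (hΦ : MDifferentiableAt (𝓡 n) 𝓘(ℝ, ℝ) Φ (ι y)) (hf : ∀ᶠ z in 𝓝 y, Φ (ι z) = φ (orbitMap G z)) :
    mvfderiv (𝓡 d) φ c (projAnchor p C d ι hy v) =
      mvfderiv (𝓡 n) Φ (ι y) (C.anchor (ι y) v) := by
  rw [mvfderiv_projAnchor hS hy v hφ]
  exact h.mvfderiv_leafAnchor hv hΦ hf

theorem exists_pullback_extension (hS : IsSmoothOrbitSpace k p d G P)
    {φ : MulAction.orbitRel.Quotient G P → ℝ} (x : P) (hφ : SmoothNear d φ (orbitMap G x)) :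
    ∃ Φ : C^∞⟮𝓡 n, M; 𝓘(ℝ, ℝ), ℝ⟯, ∀ᶠ y in 𝓝 x, Φ (ι y) = φ (orbitMap G y) :=
  h.integral.immersion.exists_extension (f := fun y => φ (orbitMap G y))
    (hφ.comp (Eventually.of_forall fun y => hS.contMDiff y))

/-- Commuting derivations, `π(ρ(a)) π(v) φ = π([ρ(a), v]) φ + π(v) π(ρ(a)) φ`. The first term
vanishes because `[ρ(a), v]` lies in `K`, the second because the pullback of `φ` is invariant. So
`π(v) φ` is constant along orbits. -/
theorem mvfderiv_infinitesimalAction_lift [ConnectedSpace G] (hS : IsSmoothOrbitSpace k p d G P)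
    (φ : C^∞⟮𝓡 d, MulAction.orbitRel.Quotient G P; 𝓘(ℝ, ℝ), ℝ⟯) {x : P} {v : Cₛ^∞⟮𝓡 n; F, E⟯}
    {e : ∀ c : MulAction.orbitRel.Quotient G P, R.ReducedFiber ι hι c}
    (hv : R.IsLiftAt ι hι x v e) :
    MDifferentiableAt (𝓡 p) 𝓘(ℝ, ℝ) (fun y => mvfderiv (𝓡 p) (fun y => φ (orbitMap G y)) y
      (C.leafAnchor p ι y (v (ι y)))) x ∧
    ∀ u : GroupLieAlgebra (𝓡 k) G, mvfderiv (𝓡 p) (fun y => mvfderiv (𝓡 p)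
      (fun y => φ (orbitMap G y)) y (C.leafAnchor p ι y (v (ι y)))) x
      (infinitesimalAction u x) = 0 := by
  obtain ⟨Φ, hΦ⟩ := h.exists_pullback_extension hS x (φ.contMDiff.smoothNear _)
  have hΦd : ∀ z, MDifferentiableAt (𝓡 n) 𝓘(ℝ, ℝ) Φ z := fun z =>
    Φ.contMDiff.contMDiffAt.mdifferentiableAt (by simp)
  have hvK : ∀ᶠ y in 𝓝 x, v (ι y) ∈ R.Kperp (ι y) := hv.mono fun y hy => hy.1
  have hφd : ∀ y, MDifferentiableAt (𝓡 p) 𝓘(ℝ, ℝ) (fun y => φ (orbitMap G y)) y := fun y =>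
    (φ.contMDiff.comp hS.contMDiff).contMDiffAt.mdifferentiableAt (by simp)
  have hL : (fun y => mvfderiv (𝓡 p) (fun y => φ (orbitMap G y)) y
      (C.leafAnchor p ι y (v (ι y)))) =ᶠ[𝓝 x]
      fun y => mvfderiv (𝓡 n) Φ (ι y) (C.anchor (ι y) (v (ι y))) := by
    filter_upwards [hvK, hΦ.eventually_nhds] with y hy hy'
    exact h.mvfderiv_leafAnchor (Submodule.mem_sup_right hy) (hΦd _) hy'
  have hs : ∀ w : Cₛ^∞⟮𝓡 n; F, E⟯, ContMDiff (𝓡 n) 𝓘(ℝ, ℝ) ∞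
      fun z => mvfderiv (𝓡 n) Φ z (C.anchor z (w z)) := fun w => C.contMDiff_mvfderiv_anchor Φ w
  refine ⟨(((hs v).contMDiffAt.comp x h.contMDiff.contMDiffAt).congr_of_eventuallyEq
    hL).mdifferentiableAt (by simp), fun u => ?_⟩
  obtain ⟨a, rfl⟩ := R.exact.proj_surjective u
  have hK0 : ∀ (b : 𝔞) (y : P), mvfderiv (𝓡 p) (fun y => φ (orbitMap G y)) y
      (C.leafAnchor p ι y (R.toSection b (ι y))) = 0 := fun b y => by
    rw [h.leafAnchor_toSection]
    exact mvfderiv_comp_orbitMap_infinitesimalAction (hφd y) _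
  rw [← h.leafAnchor_toSection]
  have h1 := h.mvfderiv_leafAnchor (Submodule.mem_sup_left (R.toSection_mem_K a (ι x)))
    ((hs v).contMDiffAt.mdifferentiableAt (by simp)) (EventuallyEq.symm hL)
  rw [h1]
  have h2 := mvfderiv_mlieBracket (f := Φ)
    (C.anchor_smooth.comp (R.toSection a).contMDiff).contMDiffAt
    (C.anchor_smooth.comp v.contMDiff).contMDiffAt (Φ.contMDiff.smoothNear (ι x))
  have h3 : mvfderiv (𝓡 n) Φ (ι x) (C.anchor (ι x) (C.bracket (R.toSection a) v (ι x))) = 0 := by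
    obtain ⟨⟨b, hb⟩, -⟩ := h.bracket_toSection_mem hv a
    have hb' : R.toSection b (ι x) = C.bracket (R.toSection a) v (ι x) := hb
    rw [← hb', ← h.mvfderiv_leafAnchor (Submodule.mem_sup_left (R.toSection_mem_K b (ι x)))
      (hΦd _) hΦ, hK0]
  have h4 : mvfderiv (𝓡 n) (fun z => mvfderiv (𝓡 n) Φ z (C.anchor z (R.toSection a z))) (ι x)
      (C.anchor (ι x) (v (ι x))) = 0 := by
    refine h.mvfderiv_anchor_eq_zero (Submodule.mem_sup_right hvK.self_of_nhds)
      ((hs _).contMDiffAt.mdifferentiableAt (by simp)) ?_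
    filter_upwards [hΦ.eventually_nhds] with y hy
    rw [← h.mvfderiv_leafAnchor (Submodule.mem_sup_left (R.toSection_mem_K a (ι y))) (hΦd _) hy,
      hK0]
  rw [C.anchor_bracket] at h3
  have h5 := h2.symm.trans h3
  exact (sub_eq_zero.1 h5).trans h4

/-- The projected anchors of representatives at two points of an orbit agree. -/
theorem projAnchor_eq_projAnchor [ConnectedSpace G] (hS : IsSmoothOrbitSpace k p d G P)
    [T2Space (MulAction.orbitRel.Quotient G P)]
    [ContMDiffVectorBundle ∞ (EuclideanSpace ℝ (Fin r)) (R.ReducedFiber ι hι) (𝓡 d)]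
    (Q : R.IsQuotientBundle ι hι d r) {y y' : P} (hy : orbitMap G y = c) (hy' : orbitMap G y' = c)
    {e : R.ReducedFiber ι hι c} {v : E (ι y)} {v' : E (ι y')}
    (hv : R.RepresentsAt ι hι hy v e) (hv' : R.RepresentsAt ι hι hy' v' e) :
    projAnchor p C d ι hy v = projAnchor p C d ι hy' v' := by
  obtain ⟨s, rfl⟩ := exists_section_eq (m := d) (F := EuclideanSpace ℝ (Fin r)) c e
  refine eq_of_forall_mvfderiv_eq fun φ => ?_
  have hφc : MDifferentiableAt (𝓡 d) 𝓘(ℝ, ℝ) φ c :=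
    φ.contMDiff.contMDiffAt.mdifferentiableAt (by simp)
  rw [mvfderiv_projAnchor hS hy v hφc, mvfderiv_projAnchor hS hy' v' hφc]
  choose V hV using fun y : P => ExtendedAction.exists_representsAt (R := R) (ι := ι) (hι := hι)
    (y := y) rfl (s (orbitMap G y))
  -- The representatives `V y` are chosen without regularity. `L` is nevertheless smooth, because it
  -- may be computed with a local lift, whose values differ from them by elements of `K`.
  let L : P → ℝ := fun y => mvfderiv (𝓡 p) (fun y => φ (orbitMap G y)) y
    (C.leafAnchor p ι y (V y))
  have hcongr : ∀ (z : P) (w : E (ι z)) (hz : orbitMap G z = orbitMap G z),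
      R.RepresentsAt ι hι hz w (s (orbitMap G z)) →
      L z = mvfderiv (𝓡 p) (fun y => φ (orbitMap G y)) z (C.leafAnchor p ι z w) := by
    intro z w hz hw
    have h1 := h.projAnchor_congr hS hz ((hV z).sub_mem hw)
    have hφz : MDifferentiableAt (𝓡 d) 𝓘(ℝ, ℝ) φ (orbitMap G z) :=
      φ.contMDiff.contMDiffAt.mdifferentiableAt (by simp)
    have h2 := mvfderiv_projAnchor (C := C) hS hz (V z) hφz
    have h3 := mvfderiv_projAnchor (C := C) hS hz w hφz
    exact h2.symm.trans ((congrArg _ h1).trans h3)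
  have hcongr' : ∀ (z : P) (hz : orbitMap G z = c) (w : E (ι z)),
      R.RepresentsAt ι hι hz w (s c) →
      L z = mvfderiv (𝓡 p) (fun y => φ (orbitMap G y)) z (C.leafAnchor p ι z w) := by
    rintro z rfl w hw
    exact hcongr z w rfl hw
  rw [← hcongr' y hy v hv, ← hcongr' y' hy' v' hv']
  have hloc : ∀ x : P, MDifferentiableAt (𝓡 p) 𝓘(ℝ, ℝ) L x ∧
      ∀ u : GroupLieAlgebra (𝓡 k) G, mvfderiv (𝓡 p) L x (infinitesimalAction u x) = 0 := by
    intro x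
    obtain ⟨w, hw⟩ := Q.exists_isLiftAt s x
    have h1 : L =ᶠ[𝓝 x] fun y => mvfderiv (𝓡 p) (fun y => φ (orbitMap G y)) y
        (C.leafAnchor p ι y (w (ι y))) := by
      filter_upwards [hw] with z hz using hcongr z _ rfl hz
    obtain ⟨h2, h3⟩ := h.mvfderiv_infinitesimalAction_lift hS φ hw
    refine ⟨h2.congr_of_eventuallyEq h1, fun u => ?_⟩
    rw [h1.mvfderiv_eq]
    exact h3 u
  obtain ⟨g, rfl⟩ := exists_smul_eq_of_orbitMap_eq (hy.trans hy'.symm)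
  exact eq_of_mvfderiv_infinitesimalAction_eq_zero (fun x => (hloc x).1) (fun x => (hloc x).2) g y'

end IsReductionLeaf

end Leaf

/-! ### Pairing, anchor and bracket on the reduced bundle. -/

section Leaf

variable {k n p m : ℕ}
  {G : Type*} [TopologicalSpace G] [ChartedSpace (EuclideanSpace ℝ (Fin k)) G] [Group G]
  [LieGroup (𝓡 k) ∞ G]
  {M : Type*} [TopologicalSpace M] [ChartedSpace (EuclideanSpace ℝ (Fin n)) M]
  [IsManifold (𝓡 n) ∞ M] [T2Space M] [MulAction G M] [ContMDiffSMul (𝓡 k) (𝓡 n) ∞ G M]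
  {F : Type*} [NormedAddCommGroup F] [NormedSpace ℝ F] [FiniteDimensional ℝ F]
  {E : M → Type*} [TopologicalSpace (TotalSpace F E)] [∀ x, AddCommGroup (E x)]
  [∀ x, Module ℝ (E x)] [∀ x, TopologicalSpace (E x)] [FiberBundle F E] [VectorBundle ℝ F E]
  [ContMDiffVectorBundle ∞ F E (𝓡 n)]
  {𝔞 : Type*} [AddCommGroup 𝔞] [Module ℝ 𝔞]
  {C : CourantAlgebroid n F E} {A : CourantAlgebra (GroupLieAlgebra (𝓡 k) G) 𝔞}
  {R : ExtendedAction C A}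
  {d r : ℕ} {P : Type*} [TopologicalSpace P] [ChartedSpace (EuclideanSpace ℝ (Fin p)) P]
  [IsManifold (𝓡 p) ∞ P] [MulAction G P] [ContMDiffSMul (𝓡 k) (𝓡 p) ∞ G P]
  [ChartedSpace (EuclideanSpace ℝ (Fin d)) (MulAction.orbitRel.Quotient G P)]
  {ι : P → M} {hι : ∀ (g : G) (p : P), ι (g • p) = g • ι p}
  [IsManifold (𝓡 d) ∞ (MulAction.orbitRel.Quotient G P)]
  [TopologicalSpace (TotalSpace (EuclideanSpace ℝ (Fin r)) (R.ReducedFiber ι hι))]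
  [∀ c, TopologicalSpace (R.ReducedFiber ι hι c)]
  [FiberBundle (EuclideanSpace ℝ (Fin r)) (R.ReducedFiber ι hι)]
  [VectorBundle ℝ (EuclideanSpace ℝ (Fin r)) (R.ReducedFiber ι hι)]

namespace ExtendedAction.IsLiftAt

variable {x : P} {v v' : Cₛ^∞⟮𝓡 n; F, E⟯}
  {e e' : ∀ c : MulAction.orbitRel.Quotient G P, R.ReducedFiber ι hι c}

theorem add (hv : R.IsLiftAt ι hι x v e) (hv' : R.IsLiftAt ι hι x v' e') :
    R.IsLiftAt ι hι x (v + v') (e + e') := by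
  filter_upwards [hv, hv'] with y hy hy'
  exact RepresentsAt.add hy hy'

theorem smul (t : ℝ) (hv : R.IsLiftAt ι hι x v e) : R.IsLiftAt ι hι x (t • v) (t • e) := by
  filter_upwards [hv] with y hy
  exact RepresentsAt.smul t hy

theorem funSMul (hv : R.IsLiftAt ι hι x v e) {Φ : C^∞⟮𝓡 n, M; 𝓘(ℝ, ℝ), ℝ⟯}
    {φ : MulAction.orbitRel.Quotient G P → ℝ} (hΦ : ∀ᶠ y in 𝓝 x, Φ (ι y) = φ (orbitMap G y)) :
    R.IsLiftAt ι hι x (funSMulSection Φ v) fun c => φ c • e c := by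
  filter_upwards [hv, hΦ] with y hy hy'
  have h1 := RepresentsAt.smul (φ (orbitMap G y)) hy
  rw [← hy'] at h1
  change R.RepresentsAt ι hι _ (Φ (ι y) • v (ι y)) (φ (orbitMap G y) • e (orbitMap G y))
  rwa [← hy']

end ExtendedAction.IsLiftAt

theorem IsSmoothOrbitSpace.exists_localSection (hS : IsSmoothOrbitSpace k p d G P) {x : P}
    {c : MulAction.orbitRel.Quotient G P} (hx : orbitMap G x = c) :
    ∃ s : MulAction.orbitRel.Quotient G P → P, s c = x ∧
      ∀ᶠ c' in 𝓝 c, orbitMap G (s c') = c' ∧ ContMDiffAt (𝓡 d) (𝓡 p) ∞ s c' := by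
  subst hx
  obtain ⟨U, s, γ, hU, hxU, hsx, hs, -⟩ := hS.exists_section x
  exact ⟨s, hsx, eventually_of_mem (hU.mem_nhds hxU) hs⟩

namespace IsReductionLeaf

variable {c : MulAction.orbitRel.Quotient G P} (h : IsReductionLeaf p m R ι)
include h

/-- Compose with a local section of the orbit map: smoothness downstairs is read off from a smooth
function on `M`. -/
theorem smoothNear_of_pullback (hS : IsSmoothOrbitSpace k p d G P) {x : P}
    (hx : orbitMap G x = c) {f : MulAction.orbitRel.Quotient G P → ℝ} {Ψ : M → ℝ}
    (hΨ : ContMDiff (𝓡 n) 𝓘(ℝ, ℝ) ∞ Ψ) (hf : ∀ᶠ y in 𝓝 x, f (orbitMap G y) = Ψ (ι y)) :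
    SmoothNear d f c := by
  obtain ⟨s, hsx, hs⟩ := hS.exists_localSection hx
  have h1 : SmoothNear d (fun c => Ψ (ι (s c))) c := by
    filter_upwards [hs] with c' hc'
    exact (hΨ.comp h.contMDiff).contMDiffAt.comp c' hc'.2
  refine h1.congr ?_
  have h2 : ContinuousAt s c := hs.self_of_nhds.2.continuousAt
  rw [ContinuousAt, hsx] at h2
  filter_upwards [hs, h2.eventually hf] with c' hc' hc''
  rw [← hc'', hc'.1]

/-- The form is computed at one chosen point of each orbit. Elements of `K` pair to zero with `K^⊥`,
and the action is isometric, so any other point and representatives give the same value. -/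
theorem exists_reducedPairing [ConnectedSpace G] (hι : ∀ (g : G) (p : P), ι (g • p) = g • ι p) :
    ∃ β : ∀ c : MulAction.orbitRel.Quotient G P, LinearMap.BilinForm ℝ (R.ReducedFiber ι hι c),
      ∀ c y (hy : orbitMap G y = c) v v' e e', R.RepresentsAt ι hι hy v e →
        R.RepresentsAt ι hι hy v' e' → β c e e' = C.pairing (ι y) v v' := by
  choose V hV using fun c : MulAction.orbitRel.Quotient G P =>
    ExtendedAction.exists_representsAt (R := R) (ι := ι) (hι := hι) (y := c.out) (orbitMap_out c)
  refine ⟨fun c => LinearMap.mk₂ ℝ (fun e e' => C.pairing _ (V c e) (V c e')) ?_ ?_ ?_ ?_, ?_⟩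
  · intro e₁ e₂ e'
    rw [(hV c _).pairing_congr ((hV c e₁).add (hV c e₂)) (hV c e') (hV c e'), map_add,
      LinearMap.add_apply]
  · intro t e e'
    rw [(hV c _).pairing_congr ((hV c e).smul t) (hV c e') (hV c e'), map_smul,
      LinearMap.smul_apply]
  · intro e e₁ e₂
    rw [(hV c e).pairing_congr (hV c e) (hV c _) ((hV c e₁).add (hV c e₂)), map_add]
  · intro t e e'
    rw [(hV c e).pairing_congr (hV c e) (hV c _) ((hV c e').smul t), map_smul]
  · intro c y hy v v' e e' hv hv'
    obtain ⟨g, hg⟩ := exists_smul_eq_of_orbitMap_eq ((orbitMap_out c).trans hy.symm)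
    have hg' : g • ι y = ι c.out := by rw [← hι, hg]
    obtain ⟨_, h1⟩ := hv.actTo h g hg'
    obtain ⟨_, h2⟩ := hv'.actTo h g hg'
    exact ((hV c e).pairing_congr h1 (hV c e') h2).trans (R.pairing_actTo g hg' _ _)

theorem exists_reducedAnchor [ConnectedSpace G] (hS : IsSmoothOrbitSpace k p d G P)
    [T2Space (MulAction.orbitRel.Quotient G P)]
    [ContMDiffVectorBundle ∞ (EuclideanSpace ℝ (Fin r)) (R.ReducedFiber ι hι) (𝓡 d)]
    (Q : R.IsQuotientBundle ι hι d r) :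
    ∃ α : ∀ c : MulAction.orbitRel.Quotient G P,
      R.ReducedFiber ι hι c →ₗ[ℝ] TangentSpace (𝓡 d) c,
      ∀ c y (hy : orbitMap G y = c) v e, R.RepresentsAt ι hι hy v e →
        α c e = projAnchor p C d ι hy v := by
  choose V hV using fun c : MulAction.orbitRel.Quotient G P =>
    ExtendedAction.exists_representsAt (R := R) (ι := ι) (hι := hι) (y := c.out) (orbitMap_out c)
  refine ⟨fun c => ⟨⟨fun e => projAnchor p C d ι (orbitMap_out c) (V c e), ?_⟩, ?_⟩, ?_⟩
  · intro e e'
    rw [← projAnchor_add]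
    exact h.projAnchor_eq_projAnchor hS Q _ _ (hV c _) ((hV c e).add (hV c e'))
  · intro t e
    refine Eq.trans ?_ (projAnchor_smul (orbitMap_out c) t (V c e))
    exact h.projAnchor_eq_projAnchor hS Q _ _ (hV c _) ((hV c e).smul t)
  · intro c y hy v e hv
    exact h.projAnchor_eq_projAnchor hS Q _ _ (hV c _) hv

/-- The bracket of sections of the reduced bundle. -/
theorem exists_reducedBracket [ConnectedSpace G]
    (Q : R.IsQuotientBundle ι hι d r) :
    ∃ br : Cₛ^∞⟮𝓡 d; EuclideanSpace ℝ (Fin r), R.ReducedFiber ι hι⟯ →ₗ[ℝ]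
        Cₛ^∞⟮𝓡 d; EuclideanSpace ℝ (Fin r), R.ReducedFiber ι hι⟯ →ₗ[ℝ]
        Cₛ^∞⟮𝓡 d; EuclideanSpace ℝ (Fin r), R.ReducedFiber ι hι⟯,
      ∀ x v₁ v₂ (e₁ e₂ : Cₛ^∞⟮𝓡 d; EuclideanSpace ℝ (Fin r), R.ReducedFiber ι hι⟯),
        R.IsLiftAt ι hι x v₁ e₁ → R.IsLiftAt ι hι x v₂ e₂ →
        R.IsLiftAt ι hι x (C.bracket v₁ v₂) (br e₁ e₂) := by
  have key : ∀ e₁ e₂ : Cₛ^∞⟮𝓡 d; EuclideanSpace ℝ (Fin r), R.ReducedFiber ι hι⟯,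
      ∃ s : Cₛ^∞⟮𝓡 d; EuclideanSpace ℝ (Fin r), R.ReducedFiber ι hι⟯,
      ∀ x v₁ v₂, R.IsLiftAt ι hι x v₁ e₁ → R.IsLiftAt ι hι x v₂ e₂ →
        R.IsLiftAt ι hι x (C.bracket v₁ v₂) s := by
    intro e₁ e₂
    choose V₁ hV₁ using Q.exists_isLiftAt e₁
    choose V₂ hV₂ using Q.exists_isLiftAt e₂
    have hK : ∀ {x : P} {v₁ v₂ : Cₛ^∞⟮𝓡 n; F, E⟯}, R.IsLiftAt ι hι x v₁ e₁ →
        R.IsLiftAt ι hι x v₂ e₂ → C.bracket v₁ v₂ (ι x) ∈ R.Kperp (ι x) := fun h₁ h₂ =>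
      h.bracket_mem_Kperp (h.isInvariantNear h₁) (h₂.mono fun y hy => hy.1)
    choose f hf using fun c : MulAction.orbitRel.Quotient G P =>
      ExtendedAction.exists_representsAt_of_mem h hι (orbitMap_out c)
        (hK (hV₁ c.out) (hV₂ c.out))
    -- The value `f c` was fixed at one point of the orbit; equivariance modulo `K` shows that it is
    -- represented by the bracket of any lifts at any other point.
    have hrep : ∀ c y (hy : orbitMap G y = c) (v₁ v₂ : Cₛ^∞⟮𝓡 n; F, E⟯),
        R.IsLiftAt ι hι y v₁ e₁ → R.IsLiftAt ι hι y v₂ e₂ →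
        R.RepresentsAt ι hι hy (C.bracket v₁ v₂ (ι y)) (f c) := by
      intro c y hy v₁ v₂ h₁ h₂
      obtain ⟨g, hg⟩ := exists_smul_eq_of_orbitMap_eq (hy.trans (orbitMap_out c).symm)
      have hg' : g • ι c.out = ι y := by rw [← hι, hg]
      obtain ⟨_, h3⟩ := (hf c).actTo h g hg'
      exact h3.of_sub_mem (hK h₁ h₂) (h.actTo_bracket_sub_mem_K hg'
        (fun z _ => ⟨V₁ z, V₂ z, hV₁ z, hV₂ z⟩) (hV₁ _) (hV₂ _) h₁ h₂)
    have hlift : ∀ x (v₁ v₂ : Cₛ^∞⟮𝓡 n; F, E⟯), R.IsLiftAt ι hι x v₁ e₁ →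
        R.IsLiftAt ι hι x v₂ e₂ → R.IsLiftAt ι hι x (C.bracket v₁ v₂) f := by
      intro x v₁ v₂ h₁ h₂
      filter_upwards [h₁.eventually_isLiftAt, h₂.eventually_isLiftAt] with y hy₁ hy₂
      exact hrep _ y rfl v₁ v₂ hy₁ hy₂
    obtain ⟨s, hs⟩ := Q.exists_section_eq f fun x => ⟨_, hlift x _ _ (hV₁ x) (hV₂ x)⟩
    refine ⟨s, fun x v₁ v₂ h₁ h₂ => ?_⟩
    rw [show (s : ∀ c, R.ReducedFiber ι hι c) = f from funext hs]
    exact hlift x v₁ v₂ h₁ h₂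
  choose br hbr using key
  -- Sections of `E_red` agree if they have common lifts. This reduces bilinearity to that of the
  -- bracket of `E`.
  have hext : ∀ s s' : Cₛ^∞⟮𝓡 d; EuclideanSpace ℝ (Fin r), R.ReducedFiber ι hι⟯,
      (∀ x, ∃ v, R.IsLiftAt ι hι x v s ∧ R.IsLiftAt ι hι x v s') → s = s' := by
    intro s s' hss
    refine ContMDiffSection.ext fun c => ?_
    obtain ⟨v, hv, hv'⟩ := hss c.out
    exact (hv.representsAt (orbitMap_out c)).ext h (hv'.representsAt (orbitMap_out c))
  refine ⟨LinearMap.mk₂ ℝ br ?_ ?_ ?_ ?_, fun x v₁ v₂ e₁ e₂ => hbr e₁ e₂ x v₁ v₂⟩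
  · intro e₁ e₁' e₂
    refine hext _ _ fun x => ?_
    obtain ⟨v₁, h₁⟩ := Q.exists_isLiftAt e₁ x
    obtain ⟨v₁', h₁'⟩ := Q.exists_isLiftAt e₁' x
    obtain ⟨v₂, h₂⟩ := Q.exists_isLiftAt e₂ x
    refine ⟨_, hbr _ _ x _ _ (h₁.add h₁') h₂, ?_⟩
    rw [map_add]
    exact (hbr _ _ x _ _ h₁ h₂).add (hbr _ _ x _ _ h₁' h₂)
  · intro t e₁ e₂
    refine hext _ _ fun x => ?_
    obtain ⟨v₁, h₁⟩ := Q.exists_isLiftAt e₁ x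
    obtain ⟨v₂, h₂⟩ := Q.exists_isLiftAt e₂ x
    refine ⟨_, hbr _ _ x _ _ (h₁.smul t) h₂, ?_⟩
    rw [map_smul]
    exact (hbr _ _ x _ _ h₁ h₂).smul t
  · intro e₁ e₂ e₂'
    refine hext _ _ fun x => ?_
    obtain ⟨v₁, h₁⟩ := Q.exists_isLiftAt e₁ x
    obtain ⟨v₂, h₂⟩ := Q.exists_isLiftAt e₂ x
    obtain ⟨v₂', h₂'⟩ := Q.exists_isLiftAt e₂' x
    refine ⟨_, hbr _ _ x _ _ h₁ (h₂.add h₂'), ?_⟩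
    rw [map_add]
    exact (hbr _ _ x _ _ h₁ h₂).add (hbr _ _ x _ _ h₁ h₂')
  · intro t e₁ e₂
    refine hext _ _ fun x => ?_
    obtain ⟨v₁, h₁⟩ := Q.exists_isLiftAt e₁ x
    obtain ⟨v₂, h₂⟩ := Q.exists_isLiftAt e₂ x
    refine ⟨_, hbr _ _ x _ _ h₁ (h₂.smul t), ?_⟩
    rw [map_smul]
    exact (hbr _ _ x _ _ h₁ h₂).smul t

end IsReductionLeaf

end Leaf

/-! ### The Courant algebroid axioms for the reduced bundle. -/

section Leaf

variable {k n p m : ℕ}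
  {G : Type*} [TopologicalSpace G] [ChartedSpace (EuclideanSpace ℝ (Fin k)) G] [Group G]
  [LieGroup (𝓡 k) ∞ G]
  {M : Type*} [TopologicalSpace M] [ChartedSpace (EuclideanSpace ℝ (Fin n)) M]
  [IsManifold (𝓡 n) ∞ M] [T2Space M] [MulAction G M] [ContMDiffSMul (𝓡 k) (𝓡 n) ∞ G M]
  {F : Type*} [NormedAddCommGroup F] [NormedSpace ℝ F] [FiniteDimensional ℝ F]
  {E : M → Type*} [TopologicalSpace (TotalSpace F E)] [∀ x, AddCommGroup (E x)]
  [∀ x, Module ℝ (E x)] [∀ x, TopologicalSpace (E x)] [FiberBundle F E] [VectorBundle ℝ F E]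
  [ContMDiffVectorBundle ∞ F E (𝓡 n)]
  {𝔞 : Type*} [AddCommGroup 𝔞] [Module ℝ 𝔞]
  {C : CourantAlgebroid n F E} {A : CourantAlgebra (GroupLieAlgebra (𝓡 k) G) 𝔞}
  {R : ExtendedAction C A}
  {d r : ℕ} {P : Type*} [TopologicalSpace P] [ChartedSpace (EuclideanSpace ℝ (Fin p)) P]
  [IsManifold (𝓡 p) ∞ P] [MulAction G P] [ContMDiffSMul (𝓡 k) (𝓡 p) ∞ G P]
  [ChartedSpace (EuclideanSpace ℝ (Fin d)) (MulAction.orbitRel.Quotient G P)]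
  {ι : P → M} {hι : ∀ (g : G) (p : P), ι (g • p) = g • ι p}
  [IsManifold (𝓡 d) ∞ (MulAction.orbitRel.Quotient G P)]
  [TopologicalSpace (TotalSpace (EuclideanSpace ℝ (Fin r)) (R.ReducedFiber ι hι))]
  [∀ c, TopologicalSpace (R.ReducedFiber ι hι c)]
  [FiberBundle (EuclideanSpace ℝ (Fin r)) (R.ReducedFiber ι hι)]
  [VectorBundle ℝ (EuclideanSpace ℝ (Fin r)) (R.ReducedFiber ι hι)]

namespace IsReductionLeaf

variable {c : MulAction.orbitRel.Quotient G P} (h : IsReductionLeaf p m R ι)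
  [ConnectedSpace G] [T2Space (MulAction.orbitRel.Quotient G P)]
  [ContMDiffVectorBundle ∞ (EuclideanSpace ℝ (Fin r)) (R.ReducedFiber ι hι) (𝓡 d)]
  (hS : IsSmoothOrbitSpace k p d G P) (Q : R.IsQuotientBundle ι hι d r)
include h hS Q

/-- The Courant algebroid structure of the reduced bundle. -/
theorem exists_isInduced :
    ∃ B : CourantAlgebroid d (EuclideanSpace ℝ (Fin r)) (R.ReducedFiber ι hι),
      R.IsInduced ι hι p B := by
  obtain ⟨β, hβ⟩ := h.exists_reducedPairing hι
  obtain ⟨α, hα⟩ := h.exists_reducedAnchor hS Q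
  obtain ⟨br, hbr⟩ := h.exists_reducedBracket Q
  have hrep := fun {e : ∀ c : MulAction.orbitRel.Quotient G P, R.ReducedFiber ι hι c}
    (c : MulAction.orbitRel.Quotient G P) {v : Cₛ^∞⟮𝓡 n; F, E⟯} (hv : R.IsLiftAt ι hι c.out v e) =>
    hv.representsAt (orbitMap_out c)
  -- pullbacks of functions on the orbit space
  have hβlift : ∀ {x : P} {v v' : Cₛ^∞⟮𝓡 n; F, E⟯}
      {e e' : ∀ c : MulAction.orbitRel.Quotient G P, R.ReducedFiber ι hι c},
      R.IsLiftAt ι hι x v e → R.IsLiftAt ι hι x v' e' → ∀ᶠ y in 𝓝 x,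
        β (orbitMap G y) (e (orbitMap G y)) (e' (orbitMap G y)) =
          C.pairing (ι y) (v (ι y)) (v' (ι y)) := by
    intro x v v' e e' hv hv'
    filter_upwards [hv, hv'] with y hy hy' using hβ _ y rfl _ _ _ _ hy hy'
  have hβs : ∀ e e' : Cₛ^∞⟮𝓡 d; EuclideanSpace ℝ (Fin r), R.ReducedFiber ι hι⟯,
      ContMDiff (𝓡 d) 𝓘(ℝ, ℝ) ∞ fun c => β c (e c) (e' c) := by
    intro e e' c
    obtain ⟨v, hv⟩ := Q.exists_isLiftAt e c.out
    obtain ⟨v', hv'⟩ := Q.exists_isLiftAt e' c.out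
    exact (h.smoothNear_of_pullback hS (orbitMap_out c) (C.pairing_smooth v v')
      (hβlift hv hv')).contMDiffAt
  -- Derivatives along the reduced anchor are computed on `M`, with extensions of the pulled-back
  -- functions. With this dictionary, (C2) to (C5) become the axioms of `C` for lifts.
  have hαd : ∀ {y : P} {c : MulAction.orbitRel.Quotient G P} (hy : orbitMap G y = c) {v : E (ι y)}
      {e : R.ReducedFiber ι hι c}, R.RepresentsAt ι hι hy v e →
      ∀ {φ : MulAction.orbitRel.Quotient G P → ℝ} {Φ : M → ℝ},
      MDifferentiableAt (𝓡 d) 𝓘(ℝ, ℝ) φ c → MDifferentiableAt (𝓡 n) 𝓘(ℝ, ℝ) Φ (ι y) →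
      (∀ᶠ z in 𝓝 y, Φ (ι z) = φ (orbitMap G z)) →
      mvfderiv (𝓡 d) φ c (α c e) = mvfderiv (𝓡 n) Φ (ι y) (C.anchor (ι y) v) := by
    intro y c hy v e hv φ Φ hφ hΦ hf
    rw [hα c y hy v e hv]
    exact h.mvfderiv_projAnchor_eq hS hy (Submodule.mem_sup_right hv.1) hφ hΦ hf
  have hαlift : ∀ {x : P} {v : Cₛ^∞⟮𝓡 n; F, E⟯}
      {e : ∀ c : MulAction.orbitRel.Quotient G P, R.ReducedFiber ι hι c},
      R.IsLiftAt ι hι x v e → ∀ {φ : MulAction.orbitRel.Quotient G P → ℝ}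
      {Φ : C^∞⟮𝓡 n, M; 𝓘(ℝ, ℝ), ℝ⟯}, SmoothNear d φ (orbitMap G x) →
      (∀ᶠ y in 𝓝 x, Φ (ι y) = φ (orbitMap G y)) → ∀ᶠ y in 𝓝 x,
      mvfderiv (𝓡 d) φ (orbitMap G y) (α (orbitMap G y) (e (orbitMap G y))) =
        mvfderiv (𝓡 n) Φ (ι y) (C.anchor (ι y) (v (ι y))) := by
    intro x v e hv φ Φ hφ hΦ
    have hq : ∀ᶠ y in 𝓝 x, SmoothNear d φ (orbitMap G y) :=
      hS.contMDiff.continuous.continuousAt.eventually hφ.eventually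
    filter_upwards [hv, hΦ.eventually_nhds, hq] with y hy hy' hy''
    exact hαd rfl hy hy''.mdifferentiableAt
      (Φ.contMDiff.contMDiffAt.mdifferentiableAt (by simp)) hy'
  have hαf : ∀ (e : Cₛ^∞⟮𝓡 d; EuclideanSpace ℝ (Fin r), R.ReducedFiber ι hι⟯) c
      {φ : MulAction.orbitRel.Quotient G P → ℝ}, SmoothNear d φ c →
      SmoothNear d (fun c => mvfderiv (𝓡 d) φ c (α c (e c))) c := by
    intro e c φ hφ
    have hφ' : SmoothNear d φ (orbitMap G c.out) := by rwa [orbitMap_out]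
    obtain ⟨v, hv⟩ := Q.exists_isLiftAt e c.out
    obtain ⟨Φ, hΦ⟩ := h.exists_pullback_extension hS c.out hφ'
    exact h.smoothNear_of_pullback hS (orbitMap_out c) (C.contMDiff_mvfderiv_anchor Φ v)
      (hαlift hv hφ' hΦ)
  have hαs : ∀ (e : Cₛ^∞⟮𝓡 d; EuclideanSpace ℝ (Fin r), R.ReducedFiber ι hι⟯) c,
      ContMDiffAt (𝓡 d) (𝓡 d).tangent ∞ (fun c => (⟨c, α c (e c)⟩ :
        TangentBundle (𝓡 d) (MulAction.orbitRel.Quotient G P))) c := fun e c =>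
    contMDiffAt_vectorField_of_mvfderiv fun φ hφ => (hαf e c hφ).contMDiffAt
  refine ⟨{
    pairing := β
    pairing_symm := ?_
    pairing_nondegenerate := ?_
    pairing_smooth := hβs
    anchor := α
    anchor_smooth := contMDiff_bundleMap_of_sections α hαs
    bracket := br
    jacobi := ?_
    anchor_bracket := ?_
    leibniz := ?_
    invariance := ?_
    bracket_self := ?_ }, ⟨?_, ?_, ?_⟩⟩
  · intro c e e'
    obtain ⟨v, hv⟩ := R.exists_representsAt (orbitMap_out c) e
    obtain ⟨v', hv'⟩ := R.exists_representsAt (orbitMap_out c) e'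
    rw [hβ _ _ _ _ _ _ _ hv hv', hβ _ _ _ _ _ _ _ hv' hv, C.pairing_symm]
  · intro c e he
    obtain ⟨v, hv⟩ := R.exists_representsAt (orbitMap_out c) e
    -- A representative orthogonal to all of `K^⊥` lies in `K`, so its class is zero.
    refine hv.ext_of_sub_mem h (ExtendedAction.RepresentsAt.zero _) ?_
    rw [sub_zero]
    refine R.mem_K_of_forall_pairing fun w hw => ?_
    obtain ⟨e', he'⟩ := ExtendedAction.exists_representsAt_of_mem h hι (orbitMap_out c) hw
    rw [C.pairing_symm, ← hβ _ _ _ _ _ _ _ hv he', he]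
  · intro e₁ e₂ e₃
    refine ContMDiffSection.ext fun c => ?_
    obtain ⟨v₁, h₁⟩ := Q.exists_isLiftAt e₁ c.out
    obtain ⟨v₂, h₂⟩ := Q.exists_isLiftAt e₂ c.out
    obtain ⟨v₃, h₃⟩ := Q.exists_isLiftAt e₃ c.out
    have h4 := hbr _ _ _ _ _ h₁ (hbr _ _ _ _ _ h₂ h₃)
    have h5 := (hbr _ _ _ _ _ (hbr _ _ _ _ _ h₁ h₂) h₃).add
      (hbr _ _ _ _ _ h₂ (hbr _ _ _ _ _ h₁ h₃))
    rw [← C.jacobi] at h5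
    exact (hrep c h4).ext h (hrep c h5)
  · intro e₁ e₂ c
    obtain ⟨v₁, h₁⟩ := Q.exists_isLiftAt e₁ c.out
    obtain ⟨v₂, h₂⟩ := Q.exists_isLiftAt e₂ c.out
    -- Compare the two vectors as derivations: on both `P/G` and `M` the Lie bracket is a
    -- commutator, and each iterated derivative lifts.
    refine eq_of_forall_mvfderiv_eq fun φ => ?_
    obtain ⟨Φ, hΦ⟩ := h.exists_pullback_extension hS c.out (φ.contMDiff.smoothNear _)
    have hφ := φ.contMDiff.smoothNear c
    have hφ' := φ.contMDiff.smoothNear (orbitMap G c.out)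
    have hΦd := Φ.contMDiff.smoothNear (ι c.out)
    rw [mvfderiv_mlieBracket (hαs e₁ c) (hαs e₂ c) hφ]
    rw [hαd (orbitMap_out c) (hrep c (hbr _ _ _ _ _ h₁ h₂)) hφ.mdifferentiableAt
        hΦd.mdifferentiableAt hΦ,
      hαd (orbitMap_out c) (hrep c h₁) (hαf e₂ c hφ).mdifferentiableAt
        ((C.contMDiff_mvfderiv_anchor Φ v₂).contMDiffAt.mdifferentiableAt (by simp))
        (EventuallyEq.symm (hαlift h₂ hφ' hΦ)),
      hαd (orbitMap_out c) (hrep c h₂) (hαf e₁ c hφ).mdifferentiableAt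
        ((C.contMDiff_mvfderiv_anchor Φ v₁).contMDiffAt.mdifferentiableAt (by simp))
        (EventuallyEq.symm (hαlift h₁ hφ' hΦ)), C.anchor_bracket]
    exact mvfderiv_mlieBracket (C.anchor_smooth.comp v₁.contMDiff).contMDiffAt
      (C.anchor_smooth.comp v₂.contMDiff).contMDiffAt hΦd
  · intro e₁ e₂ f c
    obtain ⟨v₁, h₁⟩ := Q.exists_isLiftAt e₁ c.out
    obtain ⟨v₂, h₂⟩ := Q.exists_isLiftAt e₂ c.out
    obtain ⟨Φ, hΦ⟩ := h.exists_pullback_extension hS c.out (f.contMDiff.smoothNear _)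
    have h3 : R.IsLiftAt ι hι c.out (funSMulSection Φ v₂) (funSMulSection f e₂) :=
      h₂.funSMul hΦ
    have h4 := hrep c (hbr _ _ _ _ _ h₁ h3)
    have h5 : Φ (ι c.out) = f c := by rw [hΦ.self_of_nhds, orbitMap_out]
    rw [C.leibniz, h5, ← hαd (orbitMap_out c) (hrep c h₁)
      (f.contMDiff.contMDiffAt.mdifferentiableAt (by simp))
      (Φ.contMDiff.contMDiffAt.mdifferentiableAt (by simp)) hΦ] at h4
    exact h4.ext h (((hrep c (hbr _ _ _ _ _ h₁ h₂)).smul (f c)).add ((hrep c h₂).smul _))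
  · intro e₁ e₂ e₃ c
    obtain ⟨v₁, h₁⟩ := Q.exists_isLiftAt e₁ c.out
    obtain ⟨v₂, h₂⟩ := Q.exists_isLiftAt e₂ c.out
    obtain ⟨v₃, h₃⟩ := Q.exists_isLiftAt e₃ c.out
    rw [hαd (orbitMap_out c) (hrep c h₁) ((hβs e₂ e₃).contMDiffAt.mdifferentiableAt (by simp))
      (C.mdifferentiableAt_pairing v₂ v₃ _) (EventuallyEq.symm (hβlift h₂ h₃)), C.invariance,
      hβ _ _ _ _ _ _ _ (hrep c (hbr _ _ _ _ _ h₁ h₂)) (hrep c h₃),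
      hβ _ _ _ _ _ _ _ (hrep c h₂) (hrep c (hbr _ _ _ _ _ h₁ h₃))]
  · intro e c w
    obtain ⟨v, hv⟩ := Q.exists_isLiftAt e c.out
    obtain ⟨w', hw'⟩ := R.exists_representsAt (orbitMap_out c) w
    rw [hβ _ _ _ _ _ _ _ (hrep c (hbr _ _ _ _ _ hv hv)) hw', C.bracket_self,
      hαd (orbitMap_out c) hw' ((hβs e e).contMDiffAt.mdifferentiableAt (by simp))
      (C.mdifferentiableAt_pairing v v _) (EventuallyEq.symm (hβlift hv hv))]
  · intro x v v' e e' hv hv'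
    exact hβ _ x rfl _ _ _ _ hv hv'
  · intro x v e u hv hu
    refine (hα _ x rfl v e hv).trans ?_
    change mfderiv (𝓡 p) (𝓡 d) (orbitMap G) x (C.leafAnchor p ι x v) = _
    rw [h.leafAnchor_eq hu]
  · intro x v₁ v₂ e₁ e₂ h₁ h₂
    exact (hbr x v₁ v₂ e₁ e₂ h₁ h₂).representsAt rfl

end IsReductionLeaf

end Leaf

/-! ### Surjectivity of the anchor and exactness. -/

section Leaf

variable {k n p m : ℕ}
  {G : Type*} [TopologicalSpace G] [ChartedSpace (EuclideanSpace ℝ (Fin k)) G] [Group G]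
  [LieGroup (𝓡 k) ∞ G]
  {M : Type*} [TopologicalSpace M] [ChartedSpace (EuclideanSpace ℝ (Fin n)) M]
  [IsManifold (𝓡 n) ∞ M] [T2Space M] [MulAction G M] [ContMDiffSMul (𝓡 k) (𝓡 n) ∞ G M]
  {F : Type*} [NormedAddCommGroup F] [NormedSpace ℝ F] [FiniteDimensional ℝ F]
  {E : M → Type*} [TopologicalSpace (TotalSpace F E)] [∀ x, AddCommGroup (E x)]
  [∀ x, Module ℝ (E x)] [∀ x, TopologicalSpace (E x)] [FiberBundle F E] [VectorBundle ℝ F E]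
  [ContMDiffVectorBundle ∞ F E (𝓡 n)]
  {𝔞 : Type*} [AddCommGroup 𝔞] [Module ℝ 𝔞]
  {C : CourantAlgebroid n F E} {A : CourantAlgebra (GroupLieAlgebra (𝓡 k) G) 𝔞}
  {R : ExtendedAction C A}
  {d r : ℕ} {P : Type*} [TopologicalSpace P] [ChartedSpace (EuclideanSpace ℝ (Fin p)) P]
  [IsManifold (𝓡 p) ∞ P] [MulAction G P] [ContMDiffSMul (𝓡 k) (𝓡 p) ∞ G P]
  [ChartedSpace (EuclideanSpace ℝ (Fin d)) (MulAction.orbitRel.Quotient G P)]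
  {ι : P → M} {hι : ∀ (g : G) (p : P), ι (g • p) = g • ι p}
  [IsManifold (𝓡 d) ∞ (MulAction.orbitRel.Quotient G P)]
  [TopologicalSpace (TotalSpace (EuclideanSpace ℝ (Fin r)) (R.ReducedFiber ι hι))]
  [∀ c, TopologicalSpace (R.ReducedFiber ι hι c)]
  [FiberBundle (EuclideanSpace ℝ (Fin r)) (R.ReducedFiber ι hι)]
  [VectorBundle ℝ (EuclideanSpace ℝ (Fin r)) (R.ReducedFiber ι hι)]

namespace IsSmoothOrbitSpace

variable (hS : IsSmoothOrbitSpace k p d G P)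
include hS

theorem mfderiv_surjective (x : P) :
    Function.Surjective (mfderiv (𝓡 p) (𝓡 d)
      (orbitMap G : P → MulAction.orbitRel.Quotient G P) x) := by
  intro w
  obtain ⟨s, hsx, hs⟩ := hS.exists_localSection (x := x) rfl
  refine ⟨mfderiv (𝓡 d) (𝓡 p) s (orbitMap G x) w, ?_⟩
  have h1 := mfderiv_comp_apply_of_eq (I := 𝓡 d) (I' := 𝓡 p) (I'' := 𝓡 d) (f := s)
    (g := (orbitMap G : P → MulAction.orbitRel.Quotient G P)) (orbitMap G x)
    (hS.contMDiff.contMDiffAt.mdifferentiableAt (by simp))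
    (hs.self_of_nhds.2.mdifferentiableAt (by simp)) hsx w
  have h2 : mfderiv (𝓡 d) (𝓡 d) ((orbitMap G : P → MulAction.orbitRel.Quotient G P) ∘ s)
      (orbitMap G x) w = mfderiv (𝓡 d) (𝓡 d) (id : MulAction.orbitRel.Quotient G P → _)
      (orbitMap G x) w := by
    have h3 : (orbitMap G : P → MulAction.orbitRel.Quotient G P) ∘ s =ᶠ[𝓝 (orbitMap G x)] id :=
      hs.mono fun c hc => hc.1
    have h4 := EventuallyEq.mfderiv_eq (I := 𝓡 d) (I' := 𝓡 d) h3
    exact congrArg (fun L => L w) h4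
  exact h1.symm.trans (h2.trans (by rw [mfderiv_id]; rfl))

/-- Differentiate `γ(y) • s(q(y)) = y` at `x`, where `γ(x) = 1` and `q` is the orbit map. If `dq(u)
= 0`, only the derivative of `γ` contributes, and `u` is an orbit direction. -/
theorem exists_infinitesimalAction_eq (hfree : ∀ (g : G) (x : P), g • x = x → g = 1) {x : P}
    {u : TangentSpace (𝓡 p) x}
    (hu : mfderiv (𝓡 p) (𝓡 d) (orbitMap G : P → MulAction.orbitRel.Quotient G P) x u = 0) :
    ∃ w : GroupLieAlgebra (𝓡 k) G, infinitesimalAction w x = u := by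
  obtain ⟨U, s, γ, hU, hxU, hsx, hs, hγ⟩ := hS.exists_section x
  have hγx : γ x = 1 := hfree _ x (by simpa only [hsx] using (hγ x hxU).2)
  have hγd : MDifferentiableAt (𝓡 p) (𝓡 k) γ x := (hγ x hxU).1.mdifferentiableAt (by simp)
  have hqd : MDifferentiableAt (𝓡 p) (𝓡 d)
      (orbitMap G : P → MulAction.orbitRel.Quotient G P) x :=
    hS.contMDiff.contMDiffAt.mdifferentiableAt (by simp)
  have hsd : MDifferentiableAt (𝓡 d) (𝓡 p) s (orbitMap G x) :=
    (hs _ hxU).2.mdifferentiableAt (by simp)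
  have hsq : MDifferentiableAt (𝓡 p) (𝓡 p) (fun y => s (orbitMap G y)) x := hsd.comp x hqd
  have hsq0 : mfderiv (𝓡 p) (𝓡 p) (fun y => s (orbitMap G y)) x u = 0 := by
    refine (mfderiv_comp_apply x hsd hqd u).trans ?_
    rw [hu]
    exact map_zero _
  have hm : MDifferentiableAt ((𝓡 k).prod (𝓡 p)) (𝓡 p) (fun z : G × P => z.1 • z.2) (1, x) :=
    (ContMDiffSMul.contMDiff_smul (I := 𝓡 k) (I' := 𝓡 p) (n := ∞)).contMDiffAt.mdifferentiableAt
      (by simp)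
  have h1 : mfderiv (𝓡 p) (𝓡 p) (fun y => γ y • s (orbitMap G y)) x u = u := by
    have h3 : (fun y => γ y • s (orbitMap G y)) =ᶠ[𝓝 x] id := by
      filter_upwards [hS.contMDiff.continuous.continuousAt.eventually (hU.mem_nhds hxU)] with y hy
      exact (hγ y hy).2
    have h4 := EventuallyEq.mfderiv_eq (I := 𝓡 p) (I' := 𝓡 p) h3
    exact (congrArg (fun L => L u) h4).trans (by rw [mfderiv_id])
  have h2 := mfderiv_comp_apply_of_eq (I := 𝓡 p) (I' := (𝓡 k).prod (𝓡 p)) (I'' := 𝓡 p)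
    (f := fun y => (γ y, s (orbitMap G y))) (g := fun z : G × P => z.1 • z.2) x hm
    (hγd.prodMk hsq) (Prod.ext hγx hsx) u
  let a : EuclideanSpace ℝ (Fin k) := mfderiv (𝓡 p) (𝓡 k) γ x u
  have h5 : mfderiv (𝓡 p) ((𝓡 k).prod (𝓡 p)) (fun y => (γ y, s (orbitMap G y))) x u =
      (a, (0 : EuclideanSpace ℝ (Fin p))) := by
    refine (congrArg (fun L => L u) (mfderiv_prodMk hγd hsq)).trans ?_
    exact congrArg (Prod.mk (a : EuclideanSpace ℝ (Fin k))) hsq0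
  have h6 := mfderiv_prod_eq_add_apply (v := (a, (0 : EuclideanSpace ℝ (Fin p)))) hm
  have h7 : mfderiv (𝓡 k) (𝓡 p) (fun g : G => g • x) 1 a = u := by
    refine Eq.trans ?_ (h6.symm.trans (((congrArg _ h5).symm.trans h2.symm).trans h1))
    exact (add_zero _).symm.trans (congrArg _ (map_zero _).symm)
  -- The sign compensates the one in `infinitesimalAction`.
  exact ⟨-a, (congrArg Neg.neg (map_neg _ a)).trans ((neg_neg _).trans h7)⟩

end IsSmoothOrbitSpace

namespace IsReductionLeaf

variable {c : MulAction.orbitRel.Quotient G P} (h : IsReductionLeaf p m R ι)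
  [ConnectedSpace G] [T2Space (MulAction.orbitRel.Quotient G P)]
  [ContMDiffVectorBundle ∞ (EuclideanSpace ℝ (Fin r)) (R.ReducedFiber ι hι) (𝓡 d)]
  (hS : IsSmoothOrbitSpace k p d G P)
  {B : CourantAlgebroid d (EuclideanSpace ℝ (Fin r)) (R.ReducedFiber ι hι)}
  (hB : R.IsInduced ι hι p B)
include h hB

theorem reducedAnchor_eq {x : P} {v : E (ι x)} {e : R.ReducedFiber ι hι (orbitMap G x)}
    (hv : R.RepresentsAt ι hι rfl v e) :
    B.anchor (orbitMap G x) e = projAnchor p C d ι (c := orbitMap G x) rfl v :=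
  hB.anchor x v e _ hv (h.mfderiv_leafAnchor (Submodule.mem_sup_right hv.1))

include hS

/-- A tangent vector of `P` is `π(ρ(a)) + π(v)` with `v ∈ K^⊥`, and the orbit map kills the first
term. -/
theorem reducedAnchor_surjective (c : MulAction.orbitRel.Quotient G P) :
    Function.Surjective (B.anchor c) := by
  obtain ⟨x, rfl⟩ := orbitMap_surjective G c
  intro w
  obtain ⟨u, rfl⟩ := hS.mfderiv_surjective x w
  obtain ⟨a, v, hv, rfl⟩ := h.exists_leafAnchor_eq x u
  obtain ⟨e, he⟩ := ExtendedAction.exists_representsAt_of_mem h hι (y := x) rfl hv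
  refine ⟨e, (h.reducedAnchor_eq hB he).trans ?_⟩
  have h1 := projAnchor_add (p := p) (C := C) (d := d) (y := x) (c := orbitMap G x) rfl
    (R.toSection a (ι x)) v
  rw [h.projAnchor_eq_zero hS rfl (R.toSection_mem_K a _), zero_add] at h1
  exact h1.symm

/-- An element of `E_red` in the image of `π^*` is represented by an element in the kernel of the
anchor of `E`. -/
theorem exists_representsAt_of_isCoanchor (hC : C.IsExact) {x : P}
    {ξ : Module.Dual ℝ (TangentSpace (𝓡 d) (orbitMap G x))}
    {e : R.ReducedFiber ι hι (orbitMap G x)} (he : B.IsCoanchor (orbitMap G x) ξ e) :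
    ∃ v : E (ι x), R.RepresentsAt ι hι rfl v e ∧ C.anchor (ι x) v = 0 := by
  -- Pull `ξ` back to `T P` and extend it to the tangent space of `M` through a left inverse of the
  -- differential of `ι`; then `v₀ = π^* η`.
  let η : Module.Dual ℝ (TangentSpace (𝓡 n) (ι x)) :=
    ξ ∘ₗ (mfderiv (𝓡 p) (𝓡 d) (orbitMap G : P → MulAction.orbitRel.Quotient G P) x).toLinearMap ∘ₗ
      (mfderiv (𝓡 p) (𝓡 n) ι x).toLinearMap.leftInverse
  obtain ⟨v₀, hv₀⟩ := C.exists_pairing_eq (ι x) (η ∘ₗ C.anchor (ι x))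
  have hv₀' : ∀ w, C.pairing (ι x) v₀ w = ξ (projAnchor p C d ι (c := orbitMap G x) rfl w) := hv₀
  -- The pulled-back covector vanishes on orbit directions, that is on `π(K)`.
  have hK : v₀ ∈ R.Kperp (ι x) := R.mem_Kperp_iff.2 fun a => by
    rw [hv₀', h.projAnchor_eq_zero hS rfl (R.toSection_mem_K a _), map_zero]
  obtain ⟨v, hv⟩ := R.exists_representsAt rfl e
  refine ⟨v₀, hv.of_sub_mem hK (R.mem_K_of_forall_pairing fun w hw => ?_),
    -- Exactness of `E` in the form `π π^* = 0`.
    (hC.ker_anchor _ _).2 ⟨η, hv₀⟩⟩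
  obtain ⟨e', he'⟩ := ExtendedAction.exists_representsAt_of_mem h hι (y := x) rfl hw
  have h1 := he e'
  rw [hB.pairing x v w e e' hv he', h.reducedAnchor_eq hB he', ← hv₀'] at h1
  rw [C.pairing_symm, map_sub, LinearMap.sub_apply, h1, sub_self]

theorem reducedAnchor_eq_zero_of_isCoanchor (hC : C.IsExact) {x : P}
    {ξ : Module.Dual ℝ (TangentSpace (𝓡 d) (orbitMap G x))}
    {e : R.ReducedFiber ι hι (orbitMap G x)} (he : B.IsCoanchor (orbitMap G x) ξ e) :
    B.anchor (orbitMap G x) e = 0 := by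
  obtain ⟨v, hv, hv0⟩ := h.exists_representsAt_of_isCoanchor hS hB hC he
  have h1 : C.leafAnchor p ι x v = 0 := h.leafAnchor_eq ((map_zero _).trans hv0.symm)
  rw [h.reducedAnchor_eq hB hv]
  change mfderiv (𝓡 p) (𝓡 d) (orbitMap G) x (C.leafAnchor p ι x v) = 0
  rw [h1]
  exact map_zero _

/-- A zero reduced anchor means that `π(v)` is an orbit direction, so `π(v) ∈ π(K) ∩ π(K^⊥)`. The
condition provides `κ ∈ K ∩ K^⊥` with `π(v - κ) = 0`, so `v - κ = π^* η` by exactness of `E`; being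
orthogonal to `K`, it makes `η` descend to `P/G`. -/
theorem exists_isCoanchor (hC : C.IsExact) (hE : R.ExactnessCondition ι) {x : P}
    {e : R.ReducedFiber ι hι (orbitMap G x)} (he : B.anchor (orbitMap G x) e = 0) :
    ∃ ξ, B.IsCoanchor (orbitMap G x) ξ e := by
  obtain ⟨v, hv⟩ := R.exists_representsAt rfl e
  rw [h.reducedAnchor_eq hB hv] at he
  obtain ⟨u, hu⟩ := hS.exists_infinitesimalAction_eq h.free he
  obtain ⟨a, rfl⟩ := R.exact.proj_surjective u
  have h1 : C.anchor (ι x) (R.toSection a (ι x)) = C.anchor (ι x) v := by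
    rw [← h.leafAnchor_toSection] at hu
    rw [← h.mfderiv_leafAnchor (Submodule.mem_sup_right hv.1), ← hu,
      h.mfderiv_leafAnchor (Submodule.mem_sup_left (R.toSection_mem_K a _))]
  have h2 : C.anchor (ι x) v ∈ (R.K (ι x) ⊓ R.Kperp (ι x)).map (C.anchor (ι x)) := by
    rw [← hE x]
    exact ⟨⟨_, R.toSection_mem_K a _, h1⟩, ⟨v, hv.1, rfl⟩⟩
  obtain ⟨κ, hκ, hκv⟩ := h2
  have hv' : R.RepresentsAt ι hι rfl (v - κ) e :=
    hv.of_sub_mem (Submodule.sub_mem _ hv.1 hκ.2) (by rw [sub_sub_cancel]; exact hκ.1)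
  have hv0 : C.anchor (ι x) (v - κ) = 0 := by rw [map_sub, hκv, sub_self]
  obtain ⟨η, hη⟩ := (hC.ker_anchor _ _).1 hv0
  -- The restriction `θ` of `η` to `T P` vanishes on the kernel of the differential of the orbit
  -- map, so `θ ∘ σ` is the descended covector for any linear section `σ`.
  obtain ⟨σ, hσ⟩ := LinearMap.exists_rightInverse_of_surjective
    (mfderiv (𝓡 p) (𝓡 d) (orbitMap G : P → MulAction.orbitRel.Quotient G P) x).toLinearMap
    (LinearMap.range_eq_top.2 (hS.mfderiv_surjective x))
  let θ : Module.Dual ℝ (TangentSpace (𝓡 p) x) := η ∘ₗ (mfderiv (𝓡 p) (𝓡 n) ι x).toLinearMap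
  have hθ : ∀ u, mfderiv (𝓡 p) (𝓡 d) (orbitMap G : P → MulAction.orbitRel.Quotient G P) x u = 0 →
      θ u = 0 := by
    intro u hu
    obtain ⟨u', rfl⟩ := hS.exists_infinitesimalAction_eq h.free hu
    obtain ⟨b, rfl⟩ := R.exact.proj_surjective u'
    change η (mfderiv (𝓡 p) (𝓡 n) ι x (infinitesimalAction (A.proj b) x)) = 0
    rw [← h.leafAnchor_toSection,
      h.mfderiv_leafAnchor (Submodule.mem_sup_left (R.toSection_mem_K b _)), ← hη]
    exact R.pairing_eq_zero hv'.1 (R.toSection_mem_K b _)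
  refine ⟨θ ∘ₗ σ, fun e' => ?_⟩
  obtain ⟨w, hw⟩ := R.exists_representsAt rfl e'
  rw [hB.pairing x _ _ _ _ hv' hw, hη, h.reducedAnchor_eq hB hw,
    ← h.mfderiv_leafAnchor (Submodule.mem_sup_right hw.1)]
  change θ (C.leafAnchor p ι x w) = θ (σ (mfderiv (𝓡 p) (𝓡 d) (orbitMap G) x _))
  refine sub_eq_zero.1 ((map_sub θ _ _).symm.trans (hθ _ ?_))
  refine (map_sub _ _ _).trans (sub_eq_zero.2 ?_)
  exact (LinearMap.congr_fun hσ _).symm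

theorem isExact_of_exactnessCondition (hC : C.IsExact) (hE : R.ExactnessCondition ι) :
    B.IsExact where
  coanchor_injective c ξ hξ := by
    refine LinearMap.ext fun w => ?_
    obtain ⟨e, rfl⟩ := h.reducedAnchor_surjective hS hB c w
    rw [← hξ e, map_zero, LinearMap.zero_apply, LinearMap.zero_apply]
  ker_anchor c e := by
    obtain ⟨x, rfl⟩ := orbitMap_surjective G c
    exact ⟨h.exists_isCoanchor hS hB hC hE,
      fun ⟨ξ, hξ⟩ => h.reducedAnchor_eq_zero_of_isCoanchor hS hB hC hξ⟩
  anchor_surjective := h.reducedAnchor_surjective hS hB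

/-- If `v ∈ K^⊥` and `π(v) ∈ π(K)`, the class of `v` has zero anchor, so it comes from a covector
and has a representative `v₀` with `π(v₀) = 0`. Then `v - v₀ ∈ K ∩ K^⊥` has the anchor of `v`. -/
theorem exactnessCondition_of_isExact (hC : C.IsExact) (hE : B.IsExact) :
    R.ExactnessCondition ι := by
  intro x
  refine le_antisymm ?_ (le_inf (Submodule.map_mono inf_le_left) (Submodule.map_mono inf_le_right))
  rintro t ⟨⟨_, ⟨a, rfl⟩, ha⟩, ⟨v, hv, rfl⟩⟩
  have ha' : C.anchor (ι x) (R.toSection a (ι x)) = C.anchor (ι x) v := ha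
  obtain ⟨e, he⟩ := ExtendedAction.exists_representsAt_of_mem h hι (y := x) rfl hv
  have h1 : B.anchor (orbitMap G x) e = 0 := by
    rw [h.reducedAnchor_eq hB he,
      ← h.projAnchor_eq_zero (d := d) hS rfl (R.toSection_mem_K a (ι x))]
    change mfderiv (𝓡 p) (𝓡 d) (orbitMap G) x ((mfderiv (𝓡 p) (𝓡 n) ι x).toLinearMap.leftInverse
      (C.anchor (ι x) v)) = mfderiv (𝓡 p) (𝓡 d) (orbitMap G) x
      ((mfderiv (𝓡 p) (𝓡 n) ι x).toLinearMap.leftInverse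
      (C.anchor (ι x) (R.toSection a (ι x))))
    rw [ha']
  obtain ⟨ξ, hξ⟩ := (hE.ker_anchor _ _).1 h1
  obtain ⟨v₀, hv₀, hv₀0⟩ := h.exists_representsAt_of_isCoanchor hS hB hC hξ
  refine ⟨v - v₀, ⟨he.sub_mem hv₀, Submodule.sub_mem _ hv hv₀.1⟩, ?_⟩
  rw [map_sub, hv₀0, sub_zero]

end IsReductionLeaf

/-- If `K ⊆ K^⊥`, both sides are `π(K)`. -/
theorem ExtendedAction.IsIsotropicAlong.exactnessCondition (hK : R.IsIsotropicAlong ι) :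
    R.ExactnessCondition ι := fun x => by
  rw [inf_eq_left.2 (hK x), inf_eq_left.2 (Submodule.map_mono (hK x))]

end Leaf

end

theorem mainTheorem1
    {k n p : ℕ}
    {G : Type*} [TopologicalSpace G] [ChartedSpace (EuclideanSpace ℝ (Fin k)) G] [Group G]
    [LieGroup (𝓡 k) ∞ G] [ConnectedSpace G]
    {M : Type*} [TopologicalSpace M] [ChartedSpace (EuclideanSpace ℝ (Fin n)) M]
    [IsManifold (𝓡 n) ∞ M] [T2Space M] [SecondCountableTopology M]
    [MulAction G M] [ContMDiffSMul (𝓡 k) (𝓡 n) ∞ G M]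
    {F : Type*} [NormedAddCommGroup F] [NormedSpace ℝ F] [FiniteDimensional ℝ F]
    {E : M → Type*} [TopologicalSpace (TotalSpace F E)] [∀ x, AddCommGroup (E x)]
    [∀ x, Module ℝ (E x)] [∀ x, TopologicalSpace (E x)] [FiberBundle F E] [VectorBundle ℝ F E]
    [ContMDiffVectorBundle ∞ F E (𝓡 n)]
    {𝔞 : Type*} [AddCommGroup 𝔞] [Module ℝ 𝔞]
    (C : CourantAlgebroid n F E) (hC : C.IsExact)
    (A : CourantAlgebra (GroupLieAlgebra (𝓡 k) G) 𝔞)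
    (R : ExtendedAction C A)
    {P : Type*} [TopologicalSpace P] [ChartedSpace (EuclideanSpace ℝ (Fin p)) P]
    [IsManifold (𝓡 p) ∞ P] [SecondCountableTopology P]
    (ι : P → M) (hP : IsLeaf n p R.bigDistribution ι)
    [MulAction G P] (hι : ∀ (g : G) (x : P), ι (g • x) = g • ι x)
    [ProperSMul G P] (hfree : ∀ (g : G) (x : P), g • x = x → g = 1)
    (hrank : ∃ m : ℕ, ∀ x : P, Module.finrank ℝ (R.idealImage (ι x)) = m) :
    T2Space (MulAction.orbitRel.Quotient G P) ∧
    SecondCountableTopology (MulAction.orbitRel.Quotient G P) ∧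
    ∃ (d r : ℕ)
      (_ : ChartedSpace (EuclideanSpace ℝ (Fin d)) (MulAction.orbitRel.Quotient G P))
      (_ : IsManifold (𝓡 d) ∞ (MulAction.orbitRel.Quotient G P))
      (_ : TopologicalSpace (TotalSpace (EuclideanSpace ℝ (Fin r)) (R.ReducedFiber ι hι)))
      (_ : ∀ c, TopologicalSpace (R.ReducedFiber ι hι c))
      (_ : FiberBundle (EuclideanSpace ℝ (Fin r)) (R.ReducedFiber ι hι))
      (_ : VectorBundle ℝ (EuclideanSpace ℝ (Fin r)) (R.ReducedFiber ι hι))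
      (_ : ContMDiffVectorBundle ∞ (EuclideanSpace ℝ (Fin r)) (R.ReducedFiber ι hι) (𝓡 d))
      (B : CourantAlgebroid d (EuclideanSpace ℝ (Fin r)) (R.ReducedFiber ι hι)),
      Manifold.IsSubmersion (𝓡 p) (𝓡 d) ∞ (orbitMap G : P → MulAction.orbitRel.Quotient G P) ∧
      R.IsQuotientBundle ι hι d r ∧
      R.IsInduced ι hι p B ∧
      (∀ c, Function.Surjective (B.anchor c)) ∧
      (R.IsIsotropicAlong ι → B.IsExact) ∧
      (B.IsExact ↔ R.ExactnessCondition ι) := by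
  obtain ⟨m, hm⟩ := hrank
  have h : IsReductionLeaf p m R ι := ⟨hP.toIsIntegralManifold, hι, hfree, hm⟩
  -- The proper action on `P` is in particular continuous, and smoothness is inherited from `M`
  -- through the immersion.
  haveI : ContMDiffSMul (𝓡 k) (𝓡 p) ∞ G P := hP.immersion.contMDiffSMul hι
  haveI := hP.connected
  have hT2 : T2Space (MulAction.orbitRel.Quotient G P) := t2Space_quotient_mulAction_of_properSMul
  refine ⟨hT2, ContinuousConstSMul.secondCountableTopology, ?_⟩
  obtain ⟨i₁, i₂, hS⟩ := exists_isSmoothOrbitSpace (k := k) (p := p) hfree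
  obtain ⟨r, hr⟩ := h.exists_finrank_quotFiber
  obtain ⟨i₃, i₄, i₅, i₆, i₇, Q⟩ := h.exists_isQuotientBundle hι hS hr
  obtain ⟨B, hB⟩ := h.exists_isInduced hS Q
  -- The dimension of the orbit space is `p - k`.
  exact ⟨_, r, i₁, i₂, i₃, i₄, i₅, i₆, i₇, B, hS.isSubmersion, Q, hB,
    h.reducedAnchor_surjective hS hB,
    fun hK => h.isExact_of_exactnessCondition hS hB hC hK.exactnessCondition,
    h.exactnessCondition_of_isExact hS hB hC, h.isExact_of_exactnessCondition hS hB hC⟩
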